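/- **Setting.** Consider a real scalar field of mass $m>0$ on the cosmological patch of de Sitter space, $ds^2=a(\eta)^2(-d\eta^2+d\vec x^2)$, $a(\eta)=-1/(H\eta)$, $\eta<0$, in the Bunch–Davies vacuum, i.e. the Gaussian state with mode functions $e_k(\eta)=\sqrt{-\pi\eta/(4a^2)}\,H^{(1)}_\nu(-k\eta)$, $\nu=\sqrt{9/4-m^2/H^2}$, at the time $\eta=-1/H$ at which $a=1$. Put $\mu^2=\mu^2(H,m)=\tfrac32-\sqrt{9/4-m^2/H^2}$. With $\Phi=\phi$, $\Pi=a^2\partial_\eta\phi$, a phase space element $\gamma=(g,f)$ consists of real integrable functions of compact support on $\mathbb R^3$ with $g\in\dot H^{1/2}$, $f\in\dot H^{-1/2}$; it defines the operator $O_\gamma=\Phi(f)-\Pi(g)$, and $\sigma(\gamma,\gamma')=\langle\{O_\gamma,O_{\gamma'}\}\rangle$ is the covariance metric of the state. A single-mode subsystem $A$ is given by two such elements with $\omega(\gamma^{(2)}_A,\gamma^{(1)}_A)=1$, where $\omega(\gamma_1,\gamma_2)=\int(f_1g_2-g_1f_2)\,d^3x$; it is non-special if $\int f_A^{(i)}d^3x\neq0$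 for some $i\in\{1,2\}$. The mutual information of two single modes is $\mathcal I(A,B)=S(\nu_A)+S(\nu_B)-S(\nu_+)-S(\nu_-)$, where $S(\nu)=\frac{\nu+1}2\log_2\frac{\nu+1}2-\frac{\nu-1}2\log_2\frac{\nu-1}2$, $\nu_I^2=\det\sigma_I$, $\nu_\pm^2=\frac12\big(\Delta\pm\sqrt{\Delta^2-4\det\sigma_{AB}}\big)$, $\Delta=\det\sigma_A+\det\sigma_B+2\det C$, and $C$ is the off-diagonal block of the covariance matrix $\sigma_{AB}$. The same formulas with the massless Minkowski vacuum, $\sigma_M(\gamma,\gamma')=\mathrm{Re}(g,g')_{1/2}+\mathrm{Re}(f,f')_{-1/2}$, $(h,h')_s=\int\frac{d^3k}{(2\pi)^3}|\vec k|^{2s}\tilde h\tilde h'^*$, define $\mathcal I^{\rm Mink}$. **Proposition 3 (large-separation behavior of $\mathcal I(A,B)$).** Let $A$ and $B$ be two non-special single-mode subsystems supported in the ball of radius $R>0$ around the origin, and let $B_{\Delta\vec x}$ be $B$ rigidly translated by $\Delta\vec x$. 1. *(Light field in the Bunch–Davies vacuum.)* For every $H_1>0$ there is $\delta\in(0,\tfrac32]$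 such that for every mass $0<m<\delta H_1$ there is a function $\alpha$ of $H$ with the following properties. - (Asymptotics and near scale invariance) For every $H\ge H_1$ one has $\alpha(H)>0$ and $$\mathcal I(A,B_{\Delta\vec x})\sim\alpha(H)\,|\Delta\vec x|^{-4\mu^2}\qquad(|\Delta\vec x|\to\infty),$$ uniformly in the direction of $\Delta\vec x$, with $0<4\mu^2\le\frac83\,m^2/H^2$. - (Growth with $H$ at fixed mass) For every $H_2>H_1$ there is $\Lambda>0$ such that for all $\Delta\vec x$ with $|\Delta\vec x|\ge\Lambda R$ and $|\Delta\vec x|H_1\ge\Lambda$ the mutual information $\mathcal I(A,B_{\Delta\vec x})$ is a strictly increasing function of $H\in[H_1,H_2]$; and so is the amplitude $\alpha_\ell(H)=\alpha(H)\,\ell^{-4\mu^2}$ in $\mathcal I\sim\alpha_\ell(H)\,(|\Delta\vec x|/\ell)^{-4\mu^2}$, for every reference length $\ell\ge\Lambda R$. 2. *(Flat limit.)* If $H\to0^+$ with $\mu$ fixed, i.e. with $m=\kappa H$ for a fixed $\kappa\in(0,\tfrac32)$, then $\mathcal I(A,B_{\Delta\vec x})\to\mathcal I^{\rm Mink}(A,B_{\Delta\vec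 x})$ for every $\Delta\vec x$ with $|\Delta\vec x|>2R$; and there is $\beta>0$ such that $\mathcal I^{\rm Mink}(A,B_{\Delta\vec x})\sim\beta\,|\Delta\vec x|^{-4}$ as $|\Delta\vec x|\to\infty$. -/

import Mathlib

open MeasureTheory Filter Topology

noncomputable section

namespace DeSitter

/-- Flat three-dimensional space, i.e. the spatial slice on which the fields are smeared. -/
abbrev Space := EuclideanSpace ℝ (Fin 3)

/-! ### Fourier transform and Sobolev products -/

/-- The Fourier transform `h̃(k) = ∫ d³x h(x) exp(i k·x)` of a real function. -/
def fourierT (h : Space → ℝ) (k : Space) : ℂ :=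
  ∫ x, Complex.exp (Complex.I * ((inner ℝ k x : ℝ) : ℂ)) * (h x : ℂ)

/-- The Sobolev product `(h, h')_s = ∫ d³k/(2π)³ |k|^(2s) h̃(k) h̃'(k)*`. -/
def sobolevProd (s : ℝ) (h h' : Space → ℝ) : ℂ :=
  (((2 * Real.pi) ^ 3 : ℝ) : ℂ)⁻¹ *
    ∫ k : Space, ((‖k‖ ^ (2 * s) : ℝ) : ℂ) * (fourierT h k * (starRingEnd ℂ) (fourierT h' k))

/-- Finiteness of the Sobolev norm of order `s`. -/
def FiniteSobolevNorm (s : ℝ) (h : Space → ℝ) : Prop :=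
  Integrable (fun k : Space => ‖k‖ ^ (2 * s) * ‖fourierT h k‖ ^ 2)

/-- The translate `x ↦ h (x - d)`. -/
def shift (d : Space) (h : Space → ℝ) : Space → ℝ := fun x => h (x - d)

theorem fourierT_shift (d : Space) (h : Space → ℝ) (k : Space) :
    fourierT (shift d h) k
      = Complex.exp (Complex.I * ((inner ℝ k d : ℝ) : ℂ)) * fourierT h k := by
  have e := integral_sub_right_eq_self (μ := (volume : Measure Space))
    (fun x : Space => Complex.exp (Complex.I * ((inner ℝ k (x + d) : ℝ) : ℂ)) * (h x : ℂ)) d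
  simp only [sub_add_cancel] at e
  unfold fourierT shift
  rw [e, ← integral_const_mul]
  congr 1
  funext x
  rw [inner_add_right, Complex.ofReal_add, mul_add, Complex.exp_add]
  ring

theorem norm_fourierT_shift (d : Space) (h : Space → ℝ) (k : Space) :
    ‖fourierT (shift d h) k‖ = ‖fourierT h k‖ := by
  rw [fourierT_shift, norm_mul, mul_comm Complex.I, Complex.norm_exp_ofReal_mul_I, one_mul]

theorem FiniteSobolevNorm.shift {s : ℝ} {h : Space → ℝ} (hs : FiniteSobolevNorm s h)
    (d : Space) : FiniteSobolevNorm s (shift d h) := by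
  simpa only [FiniteSobolevNorm, norm_fourierT_shift] using hs

theorem hasCompactSupport_shift {h : Space → ℝ} (hh : HasCompactSupport h) (d : Space) :
    HasCompactSupport (shift d h) := by
  have e : shift d h = h ∘ (Homeomorph.addRight (-d)) := by
    funext x
    simp [shift, sub_eq_add_neg]
  rw [e]
  exact hh.comp_homeomorph _

/-! ### Phase space and single-mode subsystems -/

/-- A compactly supported element `γ = (g, f)` of the classical phase space: two real functions of
compact support, with finite Sobolev norms of order `1/2` (for `g`) and `-1/2` (for `f`).
The smeared operator attached to `γ` is `O_γ = Φ(f) - Π(g)`. -/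
structure PhasePoint where
  g : Space → ℝ
  f : Space → ℝ
  integrable_g : Integrable g
  integrable_f : Integrable f
  compact_g : HasCompactSupport g
  compact_f : HasCompactSupport f
  sobolev_g : FiniteSobolevNorm (1 / 2) g
  sobolev_f : FiniteSobolevNorm (-(1 / 2)) f

/-- The rigid translate of a phase space element. -/
def PhasePoint.translate (d : Space) (γ : PhasePoint) : PhasePoint where
  g := shift d γ.g
  f := shift d γ.f
  integrable_g := γ.integrable_g.comp_sub_right d
  integrable_f := γ.integrable_f.comp_sub_right d
  compact_g := hasCompactSupport_shift γ.compact_g d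
  compact_f := hasCompactSupport_shift γ.compact_f d
  sobolev_g := γ.sobolev_g.shift d
  sobolev_f := γ.sobolev_f.shift d

/-- The symplectic form `ω(γ₁, γ₂) = ∫ d³x (f₁ g₂ - g₁ f₂)`. It is written in Fourier space
(Parseval), where the integrals converge absolutely for all pairs in `Ḣ^(1/2) × Ḣ^(-1/2)`. -/
def sympl (γ₁ γ₂ : PhasePoint) : ℝ :=
  (sobolevProd 0 γ₁.f γ₂.g - sobolevProd 0 γ₁.g γ₂.f).re

theorem sobolevProd_shift (s : ℝ) (d : Space) (h h' : Space → ℝ) :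
    sobolevProd s (shift d h) (shift d h') = sobolevProd s h h' := by
  unfold sobolevProd
  congr 2
  funext k
  rw [fourierT_shift, fourierT_shift, map_mul, mul_mul_mul_comm, Complex.mul_conj,
    Complex.normSq_eq_norm_sq, mul_comm Complex.I, Complex.norm_exp_ofReal_mul_I]
  simp

theorem sympl_translate (d : Space) (γ₁ γ₂ : PhasePoint) :
    sympl (γ₁.translate d) (γ₂.translate d) = sympl γ₁ γ₂ := by
  simp only [sympl, PhasePoint.translate, sobolevProd_shift]

/-- A compactly supported single-mode subsystem, given by a symplectic basis `(γ⁽¹⁾, γ⁽²⁾)`,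
`ω(γ⁽²⁾, γ⁽¹⁾) = 1`, of a two-dimensional symplectic subspace of phase space. -/
structure Mode where
  γ : Fin 2 → PhasePoint
  canonical : sympl (γ 1) (γ 0) = 1

/-- The rigid translate of a single-mode subsystem. -/
def Mode.translate (d : Space) (A : Mode) : Mode where
  γ := fun i => (A.γ i).translate d
  canonical := by rw [sympl_translate]; exact A.canonical

/-- A mode is special if all its field smearing functions have vanishing spatial average;
it is non-special if some element `(g, f)` of its phase space has `∫ f ≠ 0`, equivalently if this
happens for one of the two basis vectors. -/
def Mode.NonSpecial (A : Mode) : Prop := ∃ i, ∫ x, (A.γ i).f x ≠ 0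

/-- All the smearing functions of the mode are supported in the closed ball of radius `R` around
the origin. -/
def Mode.SupportedInBall (A : Mode) (R : ℝ) : Prop :=
  ∀ i, tsupport (A.γ i).f ⊆ Metric.closedBall 0 R ∧ tsupport (A.γ i).g ⊆ Metric.closedBall 0 R

/-! ### Covariance metrics of the two vacua -/

/-- The Hankel function of the first kind `H_ν⁽¹⁾(x)` for `x > 0`, `ν > -1/2`, by Hankel's integral
`√(2/(πx)) e^{i(x-νπ/2-π/4)} / Γ(ν+1/2) · ∫₀^∞ e^{-u} u^{ν-1/2} (1 + iu/(2x))^{ν-1/2} du`. -/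
def hankel1 (ν x : ℝ) : ℂ :=
  ((Real.sqrt (2 / (Real.pi * x)) : ℝ) : ℂ)
    * Complex.exp (Complex.I * ((x - ν * Real.pi / 2 - Real.pi / 4 : ℝ) : ℂ))
    / ((Real.Gamma (ν + 1 / 2) : ℝ) : ℂ)
    * ∫ u in Set.Ioi (0 : ℝ), ((Real.exp (-u) * u ^ (ν - 1 / 2) : ℝ) : ℂ)
        * (1 + Complex.I * ((u / (2 * x) : ℝ) : ℂ)) ^ ((ν - 1 / 2 : ℝ) : ℂ)

/-- The order `ν = √(9/4 - m²/H²)`. -/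
def bdOrder (H m : ℝ) : ℝ := Real.sqrt (9 / 4 - m ^ 2 / H ^ 2)

/-- The small parameter `μ² = 3/2 - √(9/4 - m²/H²)` of a light field. -/
def muSq (H m : ℝ) : ℝ := 3 / 2 - bdOrder H m

/-- The scale factor `a(η) = -1/(Hη)` of the cosmological patch, `η < 0`. -/
def scaleFactor (H η : ℝ) : ℝ := -1 / (H * η)

/-- The Bunch-Davies mode function `e_k(η) = √(-πη/(4a(η)²)) H_ν⁽¹⁾(-kη)`. -/
def bdMode (H m k η : ℝ) : ℂ :=
  ((Real.sqrt (-Real.pi * η / (4 * scaleFactor H η ^ 2)) : ℝ) : ℂ)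
    * hankel1 (bdOrder H m) (-k * η)

/-- The corresponding mode function `a(η)² e_k'(η)` of the momentum `Π = √h n^a ∇_a φ`
(for the metric `a²(-dη² + dx²)`: `√h = a³` and `n = a⁻¹ ∂_η`). -/
def bdMomentumMode (H m k η : ℝ) : ℂ :=
  ((scaleFactor H η ^ 2 : ℝ) : ℂ) * deriv (bdMode H m k) η

/-- The amplitude with which `O_γ = Φ(f) - Π(g)` at conformal time `η` contains the annihilation
operators in the Bunch-Davies Fock representation: `f̃(k) e_k(η) - g̃(k) a(η)² e_k'(η)`. -/
def bdAmplitude (H m η : ℝ) (γ : PhasePoint) (k : Space) : ℂ :=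
  fourierT γ.f k * bdMode H m ‖k‖ η - fourierT γ.g k * bdMomentumMode H m ‖k‖ η

/-- The covariance metric `σ_BD(γ, γ') = ⟨0|{O_γ, O_γ'}|0⟩` of the Bunch-Davies vacuum of the field
of mass `m`, at the time `η = -1/H` at which the scale factor equals `1`. -/
def covBD (H m : ℝ) (γ γ' : PhasePoint) : ℝ :=
  2 * ((2 * Real.pi) ^ 3)⁻¹ *
    ∫ k : Space, (bdAmplitude H m (-1 / H) γ k
      * (starRingEnd ℂ) (bdAmplitude H m (-1 / H) γ' k)).re

/-- The covariance metric of the Minkowski vacuum of a massless field,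
`σ_M(γ, γ') = Re (g, g')_{1/2} + Re (f, f')_{-1/2}`. -/
def covMink (γ γ' : PhasePoint) : ℝ :=
  (sobolevProd (1 / 2) γ.g γ'.g).re + (sobolevProd (-(1 / 2)) γ.f γ'.f).re

/-! ### Entropies and mutual information of Gaussian modes -/

/-- The block `(σ(γ_A⁽ⁱ⁾, γ_B⁽ʲ⁾))_{ij}` of the covariance matrix. -/
def covBlock (σ : PhasePoint → PhasePoint → ℝ) (A B : Mode) : Matrix (Fin 2) (Fin 2) ℝ :=
  Matrix.of fun i j => σ (A.γ i) (B.γ j)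

/-- The covariance matrix of the pair `(A, B)`. -/
def covPair (σ : PhasePoint → PhasePoint → ℝ) (A B : Mode) :
    Matrix (Fin 2 ⊕ Fin 2) (Fin 2 ⊕ Fin 2) ℝ :=
  Matrix.fromBlocks (covBlock σ A A) (covBlock σ A B) (covBlock σ A B).transpose (covBlock σ B B)

/-- The symplectic eigenvalue `ν_A = √(det σ_A)` of a single mode. -/
def nuMode (σ : PhasePoint → PhasePoint → ℝ) (A : Mode) : ℝ := Real.sqrt (covBlock σ A A).det

/-- `Δ = det σ_A + det σ_B + 2 det C`. -/
def seralian (σ : PhasePoint → PhasePoint → ℝ) (A B : Mode) : ℝ :=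
  (covBlock σ A A).det + (covBlock σ B B).det + 2 * (covBlock σ A B).det

/-- The larger symplectic eigenvalue `ν₊` of the pair. -/
def nuPlus (σ : PhasePoint → PhasePoint → ℝ) (A B : Mode) : ℝ :=
  Real.sqrt ((seralian σ A B
    + Real.sqrt (seralian σ A B ^ 2 - 4 * (covPair σ A B).det)) / 2)

/-- The smaller symplectic eigenvalue `ν₋` of the pair. -/
def nuMinus (σ : PhasePoint → PhasePoint → ℝ) (A B : Mode) : ℝ :=
  Real.sqrt ((seralian σ A B
    - Real.sqrt (seralian σ A B ^ 2 - 4 * (covPair σ A B).det)) / 2)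

/-- The von Neumann entropy `S(ν)` (in bits) of a Gaussian mode of symplectic eigenvalue `ν`. -/
def entropy (ν : ℝ) : ℝ :=
  (ν + 1) / 2 * Real.logb 2 ((ν + 1) / 2) - (ν - 1) / 2 * Real.logb 2 ((ν - 1) / 2)

/-- The mutual information `S(ν_A) + S(ν_B) - S(ν₊) - S(ν₋)` of two modes in the Gaussian state
with covariance metric `σ`. -/
def mutualInfo (σ : PhasePoint → PhasePoint → ℝ) (A B : Mode) : ℝ :=
  entropy (nuMode σ A) + entropy (nuMode σ B) - entropy (nuPlus σ A B) - entropy (nuMinus σ A B)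

/-- The mutual information in the Bunch-Davies vacuum of the field of mass `m` in the cosmological
patch of de Sitter space with Hubble rate `H`. -/
def mutualInfoBD (H m : ℝ) (A B : Mode) : ℝ := mutualInfo (covBD H m) A B

/-- The mutual information in the Minkowski vacuum of a massless field. -/
def mutualInfoMink (A B : Mode) : ℝ := mutualInfo covMink A B

end DeSitter

end

/-! Both vacua are Gaussian, so everything follows from the covariances, and the argument has four
parts.

Mutual information as an integral. Up to constants the entropy of √y is half the integral of log (y
- u²) over u in [0, 1] (`entropy_sqrt`). Summed over the two symplectic eigenvalues, only the
polynomial (ν₊² - u²)(ν₋² - u²) enters, and its coefficients are invariants of the covariance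
matrix. The mutual information becomes an integral of -log (1 - n(u)) with n quadratic to leading
order in the correlation block C (`mutual_entropy_eq`). If t(Δx) C tends to a rank-one matrix k v
wᵀ, then t² times the mutual information tends to a product of quadratic forms in v and w, up to a
positive factor (`tendsto_mutualInfo`). This needs det σ_A > 1 and det σ_B > 1 strictly. Equality
would make the Fock amplitudes of the two basis elements proportional (`RadialModes.one_lt_det`).
Compact support makes the Fourier transforms analytic on rays, while the Bunch-Davies spectrum is
singular of order r^(-2ν) with 2 < 2ν < 3, so proportionality is impossible (`bd_nondegenerate`).

Covariances at large distance. The quadratic expressions in the Hankel function and its derivative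
are Gaussian mixtures in the momentum (`hankel_products`, a Nicholson-type formula proved through
the linear system such products satisfy). Gaussians have explicit Fourier transforms, so for
separated supports the covariance is a double integral of the smearing functions against explicit
position kernels (`covBD_position`). With a = ν - 1/2 and 1 - a = μ², the three kernels decay like
|Δx|^(-2μ²) with relative coefficients 1, Hμ², (Hμ²)². The limit of the block is therefore rank one,
with vector ∫f + Hμ² ∫g (`tendsto_covBD`). For a light field this vector is nonzero as soon as ∫f is
(`exists_light_bound`). In the Minkowski vacuum the ff kernel decays like |Δx|^(-2) and the gg
kernel like |Δx|^(-4), which leaves ∫f alone.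

Growth with H. The mutual information is J(H) |Δx|^(-4μ²(H)). On [H₁, H₂] the factor J is Lipschitz
with a constant independent of Δx (`OrderFamily.ULB_mutualInfoBD`), and it is eventually bounded
below uniformly in H (`ULB.eventually_ge`). The exponent 4μ² decreases at a definite rate
(`muSq_slope`). Once log |Δx| is large, the exponent outweighs every variation of J
(`strictMonoOn_mul_rpow`). The Lipschitz bounds are carried through all the nested integrals by the
calculus of `LB` and `ULB`.

Flat limit. At fixed momentum r, H → 0 sends the Hankel argument r/H to infinity, so the spectral
functions converge to the Minkowski ones with a common majorant (`tendsto_covBD_covMink`). The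
mutual information is a continuous function of the covariances. -/

noncomputable section

namespace DeSitter

open Set

/-! ### The confluent integrals behind the Hankel function -/

/-- `∫₀^∞ e^{-u} u^p (1 + w u)^q du`. -/
def confl (p q : ℝ) (w : ℂ) : ℂ :=
  ∫ u in Ioi (0 : ℝ), ((Real.exp (-u) * u ^ p : ℝ) : ℂ) * (1 + w * (u : ℂ)) ^ (q : ℂ)

theorem one_le_re_one_add_mul {w : ℂ} (hw : 0 ≤ w.re) {u : ℝ} (hu : 0 ≤ u) :
    1 ≤ (1 + w * (u : ℂ)).re := by
  simp; positivity

theorem one_add_mul_mem_slitPlane {w : ℂ} (hw : 0 ≤ w.re) {u : ℝ} (hu : 0 ≤ u) :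
    1 + w * (u : ℂ) ∈ Complex.slitPlane :=
  Or.inl (lt_of_lt_of_le one_pos (one_le_re_one_add_mul hw hu))

theorem one_add_mul_ne_zero {w : ℂ} (hw : 0 ≤ w.re) {u : ℝ} (hu : 0 ≤ u) :
    1 + w * (u : ℂ) ≠ 0 := Complex.slitPlane_ne_zero (one_add_mul_mem_slitPlane hw hu)

theorem one_le_norm_one_add_mul {w : ℂ} (hw : 0 ≤ w.re) {u : ℝ} (hu : 0 ≤ u) :
    1 ≤ ‖1 + w * (u : ℂ)‖ :=
  (one_le_re_one_add_mul hw hu).trans (Complex.re_le_norm _)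

theorem norm_cpow_le_one {q : ℝ} (hq : q ≤ 0) {w : ℂ} (hw : 0 ≤ w.re) {u : ℝ} (hu : 0 ≤ u) :
    ‖(1 + w * (u : ℂ)) ^ (q : ℂ)‖ ≤ 1 := by
  rw [Complex.norm_cpow_real]
  exact Real.rpow_le_one_of_one_le_of_nonpos (one_le_norm_one_add_mul hw hu) hq

theorem norm_cpow_le_linear {q : ℝ} (hq : q ≤ 1) {w : ℂ} (hw : 0 ≤ w.re) {u : ℝ} (hu : 0 ≤ u) :
    ‖(1 + w * (u : ℂ)) ^ (q : ℂ)‖ ≤ 1 + ‖w‖ * u := by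
  rw [Complex.norm_cpow_real]
  calc _ ≤ ‖1 + w * (u : ℂ)‖ ^ (1 : ℝ) :=
        Real.rpow_le_rpow_of_exponent_le (one_le_norm_one_add_mul hw hu) hq
    _ ≤ _ := by
        rw [Real.rpow_one]
        refine (norm_add_le _ _).trans ?_
        simp [abs_of_nonneg hu]

theorem integrableOn_exp_mul_rpow {p : ℝ} (hp : -1 < p) :
    IntegrableOn (fun u : ℝ => Real.exp (-u) * u ^ p) (Ioi 0) := by
  simpa using Real.GammaIntegral_convergent (s := p + 1) (by linarith)

theorem integral_exp_mul_rpow {p : ℝ} (hp : -1 < p) :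
    ∫ u in Ioi (0 : ℝ), Real.exp (-u) * u ^ p = Real.Gamma (p + 1) := by
  rw [Real.Gamma_eq_integral (by linarith)]; simp

theorem continuousOn_confl_integrand (p q : ℝ) {w : ℂ} (hw : 0 ≤ w.re) :
    ContinuousOn (fun u : ℝ => ((Real.exp (-u) * u ^ p : ℝ) : ℂ) * (1 + w * (u : ℂ)) ^ (q : ℂ))
      (Ioi 0) := by
  refine ContinuousOn.mul ?_ ?_
  · refine Complex.continuous_ofReal.comp_continuousOn ?_
    refine ContinuousOn.mul (by fun_prop) ?_
    exact ContinuousOn.rpow_const continuousOn_id (fun u hu => Or.inl (ne_of_gt hu))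
  · refine ContinuousOn.cpow (by fun_prop) continuousOn_const ?_
    intro u hu
    exact one_add_mul_mem_slitPlane hw (le_of_lt hu)

theorem aestronglyMeasurable_confl_integrand (p q : ℝ) {w : ℂ} (hw : 0 ≤ w.re) :
    AEStronglyMeasurable
      (fun u : ℝ => ((Real.exp (-u) * u ^ p : ℝ) : ℂ) * (1 + w * (u : ℂ)) ^ (q : ℂ))
      (volume.restrict (Ioi 0)) :=
  (continuousOn_confl_integrand p q hw).aestronglyMeasurable measurableSet_Ioi

theorem norm_exp_mul_rpow {p u : ℝ} (hu : 0 < u) :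
    ‖((Real.exp (-u) * u ^ p : ℝ) : ℂ)‖ = Real.exp (-u) * u ^ p := by
  rw [Complex.norm_real, Real.norm_of_nonneg (by positivity)]

theorem integrableOn_confl {p q : ℝ} (hp : -1 < p) (hq : q ≤ 1) {w : ℂ} (hw : 0 ≤ w.re) :
    IntegrableOn
      (fun u : ℝ => ((Real.exp (-u) * u ^ p : ℝ) : ℂ) * (1 + w * (u : ℂ)) ^ (q : ℂ)) (Ioi 0) := by
  have h1 := (integrableOn_exp_mul_rpow hp).add
    ((integrableOn_exp_mul_rpow (p := p + 1) (by linarith)).const_mul ‖w‖)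
  refine Integrable.mono' h1 (aestronglyMeasurable_confl_integrand p q hw) ?_
  filter_upwards [ae_restrict_mem measurableSet_Ioi] with u hu
  have hu' : (0 : ℝ) < u := hu
  rw [norm_mul, norm_exp_mul_rpow hu']
  have h2 := norm_cpow_le_linear hq hw hu'.le
  have : u ^ (p + 1) = u ^ p * u := by rw [Real.rpow_add hu', Real.rpow_one]
  simp only [Pi.add_apply]
  rw [this]
  calc _ ≤ Real.exp (-u) * u ^ p * (1 + ‖w‖ * u) := by gcongr
    _ = _ := by ring

theorem norm_confl_le {p q : ℝ} (hp : -1 < p) (hq : q ≤ 0) {w : ℂ} (hw : 0 ≤ w.re) :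
    ‖confl p q w‖ ≤ Real.Gamma (p + 1) := by
  rw [← integral_exp_mul_rpow hp]
  refine norm_integral_le_of_norm_le (integrableOn_exp_mul_rpow hp) ?_
  filter_upwards [ae_restrict_mem measurableSet_Ioi] with u hu
  rw [norm_mul, norm_exp_mul_rpow hu]
  have hu' : (0 : ℝ) < u := hu
  exact mul_le_of_le_one_right (by positivity) (norm_cpow_le_one hq hw hu'.le)

/-- Differentiation lowers the exponent to q - 1 ≤ 0, so the power has modulus at most 1 and e^(-u)
u^(p+1) dominates for every t. The ray ω = i serves the Hankel function, and ω = 1 the real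
densities of the mixtures. -/
theorem hasDerivAt_confl {p q : ℝ} (hp : -1 < p) (hq : q ≤ 1) {ω : ℂ} (hω : 0 ≤ ω.re)
    {y : ℝ} (hy : 0 < y) :
    HasDerivAt (fun t : ℝ => confl p q (ω * t)) (q * ω * confl (p + 1) (q - 1) (ω * y)) y := by
  have hre : ∀ t : ℝ, 0 < t → 0 ≤ (ω * (t : ℂ)).re := fun t ht => by simp; positivity
  have key := hasDerivAt_integral_of_dominated_loc_of_deriv_le (𝕜 := ℝ)
    (μ := volume.restrict (Ioi (0 : ℝ))) (x₀ := y) (s := Ioi 0)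
    (F := fun t u => ((Real.exp (-u) * u ^ p : ℝ) : ℂ) * (1 + ω * (t : ℂ) * (u : ℂ)) ^ (q : ℂ))
    (F' := fun t u => q * ω * (((Real.exp (-u) * u ^ (p + 1) : ℝ) : ℂ) *
      (1 + ω * (t : ℂ) * (u : ℂ)) ^ ((q - 1 : ℝ) : ℂ)))
    (bound := fun u => ‖(q : ℂ) * ω‖ * (Real.exp (-u) * u ^ (p + 1)))
    (Ioi_mem_nhds hy) ?_ (integrableOn_confl hp hq (hre y hy)) ?_ ?_
    ((integrableOn_exp_mul_rpow (by linarith)).const_mul _) ?_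
  · have h := key.2
    rw [integral_const_mul] at h
    exact h
  · filter_upwards [Ioi_mem_nhds hy] with t ht
    exact aestronglyMeasurable_confl_integrand p q (hre t ht)
  · exact (aestronglyMeasurable_confl_integrand _ _ (hre y hy)).const_mul _
  · filter_upwards [ae_restrict_mem measurableSet_Ioi] with u hu t ht
    rw [norm_mul, norm_mul _ (_ ^ _), norm_exp_mul_rpow hu]
    have hu' : (0 : ℝ) < u := hu
    refine mul_le_mul_of_nonneg_left ?_ (norm_nonneg _)
    exact mul_le_of_le_one_right (by positivity) (norm_cpow_le_one (by linarith) (hre t ht) hu'.le)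
  · filter_upwards [ae_restrict_mem measurableSet_Ioi] with u hu t ht
    have hu' : (0 : ℝ) < u := hu
    have h1 : HasDerivAt (fun t : ℝ => 1 + ω * (t : ℂ) * (u : ℂ)) (ω * u) t := by
      have := ((Complex.ofRealCLM.hasDerivAt (x := t)).const_mul ω).mul_const (u : ℂ)
      simpa using this.const_add (1 : ℂ)
    have h2 := (((hasDerivAt_id _).cpow_const (c := (q : ℂ))
      (one_add_mul_mem_slitPlane (hre t ht) hu'.le)).comp t h1).const_mul
        ((Real.exp (-u) * u ^ p : ℝ) : ℂ)
    refine h2.congr_deriv ?_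
    rw [Real.rpow_add hu', Real.rpow_one]
    simp only [id]
    push_cast
    ring

/-- The combination is the integral of a total derivative, that of e^(-u) u^(a+1) (1+wu)^(a-1),
whose boundary values vanish. Multiplied by a it is the equation w²ℓ'' + (1+2w)ℓ' = a(a+1)ℓ for ℓ =
`confl a a`; with the factor a removed it keeps its content at a = 0. -/
theorem confl_identity {a : ℝ} (ha : -1 < a) (ha1 : a < 1) {w : ℂ} (hw : 0 ≤ w.re) :
    w ^ 2 * (a - 1) * confl (a + 2) (a - 2) w + (1 + 2 * w) * confl (a + 1) (a - 1) w
      = (a + 1) * confl a a w := by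
  set S : ℝ → ℂ := fun u => ((Real.exp (-u) * u ^ (a + 1) : ℝ) : ℂ) *
    (1 + w * (u : ℂ)) ^ ((a - 1 : ℝ) : ℂ) with hS
  set g : ℝ → ℂ := fun u =>
    (a + 1) * (((Real.exp (-u) * u ^ a : ℝ) : ℂ) * (1 + w * (u : ℂ)) ^ (a : ℂ))
    - (w ^ 2 * (a - 1) * (((Real.exp (-u) * u ^ (a + 2) : ℝ) : ℂ) *
        (1 + w * (u : ℂ)) ^ ((a - 2 : ℝ) : ℂ))
      + (1 + 2 * w) * (((Real.exp (-u) * u ^ (a + 1) : ℝ) : ℂ) *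
        (1 + w * (u : ℂ)) ^ ((a - 1 : ℝ) : ℂ))) with hg
  have i0 := integrableOn_confl (p := a) (q := a) (by linarith) (by linarith) hw
  have i1 := integrableOn_confl (p := a + 1) (q := a - 1) (by linarith) (by linarith) hw
  have i2 := integrableOn_confl (p := a + 2) (q := a - 2) (by linarith) (by linarith) hw
  have hgi : IntegrableOn g (Ioi 0) :=
    (i0.const_mul _).sub ((i2.const_mul _).add (i1.const_mul _))
  have hder : ∀ u ∈ Ioi (0 : ℝ), HasDerivAt S (g u) u := by
    intro u hu
    have hu' : (0 : ℝ) < u := hu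
    have hne := one_add_mul_ne_zero hw hu'.le
    have h1 : HasDerivAt (fun t : ℝ => 1 + w * (t : ℂ)) w u := by
      have := ((Complex.ofRealCLM.hasDerivAt (x := u)).const_mul w)
      simpa using this.const_add (1 : ℂ)
    have h2 := ((hasDerivAt_id _).cpow_const (c := ((a - 1 : ℝ) : ℂ))
      (one_add_mul_mem_slitPlane hw hu'.le)).comp u h1
    have h3 : HasDerivAt (fun u : ℝ => Real.exp (-u) * u ^ (a + 1))
        (-Real.exp (-u) * u ^ (a + 1) + Real.exp (-u) * ((a + 1) * u ^ a)) u := by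
      have e1 : HasDerivAt (fun u : ℝ => Real.exp (-u)) (-Real.exp (-u)) u := by
        simpa using (hasDerivAt_neg u).exp
      have e2 := Real.hasDerivAt_rpow_const (x := u) (p := a + 1) (Or.inl hu'.ne')
      have e2' : HasDerivAt (fun u : ℝ => u ^ (a + 1)) ((a + 1) * u ^ a) u := by
        simpa using e2
      exact e1.mul e2'
    have h4 := h3.ofReal_comp.mul h2
    refine h4.congr_deriv ?_
    have c2 : (1 + w * (u : ℂ)) ^ (a : ℂ)
        = (1 + w * (u : ℂ)) ^ ((a - 2 : ℝ) : ℂ) * (1 + w * (u : ℂ)) ^ 2 := by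
      rw [← Complex.cpow_natCast, ← Complex.cpow_add _ _ hne]; congr 1; push_cast; ring
    have c1 : (1 + w * (u : ℂ)) ^ ((a - 1 : ℝ) : ℂ)
        = (1 + w * (u : ℂ)) ^ ((a - 2 : ℝ) : ℂ) * (1 + w * (u : ℂ)) := by
      have h := Complex.cpow_add ((a - 2 : ℝ) : ℂ) 1 hne
      rw [Complex.cpow_one] at h
      rw [← h]; congr 1; push_cast; ring
    have c3 : (1 + w * (u : ℂ)) ^ (((a - 1 : ℝ) : ℂ) - 1)
        = (1 + w * (u : ℂ)) ^ ((a - 2 : ℝ) : ℂ) := by congr 1; push_cast; ring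
    have d1 : u ^ (a + 1) = u ^ a * u := by rw [Real.rpow_add hu', Real.rpow_one]
    have d2 : u ^ (a + 2) = u ^ a * u ^ 2 := by
      rw [Real.rpow_add hu']; norm_cast
    simp only [hg, id, Function.comp]
    rw [c3, c2, c1, d1, d2]
    push_cast
    ring
  have hS0 : S 0 = 0 := by
    simp [hS, Real.zero_rpow (by linarith : a + 1 ≠ 0)]
  have hb : ∀ u : ℝ, 0 ≤ u → ‖S u‖ ≤ Real.exp (-u) * u ^ (a + 1) := by
    intro u hu
    rw [hS]
    simp only
    rw [norm_mul, Complex.norm_real, Real.norm_of_nonneg (by positivity)]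
    exact mul_le_of_le_one_right (by positivity) (norm_cpow_le_one (by linarith) hw hu)
  have hcont : ContinuousWithinAt S (Ici 0) 0 := by
    have h1 : Tendsto (fun u : ℝ => Real.exp (-u) * u ^ (a + 1)) (𝓝[Ici 0] 0) (𝓝 0) := by
      have : ContinuousAt (fun u : ℝ => Real.exp (-u) * u ^ (a + 1)) 0 := by
        refine ContinuousAt.mul (by fun_prop) ?_
        exact Real.continuousAt_rpow_const _ _ (Or.inr (by linarith))
      have h := this.tendsto
      simp only [Real.zero_rpow (by linarith : a + 1 ≠ 0), mul_zero] at h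
      exact h.mono_left nhdsWithin_le_nhds
    rw [ContinuousWithinAt, hS0]
    refine squeeze_zero_norm' ?_ h1
    filter_upwards [self_mem_nhdsWithin] with u hu using hb u hu
  have hlim : Tendsto S atTop (𝓝 0) := by
    have h1 : Tendsto (fun u : ℝ => Real.exp (-u) * u ^ (a + 1)) atTop (𝓝 0) := by
      have := tendsto_rpow_mul_exp_neg_mul_atTop_nhds_zero (a + 1) 1 one_pos
      refine this.congr (fun u => ?_)
      rw [mul_comm]; simp
    refine squeeze_zero_norm' ?_ h1
    filter_upwards [eventually_ge_atTop 0] with u hu using hb u hu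
  have key := integral_Ioi_of_hasDerivAt_of_tendsto hcont hder hgi hlim
  rw [hS0, sub_zero] at key
  have e : ∫ u in Ioi (0 : ℝ), g u = (a + 1) * confl a a w -
      (w ^ 2 * (a - 1) * confl (a + 2) (a - 2) w + (1 + 2 * w) * confl (a + 1) (a - 1) w) := by
    have h := integral_sub (i0.const_mul ((a : ℂ) + 1))
      ((i2.const_mul (w ^ 2 * ((a : ℂ) - 1))).add (i1.const_mul (1 + 2 * w)))
    have h' := integral_add (i2.const_mul (w ^ 2 * ((a : ℂ) - 1))) (i1.const_mul (1 + 2 * w))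
    simp only [integral_const_mul] at h h'
    rw [← confl, ← confl] at h'
    rw [← confl] at h
    simp only [Pi.add_apply, h'] at h
    rw [← h]
  rw [e] at key
  linear_combination -key

/-- `w ℓ'' ` in terms of `ℓ, ℓ'`, for `ℓ = confl a a`. -/
theorem hasDerivAt_confl_one {a : ℝ} (ha : -1 < a) (ha1 : a < 1) {ω : ℂ} (hω : 0 ≤ ω.re)
    (hω0 : ω ≠ 0) {y : ℝ} (hy : 0 < y) :
    HasDerivAt (fun t : ℝ => confl (a + 1) (a - 1) (ω * t))
      (ω * (((a + 1) * confl a a (ω * y) - (1 + 2 * (ω * y)) * confl (a + 1) (a - 1) (ω * y))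
        / (ω * y) ^ 2)) y := by
  have h := hasDerivAt_confl (p := a + 1) (q := a - 1) (by linarith) (by linarith) hω hy
  have hre : 0 ≤ (ω * (y : ℂ)).re := by simp; positivity
  have id := confl_identity ha ha1 hre
  refine h.congr_deriv ?_
  have hy' : (y : ℂ) ≠ 0 := by exact_mod_cast hy.ne'
  rw [← id]
  have e1 : a + 1 + 1 = a + 2 := by ring
  have e2 : a - 1 - 1 = a - 2 := by ring
  rw [e1, e2]
  field_simp
  push_cast
  ring

theorem tendsto_confl_zero {a : ℝ} (ha : -1 < a) (ha1 : a < 1) {ω : ℂ} (hω : 0 ≤ ω.re) :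
    Tendsto (fun t : ℝ => confl a a (ω * t)) (𝓝[>] 0) (𝓝 (Real.Gamma (a + 1))) := by
  have e : ((Real.Gamma (a + 1) : ℝ) : ℂ) = confl a a 0 := by
    rw [← integral_exp_mul_rpow ha, ← integral_complex_ofReal]; simp [confl]
  rw [e]
  have hre : ∀ t : ℝ, 0 < t → 0 ≤ (ω * (t : ℂ)).re := fun t ht => by simp; positivity
  refine tendsto_integral_filter_of_dominated_convergence
    (fun u => Real.exp (-u) * u ^ a + ‖ω‖ * (Real.exp (-u) * u ^ (a + 1))) ?_ ?_
    ((integrableOn_exp_mul_rpow ha).add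
      ((integrableOn_exp_mul_rpow (p := a + 1) (by linarith)).const_mul ‖ω‖)) ?_
  · filter_upwards [self_mem_nhdsWithin] with t ht
    exact aestronglyMeasurable_confl_integrand a a (hre t ht)
  · have h1 : ∀ᶠ t : ℝ in 𝓝[>] 0, t < 1 := nhdsWithin_le_nhds (Iio_mem_nhds one_pos)
    filter_upwards [self_mem_nhdsWithin, h1] with t ht ht1
    have ht' : 0 < t := ht
    filter_upwards [ae_restrict_mem measurableSet_Ioi] with u hu
    have hu' : (0 : ℝ) < u := hu
    rw [norm_mul, norm_exp_mul_rpow hu']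
    have h2 := norm_cpow_le_linear ha1.le (hre t ht) hu'.le
    have h3 : ‖ω * (t : ℂ)‖ ≤ ‖ω‖ := by
      rw [norm_mul, Complex.norm_real, Real.norm_of_nonneg ht'.le]
      exact mul_le_of_le_one_right (norm_nonneg _) ht1.le
    rw [Real.rpow_add hu', Real.rpow_one]
    calc _ ≤ Real.exp (-u) * u ^ a * (1 + ‖ω‖ * u) := by
          gcongr; exact h2.trans (by gcongr)
      _ = _ := by ring
  · filter_upwards [ae_restrict_mem measurableSet_Ioi] with u hu
    refine Tendsto.const_mul _ ?_
    have hc : ContinuousAt (fun t : ℝ => (1 + ω * (t : ℂ) * (u : ℂ)) ^ (a : ℂ)) 0 := by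
      refine ContinuousAt.cpow (by fun_prop) continuousAt_const ?_
      simp
    have := hc.tendsto
    simp only [Complex.ofReal_zero, mul_zero] at this
    exact this.mono_left nhdsWithin_le_nhds

/-! ### Gaussian mixtures -/

/-- `∫₀^∞ e^{-x² w} f(w) w^{-1/2} dw`. -/
def mix (f : ℝ → ℝ) (x : ℝ) : ℝ :=
  ∫ w in Ioi (0 : ℝ), Real.exp (-x ^ 2 * w) * f w * w ^ (-(1 / 2) : ℝ)

/-- Functions on `(0, ∞)` that are continuous and of at most polynomial growth. -/
structure PolyBdd (f : ℝ → ℝ) : Prop where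
  cont : ContinuousOn f (Ioi 0)
  bdd : ∃ K : ℝ, ∃ n : ℕ, 0 ≤ K ∧ ∀ w, 0 < w → |f w| ≤ K * (1 + w ^ n)

theorem integrableOn_exp_sq_mul_rpow {x s : ℝ} (hx : 0 < x) (hs : -1 < s) :
    IntegrableOn (fun w : ℝ => Real.exp (-x ^ 2 * w) * w ^ s) (Ioi 0) := by
  have h := integrableOn_rpow_mul_exp_neg_mul_rpow (p := 1) (s := s) (b := x ^ 2) hs one_pos
    (by positivity)
  refine h.congr_fun (fun w _ => ?_) measurableSet_Ioi
  simp only [Real.rpow_one]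
  ring

theorem integral_exp_sq_mul_rpow {x s : ℝ} (hx : 0 < x) (hs : -1 < s) :
    ∫ w in Ioi (0 : ℝ), Real.exp (-x ^ 2 * w) * w ^ s
      = Real.Gamma (s + 1) * x ^ (-(2 * s + 2)) := by
  have h := Real.integral_rpow_mul_exp_neg_mul_Ioi (a := s + 1) (r := x ^ 2) (by linarith)
    (by positivity)
  have e : (1 / x ^ 2) ^ (s + 1) = x ^ (-(2 * s + 2)) := by
    rw [one_div, ← Real.rpow_natCast, ← Real.rpow_neg hx.le, ← Real.rpow_mul hx.le]
    congr 1; push_cast; ring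
  rw [e] at h
  rw [mul_comm, ← h]
  refine setIntegral_congr_fun measurableSet_Ioi (fun w _ => ?_)
  simp only [add_sub_cancel_right, neg_mul]
  ring

theorem PolyBdd.integrableOn {f : ℝ → ℝ} (hf : PolyBdd f) {x : ℝ} (hx : 0 < x) :
    IntegrableOn (fun w : ℝ => Real.exp (-x ^ 2 * w) * f w * w ^ (-(1 / 2) : ℝ)) (Ioi 0) := by
  obtain ⟨K, n, hK, hb⟩ := hf.bdd
  have h1 := ((integrableOn_exp_sq_mul_rpow (s := -(1 / 2)) hx (by norm_num)).add
    (integrableOn_exp_sq_mul_rpow (s := n - 1 / 2) hx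
      (by have : (0 : ℝ) ≤ n := by positivity
          linarith))).const_mul K
  refine Integrable.mono' h1 ?_ ?_
  · refine ContinuousOn.aestronglyMeasurable ?_ measurableSet_Ioi
    refine ContinuousOn.mul (ContinuousOn.mul (by fun_prop) hf.cont) ?_
    exact ContinuousOn.rpow_const continuousOn_id (fun u hu => Or.inl (ne_of_gt hu))
  · filter_upwards [ae_restrict_mem measurableSet_Ioi] with w hw
    have hw' : (0 : ℝ) < w := hw
    rw [Real.norm_eq_abs, abs_mul, abs_mul, abs_of_pos (Real.exp_pos _),
      abs_of_pos (Real.rpow_pos_of_pos hw' _)]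
    have e : w ^ ((n : ℝ) - 1 / 2) = w ^ n * w ^ (-(1 / 2) : ℝ) := by
      rw [sub_eq_add_neg, Real.rpow_add hw', Real.rpow_natCast]
    simp only [Pi.add_apply]
    rw [e]
    calc _ ≤ Real.exp (-x ^ 2 * w) * (K * (1 + w ^ n)) * w ^ (-(1 / 2) : ℝ) := by
          gcongr; exact hb w hw'
      _ = _ := by ring

theorem PolyBdd.id_mul {f : ℝ → ℝ} (hf : PolyBdd f) : PolyBdd (fun w => w * f w) := by
  obtain ⟨K, n, hK, hb⟩ := hf.bdd
  refine ⟨continuousOn_id.mul hf.cont, 2 * K, n + 1, by positivity, fun w hw => ?_⟩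
  rw [abs_mul, abs_of_pos hw]
  have h1 : w ≤ 1 + w ^ (n + 1) := by
    rcases le_total w 1 with h | h
    · have : 0 ≤ w ^ (n + 1) := by positivity
      linarith
    · have : w ≤ w ^ (n + 1) := le_self_pow₀ h (Nat.succ_ne_zero n)
      linarith
  calc w * |f w| ≤ w * (K * (1 + w ^ n)) := by gcongr; exact hb w hw
    _ = K * (w + w ^ (n + 1)) := by ring
    _ ≤ K * ((1 + w ^ (n + 1)) + (1 + w ^ (n + 1))) := by gcongr; linarith
    _ = _ := by ring

theorem PolyBdd.const_mul {f : ℝ → ℝ} (hf : PolyBdd f) (c : ℝ) : PolyBdd (fun w => c * f w) := by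
  obtain ⟨K, n, hK, hb⟩ := hf.bdd
  refine ⟨continuousOn_const.mul hf.cont, |c| * K, n, by positivity, fun w hw => ?_⟩
  rw [abs_mul, mul_assoc]
  gcongr
  exact hb w hw

theorem PolyBdd.add {f g : ℝ → ℝ} (hf : PolyBdd f) (hg : PolyBdd g) :
    PolyBdd (fun w => f w + g w) := by
  obtain ⟨K, n, hK, hb⟩ := hf.bdd
  obtain ⟨L, k, hL, hb'⟩ := hg.bdd
  have key : ∀ (i j : ℕ) (w : ℝ), 0 < w → w ^ i ≤ 1 + w ^ (i + j) := by
    intro i j w hw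
    rcases le_total w 1 with h | h
    · have : w ^ i ≤ 1 := pow_le_one₀ hw.le h
      have : 0 ≤ w ^ (i + j) := by positivity
      linarith
    · have := pow_le_pow_right₀ h (Nat.le_add_right i j)
      linarith
  refine ⟨hf.cont.add hg.cont, 2 * (K + L), n + k, by positivity, fun w hw => ?_⟩
  have h1 := key n k w hw
  have h2 := key k n w hw
  rw [add_comm k n] at h2
  have h3 : 0 ≤ w ^ (n + k) := by positivity
  calc |f w + g w| ≤ |f w| + |g w| := abs_add_le _ _
    _ ≤ K * (1 + w ^ n) + L * (1 + w ^ k) := add_le_add (hb w hw) (hb' w hw)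
    _ ≤ K * (2 + 2 * w ^ (n + k)) + L * (2 + 2 * w ^ (n + k)) :=
        add_le_add (mul_le_mul_of_nonneg_left (by linarith) hK)
          (mul_le_mul_of_nonneg_left (by linarith) hL)
    _ = _ := by ring

theorem mix_add {f g : ℝ → ℝ} (hf : PolyBdd f) (hg : PolyBdd g) {x : ℝ} (hx : 0 < x) :
    mix (fun w => f w + g w) x = mix f x + mix g x := by
  unfold mix
  rw [← integral_add (hf.integrableOn hx) (hg.integrableOn hx)]
  congr 1
  funext w
  ring

theorem mix_const_mul (f : ℝ → ℝ) (c x : ℝ) : mix (fun w => c * f w) x = c * mix f x := by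
  unfold mix
  rw [← integral_const_mul]
  congr 1
  funext w
  ring

theorem hasDerivAt_mix {f : ℝ → ℝ} (hf : PolyBdd f) {x : ℝ} (hx : 0 < x) :
    HasDerivAt (mix f) (-2 * x * mix (fun w => w * f w) x) x := by
  have hf1 := hf.id_mul
  have key := hasDerivAt_integral_of_dominated_loc_of_deriv_le (𝕜 := ℝ)
    (μ := volume.restrict (Ioi (0 : ℝ))) (x₀ := x) (s := Ioo (x / 2) (2 * x))
    (F := fun t w => Real.exp (-t ^ 2 * w) * f w * w ^ (-(1 / 2) : ℝ))
    (F' := fun t w => -2 * t * (Real.exp (-t ^ 2 * w) * (w * f w) * w ^ (-(1 / 2) : ℝ)))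
    (bound := fun w => 4 * x * ‖Real.exp (-(x / 2) ^ 2 * w) * (w * f w) * w ^ (-(1 / 2) : ℝ)‖)
    (Ioo_mem_nhds (by linarith) (by linarith)) ?_ (hf.integrableOn hx)
    ((hf1.integrableOn hx).const_mul _).aestronglyMeasurable ?_
    ((hf1.integrableOn (by positivity)).norm.const_mul _) ?_
  · have h := key.2
    rw [integral_const_mul] at h
    exact h
  · filter_upwards [Ioi_mem_nhds hx] with t ht
    exact (hf.integrableOn ht).aestronglyMeasurable
  · filter_upwards [ae_restrict_mem measurableSet_Ioi] with w hw t ht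
    have hw' : (0 : ℝ) < w := hw
    have ht0 : 0 < t := by linarith [ht.1]
    simp only [norm_mul, Real.norm_eq_abs, Real.abs_exp]
    have e1 : Real.exp (-t ^ 2 * w) ≤ Real.exp (-(x / 2) ^ 2 * w) := by
      apply Real.exp_le_exp.2
      have : (x / 2) ^ 2 ≤ t ^ 2 := pow_le_pow_left₀ (by positivity) ht.1.le 2
      nlinarith
    have e2 : |(-2 : ℝ)| * |t| ≤ 4 * x := by
      rw [abs_of_pos ht0]; norm_num; linarith [ht.2]
    gcongr
  · filter_upwards [ae_restrict_mem measurableSet_Ioi] with w hw t ht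
    have h1 : HasDerivAt (fun t : ℝ => -t ^ 2 * w) (-(2 * t) * w) t := by
      have := ((hasDerivAt_pow 2 t).neg).mul_const w
      simpa using this
    refine ((h1.exp.mul_const (f w)).mul_const (w ^ (-(1 / 2) : ℝ))).congr_deriv ?_
    ring

/-- Integration by parts. -/
theorem mix_integration_by_parts {f f' : ℝ → ℝ} (hf : PolyBdd f)
    (hf' : PolyBdd (fun w => w * f' w)) (hd : ∀ w, 0 < w → HasDerivAt f (f' w) w)
    {x : ℝ} (hx : 0 < x) :
    2 * x ^ 2 * mix (fun w => w * f w) x = mix f x + 2 * mix (fun w => w * f' w) x := by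
  obtain ⟨K, n, hK, hb⟩ := hf.bdd
  -- The primitive carries w^(1/2), which kills the boundary term at 0; differentiating this power
  -- restores the weight w^(-1/2) of `mix` and produces the term 1/2 · `mix f x`.
  set S : ℝ → ℝ := fun w => Real.exp (-x ^ 2 * w) * f w * w ^ (1 / 2 : ℝ) with hS
  set S' : ℝ → ℝ := fun w =>
    (1 / 2) * (Real.exp (-x ^ 2 * w) * f w * w ^ (-(1 / 2) : ℝ))
    + Real.exp (-x ^ 2 * w) * (w * f' w) * w ^ (-(1 / 2) : ℝ)
    - x ^ 2 * (Real.exp (-x ^ 2 * w) * (w * f w) * w ^ (-(1 / 2) : ℝ)) with hS'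
  have hI : IntegrableOn S' (Ioi 0) :=
    (((hf.integrableOn hx).const_mul _).add (hf'.integrableOn hx)).sub
      ((hf.id_mul.integrableOn hx).const_mul _)
  have hbS : ∀ w : ℝ, 0 ≤ w → ‖S w‖ ≤
      K * (Real.exp (-x ^ 2 * w) * w ^ (1 / 2 : ℝ)
        + Real.exp (-x ^ 2 * w) * w ^ ((n : ℝ) + 1 / 2)) := by
    intro w hw
    rcases hw.eq_or_lt with h | hw
    · rw [hS, ← h]
      simp only [Real.norm_eq_abs]
      rw [Real.zero_rpow (by norm_num), Real.zero_rpow (by positivity)]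
      simp
    · rw [hS]
      simp only [Real.norm_eq_abs]
      rw [abs_mul, abs_mul, Real.abs_exp, abs_of_pos (Real.rpow_pos_of_pos hw _),
        Real.rpow_add hw, Real.rpow_natCast]
      calc _ ≤ Real.exp (-x ^ 2 * w) * (K * (1 + w ^ n)) * w ^ (1 / 2 : ℝ) := by
            gcongr; exact hb w hw
        _ = _ := by ring
  have hcont : ContinuousWithinAt S (Ici 0) 0 := by
    have hc : ContinuousAt (fun w : ℝ => K * (Real.exp (-x ^ 2 * w) * w ^ (1 / 2 : ℝ)
        + Real.exp (-x ^ 2 * w) * w ^ ((n : ℝ) + 1 / 2))) 0 := by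
      have h1 := Real.continuousAt_rpow_const 0 (1 / 2) (Or.inr (by norm_num))
      have h2 := Real.continuousAt_rpow_const 0 ((n : ℝ) + 1 / 2) (Or.inr (by positivity))
      refine continuousAt_const.mul (ContinuousAt.add ?_ ?_)
      · exact ContinuousAt.mul (by fun_prop) h1
      · exact ContinuousAt.mul (by fun_prop) h2
    have h := hc.tendsto
    have z1 : (0 : ℝ) ^ (1 / 2 : ℝ) = 0 := Real.zero_rpow (by norm_num)
    have z2 : (0 : ℝ) ^ ((n : ℝ) + 1 / 2) = 0 := Real.zero_rpow (by positivity)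
    simp only [z1, z2, mul_zero, add_zero] at h
    have hS0 : S 0 = 0 := by rw [hS]; simp only [z1, mul_zero]
    rw [ContinuousWithinAt, hS0]
    refine squeeze_zero_norm' ?_ (h.mono_left nhdsWithin_le_nhds)
    filter_upwards [self_mem_nhdsWithin] with w hw using hbS w hw
  have hlim : Tendsto S atTop (𝓝 0) := by
    have h1 := tendsto_rpow_mul_exp_neg_mul_atTop_nhds_zero (1 / 2) (x ^ 2) (by positivity)
    have h2 := tendsto_rpow_mul_exp_neg_mul_atTop_nhds_zero ((n : ℝ) + 1 / 2) (x ^ 2)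
      (by positivity)
    have h3 := (h1.add h2).const_mul K
    simp only [add_zero, mul_zero] at h3
    refine squeeze_zero_norm' ?_ h3
    filter_upwards [eventually_ge_atTop 0] with w hw
    refine (hbS w hw).trans (le_of_eq ?_)
    ring
  have hder : ∀ w ∈ Ioi (0 : ℝ), HasDerivAt S (S' w) w := by
    intro w hw
    have hw' : (0 : ℝ) < w := hw
    have h1 : HasDerivAt (fun w : ℝ => -x ^ 2 * w) (-x ^ 2) w := by
      simpa using (hasDerivAt_id w).const_mul (-x ^ 2)
    have h2 := Real.hasDerivAt_rpow_const (x := w) (p := 1 / 2) (Or.inl hw'.ne')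
    refine ((h1.exp.mul (hd w hw')).mul h2).congr_deriv ?_
    have e1 : w ^ (1 / 2 : ℝ) = w * w ^ (-(1 / 2) : ℝ) := by
      conv_rhs => rw [← Real.rpow_one w, ← Real.rpow_mul hw'.le, ← Real.rpow_add hw']
      norm_num
    have e2 : w ^ ((1 / 2 : ℝ) - 1) = w ^ (-(1 / 2) : ℝ) := by norm_num
    simp only [hS', Pi.mul_apply]
    rw [e2, e1]
    ring
  have key := integral_Ioi_of_hasDerivAt_of_tendsto hcont hder hI hlim
  have hS0 : S 0 = 0 := by
    rw [hS]; simp only [Real.zero_rpow (by norm_num : (1 / 2 : ℝ) ≠ 0), mul_zero]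
  rw [hS0, sub_zero] at key
  have e : ∫ w in Ioi (0 : ℝ), S' w = (1 / 2) * mix f x + mix (fun w => w * f' w) x
      - x ^ 2 * mix (fun w => w * f w) x := by
    have h := integral_sub (((hf.integrableOn hx).const_mul (1 / 2)).add (hf'.integrableOn hx))
      ((hf.id_mul.integrableOn hx).const_mul (x ^ 2))
    have h' := integral_add ((hf.integrableOn hx).const_mul (1 / 2)) (hf'.integrableOn hx)
    simp only [integral_const_mul] at h h'
    simp only [Pi.add_apply] at h
    rw [h'] at h
    exact h
  rw [e] at key
  linarith

theorem mix_rpow {x b : ℝ} (hx : 0 < x) (hb : -(1 / 2) < b) :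
    mix (fun w => w ^ b) x = Real.Gamma (b + 1 / 2) * x ^ (-(2 * b + 1)) := by
  have h := integral_exp_sq_mul_rpow (x := x) (s := b - 1 / 2) hx (by linarith)
  have e1 : b - 1 / 2 + 1 = b + 1 / 2 := by ring
  have e2 : -(2 * (b - 1 / 2) + 2) = -(2 * b + 1) := by ring
  rw [e1, e2] at h
  rw [← h]
  refine setIntegral_congr_fun measurableSet_Ioi (fun w hw => ?_)
  simp only
  rw [sub_eq_add_neg, Real.rpow_add hw, mul_assoc]

theorem abs_mix_le {f : ℝ → ℝ} {K b : ℝ} (hb : 0 ≤ b)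
    (hf : ∀ w, 0 < w → |f w| ≤ K * (1 + w ^ b)) {x : ℝ} (hx : 0 < x) :
    |mix f x| ≤ K * (Real.Gamma (1 / 2) * x⁻¹ + Real.Gamma (b + 1 / 2) * x ^ (-(2 * b + 1))) := by
  have i0 := integrableOn_exp_sq_mul_rpow (x := x) (s := -(1 / 2)) hx (by norm_num)
  have i1 := integrableOn_exp_sq_mul_rpow (x := x) (s := b - 1 / 2) hx (by linarith)
  have h0 := integral_exp_sq_mul_rpow (x := x) (s := -(1 / 2)) hx (by norm_num)
  have h1 := integral_exp_sq_mul_rpow (x := x) (s := b - 1 / 2) hx (by linarith)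
  have e1 : b - 1 / 2 + 1 = b + 1 / 2 := by ring
  have e2 : -(2 * (b - 1 / 2) + 2) = -(2 * b + 1) := by ring
  have e3 : -(1 / 2) + 1 = (1 / 2 : ℝ) := by ring
  have e4 : x ^ (-(2 * (-(1 / 2)) + 2) : ℝ) = x⁻¹ := by
    rw [← Real.rpow_neg_one]; norm_num
  rw [e1, e2] at h1
  rw [e3, e4] at h0
  have h2 := integral_add i0 i1
  rw [h0, h1] at h2
  rw [← h2, ← integral_const_mul, mix, ← Real.norm_eq_abs]
  refine norm_integral_le_of_norm_le ((i0.add i1).const_mul K) ?_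
  filter_upwards [ae_restrict_mem measurableSet_Ioi] with w hw
  have hw' : (0 : ℝ) < w := hw
  rw [Real.norm_eq_abs, abs_mul, abs_mul, Real.abs_exp, abs_of_pos (Real.rpow_pos_of_pos hw' _)]
  rw [sub_eq_add_neg, Real.rpow_add hw']
  calc _ ≤ Real.exp (-x ^ 2 * w) * (K * (1 + w ^ b)) * w ^ (-(1 / 2) : ℝ) := by
        gcongr; exact hf w hw'
    _ = _ := by ring

/-- The substitution y = x²w replaces f(w) by f(y/x²), so for large x only the value of f at 0+ is
seen (Watson's lemma). -/
theorem tendsto_mul_mix {f : ℝ → ℝ} (hf : PolyBdd f) {c : ℝ}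
    (hc : Tendsto f (𝓝[>] 0) (𝓝 c)) :
    Tendsto (fun x => x * mix f x) atTop (𝓝 (c * Real.Gamma (1 / 2))) := by
  obtain ⟨K, n, hK, hb⟩ := hf.bdd
  have hsub : ∀ x : ℝ, 0 < x → x * mix f x
      = ∫ y in Ioi (0 : ℝ), Real.exp (-y) * f (y / x ^ 2) * y ^ (-(1 / 2) : ℝ) := by
    intro x hx
    have h := integral_comp_mul_left_Ioi
      (fun y : ℝ => Real.exp (-y) * f (y / x ^ 2) * y ^ (-(1 / 2) : ℝ)) 0 (b := x ^ 2)
      (by positivity)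
    rw [mul_zero] at h
    have h' : ∫ y in Ioi (0 : ℝ), Real.exp (-y) * f (y / x ^ 2) * y ^ (-(1 / 2) : ℝ)
        = x ^ 2 * ∫ w in Ioi (0 : ℝ), Real.exp (-(x ^ 2 * w)) * f (x ^ 2 * w / x ^ 2)
          * (x ^ 2 * w) ^ (-(1 / 2) : ℝ) := by
      rw [h, smul_eq_mul, ← mul_assoc, mul_inv_cancel₀ (by positivity), one_mul]
    rw [h', mix, ← integral_const_mul, ← integral_const_mul]
    refine setIntegral_congr_fun measurableSet_Ioi (fun w hw => ?_)
    have hw' : (0 : ℝ) < w := hw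
    rw [mul_div_cancel_left₀ _ (by positivity), Real.mul_rpow (by positivity) hw'.le,
      ← Real.rpow_natCast x 2, ← Real.rpow_mul hx.le]
    have : x ^ (((2 : ℕ) : ℝ) * -(1 / 2)) = x⁻¹ := by
      rw [← Real.rpow_neg_one]; norm_num
    rw [this]
    norm_cast
    field_simp
  have hG : c * Real.Gamma (1 / 2)
      = ∫ y in Ioi (0 : ℝ), Real.exp (-y) * c * y ^ (-(1 / 2) : ℝ) := by
    have := integral_exp_mul_rpow (p := -(1 / 2)) (by norm_num)
    rw [show (1 / 2 : ℝ) = -(1 / 2) + 1 by norm_num, ← this, ← integral_const_mul]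
    congr 1; funext y; ring_nf
  rw [hG]
  have h0 : Tendsto (fun x => ∫ y in Ioi (0 : ℝ),
      Real.exp (-y) * f (y / x ^ 2) * y ^ (-(1 / 2) : ℝ)) atTop
      (𝓝 (∫ y in Ioi (0 : ℝ), Real.exp (-y) * c * y ^ (-(1 / 2) : ℝ))) := by
    refine tendsto_integral_filter_of_dominated_convergence
      (fun y => K * (Real.exp (-y) * y ^ (-(1 / 2) : ℝ)
        + Real.exp (-y) * y ^ ((n : ℝ) - 1 / 2))) ?_ ?_
      (((integrableOn_exp_mul_rpow (by norm_num)).add (integrableOn_exp_mul_rpow (by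
          have : (0 : ℝ) ≤ n := by positivity
          linarith))).const_mul K) ?_
    · filter_upwards [eventually_gt_atTop 0] with x hx
      refine ContinuousOn.aestronglyMeasurable ?_ measurableSet_Ioi
      refine ContinuousOn.mul (ContinuousOn.mul (by fun_prop) ?_) ?_
      · refine hf.cont.comp (by fun_prop) (fun y hy => ?_)
        have : (0 : ℝ) < y := hy
        exact div_pos this (by positivity)
      · exact ContinuousOn.rpow_const continuousOn_id (fun u hu => Or.inl (ne_of_gt hu))
    · filter_upwards [eventually_ge_atTop 1] with x hx
      filter_upwards [ae_restrict_mem measurableSet_Ioi] with y hy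
      have hy' : (0 : ℝ) < y := hy
      have hx0 : 0 < x := by linarith
      rw [Real.norm_eq_abs, abs_mul, abs_mul, Real.abs_exp,
        abs_of_pos (Real.rpow_pos_of_pos hy' _), sub_eq_add_neg, Real.rpow_add hy',
        Real.rpow_natCast]
      have h1 : y / x ^ 2 ≤ y := div_le_self hy'.le (one_le_pow₀ hx)
      calc _ ≤ Real.exp (-y) * (K * (1 + (y / x ^ 2) ^ n)) * y ^ (-(1 / 2) : ℝ) := by
            gcongr; exact hb _ (by positivity)
        _ ≤ Real.exp (-y) * (K * (1 + y ^ n)) * y ^ (-(1 / 2) : ℝ) := by gcongr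
        _ = _ := by ring
    · filter_upwards [ae_restrict_mem measurableSet_Ioi] with y hy
      have hy' : (0 : ℝ) < y := hy
      refine Tendsto.mul_const _ (Tendsto.const_mul _ (hc.comp ?_))
      refine tendsto_nhdsWithin_iff.2 ⟨?_, ?_⟩
      · exact tendsto_const_nhds.div_atTop (tendsto_pow_atTop two_ne_zero)
      · filter_upwards [eventually_gt_atTop 0] with x hx
        exact div_pos hy' (by positivity)
  refine h0.congr' ?_
  filter_upwards [eventually_gt_atTop 0] with x hx
  exact (hsub x hx).symm

/-! ### The Nicholson-type representation of the products of Hankel functions -/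

theorem eq_of_hasDerivAt_zero_of_tendsto {f : ℝ → ℂ} {c : ℂ}
    (hf : ∀ x, 0 < x → HasDerivAt f 0 x) (hc : Tendsto f atTop (𝓝 c)) {x : ℝ} (hx : 0 < x) :
    f x = c := by
  have h : ∀ y, 0 < y → f y = f x := fun y hy =>
    isOpen_Ioi.is_const_of_deriv_eq_zero isPreconnected_Ioi
      (fun z hz => (hf z hz).differentiableAt.differentiableWithinAt)
      (fun z hz => (hf z hz).deriv) hy hx
  refine tendsto_nhds_unique (tendsto_const_nhds.congr' ?_) hc
  filter_upwards [eventually_gt_atTop 0] with y hy using (h y hy).symm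

/-- The real form of `confl` on the positive axis. -/
def rconfl (p q w : ℝ) : ℝ :=
  ∫ u in Ioi (0 : ℝ), Real.exp (-u) * u ^ p * (1 + w * u) ^ q

theorem confl_ofReal (p q : ℝ) {w : ℝ} (hw : 0 ≤ w) : confl p q (w : ℂ) = rconfl p q w := by
  unfold confl rconfl
  rw [← integral_complex_ofReal]
  refine setIntegral_congr_fun measurableSet_Ioi (fun u hu => ?_)
  have hu' : (0 : ℝ) < u := hu
  have h := Complex.ofReal_cpow (show 0 ≤ 1 + w * u by positivity) q
  push_cast at h ⊢
  rw [h]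

theorem hasDerivAt_rconfl {p q : ℝ} (hp : -1 < p) (hq : q ≤ 1) {w : ℝ} (hw : 0 < w) :
    HasDerivAt (rconfl p q) (q * rconfl (p + 1) (q - 1) w) w := by
  have h := (hasDerivAt_confl hp hq (ω := 1) (by simp) hw)
  have h2 : HasDerivAt (fun t : ℝ => ((rconfl p q t : ℝ) : ℂ))
      ((q * rconfl (p + 1) (q - 1) w : ℝ) : ℂ) w := by
    have e : (q : ℂ) * 1 * confl (p + 1) (q - 1) (1 * (w : ℂ))
        = ((q * rconfl (p + 1) (q - 1) w : ℝ) : ℂ) := by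
      rw [one_mul, confl_ofReal _ _ hw.le]; push_cast; ring
    rw [← e]
    refine h.congr_of_eventuallyEq ?_
    filter_upwards [Ioi_mem_nhds hw] with t ht
    rw [one_mul, confl_ofReal _ _ (le_of_lt ht)]
  exact Complex.reCLM.hasFDerivAt.comp_hasDerivAt w h2

theorem hasDerivAt_rconfl_one {a : ℝ} (ha : -1 < a) (ha1 : a < 1) {w : ℝ} (hw : 0 < w) :
    HasDerivAt (rconfl (a + 1) (a - 1))
      (((a + 1) * rconfl a a w - (1 + 2 * w) * rconfl (a + 1) (a - 1) w) / w ^ 2) w := by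
  have h := (hasDerivAt_confl_one ha ha1 (ω := 1) (by simp) one_ne_zero hw)
  have h2 : HasDerivAt (fun t : ℝ => ((rconfl (a + 1) (a - 1) t : ℝ) : ℂ))
      ((((a + 1) * rconfl a a w - (1 + 2 * w) * rconfl (a + 1) (a - 1) w) / w ^ 2 : ℝ) : ℂ) w := by
    refine (h.congr_of_eventuallyEq ?_).congr_deriv ?_
    · filter_upwards [Ioi_mem_nhds hw] with t ht
      rw [one_mul, confl_ofReal _ _ (le_of_lt ht)]
    · rw [one_mul, one_mul, confl_ofReal _ _ hw.le, confl_ofReal _ _ hw.le]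
      push_cast
      ring
  exact Complex.reCLM.hasFDerivAt.comp_hasDerivAt w h2

theorem rconfl_nonneg (p q : ℝ) {w : ℝ} (hw : 0 ≤ w) : 0 ≤ rconfl p q w := by
  refine setIntegral_nonneg measurableSet_Ioi (fun u hu => ?_)
  have hu' : (0 : ℝ) < u := hu
  positivity

theorem rconfl_le_gamma {p q : ℝ} (hp : -1 < p) (hq : q ≤ 0) {w : ℝ} (hw : 0 ≤ w) :
    rconfl p q w ≤ Real.Gamma (p + 1) := by
  have h := norm_confl_le hp hq (w := (w : ℂ)) (by simpa using hw)
  rw [confl_ofReal _ _ hw, Complex.norm_real] at h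
  exact (le_abs_self _).trans h

/-! ### Growth bounds for the mixing densities -/

theorem one_add_rpow_le {a b y : ℝ} (hb : 0 ≤ b) (hab : a ≤ b) (hb1 : b ≤ 1) (hy : 0 ≤ y) :
    (1 + y) ^ a ≤ 1 + y ^ b := by
  calc (1 + y) ^ a ≤ (1 + y) ^ b := Real.rpow_le_rpow_of_exponent_le (by linarith) hab
    _ ≤ 1 ^ b + y ^ b := Real.rpow_add_le_add_rpow one_pos.le hy hb hb1
    _ = _ := by rw [Real.one_rpow]

/-- A density growing like w^b has a mixture of size x^(-(2b+1)) at small x. The exponent b is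
therefore kept free instead of being rounded up to 1: with b = max a 0 the infrared power stays
below 3, hence integrable in three dimensions. -/
theorem rconfl_self_le {a b : ℝ} (ha : -1 < a) (hb : 0 ≤ b) (hab : a ≤ b) (hb1 : b ≤ 1) {w : ℝ}
    (hw : 0 < w) :
    rconfl a a w ≤ (Real.Gamma (a + 1) + Real.Gamma (a + b + 1)) * (1 + w ^ b) := by
  have i0 := integrableOn_exp_mul_rpow ha
  have i1 := integrableOn_exp_mul_rpow (p := a + b) (by linarith)
  have h : rconfl a a w ≤ Real.Gamma (a + 1) + w ^ b * Real.Gamma (a + b + 1) := by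
    rw [← integral_exp_mul_rpow ha, ← integral_exp_mul_rpow (p := a + b) (by linarith),
      ← integral_const_mul, ← integral_add i0 (i1.const_mul _)]
    refine integral_mono_of_nonneg ?_ (i0.add (i1.const_mul _)) ?_
    · filter_upwards [ae_restrict_mem measurableSet_Ioi] with u hu
      have hu' : (0 : ℝ) < u := hu
      simp only [Pi.zero_apply]
      positivity
    · filter_upwards [ae_restrict_mem measurableSet_Ioi] with u hu
      have hu' : (0 : ℝ) < u := hu
      have h1 := one_add_rpow_le hb hab hb1 (y := w * u) (by positivity)
      rw [Real.mul_rpow hw.le hu'.le] at h1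
      rw [Real.rpow_add hu']
      calc _ ≤ Real.exp (-u) * u ^ a * (1 + w ^ b * u ^ b) := by gcongr
        _ = _ := by ring
  have g0 := Real.Gamma_pos_of_pos (show 0 < a + 1 by linarith)
  have g1 := Real.Gamma_pos_of_pos (show 0 < a + b + 1 by linarith)
  have hwb : 0 ≤ w ^ b := by positivity
  nlinarith [mul_nonneg g0.le hwb]

theorem polyBdd_rconfl_self {a : ℝ} (ha : -1 < a) (ha1 : a < 1) : PolyBdd (rconfl a a) := by
  refine ⟨fun w hw => (hasDerivAt_rconfl ha ha1.le hw).continuousAt.continuousWithinAt,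
    Real.Gamma (a + 1) + Real.Gamma (a + 1 + 1), 1, ?_, fun w hw => ?_⟩
  · have g0 := Real.Gamma_pos_of_pos (show 0 < a + 1 by linarith)
    have g1 := Real.Gamma_pos_of_pos (show 0 < a + 1 + 1 by linarith)
    positivity
  · rw [abs_of_nonneg (rconfl_nonneg _ _ hw.le)]
    simpa using rconfl_self_le ha zero_le_one ha1.le le_rfl hw

theorem polyBdd_rconfl_one {a : ℝ} (ha : -1 < a) (ha1 : a < 1) :
    PolyBdd (rconfl (a + 1) (a - 1)) := by
  have g1 := Real.Gamma_pos_of_pos (show 0 < a + 1 + 1 by linarith)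
  refine ⟨fun w hw => (hasDerivAt_rconfl_one ha ha1 hw).continuousAt.continuousWithinAt,
    Real.Gamma (a + 1 + 1), 0, g1.le, fun w hw => ?_⟩
  rw [abs_of_nonneg (rconfl_nonneg _ _ hw.le)]
  have := rconfl_le_gamma (p := a + 1) (q := a - 1) (by linarith) (by linarith) hw.le
  simp
  linarith

/-- The Gaussian-mixture representations of `|H|²`, `2 Re (θH H̄)`, `|θH|²`, where `H` is the Hankel
function of order `a + 1/2` and `θ = x d/dx`. -/
def nichC (a : ℝ) : ℝ := 2 / (Real.pi * Real.sqrt Real.pi * Real.Gamma (a + 1))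

def nichP (a x : ℝ) : ℝ := nichC a * mix (rconfl a a) x

/-- This is x d/dx applied to `nichP`, with the first moment of `rconfl a a` removed by
`mix_id_mul_rconfl`. -/
def nichQ (a x : ℝ) : ℝ :=
  nichC a * (-mix (rconfl a a) x - 2 * (a * mix (fun w => w * rconfl (a + 1) (a - 1) w) x))

/-- The form is dictated by the system: it is the R for which θQ = 2R + 2(ν² - x²)P holds with ν = a
+ 1/2. -/
def nichR (a x : ℝ) : ℝ :=
  nichC a * ((a + 1 / 2) ^ 2 * mix (rconfl a a) x - 2 * (a * mix (rconfl (a + 1) (a - 1)) x)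
    + x ^ 2 * mix (rconfl a a) x)

theorem mix_id_mul_rconfl {a : ℝ} (ha : -1 < a) (ha1 : a < 1) {x : ℝ} (hx : 0 < x) :
    2 * x ^ 2 * mix (fun w => w * rconfl a a w) x
      = mix (rconfl a a) x + 2 * (a * mix (fun w => w * rconfl (a + 1) (a - 1) w) x) := by
  have h0 := polyBdd_rconfl_self ha ha1
  have h1 := (polyBdd_rconfl_one ha ha1).id_mul
  have e : ∀ w : ℝ, w * (a * rconfl (a + 1) (a - 1) w)
      = a * (w * rconfl (a + 1) (a - 1) w) := fun w => by ring
  have := mix_integration_by_parts (f' := fun w => a * rconfl (a + 1) (a - 1) w) h0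
    (by simp only [e]; exact h1.const_mul a) (fun w hw => hasDerivAt_rconfl ha ha1.le hw) hx
  rw [this]
  simp only [e, mix_const_mul]

/-- Integration by parts for the density w ℓ₁(w), with ℓ₁ = `rconfl (a + 1) (a - 1)`. The
differential equation of ℓ₁ expresses w times the derivative of this density through ℓ, ℓ₁ and w ℓ₁,
the pole at w = 0 cancelling. Second moments can thus be eliminated and the system below closes. -/
theorem mix_id_mul_id_mul_rconfl {a : ℝ} (ha : -1 < a) (ha1 : a < 1) {x : ℝ} (hx : 0 < x) :
    2 * x ^ 2 * mix (fun w => w * (w * rconfl (a + 1) (a - 1) w)) x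
      = 2 * (a + 1) * mix (rconfl a a) x - 2 * mix (rconfl (a + 1) (a - 1)) x
        - mix (fun w => w * rconfl (a + 1) (a - 1) w) x := by
  have h0 := polyBdd_rconfl_self ha ha1
  have h1 := polyBdd_rconfl_one ha ha1
  set f' : ℝ → ℝ := fun w => rconfl (a + 1) (a - 1) w +
    w * (((a + 1) * rconfl a a w - (1 + 2 * w) * rconfl (a + 1) (a - 1) w) / w ^ 2) with hf'
  set g : ℝ → ℝ := fun w => (a + 1) * rconfl a a w +
    ((-1) * rconfl (a + 1) (a - 1) w + (-1) * (w * rconfl (a + 1) (a - 1) w)) with hg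
  have hgb : PolyBdd g := (h0.const_mul _).add ((h1.const_mul _).add (h1.id_mul.const_mul _))
  have e : ∀ w : ℝ, 0 < w → w * f' w = g w := by
    intro w hw
    simp only [hf', hg]
    field_simp
    ring
  have hw' : PolyBdd (fun w => w * f' w) := by
    refine ⟨hgb.cont.congr (fun w hw => e w hw), ?_⟩
    obtain ⟨K, n, hK, hb⟩ := hgb.bdd
    exact ⟨K, n, hK, fun w hw => by rw [e w hw]; exact hb w hw⟩
  have h := mix_integration_by_parts h1.id_mul hw' (fun w hw => by
    refine ((hasDerivAt_id w).mul (hasDerivAt_rconfl_one ha ha1 hw)).congr_deriv ?_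
    simp [hf']) hx
  have e2 : mix (fun w => w * f' w) x = mix g x := by
    refine setIntegral_congr_fun measurableSet_Ioi (fun w hw => ?_)
    simp only
    rw [e w hw]
  rw [e2, hg, mix_add (h0.const_mul _) ((h1.const_mul _).add (h1.id_mul.const_mul _)) hx,
    mix_add (h1.const_mul _) (h1.id_mul.const_mul _) hx, mix_const_mul, mix_const_mul,
    mix_const_mul] at h
  rw [h]
  ring

/-- With θ = x d/dx, this and the next two lemmas are θP = Q, θQ = 2R + 2(ν² - x²)P, θR = (ν² -
x²)Q. Any solution of θ²U = (ν² - x²)U has |U|², 2 Re(θU Ū), |θU|² obeying the same system. -/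
theorem hasDerivAt_nichP {a : ℝ} (ha : -1 < a) (ha1 : a < 1) {x : ℝ} (hx : 0 < x) :
    HasDerivAt (nichP a) (nichQ a x / x) x := by
  refine ((hasDerivAt_mix (polyBdd_rconfl_self ha ha1) hx).const_mul (nichC a)).congr_deriv ?_
  have h := mix_id_mul_rconfl ha ha1 hx
  rw [nichQ]
  field_simp
  linear_combination -nichC a * h

theorem hasDerivAt_nichQ {a : ℝ} (ha : -1 < a) (ha1 : a < 1) {x : ℝ} (hx : 0 < x) :
    HasDerivAt (nichQ a)
      ((2 * nichR a x + 2 * ((a + 1 / 2) ^ 2 - x ^ 2) * nichP a x) / x) x := by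
  have d0 := hasDerivAt_mix (polyBdd_rconfl_self ha ha1) hx
  have d1 := hasDerivAt_mix (polyBdd_rconfl_one ha ha1).id_mul hx
  refine ((d0.neg.sub ((d1.const_mul a).const_mul 2)).const_mul (nichC a)).congr_deriv ?_
  have h := mix_id_mul_rconfl ha ha1 hx
  have h' := mix_id_mul_id_mul_rconfl ha ha1 hx
  rw [nichR, nichP]
  generalize mix (fun w => w * (w * rconfl (a + 1) (a - 1) w)) x = M2 at *
  field_simp
  linear_combination 2 * nichC a * h + 4 * nichC a * a * h'

theorem hasDerivAt_nichR {a : ℝ} (ha : -1 < a) (ha1 : a < 1) {x : ℝ} (hx : 0 < x) :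
    HasDerivAt (nichR a) (((a + 1 / 2) ^ 2 - x ^ 2) * nichQ a x / x) x := by
  have d0 := hasDerivAt_mix (polyBdd_rconfl_self ha ha1) hx
  have d1 := hasDerivAt_mix (polyBdd_rconfl_one ha ha1) hx
  refine ((((d0.const_mul ((a + 1 / 2) ^ 2)).sub ((d1.const_mul a).const_mul 2)).add
    ((hasDerivAt_pow 2 x).mul d0)).const_mul (nichC a)).congr_deriv ?_
  have h := mix_id_mul_rconfl ha ha1 hx
  rw [nichQ]
  field_simp
  push_cast
  linear_combination (-4 * nichC a * x ^ 2 - (2 * a + 1) ^ 2 * nichC a) * h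

theorem tendsto_rconfl_zero {a : ℝ} (ha : -1 < a) (ha1 : a < 1) :
    Tendsto (rconfl a a) (𝓝[>] 0) (𝓝 (Real.Gamma (a + 1))) := by
  have h := tendsto_confl_zero ha ha1 (ω := 1) (by simp)
  have h2 := (Complex.continuous_re.tendsto _).comp h
  rw [Complex.ofReal_re] at h2
  refine h2.congr' ?_
  filter_upwards [self_mem_nhdsWithin] with t ht
  simp only [Function.comp, one_mul]
  rw [confl_ofReal _ _ (le_of_lt ht), Complex.ofReal_re]

theorem gamma_half : Real.Gamma (1 / 2) = Real.sqrt Real.pi := Real.Gamma_one_half_eq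

/-- This limit fixes the constant `nichC`: it matches |H_ν(x)|² ~ 2/(πx) at infinity. -/
theorem tendsto_mul_nichP {a : ℝ} (ha : -1 < a) (ha1 : a < 1) :
    Tendsto (fun x => x * nichP a x) atTop (𝓝 (2 / Real.pi)) := by
  have h := (tendsto_mul_mix (polyBdd_rconfl_self ha ha1) (tendsto_rconfl_zero ha ha1)).const_mul
    (nichC a)
  have g := Real.Gamma_pos_of_pos (show 0 < a + 1 by linarith)
  have e : nichC a * (Real.Gamma (a + 1) * Real.Gamma (1 / 2)) = 2 / Real.pi := by
    rw [gamma_half, nichC]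
    have : 0 < Real.sqrt Real.pi := Real.sqrt_pos.2 Real.pi_pos
    field_simp
  rw [e] at h
  refine h.congr (fun x => ?_)
  rw [nichP]; ring

theorem tendsto_mix_zero {f : ℝ → ℝ} {K b : ℝ} (hb : 0 ≤ b)
    (hf : ∀ w, 0 < w → |f w| ≤ K * (1 + w ^ b)) : Tendsto (mix f) atTop (𝓝 0) := by
  have h1 : Tendsto (fun x : ℝ => K * (Real.Gamma (1 / 2) * x⁻¹
      + Real.Gamma (b + 1 / 2) * x ^ (-(2 * b + 1)))) atTop (𝓝 0) := by
    have h := ((tendsto_inv_atTop_zero (𝕜 := ℝ)).const_mul (Real.Gamma (1 / 2))).add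
      ((tendsto_rpow_neg_atTop (show 0 < 2 * b + 1 by linarith)).const_mul
        (Real.Gamma (b + 1 / 2)))
    simpa using h.const_mul K
  refine squeeze_zero_norm' ?_ h1
  filter_upwards [eventually_gt_atTop 0] with x hx using abs_mix_le hb hf hx

theorem id_mul_rconfl_le {a : ℝ} (ha : -1 < a) {w : ℝ} (hw : 0 ≤ w) (ha1 : a < 1) :
    w * rconfl (a + 1) (a - 1) w ≤ rconfl a a w := by
  have hi : ∀ p q : ℝ, -1 < p → q ≤ 1 → IntegrableOn
      (fun u : ℝ => Real.exp (-u) * u ^ p * (1 + w * u) ^ q) (Ioi 0) := by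
    intro p q hp hq
    have h := (integrableOn_confl hp hq (w := (w : ℂ)) (by simpa using hw)).norm
    refine IntegrableOn.congr_fun (s := Ioi 0) h (fun u hu => ?_) measurableSet_Ioi
    have hu' : (0 : ℝ) < u := hu
    rw [norm_mul, norm_exp_mul_rpow hu', Complex.norm_cpow_real]
    have : ‖1 + (w : ℂ) * (u : ℂ)‖ = 1 + w * u := by
      rw [show 1 + (w : ℂ) * (u : ℂ) = ((1 + w * u : ℝ) : ℂ) by push_cast; rfl, Complex.norm_real,
        Real.norm_of_nonneg (by positivity)]
    rw [this]
  unfold rconfl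
  rw [← integral_const_mul]
  refine setIntegral_mono_on ((hi _ _ (by linarith) (by linarith)).const_mul _)
    (hi _ _ ha ha1.le) measurableSet_Ioi (fun u hu => ?_)
  have hu' : (0 : ℝ) < u := hu
  have e : (1 + w * u) ^ a = (1 + w * u) ^ (a - 1) * (1 + w * u) := by
    conv_lhs => rw [show a = (a - 1) + 1 by ring]
    rw [Real.rpow_add (by positivity), Real.rpow_one]
  rw [e, Real.rpow_add hu', Real.rpow_one]
  have : 0 ≤ Real.exp (-u) * u ^ a * (1 + w * u) ^ (a - 1) := by positivity
  nlinarith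

theorem abs_rconfl_self_le {a b : ℝ} (ha : -1 < a) (hb : 0 ≤ b) (hab : a ≤ b) (hb1 : b < 1) :
    ∃ K, 0 < K ∧ ∀ w, 0 < w → |rconfl a a w| ≤ K * (1 + w ^ b) ∧
      |w * rconfl (a + 1) (a - 1) w| ≤ K * (1 + w ^ b) ∧
      |rconfl (a + 1) (a - 1) w| ≤ K * (1 + w ^ b) := by
  have g0 := Real.Gamma_pos_of_pos (show 0 < a + 1 by linarith)
  have g1 := Real.Gamma_pos_of_pos (show 0 < a + b + 1 by linarith)
  have g2 := Real.Gamma_pos_of_pos (show 0 < a + 1 + 1 by linarith)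
  refine ⟨Real.Gamma (a + 1) + Real.Gamma (a + b + 1) + Real.Gamma (a + 1 + 1), by positivity,
    fun w hw => ?_⟩
  have h0 := rconfl_nonneg a a hw.le
  have h1 := rconfl_nonneg (a + 1) (a - 1) hw.le
  have h2 := rconfl_self_le ha hb hab hb1.le hw
  have h3 := id_mul_rconfl_le ha hw.le (by linarith)
  have h4 := rconfl_le_gamma (p := a + 1) (q := a - 1) (by linarith) (by linarith) hw.le
  have hwb : 0 ≤ w ^ b := by positivity
  have h5 : 0 ≤ Real.Gamma (a + 1 + 1) * (1 + w ^ b) := by positivity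
  have h6 : 0 ≤ (Real.Gamma (a + 1) + Real.Gamma (a + b + 1)) * (1 + w ^ b) := by positivity
  have h7 : 0 ≤ Real.Gamma (a + 1 + 1) * w ^ b := by positivity
  rw [abs_of_nonneg h0, abs_of_nonneg (mul_nonneg hw.le h1), abs_of_nonneg h1]
  refine ⟨?_, ?_, ?_⟩ <;> nlinarith

theorem tendsto_nichQ {a : ℝ} (ha : -1 < a) (ha1 : a < 1) : Tendsto (nichQ a) atTop (𝓝 0) := by
  obtain ⟨K, -, hK⟩ := abs_rconfl_self_le ha (le_max_right a 0) (le_max_left a 0)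
    (max_lt ha1 one_pos)
  have h0 := tendsto_mix_zero (le_max_right a 0) (fun w hw => (hK w hw).1)
  have h1 := tendsto_mix_zero (le_max_right a 0) (fun w hw => (hK w hw).2.1)
  have h := ((h0.neg.sub ((h1.const_mul a).const_mul 2)).const_mul (nichC a))
  simp only [neg_zero, mul_zero, sub_zero] at h
  exact h

theorem tendsto_nichR_div {a : ℝ} (ha : -1 < a) (ha1 : a < 1) :
    Tendsto (fun x => nichR a x / x) atTop (𝓝 (2 / Real.pi)) := by
  obtain ⟨K, -, hK⟩ := abs_rconfl_self_le ha (le_max_right a 0) (le_max_left a 0)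
    (max_lt ha1 one_pos)
  have h0 := tendsto_mix_zero (le_max_right a 0) (fun w hw => (hK w hw).1)
  have h1 := tendsto_mix_zero (le_max_right a 0) (fun w hw => (hK w hw).2.2)
  have h2 := ((h0.const_mul ((a + 1 / 2) ^ 2)).sub ((h1.const_mul a).const_mul 2)).const_mul
    (nichC a)
  have h3 := (h2.mul (tendsto_inv_atTop_zero (𝕜 := ℝ))).add (tendsto_mul_nichP ha ha1)
  simp only [mul_zero, zero_add] at h3
  refine h3.congr' ?_
  filter_upwards [eventually_gt_atTop 0] with x hx
  rw [nichR, nichP]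
  field_simp

/-- Products of solutions of `θ²U = (ν² - x²) U` are determined by the linear first-order system
they satisfy and by their behaviour at infinity. -/
theorem products_eq_of_system {ν : ℝ} {p q r : ℝ → ℝ} {U U₁ : ℝ → ℂ}
    (hp : ∀ x, 0 < x → HasDerivAt p (q x / x) x)
    (hq : ∀ x, 0 < x → HasDerivAt q ((2 * r x + 2 * (ν ^ 2 - x ^ 2) * p x) / x) x)
    (hr : ∀ x, 0 < x → HasDerivAt r ((ν ^ 2 - x ^ 2) * q x / x) x)
    (hU : ∀ x, 0 < x → HasDerivAt U (U₁ x / x) x)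
    (hU₁ : ∀ x, 0 < x → HasDerivAt U₁ ((ν ^ 2 - x ^ 2) * U x / x) x)
    (hZ : Tendsto (fun x => r x * U x ^ 2 - q x * (U x * U₁ x) + p x * U₁ x ^ 2) atTop (𝓝 0))
    (hZ' : Tendsto (fun x => r x * (U x * star (U x))
      - q x / 2 * (U x * star (U₁ x) + star (U x) * U₁ x) + p x * (U₁ x * star (U₁ x)))
      atTop (𝓝 (8 / Real.pi ^ 2)))
    (hW : Tendsto (fun x => star (U x) * U₁ x - U x * star (U₁ x)) atTop
      (𝓝 (4 * Complex.I / Real.pi))) {x : ℝ} (hx : 0 < x) :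
    p x = ‖U x‖ ^ 2 ∧ q x = 2 * (U₁ x * star (U x)).re ∧ r x = ‖U₁ x‖ ^ 2 ∧
      (star (U x) * U₁ x).im = 2 / Real.pi := by
  have hV : ∀ x, 0 < x → HasDerivAt (fun x => star (U x)) (star (U₁ x) / x) x := by
    intro x hx
    refine (hU x hx).star.congr_deriv ?_
    simp
  have hV₁ : ∀ x, 0 < x →
      HasDerivAt (fun x => star (U₁ x)) ((ν ^ 2 - x ^ 2) * star (U x) / x) x := by
    intro x hx
    refine (hU₁ x hx).star.congr_deriv ?_
    simp
  -- The triple (r, q, p) is a symmetric bilinear form on pairs (U, θU). Its values on (U, U) and on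
  -- (U, Ū), as well as the Wronskian of U and Ū, are constant along the system, hence equal to
  -- their limits at infinity.
  have e1 := eq_of_hasDerivAt_zero_of_tendsto (fun x hx => by
    have hx' : (x : ℂ) ≠ 0 := by exact_mod_cast hx.ne'
    refine ((((hr x hx).ofReal_comp.mul ((hU x hx).pow 2)).sub
      ((hq x hx).ofReal_comp.mul ((hU x hx).mul (hU₁ x hx)))).add
      ((hp x hx).ofReal_comp.mul ((hU₁ x hx).pow 2))).congr_deriv ?_
    simp only [Pi.mul_apply, Pi.pow_apply]
    push_cast
    field_simp
    ring) hZ hx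
  have e2 := eq_of_hasDerivAt_zero_of_tendsto (fun x hx => by
    have hx' : (x : ℂ) ≠ 0 := by exact_mod_cast hx.ne'
    refine ((((hr x hx).ofReal_comp.mul ((hU x hx).mul (hV x hx))).sub
      (((hq x hx).ofReal_comp.div_const 2).mul (((hU x hx).mul (hV₁ x hx)).add
        ((hV x hx).mul (hU₁ x hx))))).add
      ((hp x hx).ofReal_comp.mul ((hU₁ x hx).mul (hV₁ x hx)))).congr_deriv ?_
    simp only [Pi.mul_apply, Pi.add_apply]
    push_cast
    field_simp
    ring) hZ' hx
  have e3 := eq_of_hasDerivAt_zero_of_tendsto (fun x hx => by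
    have hx' : (x : ℂ) ≠ 0 := by exact_mod_cast hx.ne'
    refine (((hV x hx).mul (hU₁ x hx)).sub ((hU x hx).mul (hV₁ x hx))).congr_deriv ?_
    field_simp
    ring) hW hx
  have e1' := congrArg star e1
  simp only [star_add, star_sub, star_mul', star_pow, star_zero, Complex.star_def,
    Complex.conj_ofReal] at e1'
  simp only [Complex.star_def] at e2 e3 ⊢
  set V := (starRingEnd ℂ) (U x) with hVdef
  set V₁ := (starRingEnd ℂ) (U₁ x) with hV₁def
  have hpi : (Real.pi : ℂ) ≠ 0 := by exact_mod_cast Real.pi_ne_zero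
  have e3' : (V * U₁ x - U x * V₁) ^ 2 = -16 / Real.pi ^ 2 := by
    rw [e3, div_pow, mul_pow, Complex.I_sq]; ring
  have hn : ∀ z : ℂ, ((‖z‖ ^ 2 : ℝ) : ℂ) = z * (starRingEnd ℂ) z := fun z => by
    rw [Complex.mul_conj, Complex.normSq_eq_norm_sq]
  -- Since U and Ū are independent, their three contractions determine the form. Solving the linear
  -- system multiplies by the squared Wronskian -16/π², which is cancelled here.
  have key : ∀ s t : ℂ, s * (-16 / (Real.pi : ℂ) ^ 2) = t * (-16 / (Real.pi : ℂ) ^ 2) → s = t := by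
    intro s t h
    refine mul_right_cancel₀ ?_ h
    have : (Real.pi : ℂ) ^ 2 ≠ 0 := pow_ne_zero _ hpi
    field_simp
    norm_num
  refine ⟨?_, ?_, ?_, ?_⟩
  · apply Complex.ofReal_injective
    rw [hn, ← hVdef]
    apply key
    rw [← e3']
    linear_combination V ^ 2 * e1 + U x ^ 2 * e1' - 2 * U x * V * e2
      + (-U x * V) * e3'
  · apply Complex.ofReal_injective
    have : ((2 * (U₁ x * V).re : ℝ) : ℂ) = U₁ x * V + V₁ * U x := by
      apply Complex.ext
      · simp [hVdef, hV₁def]; ring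
      · simp [hVdef, hV₁def]; ring
    rw [this]
    apply key
    rw [← e3']
    linear_combination 2 * V * V₁ * e1 + 2 * U x * U₁ x * e1'
      - 2 * (V * U₁ x + U x * V₁) * e2
      - (U₁ x * V + V₁ * U x) * e3'
  · apply Complex.ofReal_injective
    rw [hn, ← hV₁def]
    apply key
    rw [← e3']
    linear_combination V₁ ^ 2 * e1 + U₁ x ^ 2 * e1' - 2 * U₁ x * V₁ * e2
      + (-U₁ x * V₁) * e3'
  · have h := congrArg Complex.im e3
    have h1 : (V * U₁ x - U x * V₁).im = 2 * (V * U₁ x).im := by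
      simp [hVdef, hV₁def]; ring
    have h2 : (4 * Complex.I / (Real.pi : ℂ)).im = 4 / Real.pi := by
      rw [Complex.div_ofReal_im]; simp
    rw [h1, h2] at h
    have : (4 : ℝ) / Real.pi = 2 * (2 / Real.pi) := by ring
    linarith

/-! ### The Hankel function -/

/-- The elementary prefactor in Hankel's integral. -/
def hankelPre (a x : ℝ) : ℂ :=
  ((Real.sqrt (2 / (Real.pi * x)) : ℝ) : ℂ)
    * Complex.exp (Complex.I * ((x - (a + 1 / 2) * Real.pi / 2 - Real.pi / 4 : ℝ) : ℂ))
    / ((Real.Gamma (a + 1) : ℝ) : ℂ)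

theorem hankel1_eq (a x : ℝ) :
    hankel1 (a + 1 / 2) x = hankelPre a x * confl a a (Complex.I * ((1 / (2 * x) : ℝ) : ℂ)) := by
  unfold hankel1 hankelPre confl
  have e1 : a + 1 / 2 + 1 / 2 = a + 1 := by ring
  have e2 : a + 1 / 2 - 1 / 2 = a := by ring
  rw [e1, e2]
  congr 2
  funext u
  congr 3
  push_cast
  field_simp

/-- `θ` applied to the Hankel function. -/
def hankelTheta (a x : ℝ) : ℂ :=
  hankelPre a x * ((Complex.I * x - 1 / 2) * confl a a (Complex.I * ((1 / (2 * x) : ℝ) : ℂ))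
    - Complex.I * ((1 / (2 * x) : ℝ) : ℂ) * (a * confl (a + 1) (a - 1)
      (Complex.I * ((1 / (2 * x) : ℝ) : ℂ))))

theorem hasDerivAt_hankelPre (a : ℝ) {x : ℝ} (hx : 0 < x) :
    HasDerivAt (hankelPre a) ((Complex.I - 1 / (2 * x)) * hankelPre a x) x := by
  have h1 : HasDerivAt (fun x : ℝ => Real.sqrt (2 / (Real.pi * x)))
      (-(1 / (2 * x)) * Real.sqrt (2 / (Real.pi * x))) x := by
    have hpos : 0 < 2 / (Real.pi * x) := by positivity
    have h : HasDerivAt (fun x : ℝ => 2 / (Real.pi * x)) (-(2 / (Real.pi * x)) / x) x := by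
      have h := (((hasDerivAt_id x).const_mul Real.pi).inv (by
        simp only [id]; positivity)).const_mul 2
      simp only [div_eq_mul_inv]
      refine h.congr_deriv ?_
      simp only [id]
      field_simp
    have h' := (Real.hasDerivAt_sqrt hpos.ne').comp x h
    refine h'.congr_deriv ?_
    have hs : 0 < Real.sqrt (2 / (Real.pi * x)) := Real.sqrt_pos.2 hpos
    have hs2 := Real.sq_sqrt hpos.le
    generalize Real.sqrt (2 / (Real.pi * x)) = s at hs hs2 ⊢
    rw [← hs2]
    field_simp
  have h2 : HasDerivAt (fun x : ℝ => Complex.exp (Complex.I *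
      ((x - (a + 1 / 2) * Real.pi / 2 - Real.pi / 4 : ℝ) : ℂ)))
      (Complex.exp (Complex.I * ((x - (a + 1 / 2) * Real.pi / 2 - Real.pi / 4 : ℝ) : ℂ))
        * Complex.I) x := by
    have h := (((hasDerivAt_id x).sub_const ((a + 1 / 2) * Real.pi / 2)).sub_const
      (Real.pi / 4)).ofReal_comp.const_mul Complex.I
    simpa using h.cexp
  refine ((h1.ofReal_comp.mul h2).div_const _).congr_deriv ?_
  rw [hankelPre]
  push_cast
  ring

theorem hasDerivAt_half_inv {f : ℝ → ℂ} {f' : ℂ} {x : ℝ} (hx : 0 < x)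
    (hf : HasDerivAt f f' (1 / (2 * x))) :
    HasDerivAt (fun x : ℝ => f (1 / (2 * x))) (-(1 / (2 * x)) * f' / x) x := by
  have h : HasDerivAt (fun x : ℝ => 1 / (2 * x)) (-(1 / (2 * x)) / x) x := by
    have h := (((hasDerivAt_id x).const_mul 2).inv (by simp only [id]; positivity))
    simp only [one_div]
    refine h.congr_deriv ?_
    simp only [id]
    field_simp
  refine (hf.scomp x h).congr_deriv ?_
  rw [Complex.real_smul]
  push_cast
  ring

theorem hasDerivAt_hankel1 {a : ℝ} (ha : -1 < a) (ha1 : a < 1) {x : ℝ} (hx : 0 < x) :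
    HasDerivAt (hankel1 (a + 1 / 2)) (hankelTheta a x / x) x := by
  have hc := hasDerivAt_half_inv hx (hasDerivAt_confl ha ha1.le (ω := Complex.I) (by simp)
    (show 0 < 1 / (2 * x) by positivity))
  have h := (hasDerivAt_hankelPre a hx).mul hc
  refine (h.congr_of_eventuallyEq ?_).congr_deriv ?_
  · exact Eventually.of_forall (fun t => hankel1_eq a t)
  · have hx' : (x : ℂ) ≠ 0 := by exact_mod_cast hx.ne'
    rw [hankelTheta]
    push_cast
    field_simp
    ring

/-- Bessel's equation θ²U = (ν² - x²)U, obtained from the confluent equation on the ray ω = i at the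
point 1/(2x). -/
theorem hasDerivAt_hankelTheta {a : ℝ} (ha : -1 < a) (ha1 : a < 1) {x : ℝ} (hx : 0 < x) :
    HasDerivAt (hankelTheta a)
      ((((a + 1 / 2 : ℝ) : ℂ) ^ 2 - x ^ 2) * hankel1 (a + 1 / 2) x / x) x := by
  have hy : 0 < 1 / (2 * x) := by positivity
  have hc := hasDerivAt_half_inv hx (hasDerivAt_confl ha ha1.le (ω := Complex.I) (by simp) hy)
  have hc1 := hasDerivAt_half_inv hx (hasDerivAt_confl_one ha ha1 (ω := Complex.I) (by simp)
    Complex.I_ne_zero hy)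
  have hl : HasDerivAt (fun x : ℝ => Complex.I * (x : ℂ) - 1 / 2) Complex.I x := by
    simpa using ((hasDerivAt_id x).ofReal_comp.const_mul Complex.I).sub_const (1 / 2)
  have hi := hasDerivAt_half_inv (f := fun y : ℝ => Complex.I * (y : ℂ)) (f' := Complex.I) hx (by
    simpa using ((hasDerivAt_id (1 / (2 * x))).ofReal_comp.const_mul Complex.I))
  have h := (hasDerivAt_hankelPre a hx).mul ((hl.mul hc).sub (hi.mul (hc1.const_mul (a : ℂ))))
  refine h.congr_deriv ?_
  have hx' : (x : ℂ) ≠ 0 := by exact_mod_cast hx.ne'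
  rw [hankel1_eq a x]
  simp only [Pi.mul_apply, Pi.sub_apply]
  generalize confl a a (Complex.I * ((1 / (2 * x) : ℝ) : ℂ)) = L0
  generalize confl (a + 1) (a - 1) (Complex.I * ((1 / (2 * x) : ℝ) : ℂ)) = L1
  push_cast
  have hI : Complex.I ^ 2 = -1 := Complex.I_sq
  field_simp
  ring_nf
  simp only [hI]
  ring

theorem hankelPre_mul_star {a : ℝ} {x : ℝ} (hx : 0 < x) :
    hankelPre a x * star (hankelPre a x) * x
      = ((2 / Real.pi / Real.Gamma (a + 1) ^ 2 : ℝ) : ℂ) := by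
  have h1 : hankelPre a x * star (hankelPre a x) = ((‖hankelPre a x‖ ^ 2 : ℝ) : ℂ) := by
    rw [Complex.star_def, Complex.mul_conj, Complex.normSq_eq_norm_sq]
  have h2 : ‖hankelPre a x‖ ^ 2 = 2 / (Real.pi * x) / Real.Gamma (a + 1) ^ 2 := by
    rw [hankelPre, norm_div, norm_mul, mul_comm Complex.I, Complex.norm_exp_ofReal_mul_I,
      Complex.norm_real, Complex.norm_real, Real.norm_eq_abs, Real.norm_eq_abs, mul_one, div_pow,
      sq_abs, sq_abs, Real.sq_sqrt (by positivity)]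
  rw [h1, h2, ← Complex.ofReal_mul]
  congr 1
  field_simp

/-- The second factor of `hankelTheta`. -/
def hankelM (a x : ℝ) : ℂ :=
  (Complex.I * x - 1 / 2) * confl a a (Complex.I * ((1 / (2 * x) : ℝ) : ℂ))
    - Complex.I * ((1 / (2 * x) : ℝ) : ℂ) * (a * confl (a + 1) (a - 1)
      (Complex.I * ((1 / (2 * x) : ℝ) : ℂ)))

theorem tendsto_half_inv : Tendsto (fun x : ℝ => 1 / (2 * x)) atTop (𝓝[>] 0) := by
  refine tendsto_nhdsWithin_iff.2 ⟨?_, ?_⟩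
  · exact tendsto_const_nhds.div_atTop (tendsto_id.const_mul_atTop (by norm_num : (0 : ℝ) < 2))
  · filter_upwards [eventually_gt_atTop (0 : ℝ)] with x hx
    show (0 : ℝ) < 1 / (2 * x)
    positivity

theorem tendsto_confl_half_inv {a : ℝ} (ha : -1 < a) (ha1 : a < 1) :
    Tendsto (fun x : ℝ => confl a a (Complex.I * ((1 / (2 * x) : ℝ) : ℂ))) atTop
      (𝓝 (Real.Gamma (a + 1))) :=
  (tendsto_confl_zero ha ha1 (ω := Complex.I) (by simp)).comp tendsto_half_inv

theorem tendsto_hankelM_div {a : ℝ} (ha : -1 < a) (ha1 : a < 1) :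
    Tendsto (fun x : ℝ => hankelM a x / x) atTop (𝓝 (Complex.I * Real.Gamma (a + 1))) := by
  have h0 := tendsto_confl_half_inv ha ha1
  have hinv : Tendsto (fun x : ℝ => ((x⁻¹ : ℝ) : ℂ)) atTop (𝓝 0) := by
    rw [← Complex.ofReal_zero]
    exact (Complex.continuous_ofReal.tendsto 0).comp (tendsto_inv_atTop_zero (𝕜 := ℝ))
  have h1 : Tendsto (fun x : ℝ => (a : ℂ) * confl (a + 1) (a - 1)
      (Complex.I * ((1 / (2 * x) : ℝ) : ℂ)) * ((x⁻¹ : ℝ) : ℂ)) atTop (𝓝 0) := by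
    have hb : ∀ x : ℝ, 0 < x → ‖(a : ℂ) * confl (a + 1) (a - 1)
        (Complex.I * ((1 / (2 * x) : ℝ) : ℂ)) * ((x⁻¹ : ℝ) : ℂ)‖
        ≤ |a| * Real.Gamma (a + 1 + 1) * x⁻¹ := by
      intro x hx
      rw [norm_mul, norm_mul, Complex.norm_real, Complex.norm_real, Real.norm_eq_abs,
        Real.norm_eq_abs, abs_of_pos (inv_pos.2 hx)]
      gcongr
      exact norm_confl_le (by linarith) (by linarith) (by simp)
    refine squeeze_zero_norm' ?_ (show Tendsto (fun x : ℝ => |a| * Real.Gamma (a + 1 + 1) * x⁻¹)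
      atTop (𝓝 0) by simpa using (tendsto_inv_atTop_zero (𝕜 := ℝ)).const_mul _)
    filter_upwards [eventually_gt_atTop 0] with x hx using hb x hx
  have h2 : Tendsto (fun x : ℝ => (Complex.I - 1 / 2 * ((x⁻¹ : ℝ) : ℂ))
      * confl a a (Complex.I * ((1 / (2 * x) : ℝ) : ℂ))
      - Complex.I * (1 / 2) * ((x⁻¹ : ℝ) : ℂ) * ((a : ℂ) * confl (a + 1) (a - 1)
      (Complex.I * ((1 / (2 * x) : ℝ) : ℂ)) * ((x⁻¹ : ℝ) : ℂ))) atTop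
      (𝓝 ((Complex.I - 1 / 2 * 0) * Real.Gamma (a + 1) - Complex.I * (1 / 2) * 0 * 0)) :=
    ((tendsto_const_nhds.sub (hinv.const_mul _)).mul h0).sub ((hinv.const_mul _).mul h1)
  simp only [mul_zero, sub_zero] at h2
  refine h2.congr' ?_
  filter_upwards [eventually_gt_atTop 0] with x hx
  have hx' : (x : ℂ) ≠ 0 := by exact_mod_cast hx.ne'
  rw [hankelM]
  push_cast
  field_simp

/-- The Gaussian-mixture (Nicholson) representation of the quadratic expressions in the Hankel
function, and its Wronskian. -/
theorem hankel_products {a : ℝ} (ha : -1 < a) (ha1 : a < 1) {x : ℝ} (hx : 0 < x) :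
    nichP a x = ‖hankel1 (a + 1 / 2) x‖ ^ 2 ∧
    nichQ a x = 2 * (hankelTheta a x * star (hankel1 (a + 1 / 2) x)).re ∧
    nichR a x = ‖hankelTheta a x‖ ^ 2 ∧
    (star (hankel1 (a + 1 / 2) x) * hankelTheta a x).im = 2 / Real.pi := by
  have g := Real.Gamma_pos_of_pos (show 0 < a + 1 by linarith)
  set Γ : ℂ := ((Real.Gamma (a + 1) : ℝ) : ℂ) with hΓ
  have hΓ0 : Γ ≠ 0 := by rw [hΓ]; exact_mod_cast g.ne'
  have hpi : (Real.pi : ℂ) ≠ 0 := by exact_mod_cast Real.pi_ne_zero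
  have hL := tendsto_confl_half_inv ha ha1
  have hM := tendsto_hankelM_div ha ha1
  have hLs : Tendsto (fun x : ℝ => star (confl a a (Complex.I * ((1 / (2 * x) : ℝ) : ℂ)))) atTop
      (𝓝 Γ) := by
    have e : star Γ = Γ := Complex.conj_ofReal _
    rw [← e]
    exact (continuous_star.tendsto _).comp hL
  have hMs : Tendsto (fun x : ℝ => star (hankelM a x / x)) atTop (𝓝 (-(Complex.I * Γ))) := by
    have e : star (Complex.I * Γ) = -(Complex.I * Γ) := by simp [hΓ]
    rw [← e]
    exact (continuous_star.tendsto _).comp hM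
  have hr : Tendsto (fun x : ℝ => ((nichR a x / x : ℝ) : ℂ)) atTop (𝓝 ((2 / Real.pi : ℝ) : ℂ)) :=
    (Complex.continuous_ofReal.tendsto _).comp (tendsto_nichR_div ha ha1)
  have hp : Tendsto (fun x : ℝ => ((x * nichP a x : ℝ) : ℂ)) atTop (𝓝 ((2 / Real.pi : ℝ) : ℂ)) :=
    (Complex.continuous_ofReal.tendsto _).comp (tendsto_mul_nichP ha ha1)
  have hq : Tendsto (fun x : ℝ => ((nichQ a x : ℝ) : ℂ)) atTop (𝓝 0) := by
    rw [← Complex.ofReal_zero]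
    exact (Complex.continuous_ofReal.tendsto _).comp (tendsto_nichQ ha ha1)
  have hI := Complex.I_sq
  refine products_eq_of_system (ν := a + 1 / 2) (fun x hx => hasDerivAt_nichP ha ha1 hx)
    (fun x hx => hasDerivAt_nichQ ha ha1 hx) (fun x hx => hasDerivAt_nichR ha ha1 hx)
    (fun x hx => hasDerivAt_hankel1 ha ha1 hx) (fun x hx => hasDerivAt_hankelTheta ha ha1 hx)
    ?_ ?_ ?_ hx
  · have hB := ((hr.mul (hL.pow 2)).sub (hq.mul (hL.mul hM))).add (hp.mul (hM.pow 2))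
    -- The squared prefactor keeps an oscillating phase and has no limit, but its modulus times x is
    -- constant. It is therefore enough that the remaining bracket tends to 0, which is the identity
    -- Γ² + (iΓ)² = 0.
    have e0 : ((2 / Real.pi : ℝ) : ℂ) * ((Real.Gamma (a + 1) : ℝ) : ℂ) ^ 2
        - 0 * (((Real.Gamma (a + 1) : ℝ) : ℂ) * (Complex.I * Γ))
        + ((2 / Real.pi : ℝ) : ℂ) * (Complex.I * Γ) ^ 2 = 0 := by
      rw [mul_pow, hI]; ring
    rw [e0] at hB
    have hB' := (hB.norm).const_mul (2 / Real.pi / Real.Gamma (a + 1) ^ 2)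
    rw [norm_zero, mul_zero] at hB'
    refine squeeze_zero_norm' ?_ hB'
    filter_upwards [eventually_gt_atTop 0] with x hx
    have hx' : (x : ℂ) ≠ 0 := by exact_mod_cast hx.ne'
    have hc : ‖hankelPre a x ^ 2 * x‖ = 2 / Real.pi / Real.Gamma (a + 1) ^ 2 := by
      have h := congrArg norm (hankelPre_mul_star (a := a) hx)
      rw [norm_mul, norm_mul, norm_star, Complex.norm_real, Complex.norm_real,
        Real.norm_of_nonneg (show 0 ≤ 2 / Real.pi / Real.Gamma (a + 1) ^ 2 by positivity)] at h
      rw [norm_mul, norm_pow, ← h, Complex.norm_real]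
      ring
    rw [← hc, ← norm_mul]
    refine le_of_eq (congrArg norm ?_)
    rw [hankel1_eq, hankelTheta, ← hankelM]
    push_cast
    field_simp
  · have hB := ((hr.mul (hL.mul hLs)).sub ((hq.div_const 2).mul ((hL.mul hMs).add (hLs.mul hM)))).add
      (hp.mul (hM.mul hMs))
    have hB' := hB.const_mul ((2 / Real.pi / Real.Gamma (a + 1) ^ 2 : ℝ) : ℂ)
    have e0 : ((2 / Real.pi / Real.Gamma (a + 1) ^ 2 : ℝ) : ℂ) * (((2 / Real.pi : ℝ) : ℂ) * (Γ * Γ)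
        - 0 / 2 * (Γ * (-(Complex.I * Γ)) + Γ * (Complex.I * Γ))
        + ((2 / Real.pi : ℝ) : ℂ) * (Complex.I * Γ * (-(Complex.I * Γ)))) = 8 / Real.pi ^ 2 := by
      push_cast
      rw [← hΓ]
      have : Complex.I * Γ * (-(Complex.I * Γ)) = Γ * Γ := by linear_combination (-Γ ^ 2) * hI
      rw [this]
      field_simp
      norm_num
    rw [e0] at hB'
    refine hB'.congr' ?_
    filter_upwards [eventually_gt_atTop 0] with x hx
    have hx' : (x : ℂ) ≠ 0 := by exact_mod_cast hx.ne'
    rw [← hankelPre_mul_star (a := a) hx, hankel1_eq, hankelTheta, ← hankelM]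
    simp only [star_mul', star_div₀]
    have : star (x : ℂ) = x := Complex.conj_ofReal x
    rw [this]
    push_cast
    field_simp
  · have hB := ((hLs.mul hM).sub (hL.mul hMs))
    have hB' := hB.const_mul ((2 / Real.pi / Real.Gamma (a + 1) ^ 2 : ℝ) : ℂ)
    have e0 : ((2 / Real.pi / Real.Gamma (a + 1) ^ 2 : ℝ) : ℂ) *
        (Γ * (Complex.I * Γ) - Γ * (-(Complex.I * Γ))) = 4 * Complex.I / Real.pi := by
      push_cast
      rw [← hΓ]
      field_simp
      norm_num
    rw [e0] at hB'
    refine hB'.congr' ?_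
    filter_upwards [eventually_gt_atTop 0] with x hx
    have hx' : (x : ℂ) ≠ 0 := by exact_mod_cast hx.ne'
    rw [← hankelPre_mul_star (a := a) hx, hankel1_eq, hankelTheta, ← hankelM]
    simp only [star_mul', star_div₀]
    have : star (x : ℂ) = x := Complex.conj_ofReal x
    rw [this]
    field_simp

/-! ### Fourier transforms of smearing functions -/

theorem norm_exp_I_mul (t : ℝ) : ‖Complex.exp (Complex.I * (t : ℂ))‖ = 1 := by
  rw [mul_comm, Complex.norm_exp_ofReal_mul_I]

theorem integrable_fourierT_integrand {h : Space → ℝ} (hh : Integrable h) (k : Space) :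
    Integrable (fun x => Complex.exp (Complex.I * ((inner ℝ k x : ℝ) : ℂ)) * (h x : ℂ)) := by
  refine hh.ofReal.bdd_mul (c := 1) ?_ (ae_of_all _ fun x => ?_)
  · exact Continuous.aestronglyMeasurable (by fun_prop)
  · rw [norm_exp_I_mul]

theorem norm_fourierT_le (h : Space → ℝ) (k : Space) : ‖fourierT h k‖ ≤ ∫ x, |h x| := by
  refine (norm_integral_le_integral_norm _).trans (le_of_eq ?_)
  congr 1
  funext x
  rw [norm_mul, norm_exp_I_mul, one_mul, Complex.norm_real, Real.norm_eq_abs]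

theorem continuous_fourierT {h : Space → ℝ} (hh : Integrable h) : Continuous (fourierT h) := by
  refine continuous_of_dominated (bound := fun x => |h x|)
    (fun k => (integrable_fourierT_integrand hh k).aestronglyMeasurable) (fun k => ?_)
    hh.abs (ae_of_all _ fun x => ?_)
  · refine ae_of_all _ fun x => ?_
    rw [norm_mul, norm_exp_I_mul, one_mul, Complex.norm_real, Real.norm_eq_abs]
  · fun_prop

theorem conj_fourierT (h : Space → ℝ) (k : Space) :
    (starRingEnd ℂ) (fourierT h k) = fourierT h (-k) := by
  unfold fourierT
  rw [← integral_conj]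
  congr 1
  funext x
  rw [map_mul, Complex.conj_ofReal, ← Complex.exp_conj, map_mul, Complex.conj_I,
    Complex.conj_ofReal, inner_neg_left]
  push_cast
  ring_nf

/-- In polar coordinates the integrand is r^(2-c). The exponent c will be 2ν, and ν < 3/2 expresses
that the mass is positive. -/
theorem integrableOn_ball_norm_rpow {c : ℝ} (hc : c < 3) :
    IntegrableOn (fun k : Space => ‖k‖ ^ (-c)) (Metric.ball 0 1) := by
  have h : Integrable (fun k : Space => (Iio (1 : ℝ)).indicator (fun r => r ^ (-c)) ‖k‖) := by
    rw [integrable_fun_norm_addHaar]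
    have hd : Module.finrank ℝ Space = 3 := by simp
    rw [hd]
    have h1 : IntegrableOn (fun r : ℝ => r ^ (2 - c)) (Ioo 0 1) := by
      have := (intervalIntegral.intervalIntegrable_rpow' (a := 0) (b := 1) (r := 2 - c)
        (by linarith))
      rw [intervalIntegrable_iff_integrableOn_Ioo_of_le zero_le_one] at this
      exact this
    have h2 : IntegrableOn ((Ioo (0 : ℝ) 1).indicator fun r : ℝ => r ^ (2 - c)) (Ioi 0) :=
      (integrable_indicator_iff measurableSet_Ioo).2 h1 |>.integrableOn
    refine h2.congr_fun (fun r hr => ?_) measurableSet_Ioi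
    have hr' : (0 : ℝ) < r := hr
    by_cases h : r < 1
    · rw [indicator_of_mem (show r ∈ Ioo (0 : ℝ) 1 from ⟨hr', h⟩), smul_eq_mul,
        indicator_of_mem (show r ∈ Iio (1 : ℝ) from h), sub_eq_add_neg, Real.rpow_add hr']
      norm_cast
    · rw [indicator_of_notMem (fun h' => h h'.2), smul_eq_mul,
        indicator_of_notMem (show r ∉ Iio (1 : ℝ) from h), mul_zero]
  have h2 : (fun k : Space => (Iio (1 : ℝ)).indicator (fun r => r ^ (-c)) ‖k‖)
      = (Metric.ball (0 : Space) 1).indicator (fun k : Space => ‖k‖ ^ (-c)) := by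
    funext k
    by_cases h : ‖k‖ < 1
    · rw [indicator_of_mem (show ‖k‖ ∈ Iio (1 : ℝ) from h), indicator_of_mem (by simpa using h)]
    · rw [indicator_of_notMem (show ‖k‖ ∉ Iio (1 : ℝ) from h),
        indicator_of_notMem (by simpa using h)]
  rw [h2] at h
  exact (integrable_indicator_iff measurableSet_ball).1 h

/-- The density controlling all the spectral integrals of a phase space element. -/
def specDom (c : ℝ) (γ : PhasePoint) (k : Space) : ℝ :=
  (‖k‖ ^ (-1 : ℝ) + ‖k‖ ^ (-c)) * ‖fourierT γ.f k‖ ^ 2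
    + (‖k‖ ^ (1 : ℝ) + ‖k‖ ^ (-c)) * ‖fourierT γ.g k‖ ^ 2

theorem measurable_norm_rpow (c : ℝ) : Measurable (fun k : Space => ‖k‖ ^ c) := by fun_prop

/-- Inside the unit ball the Fourier transform is bounded by the L¹ norm and |k|^(-c) is integrable;
outside it -c ≤ -1 ≤ s lets the Sobolev norm take over. -/
theorem integrable_rpow_mul_fourierT_sq {c s : ℝ} (hc : 1 ≤ c) (hc3 : c < 3) (hs : -1 ≤ s)
    {h : Space → ℝ} (hh : Integrable h)
    (hS : Integrable (fun k : Space => ‖k‖ ^ s * ‖fourierT h k‖ ^ 2)) :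
    Integrable (fun k : Space => ‖k‖ ^ (-c) * ‖fourierT h k‖ ^ 2) := by
  have h1 : Integrable ((Metric.ball (0 : Space) 1).indicator
      (fun k : Space => (∫ x, |h x|) ^ 2 * ‖k‖ ^ (-c))) :=
    (integrable_indicator_iff measurableSet_ball).2 ((integrableOn_ball_norm_rpow hc3).const_mul _)
  refine Integrable.mono' (h1.add hS) ?_ (ae_of_all _ fun k => ?_)
  · exact ((measurable_norm_rpow _).mul
      ((continuous_fourierT hh).norm.measurable.pow_const 2)).aestronglyMeasurable
  · rw [Real.norm_of_nonneg (by positivity)]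
    simp only [Pi.add_apply]
    by_cases hk : ‖k‖ < 1
    · rw [indicator_of_mem (by simpa using hk)]
      have : 0 ≤ ‖k‖ ^ s * ‖fourierT h k‖ ^ 2 := by positivity
      have h2 := norm_fourierT_le h k
      have : ‖k‖ ^ (-c) * ‖fourierT h k‖ ^ 2 ≤ (∫ x, |h x|) ^ 2 * ‖k‖ ^ (-c) := by
        rw [mul_comm]; gcongr
      linarith
    · rw [indicator_of_notMem (by simpa using hk), zero_add]
      gcongr ?_ * _
      exact Real.rpow_le_rpow_of_exponent_le (not_lt.1 hk) (by linarith)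

theorem integrable_specDom {c : ℝ} (hc : 1 ≤ c) (hc3 : c < 3) (γ : PhasePoint) :
    Integrable (specDom c γ) := by
  have hf := γ.sobolev_f
  have hg := γ.sobolev_g
  unfold FiniteSobolevNorm at hf hg
  norm_num at hf hg
  have h1 := integrable_rpow_mul_fourierT_sq hc hc3 (by norm_num) γ.integrable_f
    (s := -1) (by simpa [Real.rpow_neg_one] using hf)
  have h2 := integrable_rpow_mul_fourierT_sq hc hc3 (by norm_num) γ.integrable_g
    (s := 1) (by simpa using hg)
  have h3 := (Integrable.add (by simpa [Real.rpow_neg_one] using hf :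
    Integrable (fun k : Space => ‖k‖ ^ (-1 : ℝ) * ‖fourierT γ.f k‖ ^ 2)) h1).add
    (Integrable.add (by simpa using hg :
    Integrable (fun k : Space => ‖k‖ ^ (1 : ℝ) * ‖fourierT γ.g k‖ ^ 2)) h2)
  refine h3.congr (ae_of_all _ fun k => ?_)
  simp only [Pi.add_apply, specDom]
  ring

/-- The integrand of a covariance metric with radial spectral functions `P₀, P₁, P₂`. -/
def specIntegrand (P₀ P₁ P₂ : ℝ → ℝ) (γ γ' : PhasePoint) (k : Space) : ℝ :=
  P₀ ‖k‖ * (fourierT γ.f k * (starRingEnd ℂ) (fourierT γ'.f k)).re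
    + P₁ ‖k‖ * (fourierT γ.f k * (starRingEnd ℂ) (fourierT γ'.g k)
      + fourierT γ.g k * (starRingEnd ℂ) (fourierT γ'.f k)).re
    + P₂ ‖k‖ * (fourierT γ.g k * (starRingEnd ℂ) (fourierT γ'.g k)).re

/-- The covariance metric with radial spectral functions `P₀, P₁, P₂`. -/
def specCov (P₀ P₁ P₂ : ℝ → ℝ) (γ γ' : PhasePoint) : ℝ :=
  2 * ((2 * Real.pi) ^ 3)⁻¹ * ∫ k : Space, specIntegrand P₀ P₁ P₂ γ γ' k

/-- The growth bounds on spectral functions. -/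
structure SpecBound (c K : ℝ) (P₀ P₁ P₂ : ℝ → ℝ) : Prop where
  bdd₀ : ∀ r, 0 < r → |P₀ r| ≤ K * (r ^ (-1 : ℝ) + r ^ (-c))
  bdd₁ : ∀ r, 0 < r → |P₁ r| ≤ K * (1 + r ^ (-c))
  bdd₂ : ∀ r, 0 < r → |P₂ r| ≤ K * (r ^ (1 : ℝ) + r ^ (-c))

theorem amgm_of_sq {s t u v w : ℝ} (hs : 0 ≤ s) (ht : 0 ≤ t) (hw : w ^ 2 ≤ s * t)
    (hu : 0 ≤ u) (hv : 0 ≤ v) : w * (u * v) ≤ s * u ^ 2 + t * v ^ 2 := by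
  have h1 : w ≤ Real.sqrt s * Real.sqrt t := by
    rw [← Real.sqrt_mul hs]; exact Real.le_sqrt_of_sq_le hw
  have h2 := Real.sq_sqrt hs
  have h3 := Real.sq_sqrt ht
  have h4 : w * (u * v) ≤ Real.sqrt s * Real.sqrt t * (u * v) := by gcongr
  have h5 : s * u ^ 2 + t * v ^ 2 = (Real.sqrt s * u) ^ 2 + (Real.sqrt t * v) ^ 2 := by
    rw [mul_pow, mul_pow, h2, h3]
  rw [h5]
  nlinarith [sq_nonneg (Real.sqrt s * u - Real.sqrt t * v),
    mul_nonneg (mul_nonneg (Real.sqrt_nonneg s) hu) (mul_nonneg (Real.sqrt_nonneg t) hv)]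

theorem abs_specIntegrand_le {c K : ℝ} {P₀ P₁ P₂ : ℝ → ℝ} (hP : SpecBound c K P₀ P₁ P₂)
    (γ γ' : PhasePoint) {k : Space} (hk : k ≠ 0) :
    |specIntegrand P₀ P₁ P₂ γ γ' k| ≤ 2 * K * (specDom c γ k + specDom c γ' k) := by
  have hr : 0 < ‖k‖ := norm_pos_iff.2 hk
  have hre : ∀ z w : ℂ, |(z * (starRingEnd ℂ) w).re| ≤ ‖z‖ * ‖w‖ := fun z w => by
    refine (Complex.abs_re_le_norm _).trans (le_of_eq ?_)
    rw [norm_mul, RCLike.norm_conj]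
  have hK : 0 ≤ K := by
    have h := (abs_nonneg _).trans (hP.bdd₀ _ hr)
    exact nonneg_of_mul_nonneg_left h (by positivity)
  have a0 := hP.bdd₀ _ hr
  have a1 := hP.bdd₁ _ hr
  have a2 := hP.bdd₂ _ hr
  unfold specIntegrand specDom
  set F := ‖fourierT γ.f k‖
  set F' := ‖fourierT γ'.f k‖
  set G := ‖fourierT γ.g k‖
  set G' := ‖fourierT γ'.g k‖
  set s := ‖k‖ ^ (-1 : ℝ) + ‖k‖ ^ (-c) with hs
  set t := ‖k‖ ^ (1 : ℝ) + ‖k‖ ^ (-c) with ht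
  set w := 1 + ‖k‖ ^ (-c) with hw
  have hs0 : 0 ≤ s := by positivity
  have ht0 : 0 ≤ t := by positivity
  have hw0 : 0 ≤ w := by positivity
  have hF : 0 ≤ F := norm_nonneg _
  have hF' : 0 ≤ F' := norm_nonneg _
  have hG : 0 ≤ G := norm_nonneg _
  have hG' : 0 ≤ G' := norm_nonneg _
  -- Because r + 1/r ≥ 2, the bound for the mixed term is at most the geometric mean of the two
  -- diagonal bounds, so the arithmetic-geometric inequality splits f g products into f² and g²
  -- parts.
  have hst : w ^ 2 ≤ s * t := by
    have e : ‖k‖ ^ (-1 : ℝ) * ‖k‖ ^ (1 : ℝ) = 1 := by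
      rw [← Real.rpow_add hr]; simp
    have p1 : 0 < ‖k‖ ^ (-1 : ℝ) := by positivity
    have p2 : 0 < ‖k‖ ^ (1 : ℝ) := by positivity
    have p3 : 0 < ‖k‖ ^ (-c) := by positivity
    have h2 : 2 ≤ ‖k‖ ^ (-1 : ℝ) + ‖k‖ ^ (1 : ℝ) := by
      have : ‖k‖ ^ (-1 : ℝ) + ‖k‖ ^ (1 : ℝ) - 2 = ‖k‖ ^ (1 : ℝ) * (‖k‖ ^ (-1 : ℝ) - 1) ^ 2 := by
        linear_combination (2 - ‖k‖ ^ (-1 : ℝ)) * e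
      have : 0 ≤ ‖k‖ ^ (1 : ℝ) * (‖k‖ ^ (-1 : ℝ) - 1) ^ 2 := by positivity
      linarith
    rw [hw, hs, ht]
    nlinarith
  have b0 : |P₀ ‖k‖ * (fourierT γ.f k * (starRingEnd ℂ) (fourierT γ'.f k)).re|
      ≤ K * (s * (F * F')) := by
    rw [abs_mul, ← mul_assoc]
    exact mul_le_mul a0 (hre _ _) (abs_nonneg _) (by positivity)
  have b2 : |P₂ ‖k‖ * (fourierT γ.g k * (starRingEnd ℂ) (fourierT γ'.g k)).re|
      ≤ K * (t * (G * G')) := by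
    rw [abs_mul, ← mul_assoc]
    exact mul_le_mul a2 (hre _ _) (abs_nonneg _) (by positivity)
  have b1 : |P₁ ‖k‖ * (fourierT γ.f k * (starRingEnd ℂ) (fourierT γ'.g k)
      + fourierT γ.g k * (starRingEnd ℂ) (fourierT γ'.f k)).re|
      ≤ K * (w * (F * G') + w * (F' * G)) := by
    rw [abs_mul, Complex.add_re]
    have h := (abs_add_le (fourierT γ.f k * (starRingEnd ℂ) (fourierT γ'.g k)).re
      (fourierT γ.g k * (starRingEnd ℂ) (fourierT γ'.f k)).re).trans
      (add_le_add (hre _ _) (hre _ _))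
    calc _ ≤ (K * w) * (F * G' + G * F') := mul_le_mul a1 h (abs_nonneg _) (by positivity)
      _ = _ := by ring
  have c0 : s * (F * F') ≤ s * F ^ 2 + s * F' ^ 2 :=
    amgm_of_sq hs0 hs0 (by rw [sq]) hF hF'
  have c2 : t * (G * G') ≤ t * G ^ 2 + t * G' ^ 2 :=
    amgm_of_sq ht0 ht0 (by rw [sq]) hG hG'
  have c1 : w * (F * G') ≤ s * F ^ 2 + t * G' ^ 2 := amgm_of_sq hs0 ht0 hst hF hG'
  have c1' : w * (F' * G) ≤ s * F' ^ 2 + t * G ^ 2 := amgm_of_sq hs0 ht0 hst hF' hG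
  refine (abs_add_le _ _).trans ((add_le_add ((abs_add_le _ _).trans (add_le_add b0 b1)) b2).trans ?_)
  nlinarith

theorem ae_ne_zero : ∀ᵐ k : Space, k ≠ 0 := by
  rw [ae_iff]; simp

theorem continuousOn_radial {P : ℝ → ℝ} (hP : ContinuousOn P (Ioi 0)) :
    AEStronglyMeasurable (fun k : Space => P ‖k‖) := by
  have h : ContinuousOn (fun k : Space => P ‖k‖) {0}ᶜ :=
    hP.comp continuous_norm.continuousOn (fun k hk => norm_pos_iff.2 hk)
  have h2 := h.aestronglyMeasurable (μ := volume) (measurableSet_singleton (0 : Space)).compl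
  have e : (volume : Measure Space).restrict {0}ᶜ = volume := by
    rw [Measure.restrict_eq_self_of_ae_mem]
    filter_upwards [ae_ne_zero] with k hk using hk
  rwa [e] at h2

theorem aestronglyMeasurable_specIntegrand {P₀ P₁ P₂ : ℝ → ℝ} (h₀ : ContinuousOn P₀ (Ioi 0))
    (h₁ : ContinuousOn P₁ (Ioi 0)) (h₂ : ContinuousOn P₂ (Ioi 0)) (γ γ' : PhasePoint) :
    AEStronglyMeasurable (specIntegrand P₀ P₁ P₂ γ γ') := by
  have c1 := continuous_fourierT γ.integrable_f
  have c2 := continuous_fourierT γ.integrable_g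
  have c3 := continuous_fourierT γ'.integrable_f
  have c4 := continuous_fourierT γ'.integrable_g
  have m : ∀ {z w : Space → ℂ}, Continuous z → Continuous w →
      Continuous (fun k => (z k * (starRingEnd ℂ) (w k)).re) := fun hz hw =>
    Complex.continuous_re.comp (hz.mul (Complex.continuous_conj.comp hw))
  refine AEStronglyMeasurable.add (AEStronglyMeasurable.add ?_ ?_) ?_
  · exact (continuousOn_radial h₀).mul (m c1 c3).aestronglyMeasurable
  · refine (continuousOn_radial h₁).mul ?_
    simp only [Complex.add_re]
    exact ((m c1 c4).add (m c2 c3)).aestronglyMeasurable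
  · exact (continuousOn_radial h₂).mul (m c2 c4).aestronglyMeasurable

/-! ### Fock representations with radial mode functions -/

/-- Radial mode functions of field and momentum with the canonical Wronskian. -/
structure RadialModes (c K : ℝ) (u v : ℝ → ℂ) : Prop where
  cont_u : ContinuousOn u (Ioi 0)
  cont_v : ContinuousOn v (Ioi 0)
  bdd_u : ∀ r, 0 < r → ‖u r‖ ^ 2 ≤ K * (r ^ (-1 : ℝ) + r ^ (-c))
  bdd_v : ∀ r, 0 < r → ‖v r‖ ^ 2 ≤ K * (r ^ (1 : ℝ) + r ^ (-c))
  wronskian : ∀ r, 0 < r → (star (u r) * v r).im = 1 / 2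

/-- The amplitude of the annihilation operators in `O_γ`. -/
def amp (u v : ℝ → ℂ) (γ : PhasePoint) (k : Space) : ℂ :=
  fourierT γ.f k * u ‖k‖ + fourierT γ.g k * v ‖k‖

/-- The covariance metric of the vacuum with mode functions `u, v`. -/
def vacCov (u v : ℝ → ℂ) (γ γ' : PhasePoint) : ℝ :=
  2 * ((2 * Real.pi) ^ 3)⁻¹ *
    ∫ k : Space, (amp u v γ k * (starRingEnd ℂ) (amp u v γ' k)).re

theorem continuousOn_radial_complex {P : ℝ → ℂ} (hP : ContinuousOn P (Ioi 0)) :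
    ContinuousOn (fun k : Space => P ‖k‖) {0}ᶜ :=
  hP.comp continuous_norm.continuousOn (fun _ hk => norm_pos_iff.2 hk)

theorem aestronglyMeasurable_of_continuousOn_compl {E : Type*} [NormedAddCommGroup E]
    {φ : Space → E} (h : ContinuousOn φ {0}ᶜ) : AEStronglyMeasurable φ := by
  have : SecondCountableTopologyEither Space E := inferInstance
  have h2 := h.aestronglyMeasurable (μ := volume) (measurableSet_singleton (0 : Space)).compl
  have e : (volume : Measure Space).restrict {0}ᶜ = volume := by
    rw [Measure.restrict_eq_self_of_ae_mem]
    filter_upwards [ae_ne_zero] with k hk using hk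
  rwa [e] at h2

theorem integral_eq_zero_of_odd {φ : Space → ℝ} (h : ∀ k, φ (-k) = -φ k) : ∫ k, φ k = 0 := by
  have h1 := integral_neg_eq_self φ (volume : Measure Space)
  simp only [h, integral_neg] at h1
  linarith

theorem integral_re_complex {φ : Space → ℂ} (h : Integrable φ) :
    ∫ k, (φ k).re = (∫ k, φ k).re := integral_re (𝕜 := ℂ) h

theorem integral_im_complex {φ : Space → ℂ} (h : Integrable φ) :
    ∫ k, (φ k).im = (∫ k, φ k).im := integral_im (𝕜 := ℂ) h

section

variable {c K : ℝ} {u v : ℝ → ℂ}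

theorem RadialModes.continuousOn_amp (M : RadialModes c K u v) (γ : PhasePoint) :
    ContinuousOn (amp u v γ) {0}ᶜ :=
  ((continuous_fourierT γ.integrable_f).continuousOn.mul
    (continuousOn_radial_complex M.cont_u)).add
    ((continuous_fourierT γ.integrable_g).continuousOn.mul (continuousOn_radial_complex M.cont_v))

theorem RadialModes.norm_amp_sq_le (M : RadialModes c K u v) (γ : PhasePoint) {k : Space}
    (hk : k ≠ 0) : ‖amp u v γ k‖ ^ 2 ≤ 2 * K * specDom c γ k := by
  have hr : 0 < ‖k‖ := norm_pos_iff.2 hk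
  have h1 := M.bdd_u _ hr
  have h2 := M.bdd_v _ hr
  have h3 : ‖amp u v γ k‖ ≤ ‖fourierT γ.f k‖ * ‖u ‖k‖‖ + ‖fourierT γ.g k‖ * ‖v ‖k‖‖ := by
    refine (norm_add_le _ _).trans (le_of_eq ?_)
    rw [norm_mul, norm_mul]
  have h4 : ‖amp u v γ k‖ ^ 2 ≤
      (‖fourierT γ.f k‖ * ‖u ‖k‖‖ + ‖fourierT γ.g k‖ * ‖v ‖k‖‖) ^ 2 := by gcongr
  have h5 := mul_le_mul_of_nonneg_left h1 (sq_nonneg ‖fourierT γ.f k‖)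
  have h6 := mul_le_mul_of_nonneg_left h2 (sq_nonneg ‖fourierT γ.g k‖)
  unfold specDom
  nlinarith [sq_nonneg (‖fourierT γ.f k‖ * ‖u ‖k‖‖ - ‖fourierT γ.g k‖ * ‖v ‖k‖‖)]

theorem RadialModes.integrable_amp_mul (M : RadialModes c K u v) (hc : 1 ≤ c) (hc3 : c < 3)
    (γ γ' : PhasePoint) :
    Integrable (fun k => amp u v γ k * (starRingEnd ℂ) (amp u v γ' k)) := by
  refine Integrable.mono' (((integrable_specDom hc hc3 γ).add
    (integrable_specDom hc hc3 γ')).const_mul K)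
    (aestronglyMeasurable_of_continuousOn_compl ((M.continuousOn_amp γ).mul
      (Complex.continuous_conj.comp_continuousOn (M.continuousOn_amp γ')))) ?_
  filter_upwards [ae_ne_zero] with k hk
  have h1 := M.norm_amp_sq_le γ hk
  have h2 := M.norm_amp_sq_le γ' hk
  rw [norm_mul, RCLike.norm_conj]
  simp only [Pi.add_apply]
  nlinarith [sq_nonneg (‖amp u v γ k‖ - ‖amp u v γ' k‖)]

/-- The local integrand of the symplectic form in momentum space. -/
def symIntegrand (γ γ' : PhasePoint) (k : Space) : ℂ :=
  fourierT γ.f k * (starRingEnd ℂ) (fourierT γ'.g k)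
    - fourierT γ.g k * (starRingEnd ℂ) (fourierT γ'.f k)

theorem integrable_fourierT_mul (γ γ' : PhasePoint) :
    Integrable (fun k => fourierT γ.f k * (starRingEnd ℂ) (fourierT γ'.g k)) := by
  have c1 := continuous_fourierT γ.integrable_f
  have c2 := continuous_fourierT γ'.integrable_g
  refine Integrable.mono' ((integrable_specDom le_rfl (by norm_num) γ).add
    (integrable_specDom (c := 1) le_rfl (by norm_num) γ'))
    (c1.mul (Complex.continuous_conj.comp c2)).aestronglyMeasurable ?_
  filter_upwards [ae_ne_zero] with k hk
  have hr : 0 < ‖k‖ := norm_pos_iff.2 hk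
  rw [norm_mul, RCLike.norm_conj]
  have e : ‖k‖ ^ (-1 : ℝ) * ‖k‖ ^ (1 : ℝ) = 1 := by rw [← Real.rpow_add hr]; simp
  have h := amgm_of_sq (s := ‖k‖ ^ (-1 : ℝ)) (t := ‖k‖ ^ (1 : ℝ)) (w := 1)
    (u := ‖fourierT γ.f k‖) (v := ‖fourierT γ'.g k‖) (by positivity) (by positivity)
    (by rw [e]; norm_num) (norm_nonneg _) (norm_nonneg _)
  rw [one_mul] at h
  refine h.trans ?_
  have p : 0 < ‖k‖ ^ (-1 : ℝ) := by positivity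
  have p' : 0 < ‖k‖ ^ (1 : ℝ) := by positivity
  simp only [Pi.add_apply, specDom]
  nlinarith [mul_nonneg p.le (sq_nonneg ‖fourierT γ.f k‖),
    mul_nonneg p.le (sq_nonneg ‖fourierT γ.g k‖), mul_nonneg p.le (sq_nonneg ‖fourierT γ'.f k‖),
    mul_nonneg p.le (sq_nonneg ‖fourierT γ'.g k‖), mul_nonneg p'.le (sq_nonneg ‖fourierT γ.g k‖)]

theorem integrable_symIntegrand (γ γ' : PhasePoint) : Integrable (symIntegrand γ γ') := by
  refine (integrable_fourierT_mul γ γ').sub ?_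
  have h := Complex.conjCLE.integrable_comp_iff.2 (integrable_fourierT_mul γ' γ)
  refine h.congr (ae_of_all _ fun k => ?_)
  simp [mul_comm]

theorem sympl_eq (γ γ' : PhasePoint) :
    sympl γ γ' = ((2 * Real.pi) ^ 3)⁻¹ * (∫ k, (symIntegrand γ γ' k).re) := by
  have h1 := integrable_fourierT_mul γ γ'
  have h2 : Integrable (fun k => fourierT γ.g k * (starRingEnd ℂ) (fourierT γ'.f k)) := by
    have h := (integrable_fourierT_mul γ γ').sub (integrable_symIntegrand γ γ')
    refine h.congr (ae_of_all _ fun k => ?_)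
    simp [symIntegrand]
  have h3 : ∫ k, (symIntegrand γ γ' k).re = (∫ k, symIntegrand γ γ' k).re :=
    integral_re (𝕜 := ℂ) (integrable_symIntegrand γ γ')
  rw [h3]
  unfold symIntegrand
  rw [integral_sub h1 h2]
  unfold sympl sobolevProd
  simp only [mul_zero, Real.rpow_zero, Complex.ofReal_one, one_mul]
  rw [← mul_sub, ← Complex.ofReal_inv, Complex.re_ofReal_mul]

/-- The Wronskian isolates the antisymmetric part of the mode products and turns it into the density
of the symplectic form. The imaginary part of that density is odd in k and drops out of the
covariance. -/
theorem RadialModes.re_amp_mul (M : RadialModes c K u v) (γ γ' : PhasePoint) {k : Space}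
    (hk : k ≠ 0) :
    (amp u v γ k * (starRingEnd ℂ) (amp u v γ' k)).re
      = specIntegrand (fun r => ‖u r‖ ^ 2) (fun r => (star (u r) * v r).re) (fun r => ‖v r‖ ^ 2)
          γ γ' k + 1 / 2 * (symIntegrand γ γ' k).im := by
  rw [← M.wronskian _ (norm_pos_iff.2 hk)]
  unfold specIntegrand amp symIntegrand
  simp only [← Complex.normSq_eq_norm_sq, Complex.normSq_apply, Complex.star_def]
  simp only [Complex.add_re, Complex.mul_re, Complex.mul_im, Complex.conj_re, Complex.conj_im,
    Complex.add_im, map_add, map_mul, Complex.sub_im]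
  ring

theorem RadialModes.im_amp_mul (M : RadialModes c K u v) (γ γ' : PhasePoint) {k : Space}
    (hk : k ≠ 0) :
    (amp u v γ k * (starRingEnd ℂ) (amp u v γ' k)).im
      = (‖u ‖k‖‖ ^ 2 * (fourierT γ.f k * (starRingEnd ℂ) (fourierT γ'.f k)).im
        + (star (u ‖k‖) * v ‖k‖).re * (fourierT γ.f k * (starRingEnd ℂ) (fourierT γ'.g k)
          + fourierT γ.g k * (starRingEnd ℂ) (fourierT γ'.f k)).im
        + ‖v ‖k‖‖ ^ 2 * (fourierT γ.g k * (starRingEnd ℂ) (fourierT γ'.g k)).im)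
        - 1 / 2 * (symIntegrand γ γ' k).re := by
  rw [← M.wronskian _ (norm_pos_iff.2 hk)]
  unfold amp symIntegrand
  simp only [← Complex.normSq_eq_norm_sq, Complex.normSq_apply, Complex.star_def]
  simp only [Complex.add_re, Complex.mul_re, Complex.mul_im, Complex.conj_re, Complex.conj_im,
    Complex.add_im, map_add, map_mul, Complex.sub_re]
  ring

theorem fourierT_neg (h : Space → ℝ) (k : Space) :
    fourierT h (-k) = (starRingEnd ℂ) (fourierT h k) := (conj_fourierT h k).symm

theorem integral_symIntegrand_im (γ γ' : PhasePoint) : ∫ k, (symIntegrand γ γ' k).im = 0 := by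
  refine integral_eq_zero_of_odd (fun k => ?_)
  unfold symIntegrand
  simp only [fourierT_neg, Complex.conj_conj, Complex.sub_im, Complex.mul_im, Complex.conj_re,
    Complex.conj_im]
  ring

theorem RadialModes.vacCov_eq (M : RadialModes c K u v) (hc : 1 ≤ c) (hc3 : c < 3)
    (γ γ' : PhasePoint) :
    vacCov u v γ γ' = specCov (fun r => ‖u r‖ ^ 2) (fun r => (star (u r) * v r).re)
      (fun r => ‖v r‖ ^ 2) γ γ' := by
  unfold vacCov specCov
  congr 1
  have h1 := (M.integrable_amp_mul hc hc3 γ γ').re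
  have h2 := ((integrable_symIntegrand γ γ').im).const_mul (1 / 2)
  have h3 := integral_sub h1 h2
  have h4 : ∫ k, 1 / 2 * (symIntegrand γ γ' k).im = 0 := by
    rw [integral_const_mul, integral_symIntegrand_im, mul_zero]
  change (∫ k, (amp u v γ k * (starRingEnd ℂ) (amp u v γ' k)).re - 1 / 2 * (symIntegrand γ γ' k).im)
    = (∫ k, (amp u v γ k * (starRingEnd ℂ) (amp u v γ' k)).re)
      - ∫ k, 1 / 2 * (symIntegrand γ γ' k).im at h3
  rw [h4, sub_zero] at h3
  rw [← h3]
  refine integral_congr_ae ?_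
  filter_upwards [ae_ne_zero] with k hk
  rw [M.re_amp_mul γ γ' hk]
  ring

/-- The canonical commutation relation: all other terms of the imaginary part are odd in k because
the smearing functions are real. This supplies the off-diagonal imaginary part of the Gram matrix in
the uncertainty relation. -/
theorem RadialModes.integral_im (M : RadialModes c K u v) (hc : 1 ≤ c) (hc3 : c < 3)
    (γ γ' : PhasePoint) :
    (∫ k, amp u v γ k * (starRingEnd ℂ) (amp u v γ' k)).im
      = -(1 / 2) * (2 * Real.pi) ^ 3 * sympl γ γ' := by
  have h1 := (M.integrable_amp_mul hc hc3 γ γ').im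
  have h2 := ((integrable_symIntegrand γ γ').re).const_mul (1 / 2)
  have h3 := integral_add h1 h2
  change (∫ k, (amp u v γ k * (starRingEnd ℂ) (amp u v γ' k)).im + 1 / 2 * (symIntegrand γ γ' k).re)
    = (∫ k, (amp u v γ k * (starRingEnd ℂ) (amp u v γ' k)).im)
      + ∫ k, 1 / 2 * (symIntegrand γ γ' k).re at h3
  have h4 : ∫ k, (amp u v γ k * (starRingEnd ℂ) (amp u v γ' k)).im + 1 / 2 * (symIntegrand γ γ' k).re
      = 0 := by
    rw [← integral_eq_zero_of_odd (φ := fun k : Space =>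
      ‖u ‖k‖‖ ^ 2 * (fourierT γ.f k * (starRingEnd ℂ) (fourierT γ'.f k)).im
        + (star (u ‖k‖) * v ‖k‖).re * (fourierT γ.f k * (starRingEnd ℂ) (fourierT γ'.g k)
          + fourierT γ.g k * (starRingEnd ℂ) (fourierT γ'.f k)).im
        + ‖v ‖k‖‖ ^ 2 * (fourierT γ.g k * (starRingEnd ℂ) (fourierT γ'.g k)).im)]
    · refine integral_congr_ae ?_
      filter_upwards [ae_ne_zero] with k hk
      rw [M.im_amp_mul γ γ' hk]
      ring
    · intro k
      simp only [fourierT_neg, norm_neg, Complex.add_im, Complex.mul_im, Complex.conj_re,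
        Complex.conj_im, Complex.conj_conj]
      ring
  have h5 : ∫ k, (amp u v γ k * (starRingEnd ℂ) (amp u v γ' k)).im
      = (∫ k, amp u v γ k * (starRingEnd ℂ) (amp u v γ' k)).im :=
    _root_.integral_im (𝕜 := ℂ) (M.integrable_amp_mul hc hc3 γ γ')
  rw [h4, integral_const_mul] at h3
  rw [← h5, sympl_eq]
  have : (2 * Real.pi) ^ 3 ≠ 0 := by positivity
  field_simp
  linarith

/-- The amplitudes of two phase space elements are proportional only if the elements are. -/
def Nondegenerate (u v : ℝ → ℂ) (A : Mode) : Prop :=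
  ∀ τ : ℂ, (∀ k, k ≠ 0 → (fourierT (A.γ 1).f k - τ * fourierT (A.γ 0).f k) * u ‖k‖
      + (fourierT (A.γ 1).g k - τ * fourierT (A.γ 0).g k) * v ‖k‖ = 0) →
    ∀ k, fourierT (A.γ 1).f k = τ * fourierT (A.γ 0).f k
      ∧ fourierT (A.γ 1).g k = τ * fourierT (A.γ 0).g k

/-- The symplectic density is linear in its first slot and integrates to 0 when both slots coincide,
so proportionality over ℂ would give ω(γ⁽²⁾, γ⁽¹⁾) = 0 instead of 1. -/
theorem not_proportional (A : Mode) (τ : ℂ)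
    (h : ∀ k, fourierT (A.γ 1).f k = τ * fourierT (A.γ 0).f k
      ∧ fourierT (A.γ 1).g k = τ * fourierT (A.γ 0).g k) : False := by
  have hc := A.canonical
  rw [sympl_eq] at hc
  have h1 : ∀ k, symIntegrand (A.γ 1) (A.γ 0) k = τ * symIntegrand (A.γ 0) (A.γ 0) k := by
    intro k
    simp only [symIntegrand, (h k).1, (h k).2]
    ring
  have h2 : (∫ k, symIntegrand (A.γ 0) (A.γ 0) k) = 0 := by
    have hi := integrable_symIntegrand (A.γ 0) (A.γ 0)
    apply Complex.ext
    · rw [← integral_re_complex hi]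
      rw [Complex.zero_re]
      refine integral_eq_zero_of_ae (ae_of_all _ fun k => ?_)
      simp [symIntegrand]
      ring
    · rw [← integral_im_complex hi]
      exact integral_symIntegrand_im _ _
  have h3 : ∫ k, (symIntegrand (A.γ 1) (A.γ 0) k).re = 0 := by
    have h4 : ∫ k, (symIntegrand (A.γ 1) (A.γ 0) k).re
        = (∫ k, symIntegrand (A.γ 1) (A.γ 0) k).re :=
      integral_re (𝕜 := ℂ) (integrable_symIntegrand _ _)
    rw [h4]
    simp only [h1]
    rw [integral_const_mul, h2]
    simp
  rw [h3, mul_zero] at hc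
  exact zero_ne_one hc

theorem vacCov_comm (u v : ℝ → ℂ) (γ γ' : PhasePoint) : vacCov u v γ γ' = vacCov u v γ' γ := by
  unfold vacCov
  congr 2
  funext k
  simp only [Complex.mul_re, Complex.conj_re, Complex.conj_im]
  ring

/-- Strict uncertainty relation. -/
theorem RadialModes.one_lt_det (M : RadialModes c K u v) (hc : 1 ≤ c) (hc3 : c < 3) (A : Mode)
    (hN : Nondegenerate u v A) : 1 < (covBlock (vacCov u v) A A).det := by
  by_contra hdet
  rw [not_lt] at hdet
  set a₀ := amp u v (A.γ 0) with ha0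
  set a₁ := amp u v (A.γ 1) with ha1
  have i00 := M.integrable_amp_mul hc hc3 (A.γ 0) (A.γ 0)
  have i01 := M.integrable_amp_mul hc hc3 (A.γ 0) (A.γ 1)
  have i10 := M.integrable_amp_mul hc hc3 (A.γ 1) (A.γ 0)
  have i11 := M.integrable_amp_mul hc hc3 (A.γ 1) (A.γ 1)
  have him := M.integral_im hc hc3 (A.γ 1) (A.γ 0)
  rw [A.canonical, mul_one] at him
  simp only [← ha0, ← ha1] at i00 i01 i10 i11 him
  set G00 := ∫ k, a₀ k * (starRingEnd ℂ) (a₀ k) with hG00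
  set G01 := ∫ k, a₀ k * (starRingEnd ℂ) (a₁ k) with hG01
  set G10 := ∫ k, a₁ k * (starRingEnd ℂ) (a₀ k) with hG10
  set G11 := ∫ k, a₁ k * (starRingEnd ℂ) (a₁ k) with hG11
  have hre : ∀ z w : Space → ℂ, Integrable (fun k => z k * (starRingEnd ℂ) (w k)) →
      ∫ k, (z k * (starRingEnd ℂ) (w k)).re = (∫ k, z k * (starRingEnd ℂ) (w k)).re :=
    fun z w h => integral_re (𝕜 := ℂ) h
  have hconj : G01 = (starRingEnd ℂ) G10 := by
    rw [hG01, hG10, ← integral_conj]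
    congr 1; funext k; rw [map_mul, Complex.conj_conj, mul_comm]
  have r00 : G00 = ((G00.re : ℝ) : ℂ) := by
    apply Complex.ext
    · simp
    · rw [Complex.ofReal_im, hG00, ← integral_im_complex i00]
      refine integral_eq_zero_of_ae (ae_of_all _ fun k => ?_)
      simp; ring
  have p00 : 0 ≤ G00.re := by
    rw [hG00, ← hre _ _ i00]
    refine integral_nonneg fun k => ?_
    simp only [Pi.zero_apply, Complex.mul_re, Complex.conj_re, Complex.conj_im]
    nlinarith [sq_nonneg (a₀ k).re, sq_nonneg (a₀ k).im]
  have hpi : 0 < (2 * Real.pi) ^ 3 := by positivity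
  -- The imaginary part of G10 is fixed to -(2π)³/2 by the commutator, so a determinant at most 1
  -- says G00 G11 ≤ |G10|², the equality case of the Cauchy-Schwarz inequality.
  have hdet' : G00.re * G11.re ≤ Complex.normSq G10 := by
    rw [Matrix.det_fin_two] at hdet
    simp only [covBlock, Matrix.of_apply, vacCov, ← ha0, ← ha1] at hdet
    rw [hre _ _ i00, hre _ _ i01, hre _ _ i10, hre _ _ i11, ← hG00, ← hG01, ← hG10, ← hG11,
      hconj, Complex.conj_re] at hdet
    rw [Complex.normSq_apply, him]
    have e : 2 * ((2 * Real.pi) ^ 3)⁻¹ * G00.re * (2 * ((2 * Real.pi) ^ 3)⁻¹ * G11.re) -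
        2 * ((2 * Real.pi) ^ 3)⁻¹ * G10.re * (2 * ((2 * Real.pi) ^ 3)⁻¹ * G10.re)
        = 4 * (((2 * Real.pi) ^ 3)⁻¹) ^ 2 * (G00.re * G11.re - G10.re * G10.re) := by ring
    rw [e] at hdet
    have h2 : G00.re * G11.re - G10.re * G10.re ≤ 1 / 4 * ((2 * Real.pi) ^ 3) ^ 2 := by
      generalize (2 * Real.pi) ^ 3 = p at hpi hdet
      have : 4 * (p⁻¹) ^ 2 * (G00.re * G11.re - G10.re * G10.re) * (1 / 4 * p ^ 2)
          ≤ 1 * (1 / 4 * p ^ 2) := by gcongr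
      have e2 : 4 * (p⁻¹) ^ 2 * (G00.re * G11.re - G10.re * G10.re) * (1 / 4 * p ^ 2)
          = G00.re * G11.re - G10.re * G10.re := by field_simp
      linarith
    nlinarith
  have him0 : G10.im ≠ 0 := by
    rw [him]
    simp
  -- This combination has squared norm G00 (G00 G11 - |G10|²) ≤ 0, so it vanishes almost everywhere
  -- and, being continuous, at every k ≠ 0.
  set b : Space → ℂ := fun k => G00 * a₁ k - G10 * a₀ k with hb
  have e : ∀ k, ((Complex.normSq (b k) : ℝ) : ℂ)
      = G00 * G00 * (a₁ k * (starRingEnd ℂ) (a₁ k))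
        - G00 * (starRingEnd ℂ) G10 * (a₁ k * (starRingEnd ℂ) (a₀ k))
        - G10 * G00 * (a₀ k * (starRingEnd ℂ) (a₁ k))
        + G10 * (starRingEnd ℂ) G10 * (a₀ k * (starRingEnd ℂ) (a₀ k)) := by
    intro k
    rw [← Complex.mul_conj, hb]
    simp only [map_sub, map_mul]
    rw [r00, Complex.conj_ofReal, ← r00]
    ring
  have ib : Integrable (fun k => Complex.normSq (b k)) := by
    have h := ((((i11.const_mul (G00 * G00)).sub (i10.const_mul (G00 * (starRingEnd ℂ) G10))).sub
      (i01.const_mul (G10 * G00))).add (i00.const_mul (G10 * (starRingEnd ℂ) G10))).re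
    refine h.congr (ae_of_all _ fun k => ?_)
    have h3 := congrArg Complex.re (e k)
    rw [Complex.ofReal_re] at h3
    exact h3.symm
  have hbi : ∫ k, Complex.normSq (b k) ≤ 0 := by
    have h := (integral_add (((i11.const_mul (G00 * G00)).sub
      (i10.const_mul (G00 * (starRingEnd ℂ) G10))).sub
      (i01.const_mul (G10 * G00))) (i00.const_mul (G10 * (starRingEnd ℂ) G10)))
    have h' := integral_sub ((i11.const_mul (G00 * G00)).sub
      (i10.const_mul (G00 * (starRingEnd ℂ) G10))) (i01.const_mul (G10 * G00))
    have h'' := integral_sub (i11.const_mul (G00 * G00)) (i10.const_mul (G00 * (starRingEnd ℂ) G10))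
    simp only [Pi.sub_apply] at h h' h''
    rw [h', h''] at h
    simp only [integral_const_mul] at h
    rw [← hG00, ← hG01, ← hG10, ← hG11] at h
    have h2 : ((∫ k, Complex.normSq (b k) : ℝ) : ℂ)
        = G00 * (G00 * G11 - G10 * (starRingEnd ℂ) G10) := by
      rw [← integral_complex_ofReal]
      simp only [e]
      rw [h, hconj]
      ring
    have h3 := congrArg Complex.re h2
    rw [Complex.ofReal_re, Complex.mul_conj] at h3
    have im0 : G00.im = 0 := by rw [r00]; simp
    rw [h3]
    simp only [Complex.mul_re, Complex.sub_re, Complex.ofReal_re, im0, zero_mul, sub_zero]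
    nlinarith
  have hb0 : (fun k => Complex.normSq (b k)) =ᵐ[volume] 0 := by
    rw [← integral_eq_zero_iff_of_nonneg (fun k => Complex.normSq_nonneg _) ib]
    exact le_antisymm hbi (integral_nonneg fun k => Complex.normSq_nonneg _)
  have hbz : ∀ k, k ≠ 0 → b k = 0 := by
    have hcont : ContinuousOn b {0}ᶜ :=
      (continuousOn_const.mul (M.continuousOn_amp _)).sub
        (continuousOn_const.mul (M.continuousOn_amp _))
    have h1 : b =ᵐ[volume.restrict ({0}ᶜ : Set Space)] (fun _ => 0) := by
      refine ae_restrict_of_ae ?_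
      filter_upwards [hb0] with k hk using Complex.normSq_eq_zero.1 hk
    exact Measure.eqOn_open_of_ae_eq h1 isOpen_compl_singleton hcont continuousOn_const
  -- If G00 vanished, then G10 a₀ = 0 would force a₀ = 0 and hence G10 = 0, against its nonzero
  -- imaginary part.
  have hG0 : G00 ≠ 0 := by
    intro h0
    have hG10 : G10 ≠ 0 := fun h => him0 (by rw [h]; rfl)
    have ha : ∀ k, k ≠ 0 → a₀ k = 0 := by
      intro k hk
      have := hbz k hk
      rw [hb] at this
      simp only [h0, zero_mul, zero_sub, neg_eq_zero, mul_eq_zero] at this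
      exact this.resolve_left hG10
    apply hG10
    rw [‹G10 = _›]
    refine integral_eq_zero_of_ae ?_
    filter_upwards [ae_ne_zero] with k hk
    rw [ha k hk]; simp
  refine not_proportional A (G10 / G00) (hN _ fun k hk => ?_)
  have h := hbz k hk
  rw [hb] at h
  simp only [ha0, ha1, amp] at h
  have e : (fourierT (A.γ 1).f k - G10 / G00 * fourierT (A.γ 0).f k) * u ‖k‖
      + (fourierT (A.γ 1).g k - G10 / G00 * fourierT (A.γ 0).g k) * v ‖k‖
      = G00⁻¹ * (G00 * (fourierT (A.γ 1).f k * u ‖k‖ + fourierT (A.γ 1).g k * v ‖k‖)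
        - G10 * (fourierT (A.γ 0).f k * u ‖k‖ + fourierT (A.γ 0).g k * v ‖k‖)) := by
    field_simp
    ring
  rw [e, h, mul_zero]

end

/-! ### The Bunch-Davies and Minkowski spectral functions -/

/-- The exponent `max(2ν, 1)` controlling the infrared behaviour. -/
def irExp (a : ℝ) : ℝ := 2 * max a 0 + 1

theorem one_le_irExp (a : ℝ) : 1 ≤ irExp a := by
  have := le_max_right a 0
  unfold irExp; linarith

theorem irExp_lt_three {a : ℝ} (ha1 : a < 1) : irExp a < 3 := by
  have := max_lt ha1 one_pos
  unfold irExp; linarith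

theorem rpow_le_add_rpow {x p q s : ℝ} (hx : 0 < x) (h1 : p ≤ q) (h2 : q ≤ s) :
    x ^ q ≤ x ^ s + x ^ p := by
  rcases le_total x 1 with h | h
  · have := Real.rpow_le_rpow_of_exponent_ge hx h h1
    have : 0 ≤ x ^ s := by positivity
    linarith
  · have := Real.rpow_le_rpow_of_exponent_le h h2
    have : 0 ≤ x ^ p := by positivity
    linarith

theorem nich_bounds {a : ℝ} (ha : -1 < a) (ha1 : a < 1) :
    ∃ C, 0 < C ∧ ∀ x, 0 < x →
      |nichP a x| ≤ C * (x ^ (-1 : ℝ) + x ^ (-irExp a)) ∧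
      |nichQ a x| ≤ C * (x ^ (-1 : ℝ) + x ^ (-irExp a)) ∧
      |nichR a x| ≤ C * (x ^ (1 : ℝ) + x ^ (-irExp a)) := by
  obtain ⟨K, hK, hb⟩ := abs_rconfl_self_le ha (le_max_right a 0) (le_max_left a 0)
    (max_lt ha1 one_pos)
  have g1 : 0 < Real.Gamma (1 / 2) := Real.Gamma_pos_of_pos (by norm_num)
  have g2 : 0 < Real.Gamma (max a 0 + 1 / 2) :=
    Real.Gamma_pos_of_pos (by have := le_max_right a 0; linarith)
  have g3 : 0 < Real.Gamma (a + 1) := Real.Gamma_pos_of_pos (by linarith)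
  set L := K * (Real.Gamma (1 / 2) + Real.Gamma (max a 0 + 1 / 2)) with hL
  have hL0 : 0 < L := by positivity
  have hmix : ∀ f : ℝ → ℝ, (∀ w, 0 < w → |f w| ≤ K * (1 + w ^ max a 0)) → ∀ x, 0 < x →
      |mix f x| ≤ L * (x ^ (-1 : ℝ) + x ^ (-irExp a)) := by
    intro f hf x hx
    refine (abs_mix_le (le_max_right a 0) hf hx).trans ?_
    rw [hL, mul_assoc, Real.rpow_neg_one]
    have p1 : 0 < x⁻¹ := by positivity
    have p2 : 0 < x ^ (-irExp a) := by positivity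
    unfold irExp at p2 ⊢
    have := mul_pos g1 p2
    have := mul_pos g2 p1
    gcongr
    nlinarith
  have hc : 0 < nichC a := by
    have := Real.pi_pos
    unfold nichC; positivity
  refine ⟨nichC a * L * (6 + 4 * |a| + 2 * (a + 1 / 2) ^ 2), by positivity, fun x hx => ?_⟩
  have m0 := hmix _ (fun w hw => (hb w hw).1) x hx
  have m1 := hmix _ (fun w hw => (hb w hw).2.1) x hx
  have m2 := hmix _ (fun w hw => (hb w hw).2.2) x hx
  set s := x ^ (-1 : ℝ) + x ^ (-irExp a) with hs
  set t := x ^ (1 : ℝ) + x ^ (-irExp a) with ht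
  have hs0 : 0 < s := by positivity
  have ht0 : 0 < t := by positivity
  have hst : s ≤ 2 * t := by
    have := rpow_le_add_rpow hx (p := -irExp a) (q := -1) (s := 1)
      (by linarith [one_le_irExp a]) (by norm_num)
    have h1 : 0 < x ^ (1 : ℝ) := by positivity
    have h2 : 0 < x ^ (-irExp a) := by positivity
    rw [hs, ht]
    generalize x ^ (1 : ℝ) = y at *
    generalize x ^ (-1 : ℝ) = z at *
    generalize x ^ (-irExp a) = w at *
    linarith
  have hxs : x ^ 2 * s ≤ 2 * t := by
    have e1 : x ^ 2 * s = x ^ (1 : ℝ) + x ^ (2 - irExp a) := by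
      rw [hs, mul_add, ← Real.rpow_natCast, ← Real.rpow_add hx, ← Real.rpow_add hx]
      norm_num
      ring_nf
    have := rpow_le_add_rpow hx (p := -irExp a) (q := 2 - irExp a) (s := 1)
      (by linarith) (by linarith [one_le_irExp a])
    have h2 : 0 < x ^ (-irExp a) := by positivity
    have h3 : 0 < x ^ (1 : ℝ) := by positivity
    rw [e1, ht]
    generalize x ^ (1 : ℝ) = y at *
    linarith
  have ha0 := abs_nonneg a
  refine ⟨?_, ?_, ?_⟩
  · rw [nichP, abs_mul, abs_of_pos hc]
    have : nichC a * |mix (rconfl a a) x| ≤ nichC a * (L * s) := by gcongr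
    have h2 : 0 ≤ nichC a * (L * s) := by positivity
    nlinarith [mul_nonneg h2 ha0, mul_nonneg h2 (sq_nonneg (a + 1 / 2))]
  · rw [nichQ, abs_mul, abs_of_pos hc]
    have h1 : |(-mix (rconfl a a) x - 2 * (a * mix (fun w => w * rconfl (a + 1) (a - 1) w) x))|
        ≤ L * s + 2 * (|a| * (L * s)) := by
      refine (abs_sub _ _).trans ?_
      rw [abs_neg, abs_mul, abs_mul, abs_two]
      gcongr
    have h3 : nichC a * |(-mix (rconfl a a) x
        - 2 * (a * mix (fun w => w * rconfl (a + 1) (a - 1) w) x))|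
        ≤ nichC a * (L * s + 2 * (|a| * (L * s))) := by gcongr
    have h2 : 0 ≤ nichC a * (L * s) := by positivity
    nlinarith [mul_nonneg h2 ha0, mul_nonneg h2 (sq_nonneg (a + 1 / 2))]
  · rw [nichR, abs_mul, abs_of_pos hc]
    have h1 : |(a + 1 / 2) ^ 2 * mix (rconfl a a) x - 2 * (a * mix (rconfl (a + 1) (a - 1)) x)
        + x ^ 2 * mix (rconfl a a) x|
        ≤ (a + 1 / 2) ^ 2 * (L * s) + 2 * (|a| * (L * s)) + x ^ 2 * (L * s) := by
      refine (abs_add_le _ _).trans (add_le_add ((abs_sub _ _).trans (add_le_add ?_ ?_)) ?_)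
      · rw [abs_mul, abs_of_nonneg (sq_nonneg _)]; gcongr
      · rw [abs_mul, abs_mul, abs_two]; gcongr
      · rw [abs_mul, abs_of_nonneg (sq_nonneg _)]; gcongr
    have h3 : (a + 1 / 2) ^ 2 * (L * s) + 2 * (|a| * (L * s)) + x ^ 2 * (L * s)
        ≤ (a + 1 / 2) ^ 2 * (L * (2 * t)) + 2 * (|a| * (L * (2 * t))) + L * (2 * t) := by
      have : x ^ 2 * (L * s) = L * (x ^ 2 * s) := by ring
      rw [this]
      gcongr
    have h4 := mul_le_mul_of_nonneg_left (h1.trans h3) hc.le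
    have h2 : 0 ≤ nichC a * (L * t) := by positivity
    nlinarith

/-- The spectral functions of the Bunch-Davies vacuum, `a = ν - 1/2`. -/
def bdP₀ (a H r : ℝ) : ℝ := Real.pi / (4 * H) * nichP a (r / H)

def bdP₁ (a H r : ℝ) : ℝ := Real.pi / 4 * (3 / 2 * nichP a (r / H) + 1 / 2 * nichQ a (r / H))

def bdP₂ (a H r : ℝ) : ℝ :=
  Real.pi * H / 4 * (9 / 4 * nichP a (r / H) + 3 / 2 * nichQ a (r / H) + nichR a (r / H))

/-- The dependence of the constant on H is explicit with nonnegative exponents. For H ≤ 1 it is at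
most 5C, which gives the dominating function of the flat limit. -/
theorem bd_specBound {a : ℝ} (ha : -1 < a) (ha1 : a < 1) :
    ∃ C, 0 < C ∧ ∀ H, 0 < H → SpecBound (irExp a)
      (C * (1 + H ^ (irExp a - 1) + H + H ^ irExp a + H ^ (irExp a + 1)))
      (bdP₀ a H) (bdP₁ a H) (bdP₂ a H) := by
  obtain ⟨C, hC, hb⟩ := nich_bounds ha ha1
  set e := irExp a with he
  have hpi := Real.pi_pos
  refine ⟨Real.pi * C * 3, by positivity, fun H hH => ?_⟩
  have p1 : 0 < H ^ (e - 1) := by positivity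
  have p2 : 0 < H ^ e := by positivity
  have p3 : 0 < H ^ (e + 1) := by positivity
  have q1 : ∀ r : ℝ, 0 < r → (r / H) ^ (-1 : ℝ) = H * r ^ (-1 : ℝ) := fun r hr => by
    rw [Real.rpow_neg_one, Real.rpow_neg_one, inv_div]; rfl
  have q2 : ∀ r : ℝ, 0 < r → (r / H) ^ (-e) = H ^ e * r ^ (-e) := fun r hr => by
    rw [Real.div_rpow hr.le hH.le, Real.rpow_neg hH.le]; field_simp
  have q3 : H ^ e = H * H ^ (e - 1) := by
    rw [mul_comm, ← Real.rpow_add_one hH.ne']; norm_num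
  have q4 : H ^ (e + 1) = H * H ^ e := by
    rw [mul_comm, ← Real.rpow_add_one hH.ne']
  refine ⟨fun r hr => ?_, fun r hr => ?_, fun r hr => ?_⟩
  · have h := (hb (r / H) (by positivity)).1
    rw [q1 r hr, q2 r hr, q3] at h
    have r1 : 0 < r ^ (-1 : ℝ) := by positivity
    have r2 : 0 < r ^ (-e) := by positivity
    rw [bdP₀, abs_mul, abs_of_pos (by positivity)]
    calc Real.pi / (4 * H) * |nichP a (r / H)|
        ≤ Real.pi / (4 * H) * (C * (H * r ^ (-1 : ℝ) + H * H ^ (e - 1) * r ^ (-e))) := by gcongr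
      _ = Real.pi * C / 4 * (1 * r ^ (-1 : ℝ) + H ^ (e - 1) * r ^ (-e)) := by field_simp
      _ ≤ Real.pi * C * 3 * ((1 + H ^ (e - 1) + H + H ^ e + H ^ (e + 1)) * r ^ (-1 : ℝ)
          + (1 + H ^ (e - 1) + H + H ^ e + H ^ (e + 1)) * r ^ (-e)) := by
        gcongr ?_ * (?_ * _ + ?_ * _)
        · nlinarith [mul_pos hpi hC]
        · linarith
        · linarith
      _ = _ := by ring
  · have h := (hb (r / H) (by positivity)).1
    have h' := (hb (r / H) (by positivity)).2.1
    rw [q1 r hr, q2 r hr] at h h'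
    have r2 : 0 < r ^ (-e) := by positivity
    have r1 : r ^ (-1 : ℝ) ≤ 1 + r ^ (-e) := by
      have := rpow_le_add_rpow hr (p := -e) (q := -1) (s := 0)
        (by linarith [one_le_irExp a]) (by norm_num)
      rwa [Real.rpow_zero] at this
    rw [bdP₁, abs_mul, abs_of_pos (by positivity)]
    have h3 : |3 / 2 * nichP a (r / H) + 1 / 2 * nichQ a (r / H)|
        ≤ 2 * (C * (H * r ^ (-1 : ℝ) + H ^ e * r ^ (-e))) := by
      refine (abs_add_le _ _).trans ?_
      rw [abs_mul, abs_mul, abs_of_pos (by norm_num : (0 : ℝ) < 3 / 2),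
        abs_of_pos (by norm_num : (0 : ℝ) < 1 / 2)]
      linarith
    calc _ ≤ Real.pi / 4 * (2 * (C * (H * r ^ (-1 : ℝ) + H ^ e * r ^ (-e)))) := by gcongr
      _ ≤ Real.pi / 4 * (2 * (C * (H * (1 + r ^ (-e)) + H ^ e * r ^ (-e)))) := by gcongr
      _ = Real.pi * C / 2 * (H * 1 + (H + H ^ e) * r ^ (-e)) := by ring
      _ ≤ Real.pi * C * 3 * ((1 + H ^ (e - 1) + H + H ^ e + H ^ (e + 1)) * 1
          + (1 + H ^ (e - 1) + H + H ^ e + H ^ (e + 1)) * r ^ (-e)) := by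
        gcongr ?_ * (?_ * _ + ?_ * _)
        · nlinarith [mul_pos hpi hC]
        · linarith
        · linarith
      _ = _ := by ring
  · have h := (hb (r / H) (by positivity)).1
    have h' := (hb (r / H) (by positivity)).2.1
    have h'' := (hb (r / H) (by positivity)).2.2
    rw [q1 r hr, q2 r hr] at h h'
    rw [q2 r hr, Real.rpow_one] at h''
    have r2 : 0 < r ^ (-e) := by positivity
    have r1 : r ^ (-1 : ℝ) ≤ r + r ^ (-e) := by
      have := rpow_le_add_rpow hr (p := -e) (q := -1) (s := 1)
        (by linarith [one_le_irExp a]) (by norm_num)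
      rwa [Real.rpow_one] at this
    rw [bdP₂, abs_mul, abs_of_pos (by positivity), Real.rpow_one]
    have h3 : |9 / 4 * nichP a (r / H) + 3 / 2 * nichQ a (r / H) + nichR a (r / H)|
        ≤ 4 * (C * (H * r ^ (-1 : ℝ) + H ^ e * r ^ (-e))) + C * (r / H + H ^ e * r ^ (-e)) := by
      refine (abs_add_le _ _).trans (add_le_add ((abs_add_le _ _).trans ?_) h'')
      rw [abs_mul, abs_mul, abs_of_pos (by norm_num : (0 : ℝ) < 9 / 4),
        abs_of_pos (by norm_num : (0 : ℝ) < 3 / 2)]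
      have : 0 ≤ C * (H * r ^ (-1 : ℝ) + H ^ e * r ^ (-e)) := by positivity
      linarith
    have hH2 : H ^ 2 ≤ 1 + H ^ (e + 1) := by
      have := rpow_le_add_rpow hH (p := 0) (q := 2) (s := e + 1)
        (by norm_num) (by linarith [one_le_irExp a])
      rw [Real.rpow_zero, Real.rpow_two] at this
      linarith
    calc _ ≤ Real.pi * H / 4 * (4 * (C * (H * r ^ (-1 : ℝ) + H ^ e * r ^ (-e)))
          + C * (r / H + H ^ e * r ^ (-e))) := by gcongr
      _ ≤ Real.pi * H / 4 * (4 * (C * (H * (r + r ^ (-e)) + H ^ e * r ^ (-e)))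
          + C * (r / H + H ^ e * r ^ (-e))) := by gcongr
      _ = Real.pi * C * ((H ^ 2 + 1 / 4) * r + (H ^ 2 + 5 / 4 * (H * H ^ e)) * r ^ (-e)) := by
        field_simp
        ring
      _ ≤ Real.pi * C * ((3 * (1 + H ^ (e - 1) + H + H ^ e + H ^ (e + 1))) * r
          + (3 * (1 + H ^ (e - 1) + H + H ^ e + H ^ (e + 1))) * r ^ (-e)) := by
        rw [← q4]
        gcongr ?_ * (?_ * _ + ?_ * _)
        · linarith
        · linarith
      _ = _ := by ring

/-- The mode functions of the Bunch-Davies vacuum at the time `η = -1/H`. -/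
def bdU (a H r : ℝ) : ℂ := ((Real.sqrt (Real.pi / (4 * H)) : ℝ) : ℂ) * hankel1 (a + 1 / 2) (r / H)

def bdV (a H r : ℝ) : ℂ := ((Real.sqrt (Real.pi / (4 * H)) * H : ℝ) : ℂ) *
  (3 / 2 * hankel1 (a + 1 / 2) (r / H) + hankelTheta a (r / H))

theorem norm_bdU_sq {a H : ℝ} (ha : -1 < a) (ha1 : a < 1) (hH : 0 < H) {r : ℝ} (hr : 0 < r) :
    ‖bdU a H r‖ ^ 2 = bdP₀ a H r := by
  have h := hankel_products ha ha1 (show 0 < r / H by positivity)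
  rw [bdU, bdP₀, h.1, norm_mul, Complex.norm_real, mul_pow, Real.norm_eq_abs, sq_abs,
    Real.sq_sqrt (by positivity)]

theorem star_bdU_mul_bdV {a H : ℝ} (ha : -1 < a) (ha1 : a < 1) (hH : 0 < H) {r : ℝ}
    (hr : 0 < r) : (star (bdU a H r) * bdV a H r).re = bdP₁ a H r ∧
      (star (bdU a H r) * bdV a H r).im = 1 / 2 := by
  obtain ⟨h1, h2, h3, h4⟩ := hankel_products ha ha1 (show 0 < r / H by positivity)
  have hs : Real.sqrt (Real.pi / (4 * H)) * Real.sqrt (Real.pi / (4 * H)) = Real.pi / (4 * H) :=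
    Real.mul_self_sqrt (by positivity)
  rw [bdP₁, h1, h2, bdU, bdV]
  generalize hankel1 (a + 1 / 2) (r / H) = U at h4 ⊢
  generalize hankelTheta a (r / H) = W at h4 ⊢
  have e : star (((Real.sqrt (Real.pi / (4 * H)) : ℝ) : ℂ) * U) *
      (((Real.sqrt (Real.pi / (4 * H)) * H : ℝ) : ℂ) * (3 / 2 * U + W))
      = ((Real.pi / 4 : ℝ) : ℂ) * (3 / 2 * (star U * U) + star U * W) := by
    have e2 : ((Real.pi / 4 : ℝ) : ℂ) = ((Real.sqrt (Real.pi / (4 * H)) *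
        Real.sqrt (Real.pi / (4 * H)) * H : ℝ) : ℂ) := by
      rw [hs]; congr 1; field_simp
    rw [e2, star_mul', Complex.star_def, Complex.conj_ofReal]
    push_cast
    ring
  rw [e, Complex.re_ofReal_mul, Complex.im_ofReal_mul]
  have hU : star U * U = ((‖U‖ ^ 2 : ℝ) : ℂ) := by
    rw [mul_comm, Complex.star_def, Complex.mul_conj, Complex.normSq_eq_norm_sq]
  have h32 : (3 / 2 : ℂ) = ((3 / 2 : ℝ) : ℂ) := by push_cast; rfl
  rw [hU, h32, ← Complex.ofReal_mul, Complex.add_re, Complex.add_im, Complex.ofReal_re,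
    Complex.ofReal_im, h4, mul_comm W]
  constructor
  · ring
  · have := Real.pi_ne_zero
    field_simp
    norm_num

theorem norm_bdV_sq {a H : ℝ} (ha : -1 < a) (ha1 : a < 1) (hH : 0 < H) {r : ℝ} (hr : 0 < r) :
    ‖bdV a H r‖ ^ 2 = bdP₂ a H r := by
  obtain ⟨h1, h2, h3, h4⟩ := hankel_products ha ha1 (show 0 < r / H by positivity)
  rw [bdV, bdP₂, h1, h2, h3, norm_mul, Complex.norm_real, mul_pow, Real.norm_eq_abs, sq_abs,
    mul_pow, Real.sq_sqrt (by positivity)]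
  generalize hankel1 (a + 1 / 2) (r / H) = U
  generalize hankelTheta a (r / H) = W
  have h32 : (3 / 2 : ℂ) = ((3 / 2 : ℝ) : ℂ) := by push_cast; rfl
  rw [h32]
  simp only [← Complex.normSq_eq_norm_sq, Complex.normSq_apply, Complex.star_def]
  simp only [Complex.add_re, Complex.mul_re, Complex.conj_re, Complex.conj_im,
    Complex.add_im, Complex.im_ofReal_mul, Complex.ofReal_re,
    Complex.ofReal_im]
  field_simp
  ring

theorem bd_radialModes {a H : ℝ} (ha : -1 < a) (ha1 : a < 1) (hH : 0 < H) :
    ∃ K, RadialModes (irExp a) K (bdU a H) (bdV a H) := by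
  obtain ⟨C, hC, hb⟩ := bd_specBound ha ha1
  have hb := hb H hH
  have hdiv : ContinuousOn (fun r : ℝ => r / H) (Ioi 0) := by fun_prop
  have hmaps : MapsTo (fun r : ℝ => r / H) (Ioi 0) (Ioi 0) := fun r hr => div_pos hr hH
  have c1 : ContinuousOn (hankel1 (a + 1 / 2)) (Ioi 0) := fun x hx =>
    (hasDerivAt_hankel1 ha ha1 hx).continuousAt.continuousWithinAt
  have c2 : ContinuousOn (hankelTheta a) (Ioi 0) := fun x hx =>
    (hasDerivAt_hankelTheta ha ha1 hx).continuousAt.continuousWithinAt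
  refine ⟨C * (1 + H ^ (irExp a - 1) + H + H ^ irExp a + H ^ (irExp a + 1)),
    continuousOn_const.mul (c1.comp hdiv hmaps), continuousOn_const.mul
    ((continuousOn_const.mul (c1.comp hdiv hmaps)).add (c2.comp hdiv hmaps)),
    fun r hr => ?_, fun r hr => ?_, fun r hr => (star_bdU_mul_bdV ha ha1 hH hr).2⟩
  · rw [norm_bdU_sq ha ha1 hH hr]
    exact (le_abs_self _).trans (hb.bdd₀ r hr)
  · rw [norm_bdV_sq ha ha1 hH hr]
    exact (le_abs_self _).trans (hb.bdd₂ r hr)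

/-! ### From the mode functions to the covariance metrics -/

theorem bdMode_eq {H m k η : ℝ} (hH : 0 < H) (hη : η < 0) :
    bdMode H m k η = ((Real.sqrt (Real.pi * H ^ 2 / 4 * (-η) ^ 3) : ℝ) : ℂ)
      * hankel1 (bdOrder H m) (-k * η) := by
  unfold bdMode scaleFactor
  congr 3
  have := hη.ne
  field_simp

/-- The prefactor is proportional to (-η)^(3/2), and its logarithmic derivative is the 3/2 in `bdV`.
The sign agrees with O_γ = Φ(f) - Π(g), so that `bdV` multiplies +g̃ in the amplitude. -/
theorem hasDerivAt_bdMode {a H m k : ℝ} (ha : -1 < a) (ha1 : a < 1) (hH : 0 < H)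
    (hm : bdOrder H m = a + 1 / 2) (hk : 0 < k) :
    HasDerivAt (bdMode H m k) (-bdV a H k) (-1 / H) := by
  have hη : -1 / H < 0 := div_neg_of_neg_of_pos (by norm_num) hH
  have hx : -k * (-1 / H) = k / H := by field_simp
  have h0 : Real.pi * H ^ 2 / 4 * (-(-1 / H)) ^ 3 = Real.pi / (4 * H) := by field_simp
  have hp : 0 < Real.pi / (4 * H) := by positivity
  have h1 : HasDerivAt (fun η : ℝ => Real.pi * H ^ 2 / 4 * (-η) ^ 3)
      (-(3 * Real.pi / 4)) (-1 / H) := by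
    have := (((hasDerivAt_id (-1 / H)).neg).pow 3).const_mul (Real.pi * H ^ 2 / 4)
    refine this.congr_deriv ?_
    simp only [Pi.neg_apply, id]
    push_cast
    field_simp
  have h2 : HasDerivAt (fun η : ℝ => Real.sqrt (Real.pi * H ^ 2 / 4 * (-η) ^ 3))
      (-(3 / 2) * H * Real.sqrt (Real.pi / (4 * H))) (-1 / H) := by
    have h := (Real.hasDerivAt_sqrt (x := Real.pi * H ^ 2 / 4 * (-(-1 / H)) ^ 3)
      (by rw [h0]; exact hp.ne')).comp (-1 / H) h1
    refine h.congr_deriv ?_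
    rw [h0]
    have hs : 0 < Real.sqrt (Real.pi / (4 * H)) := Real.sqrt_pos.2 hp
    have hs2 : Real.pi = Real.sqrt (Real.pi / (4 * H)) ^ 2 * (4 * H) := by
      rw [Real.sq_sqrt hp.le]; field_simp
    set s := Real.sqrt (Real.pi / (4 * H))
    rw [hs2]
    field_simp
  have h3 : HasDerivAt (fun η : ℝ => hankel1 (a + 1 / 2) (-k * η))
      (-(H : ℂ) * hankelTheta a (k / H)) (-1 / H) := by
    have hd := hasDerivAt_hankel1 ha ha1 (x := -k * (-1 / H)) (by rw [hx]; positivity)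
    have hl : HasDerivAt (fun η : ℝ => -k * η) (-k) (-1 / H) := by
      simpa using (hasDerivAt_id (-1 / H)).const_mul (-k)
    refine (hd.scomp (-1 / H) hl).congr_deriv ?_
    rw [hx, Complex.real_smul]
    have hH' : (H : ℂ) ≠ 0 := by exact_mod_cast hH.ne'
    have hk' : (k : ℂ) ≠ 0 := by exact_mod_cast hk.ne'
    push_cast
    field_simp
  have h4 := h2.ofReal_comp.mul h3
  refine (h4.congr_of_eventuallyEq ?_).congr_deriv ?_
  · filter_upwards [Iio_mem_nhds hη] with η hη'
    rw [bdMode_eq hH hη', hm]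
    rfl
  · rw [hx, h0, bdV]
    push_cast
    ring

theorem bdAmplitude_eq {a H m : ℝ} (ha : -1 < a) (ha1 : a < 1) (hH : 0 < H)
    (hm : bdOrder H m = a + 1 / 2) (γ : PhasePoint) {k : Space} (hk : k ≠ 0) :
    bdAmplitude H m (-1 / H) γ k = amp (bdU a H) (bdV a H) γ k := by
  have hr : 0 < ‖k‖ := norm_pos_iff.2 hk
  have hη : -1 / H < 0 := div_neg_of_neg_of_pos (by norm_num) hH
  unfold bdAmplitude amp bdMomentumMode
  rw [(hasDerivAt_bdMode ha ha1 hH hm hr).deriv, bdMode_eq hH hη, hm]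
  have h0 : Real.pi * H ^ 2 / 4 * (-(-1 / H)) ^ 3 = Real.pi / (4 * H) := by field_simp
  have hx : -‖k‖ * (-1 / H) = ‖k‖ / H := by field_simp
  have hs : scaleFactor H (-1 / H) ^ 2 = 1 := by
    unfold scaleFactor
    have : H * (-1 / H) = -1 := by field_simp
    rw [this]; norm_num
  rw [h0, hx, hs, bdU]
  push_cast
  ring

theorem covBD_eq_vacCov {a H m : ℝ} (ha : -1 < a) (ha1 : a < 1) (hH : 0 < H)
    (hm : bdOrder H m = a + 1 / 2) : covBD H m = vacCov (bdU a H) (bdV a H) := by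
  funext γ γ'
  unfold covBD vacCov
  congr 1
  refine integral_congr_ae ?_
  filter_upwards [ae_ne_zero] with k hk
  rw [bdAmplitude_eq ha ha1 hH hm γ hk, bdAmplitude_eq ha ha1 hH hm γ' hk]

theorem specCov_congr {P₀ P₁ P₂ Q₀ Q₁ Q₂ : ℝ → ℝ} (h₀ : ∀ r, 0 < r → P₀ r = Q₀ r)
    (h₁ : ∀ r, 0 < r → P₁ r = Q₁ r) (h₂ : ∀ r, 0 < r → P₂ r = Q₂ r) :
    specCov P₀ P₁ P₂ = specCov Q₀ Q₁ Q₂ := by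
  funext γ γ'
  unfold specCov
  congr 1
  refine integral_congr_ae ?_
  filter_upwards [ae_ne_zero] with k hk
  have hr : 0 < ‖k‖ := norm_pos_iff.2 hk
  rw [specIntegrand, specIntegrand, h₀ _ hr, h₁ _ hr, h₂ _ hr]

theorem covBD_eq_specCov {a H m : ℝ} (ha : -1 < a) (ha1 : a < 1) (hH : 0 < H)
    (hm : bdOrder H m = a + 1 / 2) :
    covBD H m = specCov (bdP₀ a H) (bdP₁ a H) (bdP₂ a H) := by
  obtain ⟨K, hK⟩ := bd_radialModes ha ha1 hH
  rw [covBD_eq_vacCov ha ha1 hH hm]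
  funext γ γ'
  rw [hK.vacCov_eq (one_le_irExp a) (irExp_lt_three ha1)]
  rw [specCov_congr (fun r hr => norm_bdU_sq ha ha1 hH hr)
    (fun r hr => (star_bdU_mul_bdV ha ha1 hH hr).1) (fun r hr => norm_bdV_sq ha ha1 hH hr)]

/-- The mode functions of the massless Minkowski vacuum. -/
def minkU (r : ℝ) : ℂ := ((Real.sqrt (1 / (2 * r)) : ℝ) : ℂ)

def minkV (r : ℝ) : ℂ := Complex.I * ((Real.sqrt (r / 2) : ℝ) : ℂ)

theorem mink_radialModes : RadialModes 1 1 minkU minkV := by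
  refine ⟨?_, ?_, fun r hr => ?_, fun r hr => ?_, fun r hr => ?_⟩
  · refine Complex.continuous_ofReal.comp_continuousOn (ContinuousOn.sqrt ?_)
    exact continuousOn_const.div (by fun_prop) (fun r hr => by
      have : (0 : ℝ) < r := hr
      positivity)
  · exact (Continuous.mul continuous_const (by fun_prop)).continuousOn
  · rw [minkU, Complex.norm_real, Real.norm_eq_abs, sq_abs, Real.sq_sqrt (by positivity),
      Real.rpow_neg_one, one_mul, one_div, mul_inv]
    have : 0 < r⁻¹ := by positivity
    linarith
  · rw [minkV, norm_mul, Complex.norm_I, one_mul, Complex.norm_real, Real.norm_eq_abs, sq_abs,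
      Real.sq_sqrt (by positivity), Real.rpow_one, one_mul]
    have : 0 < r ^ (-1 : ℝ) := by positivity
    linarith
  · rw [minkU, minkV, Complex.star_def, Complex.conj_ofReal]
    have h : Real.sqrt (1 / (2 * r)) * Real.sqrt (r / 2) = 1 / 2 := by
      rw [← Real.sqrt_mul (by positivity)]
      have : 1 / (2 * r) * (r / 2) = (1 / 2) ^ 2 := by field_simp
      rw [this, Real.sqrt_sq (by norm_num)]
    simp only [Complex.mul_im, Complex.mul_re, Complex.ofReal_re, Complex.ofReal_im, Complex.I_re,
      Complex.I_im]
    linarith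

theorem mink_vacCov_eq_specCov :
    vacCov minkU minkV = specCov (fun r => 1 / 2 * r ^ (-1 : ℝ)) (fun _ => 0)
      (fun r => 1 / 2 * r ^ (1 : ℝ)) := by
  funext γ γ'
  rw [mink_radialModes.vacCov_eq le_rfl (by norm_num)]
  rw [specCov_congr (fun r hr => ?_) (fun r hr => ?_) (fun r hr => ?_)]
  · rw [minkU, Complex.norm_real, Real.norm_eq_abs, sq_abs, Real.sq_sqrt (by positivity),
      Real.rpow_neg_one, one_div, mul_inv]
    norm_num
  · rw [minkU, minkV, Complex.star_def, Complex.conj_ofReal]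
    simp
  · rw [minkV, norm_mul, Complex.norm_I, one_mul, Complex.norm_real, Real.norm_eq_abs, sq_abs,
      Real.sq_sqrt (by positivity), Real.rpow_one]
    ring

theorem integrable_sobolev {s : ℝ} {h h' : Space → ℝ} (hh : Integrable h) (hh' : Integrable h')
    (i : Integrable fun k : Space => ‖k‖ ^ (2 * s) * ‖fourierT h k‖ ^ 2)
    (i' : Integrable fun k : Space => ‖k‖ ^ (2 * s) * ‖fourierT h' k‖ ^ 2) :
    Integrable fun k : Space => ((‖k‖ ^ (2 * s) : ℝ) : ℂ) *
      (fourierT h k * (starRingEnd ℂ) (fourierT h' k)) := by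
  refine Integrable.mono' (i.add i') ?_ (ae_of_all _ fun k => ?_)
  · exact (Complex.continuous_ofReal.measurable.comp (measurable_norm_rpow _)).aestronglyMeasurable.mul
      ((continuous_fourierT hh).mul
        (Complex.continuous_conj.comp (continuous_fourierT hh'))).aestronglyMeasurable
  · rw [norm_mul, norm_mul, RCLike.norm_conj, Complex.norm_real,
      Real.norm_of_nonneg (by positivity)]
    have h1 : 0 ≤ ‖k‖ ^ (2 * s) := by positivity
    simp only [Pi.add_apply]
    nlinarith [mul_nonneg h1 (sq_nonneg (‖fourierT h k‖ - ‖fourierT h' k‖)),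
      mul_nonneg h1 (sq_nonneg ‖fourierT h k‖), mul_nonneg h1 (sq_nonneg ‖fourierT h' k‖)]

theorem covMink_eq_specCov :
    covMink = specCov (fun r => 1 / 2 * r ^ (-1 : ℝ)) (fun _ => 0)
      (fun r => 1 / 2 * r ^ (1 : ℝ)) := by
  funext γ γ'
  have i1 := integrable_sobolev γ.integrable_g γ'.integrable_g γ.sobolev_g γ'.sobolev_g
  have i2 := integrable_sobolev γ.integrable_f γ'.integrable_f γ.sobolev_f γ'.sobolev_f
  have j1 : Integrable fun k : Space => (((‖k‖ ^ (2 * (1 / 2) : ℝ) : ℝ) : ℂ) *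
      (fourierT γ.g k * (starRingEnd ℂ) (fourierT γ'.g k))).re := i1.re
  have j2 : Integrable fun k : Space => (((‖k‖ ^ (2 * (-(1 / 2)) : ℝ) : ℝ) : ℂ) *
      (fourierT γ.f k * (starRingEnd ℂ) (fourierT γ'.f k))).re := i2.re
  unfold covMink sobolevProd specCov
  rw [← Complex.ofReal_inv, Complex.re_ofReal_mul, Complex.re_ofReal_mul,
    ← integral_re_complex i1, ← integral_re_complex i2, ← mul_add, ← integral_add j1 j2,
    mul_assoc 2, mul_left_comm 2, ← integral_const_mul 2]
  refine congrArg (_ * ·) (integral_congr_ae (ae_of_all _ fun k => ?_))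
  simp only [specIntegrand]
  rw [Complex.re_ofReal_mul, Complex.re_ofReal_mul, show (2 * (1 / 2) : ℝ) = 1 by norm_num,
    show (2 * (-(1 / 2)) : ℝ) = -1 by norm_num]
  ring

/-! ### Nondegeneracy: no mode is annihilated by a combination of its elements -/

/-- Paley-Wiener on a ray: for compact support the exponential stays bounded on the support for
complex z, so t ↦ h̃(tn) extends to an entire function. -/
theorem analyticAt_fourierT_ray {h : Space → ℝ} (hh : Integrable h) (hc : HasCompactSupport h)
    (n : Space) (r : ℝ) : AnalyticAt ℝ (fun t : ℝ => fourierT h (t • n)) r := by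
  obtain ⟨R, hR⟩ := hc.isCompact.isBounded.exists_norm_le
  set L := ‖n‖ * max R 0 with hL
  have hL0 : 0 ≤ L := by positivity
  have hin : ∀ x, h x ≠ 0 → |inner ℝ n x| ≤ L := fun x hx => by
    refine (abs_real_inner_le_norm n x).trans ?_
    rw [hL]
    gcongr
    exact (hR x (subset_tsupport _ hx)).trans (le_max_left _ _)
  set e : ℂ → Space → ℂ := fun z x =>
    Complex.exp (Complex.I * (z * ((inner ℝ n x : ℝ) : ℂ))) * (h x : ℂ) with he
  have hmeas : ∀ z, AEStronglyMeasurable (e z) volume := fun z =>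
    (Continuous.aestronglyMeasurable (by fun_prop)).mul
      (Complex.continuous_ofReal.comp_aestronglyMeasurable hh.aestronglyMeasurable)
  have hexp : ∀ z x, h x ≠ 0 →
      ‖Complex.exp (Complex.I * (z * ((inner ℝ n x : ℝ) : ℂ)))‖ ≤ Real.exp (‖z‖ * L) := by
    intro z x hx
    rw [Complex.norm_exp]
    refine Real.exp_le_exp.2 ((Complex.re_le_norm _).trans ?_)
    rw [norm_mul, Complex.norm_I, one_mul, norm_mul, Complex.norm_real, Real.norm_eq_abs]
    gcongr
    exact hin x hx
  have hd : Differentiable ℂ (fun z => ∫ x, e z x) := by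
    intro z₀
    have key := hasDerivAt_integral_of_dominated_loc_of_deriv_le (μ := (volume : Measure Space))
      (F := e) (x₀ := z₀) (s := Metric.ball z₀ 1)
      (F' := fun z x => (Complex.I * ((inner ℝ n x : ℝ) : ℂ)) * e z x)
      (bound := fun x => L * Real.exp ((‖z₀‖ + 1) * L) * |h x|)
      (Metric.ball_mem_nhds z₀ one_pos) (Eventually.of_forall hmeas) ?_ ?_ ?_ ?_ ?_
    · exact key.2.differentiableAt
    · refine Integrable.mono' (hh.abs.const_mul (Real.exp (‖z₀‖ * L))) (hmeas z₀)
        (ae_of_all _ fun x => ?_)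
      by_cases hx : h x = 0
      · simp [he, hx]
      · rw [he, norm_mul, Complex.norm_real, Real.norm_eq_abs]
        gcongr
        exact hexp z₀ x hx
    · exact (Continuous.aestronglyMeasurable (by fun_prop)).mul (hmeas z₀)
    · refine ae_of_all _ fun x z hz => ?_
      by_cases hx : h x = 0
      · simp [he, hx]
      · have hz' : ‖z‖ ≤ ‖z₀‖ + 1 := by
          have := norm_le_norm_add_norm_sub' z z₀
          rw [mem_ball_iff_norm] at hz
          linarith
        rw [norm_mul, norm_mul, Complex.norm_I, one_mul, he, norm_mul, Complex.norm_real,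
          Complex.norm_real, Real.norm_eq_abs, Real.norm_eq_abs, mul_assoc]
        have h1 := (hexp z x hx).trans (Real.exp_le_exp.2 (mul_le_mul_of_nonneg_right hz' hL0))
        gcongr
        exact hin x hx
    · exact hh.abs.const_mul _
    · refine ae_of_all _ fun x z _ => ?_
      have h1 : HasDerivAt (fun z : ℂ => Complex.I * (z * ((inner ℝ n x : ℝ) : ℂ)))
          (Complex.I * ((inner ℝ n x : ℝ) : ℂ)) z := by
        simpa using ((hasDerivAt_id z).mul_const ((inner ℝ n x : ℝ) : ℂ)).const_mul Complex.I
      refine (h1.cexp.mul_const (h x : ℂ)).congr_deriv ?_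
      rw [he]; ring
  have ha := (hd.analyticAt (r : ℂ)).restrictScalars (𝕜 := ℝ)
  have h2 := AnalyticAt.comp (f := fun t : ℝ => (t : ℂ)) (x := r) ha
    (Complex.ofRealCLM.analyticAt r)
  refine h2.congr (Eventually.of_forall fun t => ?_)
  simp only [Function.comp, he, fourierT, inner_smul_left, RCLike.conj_to_real]
  push_cast
  rfl

theorem eq_zero_of_analytic_of_pos {φ : ℝ → ℂ} (hφ : ∀ r, AnalyticAt ℝ φ r)
    (h : ∀ r, 0 < r → φ r = 0) (r : ℝ) : φ r = 0 := by
  have := AnalyticOnNhd.eqOn_zero_of_preconnected_of_eventuallyEq_zero (𝕜 := ℝ) (f := φ)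
    (U := univ) (fun r _ => hφ r) isPreconnected_univ (mem_univ 1)
    (by filter_upwards [Ioi_mem_nhds one_pos] with r hr using h r hr)
  exact this (mem_univ r)

section

variable (A : Mode) (τ : ℂ)

theorem analyticAt_comb (h₁ h₀ : Space → ℝ) (i₁ : Integrable h₁) (i₀ : Integrable h₀)
    (c₁ : HasCompactSupport h₁) (c₀ : HasCompactSupport h₀) (n : Space) (r : ℝ) :
    AnalyticAt ℝ (fun t : ℝ => fourierT h₁ (t • n) - τ * fourierT h₀ (t • n)) r :=
  (analyticAt_fourierT_ray i₁ c₁ n r).sub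
    (analyticAt_const.mul (analyticAt_fourierT_ray i₀ c₀ n r))

end

theorem exists_ray (k : Space) : ∃ n : Space, ‖n‖ = 1 ∧ k = ‖k‖ • n := by
  by_cases hk : k = 0
  · exact ⟨EuclideanSpace.single 0 1, by simp, by simp [hk]⟩
  · exact ⟨‖k‖⁻¹ • k, norm_smul_inv_norm hk, by
      rw [smul_smul, mul_inv_cancel₀ (norm_ne_zero_iff.2 hk), one_smul]⟩

/-- On a ray the ratio v/u is ir, hence F + irG = 0 for r > 0, and by analyticity for all real r.
The rays n and -n reach the same point with opposite signs of r, so also F - irG = 0 there, and both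
functions vanish. -/
theorem mink_nondegenerate (A : Mode) : Nondegenerate minkU minkV A := by
  intro τ hτ k
  have aF := fun n r => analyticAt_comb τ (A.γ 1).f (A.γ 0).f (A.γ 1).integrable_f
    (A.γ 0).integrable_f (A.γ 1).compact_f (A.γ 0).compact_f n r
  have aG := fun n r => analyticAt_comb τ (A.γ 1).g (A.γ 0).g (A.γ 1).integrable_g
    (A.γ 0).integrable_g (A.γ 1).compact_g (A.γ 0).compact_g n r
  set F : Space → ℂ := fun k => fourierT (A.γ 1).f k - τ * fourierT (A.γ 0).f k with hF
  set G : Space → ℂ := fun k => fourierT (A.γ 1).g k - τ * fourierT (A.γ 0).g k with hG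
  have key : ∀ n : Space, ‖n‖ = 1 → ∀ r : ℝ, F (r • n) + Complex.I * r * G (r • n) = 0 := by
    intro n hn r
    refine eq_zero_of_analytic_of_pos (φ := fun r => F (r • n) + Complex.I * r * G (r • n))
      (fun r => (aF n r).add ((analyticAt_const.mul (Complex.ofRealCLM.analyticAt r)).mul (aG n r)))
      (fun r hr => ?_) r
    have h := hτ (r • n) (by
      rw [smul_ne_zero_iff]
      exact ⟨hr.ne', norm_pos_iff.1 (by rw [hn]; exact one_pos)⟩)
    rw [norm_smul, hn, mul_one, Real.norm_of_nonneg hr.le] at h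
    change F (r • n) * minkU r + G (r • n) * minkV r = 0 at h
    have e : Real.sqrt (r / 2) = r * Real.sqrt (1 / (2 * r)) := by
      rw [← Real.sqrt_sq hr.le, ← Real.sqrt_mul (by positivity), Real.sqrt_sq hr.le]
      congr 1
      field_simp
    have hs : ((Real.sqrt (1 / (2 * r)) : ℝ) : ℂ) ≠ 0 := by
      exact_mod_cast (Real.sqrt_pos.2 (by positivity)).ne'
    rw [minkU, minkV, e] at h
    push_cast at h
    refine (mul_eq_zero.1 (?_ : ((Real.sqrt (1 / (2 * r)) : ℝ) : ℂ) *
      (F (r • n) + Complex.I * r * G (r • n)) = 0)).resolve_left hs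
    rw [← h]
    ring
  have key' : ∀ n : Space, ‖n‖ = 1 → ∀ r : ℝ, F (r • n) = 0 ∧ r * G (r • n) = 0 := by
    intro n hn r
    have h1 := key n hn r
    have h2 := key (-n) (by rwa [norm_neg]) (-r)
    rw [smul_neg, neg_smul, neg_neg] at h2
    push_cast at h2
    have h3 : F (r • n) = 0 := by linear_combination (h1 + h2) / 2
    refine ⟨h3, ?_⟩
    rw [h3] at h1
    have := Complex.I_mul_I
    linear_combination -Complex.I * h1 + (r * G (r • n)) * this
  obtain ⟨n, hn, hk⟩ := exists_ray k
  have hG0 : ∀ r : ℝ, G (r • n) = 0 := eq_zero_of_analytic_of_pos (aG n) fun r hr =>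
    (mul_eq_zero.1 (key' n hn r).2).resolve_left (by exact_mod_cast hr.ne')
  have e1 := (key' n hn ‖k‖).1
  have e2 := hG0 ‖k‖
  rw [← hk] at e1 e2
  exact ⟨sub_eq_zero.1 e1, sub_eq_zero.1 e2⟩

/-! ### The infrared singularity of the Bunch-Davies spectrum and its nondegeneracy -/

theorem gamma_mul_rpow_le_rconfl {a : ℝ} (ha : 0 < a) (ha1 : a < 1) {w : ℝ} (hw : 0 < w) :
    Real.Gamma (2 * a + 1) * w ^ a ≤ rconfl a a w := by
  have h0 := integral_exp_mul_rpow (p := 2 * a) (by linarith)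
  rw [← h0, rconfl, ← integral_mul_const]
  have hi := (integrableOn_confl (p := a) (q := a) (by linarith) ha1.le
    (w := (w : ℂ)) (by simpa using hw.le)).norm
  refine setIntegral_mono_on ((integrableOn_exp_mul_rpow (by linarith)).mul_const _) ?_
    measurableSet_Ioi (fun u hu => ?_)
  · refine IntegrableOn.congr_fun hi (fun u hu => ?_) measurableSet_Ioi
    have hu : (0 : ℝ) < u := hu
    have h1 : (0 : ℝ) ≤ 1 + w * u := by positivity
    rw [norm_mul, norm_exp_mul_rpow hu, show (1 + (w : ℂ) * u) = ((1 + w * u : ℝ) : ℂ) by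
      push_cast; rfl, ← Complex.ofReal_cpow h1, Complex.norm_real,
      Real.norm_of_nonneg (by positivity)]
  · have hu : (0 : ℝ) < u := hu
    have e : u ^ (2 * a) * w ^ a = u ^ a * (w * u) ^ a := by
      rw [two_mul, Real.rpow_add hu, Real.mul_rpow hw.le hu.le]; ring
    rw [mul_assoc, e, ← mul_assoc]
    gcongr
    linarith

/-- From (1 + wu)^a ≥ (wu)^a in the mixing density. Together with `nich_bounds` it pins |H_ν|² near
0 between two multiples of x^(-2ν). -/
theorem nichP_lower {a : ℝ} (ha : 0 < a) (ha1 : a < 1) :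
    ∃ c, 0 < c ∧ ∀ x, 0 < x → c * x ^ (-(2 * a + 1)) ≤ nichP a x := by
  have hpi := Real.pi_pos
  have g1 : 0 < Real.Gamma (a + 1) := Real.Gamma_pos_of_pos (by linarith)
  have g2 : 0 < Real.Gamma (2 * a + 1) := Real.Gamma_pos_of_pos (by linarith)
  have g3 : 0 < Real.Gamma (a + 1 / 2) := Real.Gamma_pos_of_pos (by linarith)
  have hc : 0 < nichC a := by unfold nichC; positivity
  refine ⟨nichC a * (Real.Gamma (2 * a + 1) * Real.Gamma (a + 1 / 2)), by positivity,
    fun x hx => ?_⟩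
  rw [nichP, mul_assoc, mul_assoc, ← mix_rpow hx (by linarith), ← mix_const_mul]
  gcongr
  refine setIntegral_mono_on ?_ ((polyBdd_rconfl_self (by linarith) ha1).integrableOn hx)
    measurableSet_Ioi (fun w hw => ?_)
  · refine IntegrableOn.congr_fun ((integrableOn_exp_sq_mul_rpow (s := a - 1 / 2) hx
      (by linarith)).const_mul (Real.Gamma (2 * a + 1))) (fun w hw => ?_) measurableSet_Ioi
    have hw : (0 : ℝ) < w := hw
    simp only
    rw [sub_eq_add_neg, Real.rpow_add hw]; ring
  · have hw : (0 : ℝ) < w := hw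
    gcongr
    exact gamma_mul_rpow_le_rconfl ha ha1 hw

/-- On each ray the relation Fu + Gv = 0 becomes φ = ψ |u|² with φ = |G|² and ψ = -2 Im(F Ḡ), both
analytic at r = 0. Nonzero analytic functions have integer orders there, whereas |u|² has order -2ν
with 2 < 2ν < 3. Hence G = 0 on the ray, and then F = 0 since u has no zero. -/
theorem bd_nondegenerate {a H : ℝ} (ha : 1 / 2 < a) (ha1 : a < 1) (hH : 0 < H) (A : Mode) :
    Nondegenerate (bdU a H) (bdV a H) A := by
  intro τ hτ k
  have aF := fun n r => analyticAt_comb τ (A.γ 1).f (A.γ 0).f (A.γ 1).integrable_f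
    (A.γ 0).integrable_f (A.γ 1).compact_f (A.γ 0).compact_f n r
  have aG := fun n r => analyticAt_comb τ (A.γ 1).g (A.γ 0).g (A.γ 1).integrable_g
    (A.γ 0).integrable_g (A.γ 1).compact_g (A.γ 0).compact_g n r
  set F : Space → ℂ := fun k => fourierT (A.γ 1).f k - τ * fourierT (A.γ 0).f k with hF
  set G : Space → ℂ := fun k => fourierT (A.γ 1).g k - τ * fourierT (A.γ 0).g k with hG
  obtain ⟨n, hn, hk⟩ := exists_ray k
  have hray : ∀ r : ℝ, 0 < r → F (r • n) * bdU a H r + G (r • n) * bdV a H r = 0 := by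
    intro r hr
    have h := hτ (r • n) (by
      rw [smul_ne_zero_iff]
      exact ⟨hr.ne', norm_pos_iff.1 (by rw [hn]; exact one_pos)⟩)
    rwa [norm_smul, hn, mul_one, Real.norm_of_nonneg hr.le] at h
  -- Multiply the relation by ū Ḡ and take imaginary parts; the Wronskian 1/2 turns Im(ū v)|G|² into
  -- |G|²/2.
  have hrel : ∀ r : ℝ, 0 < r → Complex.normSq (G (r • n))
      = -2 * (F (r • n) * (starRingEnd ℂ) (G (r • n))).im * bdP₀ a H r := by
    intro r hr
    have h1 := hray r hr
    have h2 := norm_bdU_sq (by linarith) ha1 hH hr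
    have h3 := (star_bdU_mul_bdV (by linarith) ha1 hH hr).2
    rw [← h2]
    generalize bdU a H r = u at *
    generalize bdV a H r = v at *
    generalize F (r • n) = f at *
    generalize G (r • n) = g at *
    have h4 := congrArg (fun z => (z * ((starRingEnd ℂ) u * (starRingEnd ℂ) g)).im) h1
    simp only [← Complex.normSq_eq_norm_sq, Complex.normSq_apply, Complex.star_def,
      Complex.add_re, Complex.add_im, Complex.mul_re, Complex.mul_im, Complex.conj_re,
      Complex.conj_im, Complex.zero_re, Complex.zero_im] at h3 h4 ⊢
    linear_combination 2 * h4 - 2 * (g.re * g.re + g.im * g.im) * h3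
  set φ : ℝ → ℝ := fun r => Complex.normSq (G (r • n)) with hφ
  set ψ : ℝ → ℝ := fun r => -2 * (F (r • n) * (starRingEnd ℂ) (G (r • n))).im with hψ
  have aconj : ∀ r, AnalyticAt ℝ (fun r : ℝ => (starRingEnd ℂ) (G (r • n))) r := fun r =>
    AnalyticAt.comp (g := fun z : ℂ => (starRingEnd ℂ) z) (f := fun r : ℝ => G (r • n))
      (Complex.conjCLE.toContinuousLinearMap.analyticAt _) (aG n r)
  have aφ : ∀ r, AnalyticAt ℝ φ r := fun r => by
    have h := AnalyticAt.comp (g := fun z : ℂ => z.re)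
      (f := fun r : ℝ => G (r • n) * (starRingEnd ℂ) (G (r • n)))
      (Complex.reCLM.analyticAt _) ((aG n r).mul (aconj r))
    refine h.congr (Eventually.of_forall fun t => ?_)
    simp only [Function.comp, hφ, Complex.mul_conj, Complex.ofReal_re]
  have aψ : ∀ r, AnalyticAt ℝ ψ r := fun r => by
    have h := AnalyticAt.comp (g := fun z : ℂ => z.im)
      (f := fun r : ℝ => F (r • n) * (starRingEnd ℂ) (G (r • n)))
      (Complex.imCLM.analyticAt _) ((aF n r).mul (aconj r))
    exact analyticAt_const.mul h
  -- Otherwise φ = r^i φ' and ψ = r^j ψ' with nonzero leading values. The function Q = r^(2ν)|u|²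
  -- lies between positive constants near 0, so r^(i + 2ν - j) φ' = ψ' Q forces the exponent to be
  -- 0.
  have hφ0 : ∀ᶠ r in 𝓝 (0 : ℝ), φ r = 0 := by
    by_contra hne
    obtain ⟨i, φ', aφ', hφ', eφ⟩ := (aφ 0).exists_eventuallyEq_pow_smul_nonzero_iff.2 hne
    have hne' : ¬ ∀ᶠ r in 𝓝 (0 : ℝ), ψ r = 0 := by
      intro hz
      have h1 : ∀ᶠ r in 𝓝[>] (0 : ℝ), φ' r = 0 := by
        filter_upwards [hz.filter_mono nhdsWithin_le_nhds, eφ.filter_mono nhdsWithin_le_nhds,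
          self_mem_nhdsWithin] with r h1 h2 (h3 : 0 < r)
        have h4 := hrel r h3
        change φ r = ψ r * _ at h4
        rw [h1, zero_mul, h2, sub_zero, smul_eq_mul] at h4
        exact (mul_eq_zero.1 h4).resolve_left (pow_pos h3 i).ne'
      have h2 : Tendsto φ' (𝓝[>] 0) (𝓝 (φ' 0)) := aφ'.continuousAt.tendsto.mono_left
        nhdsWithin_le_nhds
      exact hφ' (tendsto_nhds_unique h2 (tendsto_const_nhds.congr' (by
        filter_upwards [h1] with r hr using hr.symm)))
    obtain ⟨j, ψ', aψ', hψ', eψ⟩ := (aψ 0).exists_eventuallyEq_pow_smul_nonzero_iff.2 hne'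
    obtain ⟨c, hc, hlow⟩ := nichP_lower (a := a) (by linarith) ha1
    obtain ⟨C, hC, hup⟩ := nich_bounds (a := a) (by linarith) ha1
    have hpi := Real.pi_pos
    set p := 2 * a + 1 with hp
    have hir : irExp a = p := by rw [irExp, max_eq_left (by linarith)]
    set Q : ℝ → ℝ := fun r => r ^ p * bdP₀ a H r with hQ
    have hQl : ∃ c₁, 0 < c₁ ∧ ∀ r, 0 < r → r < H → c₁ ≤ Q r ∧ Q r ≤ 2 * C / c * c₁ := by
      refine ⟨Real.pi / (4 * H) * (c * H ^ p), by positivity, fun r hr hrH => ?_⟩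
      have hx : 0 < r / H := by positivity
      have e : r ^ p = H ^ p * (r / H) ^ p := by
        rw [← Real.mul_rpow hH.le hx.le]; congr 1; field_simp
      have e2 : (r / H) ^ p * (r / H) ^ (-p) = 1 := by
        rw [← Real.rpow_add hx, add_neg_cancel, Real.rpow_zero]
      have h1 := hlow _ hx
      have h2 := (le_abs_self _).trans (hup _ hx).1
      rw [hir] at h2
      have h3 : (r / H) ^ (-1 : ℝ) ≤ (r / H) ^ (-p) :=
        Real.rpow_le_rpow_of_exponent_ge hx ((div_le_one hH).2 hrH.le) (by linarith)
      have h4 : nichP a (r / H) ≤ 2 * C * (r / H) ^ (-p) := by nlinarith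
      have e3 : Q r = Real.pi / (4 * H) * H ^ p * ((r / H) ^ p * nichP a (r / H)) := by
        simp only [hQ, bdP₀]; rw [e]; ring
      have hq : 0 < (r / H) ^ p := by positivity
      rw [e3]
      constructor
      · calc Real.pi / (4 * H) * (c * H ^ p)
            = Real.pi / (4 * H) * H ^ p * ((r / H) ^ p * (c * (r / H) ^ (-p))) := by
              rw [mul_left_comm ((r / H) ^ p) c, e2]; ring
          _ ≤ _ := by gcongr
      · calc Real.pi / (4 * H) * H ^ p * ((r / H) ^ p * nichP a (r / H))
            ≤ Real.pi / (4 * H) * H ^ p * ((r / H) ^ p * (2 * C * (r / H) ^ (-p))) := by gcongr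
          _ = _ := by rw [mul_left_comm ((r / H) ^ p) (2 * C), e2]; field_simp
    obtain ⟨c₁, hc₁, hQb⟩ := hQl
    have hφt : Tendsto φ' (𝓝[>] 0) (𝓝 (φ' 0)) :=
      aφ'.continuousAt.tendsto.mono_left nhdsWithin_le_nhds
    have hψt : Tendsto ψ' (𝓝[>] 0) (𝓝 (ψ' 0)) :=
      aψ'.continuousAt.tendsto.mono_left nhdsWithin_le_nhds
    have hev : ∀ᶠ r in 𝓝[>] (0 : ℝ), r ^ ((i : ℝ) + p - j) * φ' r = ψ' r * Q r := by
      filter_upwards [eφ.filter_mono nhdsWithin_le_nhds, eψ.filter_mono nhdsWithin_le_nhds,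
          self_mem_nhdsWithin] with r h1 h2 (h3 : 0 < r)
      have h4 := hrel r h3
      change φ r = ψ r * _ at h4
      rw [h1, h2, sub_zero, smul_eq_mul, smul_eq_mul] at h4
      rw [Real.rpow_sub h3, Real.rpow_add h3, Real.rpow_natCast, Real.rpow_natCast]
      have h5 : r ^ j ≠ 0 := (pow_pos h3 j).ne'
      field_simp
      simp only [hQ]
      linear_combination r ^ p * h4
    have hQev : ∀ᶠ r in 𝓝[>] (0 : ℝ), c₁ ≤ Q r ∧ Q r ≤ 2 * C / c * c₁ := by
      filter_upwards [Ioo_mem_nhdsGT hH] with r hr using hQb r hr.1 hr.2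
    have hzero : Tendsto (fun r : ℝ => r) (𝓝[>] 0) (𝓝[>] 0) := tendsto_id
    -- Here p = 2a + 1 lies strictly between 2 and 3, so it is not an integer difference.
    have hs : (i : ℝ) + p - j ≠ 0 := by
      intro h0
      have h1 : (2 : ℝ) < (j : ℝ) - i := by linarith
      have h2 : (j : ℝ) - i < 3 := by linarith
      have h3 : (2 : ℤ) < (j : ℤ) - i := by exact_mod_cast h1
      have h4 : (j : ℤ) - i < 3 := by exact_mod_cast h2
      omega
    -- A negative exponent makes φ' tend to 0, a positive one makes ψ' tend to 0; either contradicts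
    -- a nonzero leading value.
    rcases lt_or_gt_of_ne hs with hneg | hpos
    · have hinv : ∀ᶠ r in 𝓝[>] (0 : ℝ), φ' r = r ^ (-((i : ℝ) + p - j)) * (ψ' r * Q r) := by
        filter_upwards [hev, self_mem_nhdsWithin] with r h1 (h3 : 0 < r)
        rw [← h1, ← mul_assoc, ← Real.rpow_add h3, neg_add_cancel, Real.rpow_zero, one_mul]
      have hb : IsBoundedUnder (· ≤ ·) (𝓝[>] (0 : ℝ)) (fun r => ‖ψ' r * Q r‖) := by
        refine isBoundedUnder_of_eventually_le (a := (‖ψ' 0‖ + 1) * (2 * C / c * c₁)) ?_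
        filter_upwards [hQev, hψt.norm.eventually (gt_mem_nhds (lt_add_one _))] with r h1 h2
        rw [norm_mul, Real.norm_of_nonneg (hc₁.le.trans h1.1)]
        exact mul_le_mul h2.le h1.2 (hc₁.le.trans h1.1) (by positivity)
      have h0 : Tendsto (fun r : ℝ => r ^ (-((i : ℝ) + p - j))) (𝓝[>] 0) (𝓝 0) := by
        have h := (Real.continuousAt_rpow_const 0 (-((i : ℝ) + p - j))
          (Or.inr (by linarith))).tendsto
        rw [Real.zero_rpow (by linarith)] at h
        exact h.mono_left nhdsWithin_le_nhds
      have h5 := h0.zero_mul_isBoundedUnder_le hb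
      exact hφ' (tendsto_nhds_unique hφt (h5.congr' (by
        filter_upwards [hinv] with r hr using hr.symm)))
    · have h0 : Tendsto (fun r : ℝ => r ^ ((i : ℝ) + p - j)) (𝓝[>] 0) (𝓝 0) := by
        have h := (Real.continuousAt_rpow_const 0 ((i : ℝ) + p - j)
          (Or.inr hpos.le)).tendsto
        rw [Real.zero_rpow hpos.ne'] at h
        exact h.mono_left nhdsWithin_le_nhds
      have h1 := h0.mul hφt
      rw [zero_mul] at h1
      have h2 : Tendsto (fun r => ψ' r * Q r) (𝓝[>] 0) (𝓝 0) := h1.congr' hev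
      have h3 : Tendsto ψ' (𝓝[>] 0) (𝓝 0) := by
        refine squeeze_zero_norm' (a := fun r => ‖ψ' r * Q r‖ / c₁) ?_ (by
          simpa using h2.norm.div_const c₁)
        filter_upwards [hQev] with r hr
        rw [le_div_iff₀ hc₁, norm_mul, Real.norm_of_nonneg (hc₁.le.trans hr.1)]
        gcongr
        exact hr.1
      exact hψ' (tendsto_nhds_unique hψt h3)
  have hG0 : ∀ r : ℝ, G (r • n) = 0 := by
    intro r
    have := AnalyticOnNhd.eqOn_zero_of_preconnected_of_eventuallyEq_zero (𝕜 := ℝ) (f := φ)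
      (U := univ) (fun r _ => aφ r) isPreconnected_univ (mem_univ 0) hφ0
    exact Complex.normSq_eq_zero.1 (this (mem_univ r))
  have hF0 : ∀ r : ℝ, F (r • n) = 0 := eq_zero_of_analytic_of_pos (aF n) fun r hr => by
    have h := hray r hr
    rw [hG0, zero_mul, add_zero] at h
    refine (mul_eq_zero.1 h).resolve_right fun hu => ?_
    have h3 := (star_bdU_mul_bdV (by linarith) ha1 hH hr).2
    rw [hu] at h3
    norm_num at h3
  have e1 := hF0 ‖k‖
  have e2 := hG0 ‖k‖
  rw [← hk] at e1 e2
  exact ⟨sub_eq_zero.1 e1, sub_eq_zero.1 e2⟩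

/-! ### The strict uncertainty relation in the two vacua -/

theorem one_lt_det_covMink (A : Mode) : 1 < (covBlock covMink A A).det := by
  rw [covMink_eq_specCov, ← mink_vacCov_eq_specCov]
  exact mink_radialModes.one_lt_det le_rfl (by norm_num) A (mink_nondegenerate A)

theorem one_lt_det_covBD {a H m : ℝ} (ha : 1 / 2 < a) (ha1 : a < 1) (hH : 0 < H)
    (hm : bdOrder H m = a + 1 / 2) (A : Mode) : 1 < (covBlock (covBD H m) A A).det := by
  obtain ⟨K, hK⟩ := bd_radialModes (a := a) (by linarith) ha1 hH
  rw [covBD_eq_vacCov (by linarith) ha1 hH hm]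
  exact hK.one_lt_det (one_le_irExp a) (irExp_lt_three ha1) A (bd_nondegenerate ha ha1 hH A)

/-! ### Position space kernels of Gaussian mixtures -/

theorem integral_gaussian_mul_exp {s : ℝ} (hs : 0 < s) (z : Space) :
    ∫ k : Space, ((Real.exp (-s * ‖k‖ ^ 2) : ℝ) : ℂ)
        * Complex.exp (Complex.I * ((inner ℝ k z : ℝ) : ℂ))
      = (((Real.pi / s) ^ (3 / 2 : ℝ) * Real.exp (-‖z‖ ^ 2 / (4 * s)) : ℝ) : ℂ) := by
  have h := GaussianFourier.integral_cexp_neg_mul_sq_norm_add (b := (s : ℂ)) (by simpa using hs)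
    Complex.I z
  have hd : Module.finrank ℝ Space = 3 := by simp
  rw [hd] at h
  have hp := Real.pi_pos
  rw [Complex.ofReal_mul, Complex.ofReal_cpow (by positivity)]
  convert h using 2
  · funext k
    rw [Complex.ofReal_exp, ← Complex.exp_add, real_inner_comm]
    push_cast
    rfl
  · push_cast; rfl
  · rw [Complex.ofReal_exp, Complex.I_sq]
    push_cast
    ring_nf

theorem sq_mul_exp_neg_le {c r : ℝ} (hc : 0 < c) :
    r ^ 2 * Real.exp (-c * r ^ 2) ≤ 2 / c * Real.exp (-(c / 2) * r ^ 2) := by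
  have h1 : c / 2 * r ^ 2 ≤ Real.exp (c / 2 * r ^ 2) := by
    linarith [Real.add_one_le_exp (c / 2 * r ^ 2)]
  have h2 : Real.exp (-(c / 2) * r ^ 2) = Real.exp (c / 2 * r ^ 2) * Real.exp (-c * r ^ 2) := by
    rw [← Real.exp_add]; ring_nf
  rw [h2, ← mul_assoc]
  gcongr
  calc r ^ 2 = 2 / c * (c / 2 * r ^ 2) := by field_simp
    _ ≤ _ := by gcongr

theorem integrable_gaussian {s : ℝ} (hs : 0 < s) :
    Integrable (fun k : Space => Real.exp (-s * ‖k‖ ^ 2)) := by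
  have h := (GaussianFourier.integrable_cexp_neg_mul_sq_norm_add (b := (s : ℂ))
    (by simpa using hs) 0 (0 : Space)).re
  refine h.congr (ae_of_all _ fun k => ?_)
  simp only [zero_mul, add_zero, RCLike.re_to_complex]
  rw [← Complex.ofReal_pow, ← Complex.ofReal_neg, ← Complex.ofReal_mul, ← Complex.ofReal_exp,
    Complex.ofReal_re]

theorem integrable_sq_mul_gaussian {s : ℝ} (hs : 0 < s) :
    Integrable (fun k : Space => ‖k‖ ^ 2 * Real.exp (-s * ‖k‖ ^ 2)) := by
  refine Integrable.mono' ((integrable_gaussian (s := s / 2) (by positivity)).const_mul (2 / s))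
    (Continuous.aestronglyMeasurable (by fun_prop)) (ae_of_all _ fun k => ?_)
  rw [Real.norm_of_nonneg (by positivity)]
  exact sq_mul_exp_neg_le hs

/-- Minus the derivative in s of both sides of `integral_gaussian_mul_exp`. It handles the term x² ·
`mix` in the spectral function of the momentum. -/
theorem integral_sq_mul_gaussian_mul_exp {s : ℝ} (hs : 0 < s) (z : Space) :
    ∫ k : Space, ((‖k‖ ^ 2 * Real.exp (-s * ‖k‖ ^ 2) : ℝ) : ℂ)
        * Complex.exp (Complex.I * ((inner ℝ k z : ℝ) : ℂ))
      = (((Real.pi / s) ^ (3 / 2 : ℝ) * (3 / (2 * s) - ‖z‖ ^ 2 / (4 * s ^ 2))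
          * Real.exp (-‖z‖ ^ 2 / (4 * s)) : ℝ) : ℂ) := by
  have key := hasDerivAt_integral_of_dominated_loc_of_deriv_le (μ := (volume : Measure Space))
    (F := fun t k => ((Real.exp (-t * ‖k‖ ^ 2) : ℝ) : ℂ)
        * Complex.exp (Complex.I * ((inner ℝ k z : ℝ) : ℂ))) (x₀ := s) (s := Metric.ball s (s / 2))
    (F' := fun t k => -(((‖k‖ ^ 2 * Real.exp (-t * ‖k‖ ^ 2) : ℝ) : ℂ)
        * Complex.exp (Complex.I * ((inner ℝ k z : ℝ) : ℂ))))
    (bound := fun k => ‖k‖ ^ 2 * Real.exp (-(s / 2) * ‖k‖ ^ 2))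
    (Metric.ball_mem_nhds s (by positivity))
    (Eventually.of_forall fun t => Continuous.aestronglyMeasurable (by fun_prop)) ?_
    (Continuous.aestronglyMeasurable (by fun_prop)) ?_ (integrable_sq_mul_gaussian (by positivity))
    ?_
  · have hr : HasDerivAt (fun t : ℝ => (((Real.pi / t) ^ (3 / 2 : ℝ)
        * Real.exp (-‖z‖ ^ 2 / (4 * t)) : ℝ) : ℂ))
        (-(((Real.pi / s) ^ (3 / 2 : ℝ) * (3 / (2 * s) - ‖z‖ ^ 2 / (4 * s ^ 2))
          * Real.exp (-‖z‖ ^ 2 / (4 * s)) : ℝ) : ℂ)) s := by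
      have hp := Real.pi_pos
      have hq : 0 < Real.pi / s := by positivity
      have h1 : HasDerivAt (fun t : ℝ => Real.pi / t) (-(Real.pi / s ^ 2)) s := by
        have := (hasDerivAt_inv hs.ne').const_mul Real.pi
        simp only [div_eq_mul_inv]
        exact this.congr_deriv (by ring)
      have h2 := h1.rpow_const (p := 3 / 2) (Or.inl hq.ne')
      have h3 : HasDerivAt (fun t : ℝ => -‖z‖ ^ 2 / (4 * t)) (‖z‖ ^ 2 / (4 * s ^ 2)) s := by
        have := (hasDerivAt_inv hs.ne').const_mul (-‖z‖ ^ 2 / 4)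
        refine (this.congr_of_eventuallyEq (Eventually.of_forall fun t => ?_)).congr_deriv ?_
        · simp only [div_eq_mul_inv, mul_inv]; ring
        · field_simp
      have h4 := (h2.mul h3.exp).ofReal_comp
      refine h4.congr_deriv ?_
      rw [← Complex.ofReal_neg]
      congr 1
      have e : (Real.pi / s) ^ (3 / 2 : ℝ) = (Real.pi / s) ^ (3 / 2 - 1 : ℝ) * (Real.pi / s) := by
        rw [← Real.rpow_add_one hq.ne']; norm_num
      rw [e]
      field_simp
      ring
    have h5 := hr.congr_of_eventuallyEq (f₁ := fun t => ∫ k : Space,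
        ((Real.exp (-t * ‖k‖ ^ 2) : ℝ) : ℂ) * Complex.exp (Complex.I * ((inner ℝ k z : ℝ) : ℂ))) (by
      filter_upwards [Ioi_mem_nhds hs] with t ht using integral_gaussian_mul_exp ht z)
    have h6 := key.2.unique h5
    rw [integral_neg] at h6
    exact neg_injective h6
  · refine Integrable.mono' (integrable_gaussian hs) (Continuous.aestronglyMeasurable (by fun_prop))
      (ae_of_all _ fun k => ?_)
    rw [norm_mul, norm_exp_I_mul, mul_one, Complex.norm_real, Real.norm_eq_abs, Real.abs_exp]
  · refine ae_of_all _ fun k t ht => ?_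
    rw [norm_neg, norm_mul, norm_exp_I_mul, mul_one, Complex.norm_real,
      Real.norm_of_nonneg (by positivity)]
    rw [Metric.mem_ball, Real.dist_eq, abs_lt] at ht
    gcongr
    linarith [ht.1]
  · refine ae_of_all _ fun k t _ => ?_
    have h1 : HasDerivAt (fun t : ℝ => -t * ‖k‖ ^ 2) (-‖k‖ ^ 2) t := by
      simpa using ((hasDerivAt_id t).neg.mul_const (‖k‖ ^ 2))
    refine (h1.exp.ofReal_comp.mul_const _).congr_deriv ?_
    push_cast
    ring

theorem integral_mul_fourierT_conj {w : Space → ℝ} (hw : Integrable w) {h h' : Space → ℝ}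
    (hh : Integrable h) (hh' : Integrable h') {v : Space → ℝ}
    (hv : ∀ z, ∫ k : Space, (w k : ℂ) * Complex.exp (Complex.I * ((inner ℝ k z : ℝ) : ℂ)) = v z) :
    ∫ k, w k * (fourierT h k * (starRingEnd ℂ) (fourierT h' k)).re
      = ∫ p : Space × Space, h p.1 * h' p.2 * v (p.1 - p.2) := by
  set F : Space → Space × Space → ℂ := fun k p => (w k : ℂ) * ((h p.1 * h' p.2 : ℝ) : ℂ)
    * Complex.exp (Complex.I * ((inner ℝ k (p.1 - p.2) : ℝ) : ℂ)) with hF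
  have h1 : ∀ k, (w k : ℂ) * (fourierT h k * (starRingEnd ℂ) (fourierT h' k)) = ∫ p, F k p := by
    intro k
    rw [conj_fourierT, fourierT, fourierT, ← integral_prod_mul, ← integral_const_mul]
    congr 1
    funext p
    simp only [hF, inner_sub_right, inner_neg_left]
    push_cast
    rw [mul_sub, sub_eq_add_neg, Complex.exp_add, ← mul_neg]
    ring
  have hint : Integrable (Function.uncurry F) ((volume : Measure Space).prod volume) := by
    have h2 := (hw.mul_prod (hh.mul_prod hh')).ofReal (𝕜 := ℂ)
    refine (h2.mul_bdd (c := 1) (g := fun q : Space × Space × Space =>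
      Complex.exp (Complex.I * ((inner ℝ q.1 (q.2.1 - q.2.2) : ℝ) : ℂ)))
      (Continuous.aestronglyMeasurable (by fun_prop)) (ae_of_all _ fun q => ?_)).congr
      (ae_of_all _ fun q => ?_)
    · rw [norm_exp_I_mul]
    · simp only [hF, Function.uncurry]
      push_cast
      rfl
  have h2 := integral_integral_swap hint
  have h3 : ∀ p, ∫ k, F k p = ((h p.1 * h' p.2 * v (p.1 - p.2) : ℝ) : ℂ) := by
    intro p
    rw [Complex.ofReal_mul, ← hv, ← integral_const_mul]
    congr 1
    funext k
    simp only [hF]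
    ring
  simp only [h3, ← h1] at h2
  have h4 : Integrable fun k => (w k : ℂ) * (fourierT h k * (starRingEnd ℂ) (fourierT h' k)) := by
    simp only [h1]
    exact hint.integral_prod_left
  rw [integral_complex_ofReal] at h2
  have h5 := integral_re_complex h4
  rw [h2, Complex.ofReal_re] at h5
  rw [← h5]
  simp only [Complex.re_ofReal_mul]

/-- Two applications of Fubini's theorem. In momentum space `D` gives absolute convergence. In
position space the superposition of kernels is controlled only at distances at least r₀, which is
why the supports must be separated. -/
theorem mixture_kernel {ρ : ℝ → ℝ} {W : ℝ → Space → ℝ} {V : ℝ → ℝ → ℝ} {h h' : Space → ℝ}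
    {b : ℝ → ℝ} {D : Space → ℝ} {r₀ : ℝ} (hρ : ContinuousOn ρ (Ioi 0))
    (hW : Continuous fun q : Space × ℝ => W q.2 q.1) (hW0 : ∀ s k, 0 ≤ W s k)
    (hV : Measurable fun q : ℝ × ℝ => V q.1 q.2) (hWi : ∀ s, 0 < s → Integrable (W s))
    (hWV : ∀ s, 0 < s → ∀ z : Space, ∫ k : Space, (W s k : ℂ)
      * Complex.exp (Complex.I * ((inner ℝ k z : ℝ) : ℂ)) = V s ‖z‖)
    (hh : Integrable h) (hh' : Integrable h')
    (hP : ∀ k, k ≠ 0 → IntegrableOn (fun s => ρ s * W s k) (Ioi 0))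
    (hD : Integrable D) (hle : ∀ k, k ≠ 0 →
      (∫ s in Ioi 0, |ρ s| * W s k) * (‖fourierT h k‖ * ‖fourierT h' k‖) ≤ D k)
    (hb : ∀ s, 0 < s → ∀ r, r₀ ≤ r → |ρ s * V s r| ≤ b s) (hbi : IntegrableOn b (Ioi 0))
    (hsep : ∀ x y, h x ≠ 0 → h' y ≠ 0 → r₀ ≤ ‖x - y‖) :
    Integrable (fun k => (∫ s in Ioi 0, ρ s * W s k)
      * (fourierT h k * (starRingEnd ℂ) (fourierT h' k)).re) ∧
    Integrable (fun p : Space × Space => h p.1 * h' p.2 * ∫ s in Ioi 0, ρ s * V s ‖p.1 - p.2‖) ∧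
    ∫ k, (∫ s in Ioi 0, ρ s * W s k) * (fourierT h k * (starRingEnd ℂ) (fourierT h' k)).re
      = ∫ p : Space × Space, h p.1 * h' p.2 * ∫ s in Ioi 0, ρ s * V s ‖p.1 - p.2‖ := by
  set Φ : Space → ℝ := fun k => (fourierT h k * (starRingEnd ℂ) (fourierT h' k)).re with hΦ
  have hΦc : Continuous Φ := Complex.continuous_re.comp ((continuous_fourierT hh).mul
    (Complex.continuous_conj.comp (continuous_fourierT hh')))
  have hΦb : ∀ k, |Φ k| ≤ ‖fourierT h k‖ * ‖fourierT h' k‖ := fun k => by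
    refine (Complex.abs_re_le_norm _).trans (le_of_eq ?_)
    rw [norm_mul, RCLike.norm_conj]
  have hρm : AEStronglyMeasurable ρ (volume.restrict (Ioi 0)) :=
    hρ.aestronglyMeasurable measurableSet_Ioi
  have m1 : AEStronglyMeasurable (fun q : Space × ℝ => ρ q.2 * W q.2 q.1)
      ((volume : Measure Space).prod (volume.restrict (Ioi 0))) :=
    (hρm.comp_snd).mul hW.aestronglyMeasurable
  have i1 : Integrable (fun q : Space × ℝ => ρ q.2 * W q.2 q.1 * Φ q.1)
      ((volume : Measure Space).prod (volume.restrict (Ioi 0))) := by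
    have m2 : AEStronglyMeasurable (fun q : Space × ℝ => ρ q.2 * W q.2 q.1 * Φ q.1)
      ((volume : Measure Space).prod (volume.restrict (Ioi 0))) :=
      m1.mul (hΦc.comp continuous_fst).aestronglyMeasurable
    refine (integrable_prod_iff m2).2 ⟨?_, ?_⟩
    · filter_upwards [ae_ne_zero] with k hk using (hP k hk).mul_const _
    · refine hD.mono' m2.norm.integral_prod_right' ?_
      filter_upwards [ae_ne_zero] with k hk
      refine le_trans ?_ (hle k hk)
      have e : ∀ s, ‖ρ s * W s k * Φ k‖ = |ρ s| * W s k * |Φ k| := fun s => by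
        rw [norm_mul, norm_mul, Real.norm_eq_abs, Real.norm_eq_abs, Real.norm_eq_abs,
          abs_of_nonneg (hW0 s k)]
      simp only [e]
      rw [integral_mul_const, norm_mul, Real.norm_eq_abs, Real.norm_eq_abs, abs_abs, abs_of_nonneg]
      · gcongr
        · exact integral_nonneg fun s => mul_nonneg (abs_nonneg _) (hW0 s k)
        · exact hΦb k
      · exact integral_nonneg fun s => mul_nonneg (abs_nonneg _) (hW0 s k)
  have i2 : Integrable (fun q : ℝ × Space × Space => ρ q.1 * V q.1 ‖q.2.1 - q.2.2‖
      * (h q.2.1 * h' q.2.2)) ((volume.restrict (Ioi 0)).prod volume) := by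
    refine Integrable.mono' (hbi.mul_prod (hh.abs.mul_prod hh'.abs)) ?_ ?_
    · refine ((hρm.comp_fst).mul ?_).mul (hh.mul_prod hh').aestronglyMeasurable.comp_snd
      exact (hV.comp (measurable_fst.prodMk (by fun_prop :
        Measurable fun q : ℝ × Space × Space => ‖q.2.1 - q.2.2‖))).aestronglyMeasurable
    · filter_upwards [Measure.quasiMeasurePreserving_fst.ae (ae_restrict_mem measurableSet_Ioi)]
        with q hq
      have hq : (0 : ℝ) < q.1 := hq
      rw [norm_mul, norm_mul (h q.2.1), Real.norm_eq_abs, Real.norm_eq_abs, Real.norm_eq_abs]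
      by_cases h1 : h q.2.1 = 0
      · simp [h1]
      by_cases h2 : h' q.2.2 = 0
      · simp [h2]
      gcongr
      exact hb _ hq _ (hsep _ _ h1 h2)
  have e1 : ∀ k, ∫ s in Ioi 0, ρ s * W s k * Φ k = (∫ s in Ioi 0, ρ s * W s k) * Φ k :=
    fun k => integral_mul_const _ _
  have e2 : ∀ p : Space × Space, ∫ s in Ioi 0, ρ s * V s ‖p.1 - p.2‖ * (h p.1 * h' p.2)
      = h p.1 * h' p.2 * ∫ s in Ioi 0, ρ s * V s ‖p.1 - p.2‖ := fun p => by
    rw [integral_mul_const, mul_comm]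
  refine ⟨?_, ?_, ?_⟩
  · simpa only [e1] using i1.integral_prod_left
  · simpa only [e2] using i2.integral_prod_right
  · have s1 := integral_integral_swap (f := fun (k : Space) (s : ℝ) => ρ s * W s k * Φ k) i1
    have s2 := integral_integral_swap (f := fun (s : ℝ) (p : Space × Space) =>
      ρ s * V s ‖p.1 - p.2‖ * (h p.1 * h' p.2)) i2
    simp only [e1] at s1
    simp only [e2] at s2
    rw [s1, ← s2]
    refine setIntegral_congr_fun measurableSet_Ioi (fun s hs => ?_)
    have h3 := integral_mul_fourierT_conj (hWi s hs) hh hh' (v := fun z => V s ‖z‖) (hWV s hs)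
    simp only [mul_assoc (ρ s)]
    rw [integral_const_mul, integral_const_mul, h3]
    congr 1
    refine integral_congr_ae (ae_of_all _ fun p => ?_)
    exact mul_comm _ _

/-! ### Position space representation of the covariance metric -/

theorem integral_inv_sq_mul_comp_div (g : ℝ → ℝ) {c : ℝ} (hc : 0 < c) :
    ∫ s in Ioi (0 : ℝ), (s ^ 2)⁻¹ * g (c / s) = c⁻¹ * ∫ τ in Ioi (0 : ℝ), g τ := by
  have h1 := integral_comp_rpow_Ioi (fun y => g (c * y)) (p := -1) (by norm_num)
  have h2 := integral_comp_mul_left_Ioi g 0 hc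
  rw [mul_zero, smul_eq_mul] at h2
  rw [← h2, ← h1]
  refine setIntegral_congr_fun measurableSet_Ioi (fun s hs => ?_)
  have hs : (0 : ℝ) < s := hs
  have e : s ^ (-1 - 1 : ℝ) = (s ^ 2)⁻¹ := by
    rw [show (-1 - 1 : ℝ) = -(2 : ℕ) by norm_num, Real.rpow_neg hs.le, Real.rpow_natCast]
  simp only [e, smul_eq_mul, Real.rpow_neg_one, abs_neg, abs_one, one_mul, div_eq_mul_inv]

theorem integrableOn_inv_sq_mul_comp_div {g : ℝ → ℝ} {c : ℝ} (hc : 0 < c)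
    (hg : IntegrableOn g (Ioi 0)) : IntegrableOn (fun s => (s ^ 2)⁻¹ * g (c / s)) (Ioi 0) := by
  have h2 := (integrableOn_Ioi_comp_mul_left_iff g 0 hc).2 (by rwa [mul_zero])
  have h1 := (integrableOn_Ioi_comp_rpow_iff' (fun y => g (c * y)) (p := -1) (by norm_num)).2 h2
  refine h1.congr_fun (fun s hs => ?_) measurableSet_Ioi
  have hs : (0 : ℝ) < s := hs
  have e : s ^ (-1 - 1 : ℝ) = (s ^ 2)⁻¹ := by
    rw [show (-1 - 1 : ℝ) = -(2 : ℕ) by norm_num, Real.rpow_neg hs.le, Real.rpow_natCast]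
  simp only [e, smul_eq_mul, Real.rpow_neg_one, div_eq_mul_inv]

/-- Continuous functions on `(0, ∞)` bounded by `K (1 + w^b)`. -/
structure MixBound (K b : ℝ) (f : ℝ → ℝ) : Prop where
  cont : ContinuousOn f (Ioi 0)
  bdd : ∀ w, 0 < w → |f w| ≤ K * (1 + w ^ b)

theorem MixBound.nonneg {K b : ℝ} {f : ℝ → ℝ} (hf : MixBound K b f) : 0 ≤ K := by
  have := hf.bdd 1 one_pos
  rw [Real.one_rpow] at this
  linarith [abs_nonneg (f 1)]

theorem MixBound.polyBdd {K b : ℝ} {f : ℝ → ℝ} (hf : MixBound K b f) (hb0 : 0 ≤ b) (hb1 : b ≤ 1) :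
    PolyBdd f := by
  have hK := hf.nonneg
  refine ⟨hf.cont, K * 2, 1, by positivity, fun w hw => (hf.bdd w hw).trans ?_⟩
  have := rpow_le_add_rpow hw hb0 hb1
  rw [Real.rpow_one, Real.rpow_zero] at this
  rw [mul_assoc]
  gcongr
  rw [pow_one]
  linarith

theorem MixBound.abs {K b : ℝ} {f : ℝ → ℝ} (hf : MixBound K b f) :
    MixBound K b (fun w => |f w|) :=
  ⟨hf.cont.abs, fun w hw => by rw [abs_abs]; exact hf.bdd w hw⟩

/-- The position kernels after the substitution s = r²/(4τ): the Gaussian factor becomes the Laplace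
weight e^(-H²τ), and the distance r enters only through the argument of f. `lapTwo` carries the
extra factor coming from |k|² times a Gaussian. -/
def lap (f : ℝ → ℝ) (H r : ℝ) : ℝ :=
  ∫ τ in Ioi (0 : ℝ), f (r ^ 2 / (4 * τ)) * Real.exp (-H ^ 2 * τ)

def lapTwo (f : ℝ → ℝ) (H r : ℝ) : ℝ :=
  ∫ τ in Ioi (0 : ℝ), f (r ^ 2 / (4 * τ)) * ((3 / 2 * τ - H ^ 2 * τ ^ 2) * Real.exp (-H ^ 2 * τ))

/-- The normalization of the position space kernels. -/
def kerC (H r : ℝ) : ℝ := Real.pi ^ (3 / 2 : ℝ) * H ^ 3 * (4 / r ^ 2)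

theorem rpow_neg_half_mul {s H : ℝ} (hs : 0 < s) (hH : 0 < H) :
    s ^ (-(1 / 2) : ℝ) * (Real.pi / (s / H ^ 2)) ^ (3 / 2 : ℝ)
      = Real.pi ^ (3 / 2 : ℝ) * H ^ 3 * (s ^ 2)⁻¹ := by
  have hp := Real.pi_pos
  rw [div_div_eq_mul_div, Real.div_rpow (by positivity) hs.le, Real.mul_rpow hp.le (by positivity),
    ← Real.rpow_natCast H 2, ← Real.rpow_mul hH.le, ← Real.rpow_natCast H 3,
    ← Real.rpow_natCast s 2, Real.rpow_neg hs.le]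
  have e : s ^ ((2 : ℕ) : ℝ) = s ^ (1 / 2 : ℝ) * s ^ (3 / 2 : ℝ) := by
    rw [← Real.rpow_add hs]; norm_num
  rw [e, show ((2 : ℕ) : ℝ) * (3 / 2) = ((3 : ℕ) : ℝ) by norm_num]
  field_simp

theorem integral_mul_kernel (f : ℝ → ℝ) {H r : ℝ} (hH : 0 < H) (hr : 0 < r) :
    ∫ s in Ioi (0 : ℝ), f s * s ^ (-(1 / 2) : ℝ) * ((Real.pi / (s / H ^ 2)) ^ (3 / 2 : ℝ)
      * Real.exp (-r ^ 2 / (4 * (s / H ^ 2)))) = kerC H r * lap f H r := by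
  have h := integral_inv_sq_mul_comp_div (c := r ^ 2 / 4)
    (fun τ => f (r ^ 2 / (4 * τ)) * Real.exp (-H ^ 2 * τ)) (by positivity)
  rw [kerC, mul_assoc, lap, show (4 / r ^ 2) = (r ^ 2 / 4)⁻¹ by rw [inv_div], ← h,
    ← integral_const_mul]
  refine setIntegral_congr_fun measurableSet_Ioi (fun s hs => ?_)
  have hs : (0 : ℝ) < s := hs
  have e1 : r ^ 2 / (4 * (r ^ 2 / 4 / s)) = s := by field_simp
  have e2 : -r ^ 2 / (4 * (s / H ^ 2)) = -H ^ 2 * (r ^ 2 / 4 / s) := by field_simp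
  simp only [e1, e2]
  linear_combination f s * Real.exp (-H ^ 2 * (r ^ 2 / 4 / s)) * rpow_neg_half_mul hs hH

theorem integral_mul_kernelTwo (f : ℝ → ℝ) {H r : ℝ} (hH : 0 < H) (hr : 0 < r) :
    ∫ s in Ioi (0 : ℝ), f s * s ^ (-(1 / 2) : ℝ) * (1 / H ^ 2 * ((Real.pi / (s / H ^ 2)) ^ (3 / 2 : ℝ)
      * (3 / (2 * (s / H ^ 2)) - r ^ 2 / (4 * (s / H ^ 2) ^ 2))
      * Real.exp (-r ^ 2 / (4 * (s / H ^ 2))))) = kerC H r * (4 / r ^ 2 * lapTwo f H r) := by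
  have h := integral_inv_sq_mul_comp_div (c := r ^ 2 / 4)
    (fun τ => f (r ^ 2 / (4 * τ)) * ((3 / 2 * τ - H ^ 2 * τ ^ 2) * Real.exp (-H ^ 2 * τ)))
    (by positivity)
  rw [kerC, mul_assoc, mul_left_comm (4 / r ^ 2), lapTwo,
    show (4 / r ^ 2) = (r ^ 2 / 4)⁻¹ by rw [inv_div], ← h, ← mul_assoc, ← integral_const_mul]
  refine setIntegral_congr_fun measurableSet_Ioi (fun s hs => ?_)
  have hs : (0 : ℝ) < s := hs
  have e1 : r ^ 2 / (4 * (r ^ 2 / 4 / s)) = s := by field_simp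
  have e2 : -r ^ 2 / (4 * (s / H ^ 2)) = -H ^ 2 * (r ^ 2 / 4 / s) := by field_simp
  have e3 : 1 / H ^ 2 * (3 / (2 * (s / H ^ 2)) - r ^ 2 / (4 * (s / H ^ 2) ^ 2))
      = (r ^ 2 / 4)⁻¹ * (3 / 2 * (r ^ 2 / 4 / s) - H ^ 2 * (r ^ 2 / 4 / s) ^ 2) := by
    field_simp
  simp only [e1, e2]
  linear_combination (1 / H ^ 2 * (3 / (2 * (s / H ^ 2)) - r ^ 2 / (4 * (s / H ^ 2) ^ 2)))
    * f s * Real.exp (-H ^ 2 * (r ^ 2 / 4 / s)) * rpow_neg_half_mul hs hH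
    + Real.pi ^ (3 / 2 : ℝ) * H ^ 3 * (s ^ 2)⁻¹ * f s * Real.exp (-H ^ 2 * (r ^ 2 / 4 / s)) * e3

theorem integrableOn_kernel_bound {b c : ℝ} (hb1 : b < 1) (hc : 0 < c) :
    IntegrableOn (fun s : ℝ => (1 + s ^ b) * ((s ^ 2)⁻¹ * Real.exp (-(c / s)))) (Ioi 0) := by
  have h0 : IntegrableOn (fun τ : ℝ => Real.exp (-τ) * τ ^ (0 : ℝ)) (Ioi 0) :=
    integrableOn_exp_mul_rpow (by norm_num)
  have h1 : IntegrableOn (fun τ : ℝ => Real.exp (-τ) * τ ^ (-b)) (Ioi 0) :=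
    integrableOn_exp_mul_rpow (by linarith)
  have h2 := integrableOn_inv_sq_mul_comp_div hc (h0.add (h1.const_mul (c ^ b)))
  refine h2.congr_fun (fun s hs => ?_) measurableSet_Ioi
  have hs : (0 : ℝ) < s := hs
  simp only [Pi.add_apply, Real.rpow_zero]
  rw [Real.div_rpow hc.le hs.le, Real.rpow_neg hc.le, Real.rpow_neg hs.le]
  have := (Real.rpow_pos_of_pos hc b).ne'
  field_simp

theorem integrableOn_kernel_bound_two {b c : ℝ} (hb1 : b < 1) (hc : 0 < c) :
    IntegrableOn (fun s : ℝ => (1 + s ^ b) * ((s ^ 2)⁻¹ * (s⁻¹ * Real.exp (-(c / s))))) (Ioi 0) := by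
  have h0 : IntegrableOn (fun τ : ℝ => Real.exp (-τ) * τ ^ (1 : ℝ)) (Ioi 0) :=
    integrableOn_exp_mul_rpow (by norm_num)
  have h1 : IntegrableOn (fun τ : ℝ => Real.exp (-τ) * τ ^ (1 - b)) (Ioi 0) :=
    integrableOn_exp_mul_rpow (by linarith)
  have h2 := (integrableOn_inv_sq_mul_comp_div hc (h0.add (h1.const_mul (c ^ b)))).const_mul c⁻¹
  refine IntegrableOn.congr_fun h2 (fun s hs => ?_) measurableSet_Ioi
  have hs : (0 : ℝ) < s := hs
  simp only [Pi.add_apply, Real.rpow_one]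
  rw [Real.div_rpow hc.le hs.le, Real.rpow_sub hc, Real.rpow_sub hs, Real.rpow_one, Real.rpow_one]
  have := (Real.rpow_pos_of_pos hc b).ne'
  have := (Real.rpow_pos_of_pos hs b).ne'
  field_simp

theorem mix_abs_le {f : ℝ → ℝ} {K b H : ℝ} (hf : MixBound K b f) (hb0 : 0 ≤ b) (hH : 0 < H) :
    ∃ M, 0 ≤ M ∧ ∀ r, 0 < r → mix (fun w => |f w|) (r / H)
      ≤ M * (r ^ (-1 : ℝ) + r ^ (-(2 * b + 1))) := by
  have hK := hf.nonneg
  have g1 : 0 < Real.Gamma (1 / 2) := Real.Gamma_pos_of_pos (by norm_num)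
  have g2 : 0 < Real.Gamma (b + 1 / 2) := Real.Gamma_pos_of_pos (by linarith)
  refine ⟨K * (Real.Gamma (1 / 2) * H + Real.Gamma (b + 1 / 2) * H ^ (2 * b + 1)), by positivity,
    fun r hr => ?_⟩
  have h := (le_abs_self _).trans (abs_mix_le hb0 hf.abs.bdd (show 0 < r / H by positivity))
  refine h.trans ?_
  have e1 : (r / H)⁻¹ = H * r ^ (-1 : ℝ) := by rw [Real.rpow_neg_one, inv_div]; rfl
  have e2 : (r / H) ^ (-(2 * b + 1)) = H ^ (2 * b + 1) * r ^ (-(2 * b + 1)) := by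
    rw [Real.div_rpow hr.le hH.le, Real.rpow_neg hH.le]; field_simp
  rw [e1, e2, mul_assoc]
  gcongr
  have p1 : 0 ≤ Real.Gamma (1 / 2) * H * r ^ (-(2 * b + 1)) := by positivity
  have p2 : 0 ≤ Real.Gamma (b + 1 / 2) * H ^ (2 * b + 1) * r ^ (-1 : ℝ) := by positivity
  nlinarith

section

theorem mix_kernel {f : ℝ → ℝ} {h h' : Space → ℝ} {K b H r₀ : ℝ} (hf : MixBound K b f)
    (hb0 : 0 ≤ b) (hb1 : b < 1) (hH : 0 < H) (hr : 0 < r₀) (hh : Integrable h) (hh' : Integrable h')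
    (hi : Integrable fun k : Space =>
      (‖k‖ ^ (-1 : ℝ) + ‖k‖ ^ (-(2 * b + 1))) * ‖fourierT h k‖ ^ 2)
    (hi' : Integrable fun k : Space =>
      (‖k‖ ^ (-1 : ℝ) + ‖k‖ ^ (-(2 * b + 1))) * ‖fourierT h' k‖ ^ 2)
    (hsep : ∀ x y, h x ≠ 0 → h' y ≠ 0 → r₀ ≤ ‖x - y‖) :
    Integrable (fun k => mix f (‖k‖ / H) * (fourierT h k * (starRingEnd ℂ) (fourierT h' k)).re) ∧
    Integrable (fun p : Space × Space =>
      h p.1 * h' p.2 * (kerC H ‖p.1 - p.2‖ * lap f H ‖p.1 - p.2‖)) ∧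
    ∫ k, mix f (‖k‖ / H) * (fourierT h k * (starRingEnd ℂ) (fourierT h' k)).re
      = ∫ p : Space × Space, h p.1 * h' p.2 * (kerC H ‖p.1 - p.2‖ * lap f H ‖p.1 - p.2‖) := by
  have hp := Real.pi_pos
  have hK := hf.nonneg
  obtain ⟨M, hM, hMb⟩ := mix_abs_le hf hb0 hH
  have em : ∀ (φ : ℝ → ℝ) (k : Space), ∫ s in Ioi (0 : ℝ), φ s * s ^ (-(1 / 2) : ℝ)
      * Real.exp (-(s / H ^ 2) * ‖k‖ ^ 2) = mix φ (‖k‖ / H) := fun φ k => by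
    refine setIntegral_congr_fun measurableSet_Ioi (fun s hs => ?_)
    have e : -(s / H ^ 2) * ‖k‖ ^ 2 = -(‖k‖ / H) ^ 2 * s := by field_simp
    simp only [e]
    ring
  have key := mixture_kernel (ρ := fun s => f s * s ^ (-(1 / 2) : ℝ))
    (W := fun s k => Real.exp (-(s / H ^ 2) * ‖k‖ ^ 2))
    (V := fun s r => (Real.pi / (s / H ^ 2)) ^ (3 / 2 : ℝ)
      * Real.exp (-r ^ 2 / (4 * (s / H ^ 2))))
    (h := h) (h' := h') (b := fun s => (Real.pi ^ (3 / 2 : ℝ) * H ^ 3 * K) *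
      ((1 + s ^ b) * ((s ^ 2)⁻¹ * Real.exp (-(H ^ 2 * r₀ ^ 2 / 4 / s)))))
    (D := fun k => M * ((‖k‖ ^ (-1 : ℝ) + ‖k‖ ^ (-(2 * b + 1))) * ‖fourierT h k‖ ^ 2
      + (‖k‖ ^ (-1 : ℝ) + ‖k‖ ^ (-(2 * b + 1))) * ‖fourierT h' k‖ ^ 2)) (r₀ := r₀)
    (hf.cont.mul (continuousOn_id.rpow_const fun s hs => Or.inl (ne_of_gt hs)))
    (by fun_prop) (fun s k => (Real.exp_pos _).le) (by fun_prop)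
    (fun s hs => integrable_gaussian (by positivity))
    (fun s hs z => integral_gaussian_mul_exp (by positivity) z) hh hh' ?_
    ((hi.add hi').const_mul M) ?_ ?_
    ((integrableOn_kernel_bound hb1 (by positivity)).const_mul _) hsep
  · simp only [em] at key
    have ek : ∀ p : Space × Space, h p.1 * h' p.2 * (∫ s in Ioi (0 : ℝ), f s * s ^ (-(1 / 2) : ℝ)
        * ((Real.pi / (s / H ^ 2)) ^ (3 / 2 : ℝ)
          * Real.exp (-‖p.1 - p.2‖ ^ 2 / (4 * (s / H ^ 2)))))
        = h p.1 * h' p.2 * (kerC H ‖p.1 - p.2‖ * lap f H ‖p.1 - p.2‖) := by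
      intro p
      by_cases h1 : h p.1 = 0
      · simp [h1]
      by_cases h2 : h' p.2 = 0
      · simp [h2]
      rw [integral_mul_kernel f hH (hr.trans_le (hsep _ _ h1 h2))]
    simpa only [ek] using key
  · intro k hk
    have hx : 0 < ‖k‖ / H := div_pos (norm_pos_iff.2 hk) hH
    refine ((hf.polyBdd hb0 hb1.le).integrableOn hx).congr_fun (fun s hs => ?_) measurableSet_Ioi
    have e : -(s / H ^ 2) * ‖k‖ ^ 2 = -(‖k‖ / H) ^ 2 * s := by field_simp
    simp only [e]
    ring
  · intro k hk
    have h1 := hMb ‖k‖ (norm_pos_iff.2 hk)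
    have e : ∫ s in Ioi (0 : ℝ), |f s * s ^ (-(1 / 2) : ℝ)| * Real.exp (-(s / H ^ 2) * ‖k‖ ^ 2)
        = mix (fun w => |f w|) (‖k‖ / H) := by
      rw [← em]
      refine setIntegral_congr_fun measurableSet_Ioi (fun s hs => ?_)
      have hs : (0 : ℝ) < s := hs
      simp only [abs_mul, abs_of_pos (Real.rpow_pos_of_pos hs _)]
    rw [e]
    have h2 : ‖fourierT h k‖ * ‖fourierT h' k‖ ≤ ‖fourierT h k‖ ^ 2 + ‖fourierT h' k‖ ^ 2 := by
      nlinarith [sq_nonneg (‖fourierT h k‖ - ‖fourierT h' k‖), sq_nonneg ‖fourierT h k‖,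
        sq_nonneg ‖fourierT h' k‖]
    calc _ ≤ M * (‖k‖ ^ (-1 : ℝ) + ‖k‖ ^ (-(2 * b + 1)))
          * (‖fourierT h k‖ ^ 2 + ‖fourierT h' k‖ ^ 2) := by gcongr
      _ = _ := by ring
  · intro s hs r hr'
    have hr0 : 0 < r := hr.trans_le hr'
    rw [← mul_assoc, mul_assoc (f s), rpow_neg_half_mul hs hH, abs_mul, abs_mul, Real.abs_exp,
      abs_of_pos (by positivity : 0 < Real.pi ^ (3 / 2 : ℝ) * H ^ 3 * (s ^ 2)⁻¹)]
    have e2 : -r ^ 2 / (4 * (s / H ^ 2)) = -(H ^ 2 * r ^ 2 / 4 / s) := by field_simp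
    rw [e2]
    calc |f s| * (Real.pi ^ (3 / 2 : ℝ) * H ^ 3 * (s ^ 2)⁻¹) * Real.exp (-(H ^ 2 * r ^ 2 / 4 / s))
        ≤ (K * (1 + s ^ b)) * (Real.pi ^ (3 / 2 : ℝ) * H ^ 3 * (s ^ 2)⁻¹)
          * Real.exp (-(H ^ 2 * r₀ ^ 2 / 4 / s)) := by
          gcongr
          exact hf.bdd s hs
      _ = _ := by ring

theorem abs_mul_exp_neg_le {t : ℝ} (ht : 0 ≤ t) :
    |3 / 2 - t| * Real.exp (-t) ≤ 2 * Real.exp (-(t / 2)) := by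
  have h1 : |3 / 2 - t| ≤ 3 / 2 + t := abs_le.2 ⟨by linarith, by linarith⟩
  have h2 : 3 / 2 + t ≤ 2 * Real.exp (t / 2) := by linarith [Real.add_one_le_exp (t / 2)]
  calc _ ≤ 2 * Real.exp (t / 2) * Real.exp (-t) := by gcongr; exact h1.trans h2
    _ = _ := by rw [mul_assoc, ← Real.exp_add]; ring_nf

set_option maxHeartbeats 800000 in
theorem mix_kernel_two {f : ℝ → ℝ} {h h' : Space → ℝ} {K b H r₀ : ℝ} (hf : MixBound K b f)
    (hb0 : 0 ≤ b) (hb1 : b < 1) (hH : 0 < H) (hr : 0 < r₀) (hh : Integrable h) (hh' : Integrable h')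
    (hi : Integrable fun k : Space =>
      (‖k‖ ^ (1 : ℝ) + ‖k‖ ^ (-(2 * b + 1))) * ‖fourierT h k‖ ^ 2)
    (hi' : Integrable fun k : Space =>
      (‖k‖ ^ (1 : ℝ) + ‖k‖ ^ (-(2 * b + 1))) * ‖fourierT h' k‖ ^ 2)
    (hsep : ∀ x y, h x ≠ 0 → h' y ≠ 0 → r₀ ≤ ‖x - y‖) :
    Integrable (fun k => (‖k‖ / H) ^ 2 * mix f (‖k‖ / H)
      * (fourierT h k * (starRingEnd ℂ) (fourierT h' k)).re) ∧
    Integrable (fun p : Space × Space => h p.1 * h' p.2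
      * (kerC H ‖p.1 - p.2‖ * (4 / ‖p.1 - p.2‖ ^ 2 * lapTwo f H ‖p.1 - p.2‖))) ∧
    ∫ k, (‖k‖ / H) ^ 2 * mix f (‖k‖ / H) * (fourierT h k * (starRingEnd ℂ) (fourierT h' k)).re
      = ∫ p : Space × Space, h p.1 * h' p.2
        * (kerC H ‖p.1 - p.2‖ * (4 / ‖p.1 - p.2‖ ^ 2 * lapTwo f H ‖p.1 - p.2‖)) := by
  have hp := Real.pi_pos
  have hK := hf.nonneg
  obtain ⟨M, hM, hMb⟩ := mix_abs_le hf hb0 hH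
  have em : ∀ (φ : ℝ → ℝ) (k : Space), ∫ s in Ioi (0 : ℝ), φ s * s ^ (-(1 / 2) : ℝ)
      * (1 / H ^ 2 * (‖k‖ ^ 2 * Real.exp (-(s / H ^ 2) * ‖k‖ ^ 2)))
      = (‖k‖ / H) ^ 2 * mix φ (‖k‖ / H) := fun φ k => by
    rw [mix, ← integral_const_mul]
    refine setIntegral_congr_fun measurableSet_Ioi (fun s hs => ?_)
    have e : -(s / H ^ 2) * ‖k‖ ^ 2 = -(‖k‖ / H) ^ 2 * s := by field_simp
    simp only [e]
    ring
  have key := mixture_kernel (ρ := fun s => f s * s ^ (-(1 / 2) : ℝ))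
    (W := fun s k => 1 / H ^ 2 * (‖k‖ ^ 2 * Real.exp (-(s / H ^ 2) * ‖k‖ ^ 2)))
    (V := fun s r => 1 / H ^ 2 * ((Real.pi / (s / H ^ 2)) ^ (3 / 2 : ℝ)
      * (3 / (2 * (s / H ^ 2)) - r ^ 2 / (4 * (s / H ^ 2) ^ 2))
      * Real.exp (-r ^ 2 / (4 * (s / H ^ 2)))))
    (h := h) (h' := h') (b := fun s => (2 * Real.pi ^ (3 / 2 : ℝ) * H ^ 3 * K) *
      ((1 + s ^ b) * ((s ^ 2)⁻¹ * (s⁻¹ * Real.exp (-(H ^ 2 * r₀ ^ 2 / 8 / s))))))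
    (D := fun k => M * (2 / H ^ 2) * ((‖k‖ ^ (1 : ℝ) + ‖k‖ ^ (-(2 * b + 1))) * ‖fourierT h k‖ ^ 2
      + (‖k‖ ^ (1 : ℝ) + ‖k‖ ^ (-(2 * b + 1))) * ‖fourierT h' k‖ ^ 2)) (r₀ := r₀)
    (hf.cont.mul (continuousOn_id.rpow_const fun s hs => Or.inl (ne_of_gt hs)))
    (by fun_prop) (fun s k => by positivity) (by fun_prop)
    (fun s hs => (integrable_sq_mul_gaussian (by positivity)).const_mul _)
    (fun s hs z => ?_) hh hh' ?_
    ((hi.add hi').const_mul (M * (2 / H ^ 2))) ?_ ?_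
    ((integrableOn_kernel_bound_two hb1 (by positivity)).const_mul _) hsep
  · simp only [em] at key
    have ek : ∀ p : Space × Space, h p.1 * h' p.2 * (∫ s in Ioi (0 : ℝ), f s * s ^ (-(1 / 2) : ℝ)
        * (1 / H ^ 2 * ((Real.pi / (s / H ^ 2)) ^ (3 / 2 : ℝ)
          * (3 / (2 * (s / H ^ 2)) - ‖p.1 - p.2‖ ^ 2 / (4 * (s / H ^ 2) ^ 2))
          * Real.exp (-‖p.1 - p.2‖ ^ 2 / (4 * (s / H ^ 2))))))
        = h p.1 * h' p.2
          * (kerC H ‖p.1 - p.2‖ * (4 / ‖p.1 - p.2‖ ^ 2 * lapTwo f H ‖p.1 - p.2‖)) := by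
      intro p
      by_cases h1 : h p.1 = 0
      · simp [h1]
      by_cases h2 : h' p.2 = 0
      · simp [h2]
      rw [integral_mul_kernelTwo f hH (hr.trans_le (hsep _ _ h1 h2))]
    simpa only [ek] using key
  · have h1 := integral_sq_mul_gaussian_mul_exp (s := s / H ^ 2) (by positivity) z
    rw [Complex.ofReal_mul (1 / H ^ 2), ← h1, ← integral_const_mul]
    congr 1
    funext k
    rw [Complex.ofReal_mul (1 / H ^ 2)]
    ring
  · intro k hk
    have hx : 0 < ‖k‖ / H := div_pos (norm_pos_iff.2 hk) hH
    refine IntegrableOn.congr_fun (((hf.polyBdd hb0 hb1.le).integrableOn hx).const_mul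
      ((‖k‖ / H) ^ 2)) (fun s hs => ?_) measurableSet_Ioi
    have e : -(s / H ^ 2) * ‖k‖ ^ 2 = -(‖k‖ / H) ^ 2 * s := by field_simp
    simp only [e]
    ring
  · intro k hk
    have hk' : 0 < ‖k‖ := norm_pos_iff.2 hk
    have h1 := hMb ‖k‖ hk'
    have e : ∫ s in Ioi (0 : ℝ), |f s * s ^ (-(1 / 2) : ℝ)|
        * (1 / H ^ 2 * (‖k‖ ^ 2 * Real.exp (-(s / H ^ 2) * ‖k‖ ^ 2)))
        = (‖k‖ / H) ^ 2 * mix (fun w => |f w|) (‖k‖ / H) := by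
      rw [← em]
      refine setIntegral_congr_fun measurableSet_Ioi (fun s hs => ?_)
      have hs : (0 : ℝ) < s := hs
      simp only [abs_mul, abs_of_pos (Real.rpow_pos_of_pos hs _)]
    rw [e]
    have h2 : ‖fourierT h k‖ * ‖fourierT h' k‖ ≤ ‖fourierT h k‖ ^ 2 + ‖fourierT h' k‖ ^ 2 := by
      nlinarith [sq_nonneg (‖fourierT h k‖ - ‖fourierT h' k‖), sq_nonneg ‖fourierT h k‖,
        sq_nonneg ‖fourierT h' k‖]
    have h3 : ‖k‖ ^ 2 * (‖k‖ ^ (-1 : ℝ) + ‖k‖ ^ (-(2 * b + 1)))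
        ≤ 2 * (‖k‖ ^ (1 : ℝ) + ‖k‖ ^ (-(2 * b + 1))) := by
      have e1 : ‖k‖ ^ 2 * (‖k‖ ^ (-1 : ℝ) + ‖k‖ ^ (-(2 * b + 1)))
          = ‖k‖ ^ (1 : ℝ) + ‖k‖ ^ (2 - (2 * b + 1)) := by
        rw [mul_add, ← Real.rpow_natCast, ← Real.rpow_add hk', ← Real.rpow_add hk']
        norm_num
        ring_nf
      have e2 := rpow_le_add_rpow hk' (p := -(2 * b + 1)) (q := 2 - (2 * b + 1)) (s := 1)
        (by linarith) (by linarith)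
      have e3 : 0 < ‖k‖ ^ (-(2 * b + 1)) := by positivity
      rw [e1]
      generalize ‖k‖ ^ (1 : ℝ) = u at *
      linarith
    calc (‖k‖ / H) ^ 2 * mix (fun w => |f w|) (‖k‖ / H) * (‖fourierT h k‖ * ‖fourierT h' k‖)
        ≤ (‖k‖ / H) ^ 2 * (M * (‖k‖ ^ (-1 : ℝ) + ‖k‖ ^ (-(2 * b + 1))))
          * (‖fourierT h k‖ ^ 2 + ‖fourierT h' k‖ ^ 2) := by gcongr
      _ = M / H ^ 2 * (‖k‖ ^ 2 * (‖k‖ ^ (-1 : ℝ) + ‖k‖ ^ (-(2 * b + 1))))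
          * (‖fourierT h k‖ ^ 2 + ‖fourierT h' k‖ ^ 2) := by ring
      _ ≤ M / H ^ 2 * (2 * (‖k‖ ^ (1 : ℝ) + ‖k‖ ^ (-(2 * b + 1))))
          * (‖fourierT h k‖ ^ 2 + ‖fourierT h' k‖ ^ 2) := by gcongr
      _ = _ := by ring
  · intro s hs r hr'
    have hr0 : 0 < r := hr.trans_le hr'
    have e3 : 1 / H ^ 2 * (3 / (2 * (s / H ^ 2)) - r ^ 2 / (4 * (s / H ^ 2) ^ 2))
        = s⁻¹ * (3 / 2 - H ^ 2 * r ^ 2 / 4 / s) := by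
      field_simp
    have e2 : -r ^ 2 / (4 * (s / H ^ 2)) = -(H ^ 2 * r ^ 2 / 4 / s) := by field_simp
    have e4 : f s * s ^ (-(1 / 2) : ℝ) * (1 / H ^ 2 * ((Real.pi / (s / H ^ 2)) ^ (3 / 2 : ℝ)
        * (3 / (2 * (s / H ^ 2)) - r ^ 2 / (4 * (s / H ^ 2) ^ 2))
        * Real.exp (-r ^ 2 / (4 * (s / H ^ 2)))))
        = f s * (Real.pi ^ (3 / 2 : ℝ) * H ^ 3 * (s ^ 2)⁻¹ * s⁻¹) *
          ((3 / 2 - H ^ 2 * r ^ 2 / 4 / s) * Real.exp (-(H ^ 2 * r ^ 2 / 4 / s))) := by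
      rw [e2]
      linear_combination f s * Real.exp (-(H ^ 2 * r ^ 2 / 4 / s)) *
        (1 / H ^ 2 * (3 / (2 * (s / H ^ 2)) - r ^ 2 / (4 * (s / H ^ 2) ^ 2)))
        * rpow_neg_half_mul hs hH + f s * Real.exp (-(H ^ 2 * r ^ 2 / 4 / s)) *
        (Real.pi ^ (3 / 2 : ℝ) * H ^ 3 * (s ^ 2)⁻¹) * e3
    rw [e4, abs_mul, abs_mul, abs_mul (3 / 2 - _), Real.abs_exp,
      abs_of_pos (by positivity : 0 < Real.pi ^ (3 / 2 : ℝ) * H ^ 3 * (s ^ 2)⁻¹ * s⁻¹)]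
    have h5 := abs_mul_exp_neg_le (t := H ^ 2 * r ^ 2 / 4 / s) (by positivity)
    have h6 : H ^ 2 * r ^ 2 / 4 / s / 2 = H ^ 2 * r ^ 2 / 8 / s := by ring
    rw [h6] at h5
    calc _ ≤ (K * (1 + s ^ b)) * (Real.pi ^ (3 / 2 : ℝ) * H ^ 3 * (s ^ 2)⁻¹ * s⁻¹)
          * (2 * Real.exp (-(H ^ 2 * r₀ ^ 2 / 8 / s))) := by
          refine mul_le_mul (mul_le_mul_of_nonneg_right (hf.bdd s hs) (by positivity))
            (h5.trans (by gcongr)) (by positivity) (by positivity)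
      _ = _ := by ring

end

section

variable {c : ℝ}

theorem integrable_fourierT_f (hc : 1 ≤ c) (hc3 : c < 3) (γ : PhasePoint) :
    Integrable fun k : Space => (‖k‖ ^ (-1 : ℝ) + ‖k‖ ^ (-c)) * ‖fourierT γ.f k‖ ^ 2 := by
  refine (integrable_specDom hc hc3 γ).mono' ?_ (ae_of_all _ fun k => ?_)
  · exact (((measurable_norm_rpow _).add (measurable_norm_rpow _)).mul
      ((continuous_fourierT γ.integrable_f).norm.measurable.pow_const 2)).aestronglyMeasurable
  · rw [Real.norm_of_nonneg (by positivity), specDom]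
    exact le_add_of_nonneg_right (by positivity)

theorem integrable_fourierT_g (hc : 1 ≤ c) (hc3 : c < 3) (γ : PhasePoint) :
    Integrable fun k : Space => (‖k‖ ^ (1 : ℝ) + ‖k‖ ^ (-c)) * ‖fourierT γ.g k‖ ^ 2 := by
  refine (integrable_specDom hc hc3 γ).mono' ?_ (ae_of_all _ fun k => ?_)
  · exact (((measurable_norm_rpow _).add (measurable_norm_rpow _)).mul
      ((continuous_fourierT γ.integrable_g).norm.measurable.pow_const 2)).aestronglyMeasurable
  · rw [Real.norm_of_nonneg (by positivity), specDom]
    exact le_add_of_nonneg_left (by positivity)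

theorem integrable_fourierT_g' (hc : 1 ≤ c) (hc3 : c < 3) (γ : PhasePoint) :
    Integrable fun k : Space => (‖k‖ ^ (-1 : ℝ) + ‖k‖ ^ (-c)) * ‖fourierT γ.g k‖ ^ 2 := by
  refine ((integrable_fourierT_g hc hc3 γ).const_mul 2).mono' ?_ ?_
  · exact (((measurable_norm_rpow _).add (measurable_norm_rpow _)).mul
      ((continuous_fourierT γ.integrable_g).norm.measurable.pow_const 2)).aestronglyMeasurable
  · filter_upwards [ae_ne_zero] with k hk
    have hk' : 0 < ‖k‖ := norm_pos_iff.2 hk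
    rw [Real.norm_of_nonneg (by positivity), ← mul_assoc]
    gcongr
    have h1 := rpow_le_add_rpow hk' (p := -c) (q := -1) (s := 1) (by linarith) (by norm_num)
    have h2 : 0 < ‖k‖ ^ (1 : ℝ) := by positivity
    have h3 : 0 < ‖k‖ ^ (-c) := by positivity
    generalize ‖k‖ ^ (1 : ℝ) = u at *
    generalize ‖k‖ ^ (-1 : ℝ) = v at *
    linarith

end

/-- The field smearing functions of two phase space elements are at distance at least `r₀`. -/
def Separated (r₀ : ℝ) (γ γ' : PhasePoint) : Prop :=
  ∀ x y, (γ.f x ≠ 0 ∨ γ.g x ≠ 0) → (γ'.f y ≠ 0 ∨ γ'.g y ≠ 0) → r₀ ≤ ‖x - y‖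

/-- Combination of products of smearing functions with a position space kernel. -/
def posIntegrand (K₀ K₁ K₂ : ℝ → ℝ) (γ γ' : PhasePoint) (p : Space × Space) : ℝ :=
  γ.f p.1 * γ'.f p.2 * K₀ ‖p.1 - p.2‖
    + (γ.f p.1 * γ'.g p.2 + γ.g p.1 * γ'.f p.2) * K₁ ‖p.1 - p.2‖
    + γ.g p.1 * γ'.g p.2 * K₂ ‖p.1 - p.2‖

theorem specCov_mix_eq {f₀ f₁ f₂ f₃ : ℝ → ℝ} {K b H r₀ : ℝ} (h₀ : MixBound K b f₀)
    (h₁ : MixBound K b f₁) (h₂ : MixBound K b f₂) (h₃ : MixBound K b f₃)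
    (hb0 : 0 ≤ b) (hb1 : b < 1) (hH : 0 < H)
    (hr : 0 < r₀) {γ γ' : PhasePoint} (hsep : Separated r₀ γ γ') :
    Integrable (posIntegrand
        (fun r => kerC H r * lap f₀ H r) (fun r => kerC H r * lap f₁ H r)
        (fun r => kerC H r * (lap f₂ H r + 4 / r ^ 2 * lapTwo f₃ H r)) γ γ') ∧
    specCov (fun r => mix f₀ (r / H)) (fun r => mix f₁ (r / H))
      (fun r => mix f₂ (r / H) + (r / H) ^ 2 * mix f₃ (r / H)) γ γ'
    = 2 * ((2 * Real.pi) ^ 3)⁻¹ * ∫ p : Space × Space, posIntegrand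
        (fun r => kerC H r * lap f₀ H r) (fun r => kerC H r * lap f₁ H r)
        (fun r => kerC H r * (lap f₂ H r + 4 / r ^ 2 * lapTwo f₃ H r)) γ γ' p := by
  have hc : 1 ≤ 2 * b + 1 := by linarith
  have hc3 : 2 * b + 1 < 3 := by linarith
  obtain ⟨a1, a2, a3⟩ := mix_kernel h₀ hb0 hb1 hH hr γ.integrable_f γ'.integrable_f
    (integrable_fourierT_f hc hc3 γ) (integrable_fourierT_f hc hc3 γ')
    (fun x y hx hy => hsep x y (Or.inl hx) (Or.inl hy))
  obtain ⟨b1, b2, b3⟩ := mix_kernel h₁ hb0 hb1 hH hr γ.integrable_f γ'.integrable_g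
    (integrable_fourierT_f hc hc3 γ) (integrable_fourierT_g' hc hc3 γ')
    (fun x y hx hy => hsep x y (Or.inl hx) (Or.inr hy))
  obtain ⟨c1, c2, c3⟩ := mix_kernel h₁ hb0 hb1 hH hr γ.integrable_g γ'.integrable_f
    (integrable_fourierT_g' hc hc3 γ) (integrable_fourierT_f hc hc3 γ')
    (fun x y hx hy => hsep x y (Or.inr hx) (Or.inl hy))
  obtain ⟨d1, d2, d3⟩ := mix_kernel h₂ hb0 hb1 hH hr γ.integrable_g γ'.integrable_g
    (integrable_fourierT_g' hc hc3 γ) (integrable_fourierT_g' hc hc3 γ')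
    (fun x y hx hy => hsep x y (Or.inr hx) (Or.inr hy))
  obtain ⟨e1, e2, e3⟩ := mix_kernel_two h₃ hb0 hb1 hH hr γ.integrable_g γ'.integrable_g
    (integrable_fourierT_g hc hc3 γ) (integrable_fourierT_g hc hc3 γ')
    (fun x y hx hy => hsep x y (Or.inr hx) (Or.inr hy))
  refine ⟨(((a2.add (b2.add c2)).add (d2.add e2))).congr (ae_of_all _ fun p => ?_), ?_⟩
  · simp only [posIntegrand, Pi.add_apply]
    ring
  unfold specCov
  congr 1
  have s1 := integral_add (a1.add (b1.add c1)) (d1.add e1)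
  have s2 := integral_add a1 (b1.add c1)
  have s3 := integral_add b1 c1
  have s4 := integral_add d1 e1
  have t1 := integral_add (a2.add (b2.add c2)) (d2.add e2)
  have t2 := integral_add a2 (b2.add c2)
  have t3 := integral_add b2 c2
  have t4 := integral_add d2 e2
  simp only [Pi.add_apply] at s1 s2 s3 s4 t1 t2 t3 t4
  rw [s2, s3, s4, a3, b3, c3, d3, e3, ← t3, ← t2, ← t4, ← t1] at s1
  refine Eq.trans (integral_congr_ae (ae_of_all _ fun k => ?_)) (s1.trans
    (integral_congr_ae (ae_of_all _ fun p => ?_)))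
  · simp only [specIntegrand, Complex.add_re]
    ring
  · simp only [posIntegrand]
    ring

/-! ### Bounded Lipschitz functions of a parameter -/

/-- `f` is bounded by `b` and `b`-Lipschitz on `S`. -/
def LB (S : Set ℝ) (f : ℝ → ℝ) (b : ℝ) : Prop :=
  (∀ x ∈ S, |f x| ≤ b) ∧ ∀ x ∈ S, ∀ y ∈ S, |f x - f y| ≤ b * |x - y|

section

variable {S : Set ℝ} {f g : ℝ → ℝ} {b b' : ℝ}

theorem LB.mono (h : LB S f b) (hb : b ≤ b') : LB S f b' :=
  ⟨fun x hx => (h.1 x hx).trans hb, fun x hx y hy => (h.2 x hx y hy).trans (by gcongr)⟩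

theorem LB.congr (h : LB S f b) (hfg : ∀ x ∈ S, f x = g x) : LB S g b :=
  ⟨fun x hx => hfg x hx ▸ h.1 x hx, fun x hx y hy => hfg x hx ▸ hfg y hy ▸ h.2 x hx y hy⟩

theorem LB.const (c : ℝ) : LB S (fun _ => c) |c| :=
  ⟨fun _ _ => le_rfl, fun x _ y _ => by rw [sub_self, abs_zero]; positivity⟩

theorem LB.add (hf : LB S f b) (hg : LB S g b') : LB S (fun x => f x + g x) (b + b') := by
  refine ⟨fun x hx => (abs_add_le _ _).trans (add_le_add (hf.1 x hx) (hg.1 x hx)),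
    fun x hx y hy => ?_⟩
  rw [add_sub_add_comm, add_mul]
  exact (abs_add_le _ _).trans (add_le_add (hf.2 x hx y hy) (hg.2 x hx y hy))

theorem LB.const_mul (hf : LB S f b) (c : ℝ) : LB S (fun x => c * f x) (|c| * b) := by
  refine ⟨fun x hx => ?_, fun x hx y hy => ?_⟩
  · rw [abs_mul]; gcongr; exact hf.1 x hx
  · rw [← mul_sub, abs_mul, mul_assoc]; gcongr; exact hf.2 x hx y hy

theorem LB.neg (hf : LB S f b) : LB S (fun x => -f x) b := by
  simpa using hf.const_mul (-1)

theorem LB.sub (hf : LB S f b) (hg : LB S g b') : LB S (fun x => f x - g x) (b + b') := by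
  simpa only [sub_eq_add_neg] using hf.add hg.neg

theorem LB.nonneg (hf : LB S f b) {x : ℝ} (hx : x ∈ S) : 0 ≤ b := (abs_nonneg _).trans (hf.1 x hx)

theorem LB.mul (hf : LB S f b) (hg : LB S g b') : LB S (fun x => f x * g x) (2 * (b * b')) := by
  refine ⟨fun x hx => ?_, fun x hx y hy => ?_⟩
  · have h1 := hf.nonneg hx
    have h2 := hg.nonneg hx
    rw [abs_mul]
    have := mul_le_mul (hf.1 x hx) (hg.1 x hx) (abs_nonneg _) h1
    have := mul_nonneg h1 h2
    linarith
  · have h1 := hf.nonneg hx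
    have h2 := hg.nonneg hx
    have e : f x * g x - f y * g y = f x * (g x - g y) + (f x - f y) * g y := by ring
    rw [e]
    refine (abs_add_le _ _).trans ?_
    rw [abs_mul, abs_mul]
    have h3 := mul_le_mul (hf.1 x hx) (hg.2 x hx y hy) (abs_nonneg _) h1
    have h4 := mul_le_mul (hf.2 x hx y hy) (hg.1 y hy) (abs_nonneg _) (by positivity)
    linarith

theorem LB.inv (hf : LB S f b) {c : ℝ} (hc : 0 < c) (h : ∀ x ∈ S, c ≤ f x) :
    LB S (fun x => (f x)⁻¹) (c⁻¹ + b / c ^ 2) := by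
  refine ⟨fun x hx => ?_, fun x hx y hy => ?_⟩
  · have h1 := h x hx
    have h2 := hf.nonneg hx
    rw [abs_of_pos (inv_pos.2 (hc.trans_le h1))]
    have : (f x)⁻¹ ≤ c⁻¹ := by gcongr
    have : 0 ≤ b / c ^ 2 := by positivity
    linarith
  · have h1 := h x hx
    have h1' := h y hy
    have h2 := hf.nonneg hx
    have p1 := hc.trans_le h1
    have p2 := hc.trans_le h1'
    rw [inv_sub_inv p1.ne' p2.ne', abs_div, abs_of_pos (mul_pos p1 p2), abs_sub_comm]
    calc |f x - f y| / (f x * f y) ≤ b * |x - y| / (c * c) := by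
          gcongr
          exact hf.2 x hx y hy
      _ = b / c ^ 2 * |x - y| := by ring
      _ ≤ _ := by
          gcongr
          have : 0 < c⁻¹ := inv_pos.2 hc
          linarith

/-- Bounds and Lipschitz constants integrate, so no differentiation under the integral sign in H is
needed. This is how regularity in H passes through the integrals over u, τ, the momenta and the
positions. -/
theorem LB.integral {α : Type*} [MeasurableSpace α] {μ : Measure α} {F : ℝ → α → ℝ} {b : α → ℝ}
    (hm : ∀ x ∈ S, AEStronglyMeasurable (F x) μ) (hb : Integrable b μ)
    (h : ∀ᵐ u ∂μ, LB S (fun x => F x u) (b u)) : LB S (fun x => ∫ u, F x u ∂μ) (∫ u, b u ∂μ) := by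
  have hi : ∀ x ∈ S, Integrable (F x) μ := fun x hx => hb.mono' (hm x hx) (by
    filter_upwards [h] with u hu using hu.1 x hx)
  refine ⟨fun x hx => ?_, fun x hx y hy => ?_⟩
  · rw [← Real.norm_eq_abs]
    refine norm_integral_le_of_norm_le hb ?_
    filter_upwards [h] with u hu using hu.1 x hx
  · rw [← integral_sub (hi x hx) (hi y hy), ← integral_mul_const, ← Real.norm_eq_abs]
    refine norm_integral_le_of_norm_le (hb.mul_const _) ?_
    filter_upwards [h] with u hu using hu.2 x hx y hy

theorem LB.continuousOn (hf : LB S f b) : ContinuousOn f S := by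
  rcases S.eq_empty_or_nonempty with rfl | ⟨x₀, hx₀⟩
  · exact continuousOn_empty _
  have hb := hf.nonneg hx₀
  refine (LipschitzOnWith.of_dist_le_mul (K := ⟨b, hb⟩) fun x hx y hy => ?_).continuousOn
  exact hf.2 x hx y hy

theorem LB.exists_pos_le (hf : LB S f b) (hS : IsCompact S) (h : ∀ x ∈ S, 0 < f x) :
    ∃ c, 0 < c ∧ ∀ x ∈ S, c ≤ f x := by
  rcases S.eq_empty_or_nonempty with rfl | hne
  · exact ⟨1, one_pos, by simp⟩
  obtain ⟨x, hx, hmin⟩ := hS.exists_isMinOn hne hf.continuousOn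
  exact ⟨f x, h x hx, fun y hy => hmin hy⟩

theorem LB.sqrt (hf : LB S f b) {c : ℝ} (hc : 0 < c) (h : ∀ x ∈ S, c ^ 2 ≤ f x) :
    LB S (fun x => Real.sqrt (f x)) (b * c⁻¹) := by
  have hs : ∀ x ∈ S, c ≤ Real.sqrt (f x) := fun x hx => Real.le_sqrt_of_sq_le (h x hx)
  refine ⟨fun x hx => ?_, fun x hx y hy => ?_⟩
  · have hp : 0 ≤ f x := (sq_nonneg c).trans (h x hx)
    rw [abs_of_nonneg (Real.sqrt_nonneg _), ← div_eq_mul_inv, le_div_iff₀ hc]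
    have h1 := Real.mul_self_sqrt hp
    have h2 := (le_abs_self _).trans (hf.1 x hx)
    nlinarith [hs x hx, Real.sqrt_nonneg (f x)]
  · have hp : 0 ≤ f x := (sq_nonneg c).trans (h x hx)
    have hq : 0 ≤ f y := (sq_nonneg c).trans (h y hy)
    have e : |Real.sqrt (f x) - Real.sqrt (f y)| * (Real.sqrt (f x) + Real.sqrt (f y))
        = |f x - f y| := by
      rw [← abs_of_nonneg (add_nonneg (Real.sqrt_nonneg (f x)) (Real.sqrt_nonneg (f y))),
        ← abs_mul]
      congr 1
      linear_combination Real.mul_self_sqrt hp - Real.mul_self_sqrt hq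
    have h1 := hf.2 x hx y hy
    rw [mul_right_comm, ← div_eq_mul_inv, le_div_iff₀ hc]
    have h2 := hs x hx
    have h3 := Real.sqrt_nonneg (f y)
    calc _ ≤ |Real.sqrt (f x) - Real.sqrt (f y)| * (Real.sqrt (f x) + Real.sqrt (f y)) := by
          gcongr; linarith
      _ ≤ _ := e ▸ h1

end

theorem LB.id {H₁ H₂ : ℝ} (hH : 0 < H₁) : LB (Icc H₁ H₂) (fun x => x) (H₂ + 1) := by
  refine ⟨fun x hx => ?_, fun x hx y hy => ?_⟩
  · rw [abs_of_pos (hH.trans_le hx.1)]; linarith [hx.2]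
  · have h1 : 1 ≤ H₂ + 1 := by linarith [hx.1, hx.2]
    nlinarith [abs_nonneg (x - y)]

theorem abs_exp_neg_sub_le {s t c : ℝ} (hs : c ≤ s) (ht : c ≤ t) :
    |Real.exp (-s) - Real.exp (-t)| ≤ Real.exp (-c) * |s - t| := by
  wlog hst : s ≤ t generalizing s t
  · rw [abs_sub_comm, abs_sub_comm s]
    exact this ht hs (le_of_not_ge hst)
  rw [abs_of_nonneg (sub_nonneg.2 (Real.exp_le_exp.2 (by linarith))), abs_sub_comm,
    abs_of_nonneg (by linarith : 0 ≤ t - s)]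
  have h1 : Real.exp (-t) = Real.exp (-s) * Real.exp (-(t - s)) := by
    rw [← Real.exp_add]; ring_nf
  have h2 := Real.add_one_le_exp (-(t - s))
  have h3 : Real.exp (-s) ≤ Real.exp (-c) := Real.exp_le_exp.2 (by linarith)
  calc _ = Real.exp (-s) * (1 - Real.exp (-(t - s))) := by rw [h1]; ring
    _ ≤ Real.exp (-s) * (t - s) := mul_le_mul_of_nonneg_left (by linarith) (Real.exp_pos _).le
    _ ≤ _ := mul_le_mul_of_nonneg_right h3 (by linarith)

theorem LB.exp_neg {S : Set ℝ} {f : ℝ → ℝ} {L c : ℝ}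
    (hf : ∀ x ∈ S, ∀ y ∈ S, |f x - f y| ≤ L * |x - y|) (hL : 0 ≤ L) (hc : ∀ x ∈ S, c ≤ f x) :
    LB S (fun x => Real.exp (-f x)) ((1 + L) * Real.exp (-c)) := by
  refine ⟨fun x hx => ?_, fun x hx y hy => ?_⟩
  · rw [Real.abs_exp]
    have h1 : Real.exp (-f x) ≤ Real.exp (-c) := Real.exp_le_exp.2 (by linarith [hc x hx])
    nlinarith [Real.exp_pos (-c)]
  · refine (abs_exp_neg_sub_le (hc x hx) (hc y hy)).trans ?_
    have h1 := hf x hx y hy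
    have h2 : 0 ≤ Real.exp (-c) * |x - y| := by positivity
    calc _ ≤ Real.exp (-c) * (L * |x - y|) := by gcongr
      _ ≤ _ := by linarith

/-- Differentiating t^x in the exponent costs a logarithm. For t ≤ 1 it is absorbed by t^p with p >
0, for t ≥ 1 by the slack between q and q'. -/
theorem abs_log_mul_rpow_le {p q q' t : ℝ} (hp : 0 < p) (hq : q < q') (ht : 0 < t)
    {x : ℝ} (hx : x ∈ Icc p q) : |Real.log t| * t ^ x ≤ (p⁻¹ + (q' - q)⁻¹) * (1 + t ^ q') := by
  have hx0 : 0 < x := hp.trans_le hx.1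
  have hd : 0 < q' - q := by linarith
  have p1 : 0 < t ^ q' := by positivity
  have p2 : 0 < p⁻¹ := by positivity
  have p3 : 0 < (q' - q)⁻¹ := by positivity
  rcases le_total t 1 with h | h
  · have h1 := Real.abs_log_mul_self_rpow_lt t p ht h hp
    rw [abs_mul, abs_of_pos (Real.rpow_pos_of_pos ht p), one_div] at h1
    have h2 : t ^ x ≤ t ^ p := Real.rpow_le_rpow_of_exponent_ge ht h hx.1
    have h3 : |Real.log t| * t ^ x ≤ |Real.log t| * t ^ p := by gcongr
    nlinarith [mul_pos p2 p1, mul_pos p3 p1]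
  · have h1 := Real.log_le_rpow_div ht.le hd
    rw [abs_of_nonneg (Real.log_nonneg h)]
    have h2 : t ^ x ≤ t ^ q := Real.rpow_le_rpow_of_exponent_le h hx.2
    have h3 : t ^ q' = t ^ (q' - q) * t ^ q := by rw [← Real.rpow_add ht]; ring_nf
    have h4 : Real.log t * t ^ x ≤ t ^ (q' - q) / (q' - q) * t ^ q := by
      gcongr
    rw [div_mul_eq_mul_div, ← h3, div_eq_mul_inv] at h4
    nlinarith [mul_pos p2 p1, mul_pos p3 p1]

theorem abs_rpow_sub_le {t x y : ℝ} (ht : 0 < t) :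
    |t ^ x - t ^ y| ≤ max (|Real.log t| * t ^ x) (|Real.log t| * t ^ y) * |x - y| := by
  have hd : ∀ z, HasDerivAt (fun z : ℝ => t ^ z) (Real.log t * t ^ z) z := fun z => by
    simpa using (hasDerivAt_id z).const_rpow ht
  wlog hxy : x ≤ y generalizing x y
  · rw [abs_sub_comm, abs_sub_comm x, max_comm]
    exact this (le_of_not_ge hxy)
  rw [abs_sub_comm, abs_sub_comm x]
  have h := (convex_Icc x y).norm_image_sub_le_of_norm_hasDerivWithin_le
    (C := max (|Real.log t| * t ^ x) (|Real.log t| * t ^ y))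
    (fun z _ => (hd z).hasDerivWithinAt) (fun z hz => ?_) (left_mem_Icc.2 hxy) (right_mem_Icc.2 hxy)
  · simpa [Real.norm_eq_abs] using h
  · rw [norm_mul, Real.norm_eq_abs, Real.norm_eq_abs, abs_of_pos (Real.rpow_pos_of_pos ht z)]
    rcases le_total t 1 with h1 | h1
    · refine le_max_of_le_left ?_
      gcongr ?_ * ?_
      exact Real.rpow_le_rpow_of_exponent_ge ht h1 hz.1
    · refine le_max_of_le_right ?_
      gcongr ?_ * ?_
      exact Real.rpow_le_rpow_of_exponent_le h1 hz.2

theorem LB.rpow {S : Set ℝ} {a : ℝ → ℝ} {b p q q' : ℝ} (ha : LB S a b) (hp : 0 < p)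
    (hq : q < q') (hr : ∀ x ∈ S, a x ∈ Icc p q) {t : ℝ} (ht : 0 < t) :
    LB S (fun x => t ^ a x) ((1 + b * (p⁻¹ + (q' - q)⁻¹)) * (1 + t ^ q')) := by
  have p1 : 0 < t ^ q' := by positivity
  have p2 : 0 < p⁻¹ := by positivity
  have p3 : 0 < (q' - q)⁻¹ := inv_pos.2 (by linarith)
  refine ⟨fun x hx => ?_, fun x hx y hy => ?_⟩
  · have hb := ha.nonneg hx
    rw [abs_of_pos (Real.rpow_pos_of_pos ht _)]
    have h1 := rpow_le_add_rpow ht (p := 0) (q := a x) (s := q') (hp.le.trans (hr x hx).1)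
      ((hr x hx).2.trans hq.le)
    rw [Real.rpow_zero] at h1
    have : 0 ≤ b * (p⁻¹ + (q' - q)⁻¹) * (1 + t ^ q') := by positivity
    linarith
  · have hb := ha.nonneg hx
    refine (abs_rpow_sub_le ht).trans ?_
    have h1 : max (|Real.log t| * t ^ a x) (|Real.log t| * t ^ a y)
        ≤ (p⁻¹ + (q' - q)⁻¹) * (1 + t ^ q') := max_le
      (abs_log_mul_rpow_le hp hq ht (hr x hx)) (abs_log_mul_rpow_le hp hq ht (hr y hy))
    have h2 := ha.2 x hx y hy
    have h3 : 0 ≤ (p⁻¹ + (q' - q)⁻¹) * (1 + t ^ q') := by positivity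
    calc _ ≤ (p⁻¹ + (q' - q)⁻¹) * (1 + t ^ q') * (b * |x - y|) :=
          mul_le_mul h1 h2 (abs_nonneg _) h3
      _ ≤ _ := by
        have : 0 ≤ (1 + t ^ q') * |x - y| := by positivity
        nlinarith

/-- A family of functions that are uniformly bounded and uniformly Lipschitz on `S`. -/
def ULB {ι : Type*} (S : Set ℝ) (T : Set ι) (F : ι → ℝ → ℝ) : Prop :=
  ∃ b, ∀ i ∈ T, LB S (F i) b

section

variable {ι : Type*} {S : Set ℝ} {T : Set ι} {F G : ι → ℝ → ℝ}

theorem ULB.add (hF : ULB S T F) (hG : ULB S T G) : ULB S T (fun i x => F i x + G i x) := by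
  obtain ⟨b, hb⟩ := hF
  obtain ⟨b', hb'⟩ := hG
  exact ⟨_, fun i hi => (hb i hi).add (hb' i hi)⟩

theorem ULB.sub (hF : ULB S T F) (hG : ULB S T G) : ULB S T (fun i x => F i x - G i x) := by
  obtain ⟨b, hb⟩ := hF
  obtain ⟨b', hb'⟩ := hG
  exact ⟨_, fun i hi => (hb i hi).sub (hb' i hi)⟩

theorem ULB.mul (hF : ULB S T F) (hG : ULB S T G) : ULB S T (fun i x => F i x * G i x) := by
  obtain ⟨b, hb⟩ := hF
  obtain ⟨b', hb'⟩ := hG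
  exact ⟨_, fun i hi => (hb i hi).mul (hb' i hi)⟩

theorem ULB.inv (hF : ULB S T F) {c : ℝ} (hc : 0 < c) (h : ∀ i ∈ T, ∀ x ∈ S, c ≤ F i x) :
    ULB S T (fun i x => (F i x)⁻¹) := by
  obtain ⟨b, hb⟩ := hF
  exact ⟨_, fun i hi => (hb i hi).inv hc (h i hi)⟩

theorem ULB.const (c : ℝ) : ULB S T (fun _ _ => c) := ⟨_, fun _ _ => LB.const c⟩

theorem ULB.of_LB {f : ℝ → ℝ} {b : ℝ} (h : LB S f b) : ULB S T (fun _ => f) := ⟨b, fun _ _ => h⟩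

theorem ULB.congr (hF : ULB S T F) (h : ∀ i ∈ T, ∀ x ∈ S, F i x = G i x) : ULB S T G := by
  obtain ⟨b, hb⟩ := hF
  exact ⟨b, fun i hi => (hb i hi).congr (h i hi)⟩

theorem ULB.mono {T' : Set ι} (hF : ULB S T F) (h : T' ⊆ T) : ULB S T' F := by
  obtain ⟨b, hb⟩ := hF
  exact ⟨b, fun i hi => hb i (h hi)⟩

theorem ULB.comp {κ : Type*} {T' : Set κ} {φ : κ → ι} (hF : ULB S T F) (h : ∀ k ∈ T', φ k ∈ T) :
    ULB S T' (fun k => F (φ k)) := by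
  obtain ⟨b, hb⟩ := hF
  exact ⟨b, fun i hi => hb _ (h i hi)⟩

end

/-! ### The scaled confluent kernels -/

theorem integrableOn_rconfl {p q w : ℝ} (hp : -1 < p) (hq : q ≤ 1) (hw : 0 ≤ w) :
    IntegrableOn (fun u : ℝ => Real.exp (-u) * u ^ p * (1 + w * u) ^ q) (Ioi 0) := by
  have hi := (integrableOn_confl hp hq (w := (w : ℂ)) (by simpa using hw)).norm
  refine IntegrableOn.congr_fun hi (fun u hu => ?_) measurableSet_Ioi
  have hu : (0 : ℝ) < u := hu
  have h1 : (0 : ℝ) ≤ 1 + w * u := by positivity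
  rw [norm_mul, norm_exp_mul_rpow hu, show (1 + (w : ℂ) * u) = ((1 + w * u : ℝ) : ℂ) by
    push_cast; rfl, ← Complex.ofReal_cpow h1, Complex.norm_real,
    Real.norm_of_nonneg (by positivity)]

/-- A combination of the three confluent densities at w/ε, multiplied by ε^a and rewritten so that ε
= 0 still makes sense. With ε = 4/r², the limit ε → 0 is the large-distance limit. -/
def triInt (A B D a ε w u : ℝ) : ℝ :=
  Real.exp (-u) * ((u * (ε + w * u)) ^ a
    * (A + B * (w * u / (ε + w * u)) + D * (u * ε / (ε + w * u))))

def triKer (A B D a ε w : ℝ) : ℝ := ∫ u in Ioi (0 : ℝ), triInt A B D a ε w u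

theorem triKer_eq (A B D : ℝ) {a ε w : ℝ} (ha : -1 < a) (ha1 : a < 1) (hε : 0 < ε) (hw : 0 < w) :
    triKer A B D a ε w = ε ^ a * (A * rconfl a a (w / ε)
      + B * (w / ε * rconfl (a + 1) (a - 1) (w / ε)) + D * rconfl (a + 1) (a - 1) (w / ε)) := by
  have hwε : 0 < w / ε := by positivity
  have i0 := (integrableOn_rconfl (p := a) (q := a) ha ha1.le hwε.le).const_mul A
  have i1 := (integrableOn_rconfl (p := a + 1) (q := a - 1) (by linarith) (by linarith)
    hwε.le).const_mul (B * (w / ε) + D)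
  have h := integral_add i0 i1
  rw [integral_const_mul, integral_const_mul] at h
  change _ = A * rconfl a a (w / ε) + (B * (w / ε) + D) * rconfl (a + 1) (a - 1) (w / ε) at h
  have e : A * rconfl a a (w / ε) + B * (w / ε * rconfl (a + 1) (a - 1) (w / ε))
      + D * rconfl (a + 1) (a - 1) (w / ε)
      = A * rconfl a a (w / ε) + (B * (w / ε) + D) * rconfl (a + 1) (a - 1) (w / ε) := by ring
  rw [e, ← h, ← integral_const_mul]
  refine setIntegral_congr_fun measurableSet_Ioi (fun u hu => ?_)
  have hu : (0 : ℝ) < u := hu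
  have h1 : 0 < ε + w * u := by positivity
  have h2 : 1 + w / ε * u = (ε + w * u) / ε := by field_simp
  simp only [triInt, h2]
  rw [Real.mul_rpow hu.le h1.le, Real.div_rpow h1.le hε.le, Real.div_rpow h1.le hε.le,
    Real.rpow_add hu, Real.rpow_sub h1, Real.rpow_sub hε, Real.rpow_one, Real.rpow_one,
    Real.rpow_one]
  have := (Real.rpow_pos_of_pos hε a).ne'
  field_simp
  ring

theorem triInt_arg_rpow_le {q ε w u : ℝ} (hq0 : 0 < q) (hq1 : q ≤ 1) (hε0 : 0 ≤ ε) (hε1 : ε ≤ 1)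
    (hw : 0 ≤ w) (hu : 0 < u) : (u * (ε + w * u)) ^ q ≤ (1 + u) ^ 2 * (1 + w ^ q) := by
  have h1 : u * (ε + w * u) ≤ (1 + u) ^ 2 * (1 + w) := by
    have := mul_nonneg hw hu.le
    have := mul_le_of_le_one_right hu.le hε1
    nlinarith
  have h2 : 0 ≤ u * (ε + w * u) := by positivity
  calc _ ≤ ((1 + u) ^ 2 * (1 + w)) ^ q := Real.rpow_le_rpow h2 h1 hq0.le
    _ = ((1 + u) ^ 2) ^ q * (1 + w) ^ q := Real.mul_rpow (by positivity) (by positivity)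
    _ ≤ (1 + u) ^ 2 * (1 + w ^ q) := by
      gcongr
      · refine Real.rpow_le_self_of_one_le ?_ hq1
        nlinarith
      · exact one_add_rpow_le hq0.le le_rfl hq1 hw

/-- The two fractions do not depend on H and are at most 1 and u uniformly down to ε = 0, so only
the power (u(ε + wu))^a needs the logarithmic estimate. The constant M is uniform in ε, w and u. -/
theorem LB_triInt {S : Set ℝ} {a A B D : ℝ → ℝ} {b p q q' : ℝ} (ha : LB S a b) (hA : LB S A b)
    (hB : LB S B b) (hD : LB S D b) (hb : 0 ≤ b) (hp : 0 < p) (hq : q < q') (hq1 : q' ≤ 1)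
    (hq0 : 0 < q') (hr : ∀ x ∈ S, a x ∈ Icc p q) :
    ∃ M, 0 ≤ M ∧ ∀ ε w u, 0 ≤ ε → ε ≤ 1 → 0 ≤ w → 0 < ε + w → 0 < u →
      LB S (fun H => triInt (A H) (B H) (D H) (a H) ε w u)
        (M * (1 + w ^ q') * (Real.exp (-u) * (1 + u) ^ 3)) := by
  set c := 1 + b * (p⁻¹ + (q' - q)⁻¹) with hc
  have hc0 : 0 ≤ c := by
    have : 0 < (q' - q)⁻¹ := inv_pos.2 (by linarith)
    positivity
  refine ⟨8 * c * b, by positivity, fun ε w u hε0 hε1 hw hεw hu => ?_⟩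
  have h1 : 0 < ε + w * u := by
    rcases hε0.eq_or_lt with rfl | h
    · rw [zero_add] at hεw ⊢; positivity
    · positivity
  have h2 := ha.rpow hp hq hr (t := u * (ε + w * u)) (by positivity)
  have s1 : |w * u / (ε + w * u)| ≤ 1 := by
    rw [abs_of_nonneg (by positivity), div_le_one h1]; linarith
  have s2 : |u * ε / (ε + w * u)| ≤ u := by
    rw [abs_of_nonneg (by positivity), div_le_iff₀ h1]
    have := mul_nonneg hw hu.le
    nlinarith
  have h3 := (hA.add (hB.const_mul (w * u / (ε + w * u)))).add
    (hD.const_mul (u * ε / (ε + w * u)))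
  have h4 := ((h2.mul (h3.mono (b' := 2 * (b * (1 + u))) (by nlinarith))).const_mul
    (Real.exp (-u)))
  refine (h4.congr fun x _ => ?_).mono ?_
  · simp only [triInt]; ring
  · rw [Real.abs_exp]
    have h5 := triInt_arg_rpow_le hq0 hq1 hε0 hε1 hw hu
    have p1 : 0 ≤ w ^ q' := by positivity
    have h6 : 1 + (u * (ε + w * u)) ^ q' ≤ 2 * ((1 + u) ^ 2 * (1 + w ^ q')) := by
      nlinarith
    calc Real.exp (-u) * (2 * (c * (1 + (u * (ε + w * u)) ^ q') * (2 * (b * (1 + u)))))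
        ≤ Real.exp (-u) * (2 * (c * (2 * ((1 + u) ^ 2 * (1 + w ^ q'))) * (2 * (b * (1 + u))))) := by
          gcongr
      _ = _ := by ring

theorem measurable_triInt (A B D a ε w : ℝ) : Measurable (triInt A B D a ε w) := by
  unfold triInt
  fun_prop

theorem integrableOn_exp_mul_pow (n : ℕ) :
    IntegrableOn (fun u : ℝ => Real.exp (-u) * (1 + u) ^ n) (Ioi 0) := by
  induction n with
  | zero =>
    have := integrableOn_exp_mul_rpow (p := 0) (by norm_num)
    simpa using this
  | succ n ih =>
    have h1 : IntegrableOn (fun u : ℝ => (2 : ℝ) ^ (n + 1) * (Real.exp (-u) * u ^ (0 : ℝ)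
        + Real.exp (-u) * u ^ ((n + 1 : ℕ) : ℝ))) (Ioi 0) :=
      ((integrableOn_exp_mul_rpow (by norm_num)).add (integrableOn_exp_mul_rpow
        (by have : (0 : ℝ) ≤ ((n + 1 : ℕ) : ℝ) := by positivity
            linarith))).const_mul _
    refine h1.mono' (Continuous.aestronglyMeasurable (by fun_prop)) ?_
    filter_upwards [ae_restrict_mem measurableSet_Ioi] with u hu
    have hu : (0 : ℝ) < u := hu
    rw [Real.norm_of_nonneg (by positivity), Real.rpow_zero, Real.rpow_natCast, ← mul_add,
      mul_left_comm]
    gcongr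
    rcases le_total u 1 with h | h
    · have : (1 + u) ^ (n + 1) ≤ 2 ^ (n + 1) := by gcongr; linarith
      have h2 : (0 : ℝ) ≤ 2 ^ (n + 1) * u ^ (n + 1) := by positivity
      linarith
    · have : (1 + u) ^ (n + 1) ≤ (2 * u) ^ (n + 1) := by gcongr; linarith
      rw [mul_pow] at this
      have h2 : (0 : ℝ) ≤ 2 ^ (n + 1) := by positivity
      linarith

theorem exists_LB_triKer {S : Set ℝ} {a A B D : ℝ → ℝ} {b p q q' : ℝ} (ha : LB S a b)
    (hA : LB S A b) (hB : LB S B b) (hD : LB S D b) (hb : 0 ≤ b) (hp : 0 < p) (hq : q < q')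
    (hq1 : q' ≤ 1) (hq0 : 0 < q') (hr : ∀ x ∈ S, a x ∈ Icc p q) :
    ∃ M, 0 ≤ M ∧ ∀ ε w, 0 ≤ ε → ε ≤ 1 → 0 ≤ w → 0 < ε + w →
      LB S (fun H => triKer (A H) (B H) (D H) (a H) ε w) (M * (1 + w ^ q')) := by
  obtain ⟨M, hM, h⟩ := LB_triInt ha hA hB hD hb hp hq hq1 hq0 hr
  set I := ∫ u in Ioi (0 : ℝ), Real.exp (-u) * (1 + u) ^ 3 with hI
  have hI0 : 0 ≤ I := setIntegral_nonneg measurableSet_Ioi fun u hu => by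
    have hu : (0 : ℝ) < u := hu
    positivity
  refine ⟨M * I, by positivity, fun ε w hε0 hε1 hw hεw => ?_⟩
  have h2 := LB.integral (S := S) (μ := volume.restrict (Ioi 0))
    (F := fun H u => triInt (A H) (B H) (D H) (a H) ε w u)
    (b := fun u => M * (1 + w ^ q') * (Real.exp (-u) * (1 + u) ^ 3))
    (fun x _ => (measurable_triInt _ _ _ _ _ _).aestronglyMeasurable)
    ((integrableOn_exp_mul_pow 3).const_mul _) (by
      filter_upwards [ae_restrict_mem measurableSet_Ioi] with u hu
        using h ε w u hε0 hε1 hw hεw hu)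
  refine h2.mono (le_of_eq ?_)
  rw [integral_const_mul]
  ring

theorem abs_triKer_le (A B D : ℝ) {a q' : ℝ} (ha : 0 < a) (hq : a < q') (hq1 : q' ≤ 1) :
    ∃ M, 0 ≤ M ∧ ∀ ε w, 0 ≤ ε → ε ≤ 1 → 0 ≤ w → 0 < ε + w →
      |triKer A B D a ε w| ≤ M * (1 + w ^ q') := by
  set b := |a| + |A| + |B| + |D| with hb
  have h0 := abs_nonneg a
  have h1 := abs_nonneg A
  have h2 := abs_nonneg B
  have h3 := abs_nonneg D
  obtain ⟨M, hM, h⟩ := exists_LB_triKer (S := {0}) (b := b) ((LB.const a).mono (by linarith))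
    ((LB.const A).mono (by linarith)) ((LB.const B).mono (by linarith))
    ((LB.const D).mono (by linarith)) (by positivity) ha hq hq1 (ha.trans hq)
    (fun _ _ => ⟨le_rfl, le_rfl⟩)
  exact ⟨M, hM, fun ε w e1 e2 e3 e4 => (h ε w e1 e2 e3 e4).1 0 rfl⟩

theorem tendsto_triKer (A B D : ℝ) {a w : ℝ} (ha : 0 < a) (ha1 : a < 1) (hw : 0 < w) :
    Tendsto (fun ε => triKer A B D a ε w) (𝓝[>] 0) (𝓝 (triKer A B D a 0 w)) := by
  set b := |a| + |A| + |B| + |D| with hb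
  have h0 := abs_nonneg a
  have h1 := abs_nonneg A
  have h2 := abs_nonneg B
  have h3 := abs_nonneg D
  obtain ⟨M, hM, h⟩ := LB_triInt (S := {0}) (b := b) ((LB.const a).mono (by linarith))
    ((LB.const A).mono (by linarith)) ((LB.const B).mono (by linarith))
    ((LB.const D).mono (by linarith)) (by positivity) ha ha1 le_rfl one_pos
    (fun _ _ => ⟨le_rfl, le_rfl⟩)
  refine tendsto_integral_filter_of_dominated_convergence
    (fun u => M * (1 + w ^ (1 : ℝ)) * (Real.exp (-u) * (1 + u) ^ 3))
    (Eventually.of_forall fun ε => (measurable_triInt _ _ _ _ _ _).aestronglyMeasurable) ?_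
    ((integrableOn_exp_mul_pow 3).const_mul _) ?_
  · filter_upwards [Ioo_mem_nhdsGT one_pos] with ε hε
    filter_upwards [ae_restrict_mem measurableSet_Ioi] with u hu
    exact (h ε w u hε.1.le hε.2.le hw.le (by linarith [hε.1]) hu).1 0 rfl
  · filter_upwards [ae_restrict_mem measurableSet_Ioi] with u hu
    have hu : (0 : ℝ) < u := hu
    have hwu : 0 < w * u := by positivity
    have hc : ContinuousAt (fun ε => triInt A B D a ε w u) 0 := by
      unfold triInt
      have c1 : ContinuousAt (fun ε : ℝ => ε + w * u) 0 := by fun_prop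
      have c2 : (fun ε : ℝ => ε + w * u) 0 ≠ 0 := by simpa using hwu.ne'
      refine continuousAt_const.mul (ContinuousAt.mul ?_ ?_)
      · exact (continuousAt_const.mul c1).rpow_const (Or.inr ha.le)
      · exact (continuousAt_const.add (continuousAt_const.mul (continuousAt_const.div c1 c2))).add
          (continuousAt_const.mul ((continuousAt_const.mul continuousAt_id).div c1 c2))
    exact hc.tendsto.mono_left nhdsWithin_le_nhds

/-- At ε = 0 the fractions become 1 and 0, so D disappears and A, B enter only through their sum. -/
theorem triKer_zero (A B D : ℝ) {a w : ℝ} (ha : 0 < a) (hw : 0 < w) :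
    triKer A B D a 0 w = (A + B) * (Real.Gamma (2 * a + 1) * w ^ a) := by
  rw [← integral_exp_mul_rpow (p := 2 * a) (by linarith), ← integral_mul_const,
    ← integral_const_mul]
  refine setIntegral_congr_fun measurableSet_Ioi (fun u hu => ?_)
  have hu : (0 : ℝ) < u := hu
  have h1 : w * u / (0 + w * u) = 1 := by rw [zero_add]; exact div_self (by positivity)
  have h2 : (u * (0 + w * u)) ^ a = u ^ (2 * a) * w ^ a := by
    rw [zero_add, Real.mul_rpow hu.le (by positivity), Real.mul_rpow hw.le hu.le, two_mul,
      Real.rpow_add hu]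
    ring
  simp only [triInt, h1, h2, mul_zero, zero_div]
  ring

theorem continuousOn_triKer (A B D : ℝ) {a ε : ℝ} (ha : -1 < a) (ha1 : a < 1) (hε : 0 < ε) :
    ContinuousOn (triKer A B D a ε) (Ioi 0) := by
  have c0 : ContinuousOn (fun w : ℝ => w / ε) (Ioi 0) := by fun_prop
  have hm : MapsTo (fun w : ℝ => w / ε) (Ioi 0) (Ioi 0) := fun w hw => div_pos hw hε
  have c1 := (polyBdd_rconfl_self ha ha1).cont.comp c0 hm
  have c2 := (polyBdd_rconfl_one ha ha1).cont.comp c0 hm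
  refine ContinuousOn.congr (f := fun w => ε ^ a * (A * rconfl a a (w / ε)
      + B * (w / ε * rconfl (a + 1) (a - 1) (w / ε)) + D * rconfl (a + 1) (a - 1) (w / ε))) ?_
    (fun w hw => triKer_eq A B D ha ha1 hε hw)
  exact continuousOn_const.mul (((continuousOn_const.mul c1).add
    (continuousOn_const.mul (c0.mul c2))).add (continuousOn_const.mul c2))

/-- The Laplace transforms of the scaled kernels. -/
def kap (A B D a ε H : ℝ) : ℝ :=
  ∫ τ in Ioi (0 : ℝ), triKer A B D a ε τ⁻¹ * Real.exp (-H ^ 2 * τ)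

def kapTwo (a ε H : ℝ) : ℝ :=
  ∫ τ in Ioi (0 : ℝ), triKer 1 0 0 a ε τ⁻¹
    * ((3 / 2 * τ - H ^ 2 * τ ^ 2) * Real.exp (-H ^ 2 * τ))

theorem continuousOn_triKer_inv (A B D : ℝ) {a ε : ℝ} (ha : -1 < a) (ha1 : a < 1) (hε : 0 < ε) :
    ContinuousOn (fun τ : ℝ => triKer A B D a ε τ⁻¹) (Ioi 0) :=
  (continuousOn_triKer A B D ha ha1 hε).comp
    (continuousOn_inv₀.mono fun _ hx => ne_of_gt hx) (fun _ hx => mem_Ioi.2 (inv_pos.2 (mem_Ioi.1 hx)))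

theorem integrableOn_exp_weight {H q : ℝ} (hH : 0 < H) (hq : q < 1) (n : ℕ) :
    IntegrableOn (fun τ : ℝ => (1 + τ⁻¹ ^ q) * (τ ^ n * Real.exp (-H ^ 2 * τ))) (Ioi 0) := by
  have h1 := integrableOn_exp_sq_mul_rpow (x := H) (s := n) hH
    (by have : (0 : ℝ) ≤ n := by positivity
        linarith)
  have h2 := integrableOn_exp_sq_mul_rpow (x := H) (s := n - q) hH
    (by have : (0 : ℝ) ≤ n := by positivity
        linarith)
  refine (h1.add h2).congr_fun (fun τ hτ => ?_) measurableSet_Ioi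
  have hτ : (0 : ℝ) < τ := hτ
  simp only [Pi.add_apply]
  rw [Real.rpow_sub hτ, Real.rpow_natCast, Real.inv_rpow hτ.le]
  field_simp

theorem LB_exp_neg_sq {H₁ H₂ τ : ℝ} (hH₁ : 0 < H₁) (hτ : 0 < τ) :
    LB (Icc H₁ H₂) (fun H => Real.exp (-H ^ 2 * τ)) ((1 + 2 * |H₂| * τ) * Real.exp (-H₁ ^ 2 * τ)) := by
  have h := LB.exp_neg (S := Icc H₁ H₂) (f := fun H => H ^ 2 * τ) (L := 2 * |H₂| * τ)
    (c := H₁ ^ 2 * τ) (fun x hx y hy => ?_) (by positivity) (fun x hx => ?_)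
  · simpa only [neg_mul] using h
  · have e : x ^ 2 * τ - y ^ 2 * τ = (x + y) * τ * (x - y) := by ring
    have hx0 := hH₁.trans_le hx.1
    have hy0 := hH₁.trans_le hy.1
    rw [e, abs_mul, abs_of_pos (by positivity)]
    have := le_abs_self H₂
    gcongr
    linarith [hx.2, hy.2]
  · have := hx.1
    gcongr

/-- The parameter ε stands for the separation, so uniformity over (0, 1] yields bounds and Lipschitz
constants in H that hold at all large distances simultaneously. The slack q < q' < 1 keeps τ^(-q')
integrable at 0. -/
theorem ULB_kap {H₁ H₂ : ℝ} (hH : 0 < H₁) {a A B D : ℝ → ℝ} {b p q : ℝ} (ha : LB (Icc H₁ H₂) a b)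
    (hA : LB (Icc H₁ H₂) A b) (hB : LB (Icc H₁ H₂) B b) (hD : LB (Icc H₁ H₂) D b) (hb : 0 ≤ b)
    (hp : 0 < p) (hpq : p ≤ q) (hq : q < 1) (hr : ∀ x ∈ Icc H₁ H₂, a x ∈ Icc p q) :
    ULB (Icc H₁ H₂) (Ioc (0 : ℝ) 1) (fun ε H => kap (A H) (B H) (D H) (a H) ε H) ∧
    ULB (Icc H₁ H₂) (Ioc (0 : ℝ) 1) (fun ε H => kapTwo (a H) ε H) := by
  obtain ⟨q', hq', hq1⟩ := exists_between hq
  have hq0 : 0 < q' := hp.trans_le (hpq.trans hq'.le)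
  obtain ⟨M, hM, h⟩ := exists_LB_triKer ha hA hB hD hb hp hq' hq1.le hq0 hr
  obtain ⟨M₁, hM₁, h₁⟩ := exists_LB_triKer (A := fun _ => 1) (B := fun _ => 0) (D := fun _ => 0)
    (b := b + 1) (ha.mono (by linarith)) ((LB.const 1).mono (by rw [abs_one]; linarith))
    ((LB.const 0).mono (by rw [abs_zero]; linarith))
    ((LB.const 0).mono (by rw [abs_zero]; linarith)) (by linarith) hp hq' hq1.le hq0 hr
  have i := fun n => integrableOn_exp_weight (H := H₁) (q := q') hH hq1 n
  have haa : ∀ x ∈ Icc H₁ H₂, -1 < a x ∧ a x < 1 := fun x hx =>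
    ⟨by linarith [(hr x hx).1], by linarith [(hr x hx).2]⟩
  have hsq := (LB.id (H₂ := H₂) hH).mul (LB.id hH)
  set c := 2 * ((H₂ + 1) * (H₂ + 1)) with hc
  have hc0 : 0 ≤ c := by rw [hc]; linarith [mul_self_nonneg (H₂ + 1)]
  constructor
  · refine ⟨_, fun ε hε => LB.integral (μ := volume.restrict (Ioi 0))
      (b := fun τ => 2 * M * ((1 + τ⁻¹ ^ q') * (τ ^ 0 * Real.exp (-H₁ ^ 2 * τ)))
        + 4 * M * |H₂| * ((1 + τ⁻¹ ^ q') * (τ ^ 1 * Real.exp (-H₁ ^ 2 * τ))))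
      (fun x hx => ((continuousOn_triKer_inv _ _ _ (haa x hx).1 (haa x hx).2 hε.1).mul
        (Continuous.continuousOn (by fun_prop))).aestronglyMeasurable measurableSet_Ioi)
      (((i 0).const_mul _).add ((i 1).const_mul _)) ?_⟩
    filter_upwards [ae_restrict_mem measurableSet_Ioi] with τ hτ
    have hτ : (0 : ℝ) < τ := hτ
    have ht : (0 : ℝ) < τ⁻¹ := inv_pos.2 hτ
    refine ((h ε τ⁻¹ hε.1.le hε.2 ht.le (by linarith [hε.1])).mul
      (LB_exp_neg_sq (H₂ := H₂) hH hτ)).mono (le_of_eq ?_)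
    ring
  · refine ⟨_, fun ε hε => LB.integral (μ := volume.restrict (Ioi 0))
      (b := fun τ => 6 * M₁ * ((1 + τ⁻¹ ^ q') * (τ ^ 1 * Real.exp (-H₁ ^ 2 * τ)))
        + (12 * M₁ * |H₂| + 4 * c * M₁) * ((1 + τ⁻¹ ^ q') * (τ ^ 2 * Real.exp (-H₁ ^ 2 * τ)))
        + 8 * c * M₁ * |H₂| * ((1 + τ⁻¹ ^ q') * (τ ^ 3 * Real.exp (-H₁ ^ 2 * τ))))
      (fun x hx => ((continuousOn_triKer_inv _ _ _ (haa x hx).1 (haa x hx).2 hε.1).mul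
        (Continuous.continuousOn (by fun_prop))).aestronglyMeasurable measurableSet_Ioi)
      ((((i 1).const_mul _).add ((i 2).const_mul _)).add ((i 3).const_mul _)) ?_⟩
    filter_upwards [ae_restrict_mem measurableSet_Ioi] with τ hτ
    have hτ : (0 : ℝ) < τ := hτ
    have ht : (0 : ℝ) < τ⁻¹ := inv_pos.2 hτ
    have h4 := ((LB.const (S := Icc H₁ H₂) (3 / 2 * τ)).sub (hsq.const_mul (τ ^ 2))).mul
      (LB_exp_neg_sq (H₂ := H₂) hH hτ)
    have h5 := (h₁ ε τ⁻¹ hε.1.le hε.2 ht.le (by linarith [hε.1])).mul h4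
    refine (h5.congr fun x _ => by ring).mono (le_of_eq ?_)
    rw [abs_of_pos (by positivity : 0 < 3 / 2 * τ), abs_of_pos (by positivity : 0 < τ ^ 2)]
    ring

/-- Only A + B survives. For the three Bunch-Davies kernels this sum is 1, 1 - a and (1 - a)², which
is the origin of the rank-one limit. -/
theorem tendsto_kap (A B D : ℝ) {a H : ℝ} (ha : 0 < a) (ha1 : a < 1) (hH : 0 < H) :
    Tendsto (fun ε => kap A B D a ε H) (𝓝[>] 0) (𝓝 ((A + B) *
      (Real.Gamma (2 * a + 1) * (Real.Gamma (1 - a) * H ^ (2 * a - 2))))) := by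
  obtain ⟨q', hq', hq1⟩ := exists_between ha1
  obtain ⟨M, hM, h⟩ := abs_triKer_le A B D ha hq' hq1.le
  have e : (A + B) * (Real.Gamma (2 * a + 1) * (Real.Gamma (1 - a) * H ^ (2 * a - 2)))
      = ∫ τ in Ioi (0 : ℝ), triKer A B D a 0 τ⁻¹ * Real.exp (-H ^ 2 * τ) := by
    have h1 := integral_exp_sq_mul_rpow (x := H) (s := -a) hH (by linarith)
    rw [show -a + 1 = 1 - a by ring, show -(2 * -a + 2) = 2 * a - 2 by ring] at h1
    rw [← h1, ← integral_const_mul, ← integral_const_mul]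
    refine setIntegral_congr_fun measurableSet_Ioi (fun τ hτ => ?_)
    have hτ : (0 : ℝ) < τ := hτ
    rw [triKer_zero A B D ha (inv_pos.2 hτ), Real.inv_rpow hτ.le, Real.rpow_neg hτ.le]
    ring
  rw [e]
  refine tendsto_integral_filter_of_dominated_convergence
    (fun τ => M * ((1 + τ⁻¹ ^ q') * (τ ^ 0 * Real.exp (-H ^ 2 * τ)))) ?_ ?_
    ((integrableOn_exp_weight hH hq1 0).const_mul M) ?_
  · filter_upwards [self_mem_nhdsWithin] with ε hε
    exact ((continuousOn_triKer_inv A B D (by linarith) ha1 hε).mul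
      (Continuous.continuousOn (by fun_prop))).aestronglyMeasurable measurableSet_Ioi
  · filter_upwards [Ioo_mem_nhdsGT one_pos] with ε hε
    filter_upwards [ae_restrict_mem measurableSet_Ioi] with τ hτ
    have hτ : (0 : ℝ) < τ := hτ
    have ht : (0 : ℝ) < τ⁻¹ := inv_pos.2 hτ
    rw [norm_mul, Real.norm_eq_abs, Real.norm_eq_abs, Real.abs_exp, pow_zero, one_mul, ← mul_assoc]
    gcongr
    exact h ε τ⁻¹ hε.1.le hε.2.le ht.le (by linarith [hε.1])
  · filter_upwards [ae_restrict_mem measurableSet_Ioi] with τ hτ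
    exact (tendsto_triKer A B D ha ha1 (inv_pos.2 hτ)).mul_const _

theorem abs_kap_le (A B D : ℝ) {a H : ℝ} (ha : 0 < a) (ha1 : a < 1) (hH : 0 < H) :
    ∃ M, ∀ ε, 0 < ε → ε ≤ 1 → |kap A B D a ε H| ≤ M ∧ |kapTwo a ε H| ≤ M := by
  set b := |a| + |A| + |B| + |D| with hb
  have h0 := abs_nonneg a
  have h1 := abs_nonneg A
  have h2 := abs_nonneg B
  have h3 := abs_nonneg D
  obtain ⟨⟨M, hM⟩, M', hM'⟩ := ULB_kap (H₁ := H) (H₂ := H) hH (b := b)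
    ((LB.const a).mono (by linarith)) ((LB.const A).mono (by linarith))
    ((LB.const B).mono (by linarith)) ((LB.const D).mono (by linarith)) (by positivity) ha le_rfl
    ha1 (fun _ _ => ⟨le_rfl, le_rfl⟩)
  refine ⟨max M M', fun ε e1 e2 => ⟨((hM ε ⟨e1, e2⟩).1 H (by simp)).trans (le_max_left _ _),
    ((hM' ε ⟨e1, e2⟩).1 H (by simp)).trans (le_max_right _ _)⟩⟩

/-! ### Covariances of distant modes -/

/-- The position space integrand for a translated second argument. -/
def shiftIntegrand (K₀ K₁ K₂ : ℝ → ℝ) (γ γ' : PhasePoint) (X : Space) (p : Space × Space) : ℝ :=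
  γ.f p.1 * γ'.f p.2 * K₀ ‖p.1 - p.2 - X‖
    + (γ.f p.1 * γ'.g p.2 + γ.g p.1 * γ'.f p.2) * K₁ ‖p.1 - p.2 - X‖
    + γ.g p.1 * γ'.g p.2 * K₂ ‖p.1 - p.2 - X‖

theorem posIntegrand_translate (K₀ K₁ K₂ : ℝ → ℝ) (γ γ' : PhasePoint) (X : Space)
    (p : Space × Space) : posIntegrand K₀ K₁ K₂ γ (γ'.translate X) (p + (0, X))
      = shiftIntegrand K₀ K₁ K₂ γ γ' X p := by
  simp only [posIntegrand, shiftIntegrand, PhasePoint.translate, shift, Prod.fst_add,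
    Prod.snd_add, add_zero, add_sub_cancel_right, sub_sub]

instance : (volume : Measure (Space × Space)).IsAddRightInvariant := by
  have h : ((volume : Measure Space).prod (volume : Measure Space)).IsAddHaarMeasure :=
    inferInstance
  rw [Measure.volume_eq_prod]
  infer_instance

theorem integral_posIntegrand_translate (K₀ K₁ K₂ : ℝ → ℝ) (γ γ' : PhasePoint) (X : Space) :
    ∫ p, posIntegrand K₀ K₁ K₂ γ (γ'.translate X) p = ∫ p, shiftIntegrand K₀ K₁ K₂ γ γ' X p := by
  rw [← integral_add_right_eq_self (μ := (volume : Measure (Space × Space)))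
    (posIntegrand K₀ K₁ K₂ γ (γ'.translate X)) (0, X)]
  simp only [posIntegrand_translate]

theorem integrable_shiftIntegrand {K₀ K₁ K₂ : ℝ → ℝ} {γ γ' : PhasePoint} {X : Space}
    (h : Integrable (posIntegrand K₀ K₁ K₂ γ (γ'.translate X))) :
    Integrable (shiftIntegrand K₀ K₁ K₂ γ γ' X) := by
  have := h.comp_add_right ((0, X) : Space × Space)
  simpa only [posIntegrand_translate] using this

/-- All smearing functions of a phase space element are supported in the ball of radius `R`. -/
def InBall (R : ℝ) (γ : PhasePoint) : Prop := ∀ x, (γ.f x ≠ 0 ∨ γ.g x ≠ 0) → ‖x‖ ≤ R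

theorem Mode.SupportedInBall.inBall {A : Mode} {R : ℝ} (h : A.SupportedInBall R) (i : Fin 2) :
    InBall R (A.γ i) := by
  intro x hx
  rcases hx with hx | hx
  · simpa using (h i).1 (subset_tsupport _ hx)
  · simpa using (h i).2 (subset_tsupport _ hx)

section

variable {γ γ' : PhasePoint} {R : ℝ}

theorem InBall.separated (h : InBall R γ) (h' : InBall R γ') (X : Space) :
    Separated (‖X‖ - 2 * R) γ (γ'.translate X) := by
  intro x y hx hy
  have h1 := h x hx
  have h2 := h' (y - X) hy
  have e : X = -(y - X) + x - (x - y) := by abel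
  have h3 : ‖X‖ ≤ ‖y - X‖ + ‖x‖ + ‖x - y‖ := by
    calc ‖X‖ = ‖-(y - X) + x - (x - y)‖ := by rw [← e]
      _ ≤ ‖-(y - X) + x‖ + ‖x - y‖ := norm_sub_le _ _
      _ ≤ ‖-(y - X)‖ + ‖x‖ + ‖x - y‖ := by gcongr; exact norm_add_le _ _
      _ = _ := by rw [norm_neg]
  linarith

theorem InBall.norm_mem (h : InBall R γ) (h' : InBall R γ') {X : Space} {p : Space × Space}
    (hp : γ.f p.1 ≠ 0 ∨ γ.g p.1 ≠ 0) (hp' : γ'.f p.2 ≠ 0 ∨ γ'.g p.2 ≠ 0) :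
    ‖X‖ - 2 * R ≤ ‖p.1 - p.2 - X‖ ∧ ‖p.1 - p.2 - X‖ ≤ ‖X‖ + 2 * R := by
  have h1 := h _ hp
  have h2 := h' _ hp'
  have h3 := norm_sub_le p.1 p.2
  have h4 := norm_sub_le (p.1 - p.2) X
  have h5 := norm_sub_norm_le X (p.1 - p.2)
  rw [norm_sub_rev X] at h5
  constructor <;> linarith

/-- The kernel bounds are only needed at distances comparable with the separation. -/
def Comparable (d r : ℝ) : Prop := 2 ≤ r ∧ d / 2 ≤ r ∧ r ≤ 2 * d

theorem InBall.comparable (h : InBall R γ) (h' : InBall R γ') {X : Space} {p : Space × Space}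
    (hX : 4 * R + 4 ≤ ‖X‖) (hR : 0 < R)
    (hp : γ.f p.1 ≠ 0 ∨ γ.g p.1 ≠ 0) (hp' : γ'.f p.2 ≠ 0 ∨ γ'.g p.2 ≠ 0) :
    Comparable ‖X‖ ‖p.1 - p.2 - X‖ := by
  obtain ⟨h1, h2⟩ := h.norm_mem h' (X := X) hp hp'
  exact ⟨by linarith, by linarith, by linarith⟩

/-- The integrable majorant of products of smearing functions. -/
def prodDom (γ γ' : PhasePoint) (p : Space × Space) : ℝ :=
  (|γ.f p.1| + |γ.g p.1|) * (|γ'.f p.2| + |γ'.g p.2|)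

theorem integrable_prodDom (γ γ' : PhasePoint) : Integrable (prodDom γ γ') :=
  Integrable.mul_prod (f := fun x => |γ.f x| + |γ.g x|) (g := fun y => |γ'.f y| + |γ'.g y|)
    (γ.integrable_f.abs.add γ.integrable_g.abs) (γ'.integrable_f.abs.add γ'.integrable_g.abs)

theorem LB_shiftIntegrand (h : InBall R γ) (h' : InBall R γ') (hR : 0 < R) {S : Set ℝ} {M : ℝ}
    {K₀ K₁ K₂ : ℝ → ℝ → ℝ} {X : Space} (hX : 4 * R + 4 ≤ ‖X‖)
    (hK : ∀ r, Comparable ‖X‖ r → LB S (fun H => K₀ H r) M ∧ LB S (fun H => K₁ H r) M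
      ∧ LB S (fun H => K₂ H r) M) (p : Space × Space) :
    LB S (fun H => shiftIntegrand (K₀ H) (K₁ H) (K₂ H) γ γ' X p) (M * prodDom γ γ' p) := by
  by_cases hp : γ.f p.1 ≠ 0 ∨ γ.g p.1 ≠ 0
  · by_cases hp' : γ'.f p.2 ≠ 0 ∨ γ'.g p.2 ≠ 0
    · obtain ⟨k0, k1, k2⟩ := hK _ (h.comparable h' hX hR hp hp')
      rcases S.eq_empty_or_nonempty with rfl | ⟨x₀, hx₀⟩
      · exact ⟨by simp, by simp⟩
      have hM := k0.nonneg hx₀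
      refine (((k0.const_mul (γ.f p.1 * γ'.f p.2)).add
        (k1.const_mul (γ.f p.1 * γ'.g p.2 + γ.g p.1 * γ'.f p.2))).add
        (k2.const_mul (γ.g p.1 * γ'.g p.2))).mono ?_
      have h1 : |γ.f p.1 * γ'.g p.2 + γ.g p.1 * γ'.f p.2|
          ≤ |γ.f p.1| * |γ'.g p.2| + |γ.g p.1| * |γ'.f p.2| := by
        rw [← abs_mul, ← abs_mul]; exact abs_add_le _ _
      have h2 := mul_le_mul_of_nonneg_right h1 hM
      rw [abs_mul, abs_mul, prodDom]
      linarith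
    · push Not at hp'
      have e : ∀ H, shiftIntegrand (K₀ H) (K₁ H) (K₂ H) γ γ' X p = 0 := fun H => by
        simp [shiftIntegrand, hp'.1, hp'.2]
      simp only [e, prodDom, hp'.1, hp'.2, abs_zero, add_zero, mul_zero]
      simpa using LB.const (S := S) 0
  · push Not at hp
    have e : ∀ H, shiftIntegrand (K₀ H) (K₁ H) (K₂ H) γ γ' X p = 0 := fun H => by
      simp [shiftIntegrand, hp.1, hp.2]
    simp only [e, prodDom, hp.1, hp.2, abs_zero, add_zero, mul_zero, zero_mul]
    simpa using LB.const (S := S) 0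

/-- Needed for dominated convergence along |Δx| → ∞; working with this filter makes all limits
uniform in the direction. -/
instance : (Bornology.cobounded Space).IsCountablyGenerated := by
  rw [← comap_norm_atTop]
  infer_instance

theorem tendsto_norm_sub_div (z : Space) :
    Tendsto (fun X : Space => ‖z - X‖ / ‖X‖) (Bornology.cobounded Space) (𝓝 1) := by
  have h1 : Tendsto (fun X : Space => ‖z‖ / ‖X‖) (Bornology.cobounded Space) (𝓝 0) :=
    tendsto_const_nhds.div_atTop tendsto_norm_cobounded_atTop
  have hev : ∀ᶠ X : Space in Bornology.cobounded Space, 0 < ‖X‖ :=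
    tendsto_norm_cobounded_atTop.eventually_gt_atTop 0
  have h2 : Tendsto (fun X : Space => 1 - ‖z‖ / ‖X‖) (Bornology.cobounded Space) (𝓝 1) := by
    simpa using tendsto_const_nhds.sub h1
  have h3 : Tendsto (fun X : Space => 1 + ‖z‖ / ‖X‖) (Bornology.cobounded Space) (𝓝 1) := by
    simpa using tendsto_const_nhds.add h1
  refine tendsto_of_tendsto_of_tendsto_of_le_of_le' h2 h3 ?_ ?_
  · filter_upwards [hev] with X hX
    rw [le_div_iff₀ hX, sub_mul, div_mul_cancel₀ _ hX.ne', one_mul]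
    have := norm_sub_norm_le X z
    rw [norm_sub_rev] at this
    linarith
  · filter_upwards [hev] with X hX
    rw [div_le_iff₀ hX, add_mul, div_mul_cancel₀ _ hX.ne', one_mul]
    have := norm_sub_le z X
    linarith

/-- Relative to |X| all distances between the supports tend to 1, so each rescaled kernel becomes a
constant and the double integral factorizes into products of spatial averages. -/
theorem tendsto_integral_shiftIntegrand (h : InBall R γ) (h' : InBall R γ') (hR : 0 < R)
    {K₀ K₁ K₂ : ℝ → ℝ → ℝ} {M c₀ c₁ c₂ : ℝ}
    (hm : ∀ X : Space, 4 * R + 4 ≤ ‖X‖ →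
      AEStronglyMeasurable (shiftIntegrand (K₀ ‖X‖) (K₁ ‖X‖) (K₂ ‖X‖) γ γ' X))
    (hb : ∀ d r, Comparable d r → |K₀ d r| ≤ M ∧ |K₁ d r| ≤ M ∧ |K₂ d r| ≤ M)
    (hl : ∀ r : Space → ℝ, Tendsto (fun X => r X / ‖X‖) (Bornology.cobounded Space) (𝓝 1) →
      Tendsto (fun X => K₀ ‖X‖ (r X)) (Bornology.cobounded Space) (𝓝 c₀) ∧
      Tendsto (fun X => K₁ ‖X‖ (r X)) (Bornology.cobounded Space) (𝓝 c₁) ∧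
      Tendsto (fun X => K₂ ‖X‖ (r X)) (Bornology.cobounded Space) (𝓝 c₂)) :
    Tendsto (fun X => ∫ p, shiftIntegrand (K₀ ‖X‖) (K₁ ‖X‖) (K₂ ‖X‖) γ γ' X p)
      (Bornology.cobounded Space)
      (𝓝 (c₀ * ((∫ x, γ.f x) * ∫ x, γ'.f x) + c₁ * ((∫ x, γ.f x) * (∫ x, γ'.g x)
        + (∫ x, γ.g x) * ∫ x, γ'.f x) + c₂ * ((∫ x, γ.g x) * ∫ x, γ'.g x))) := by
  have iff' := γ.integrable_f.mul_prod γ'.integrable_f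
  have ifg' := γ.integrable_f.mul_prod γ'.integrable_g
  have igf' := γ.integrable_g.mul_prod γ'.integrable_f
  have igg' := γ.integrable_g.mul_prod γ'.integrable_g
  have e : c₀ * ((∫ x, γ.f x) * ∫ x, γ'.f x) + c₁ * ((∫ x, γ.f x) * (∫ x, γ'.g x)
        + (∫ x, γ.g x) * ∫ x, γ'.f x) + c₂ * ((∫ x, γ.g x) * ∫ x, γ'.g x)
      = ∫ p : Space × Space, (γ.f p.1 * γ'.f p.2 * c₀
        + (γ.f p.1 * γ'.g p.2 + γ.g p.1 * γ'.f p.2) * c₁ + γ.g p.1 * γ'.g p.2 * c₂) := by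
    rw [← integral_prod_mul, ← integral_prod_mul, ← integral_prod_mul, ← integral_prod_mul]
    have s1 := integral_add ((iff'.mul_const c₀).add ((ifg'.add igf').mul_const c₁))
      (igg'.mul_const c₂)
    have s2 := integral_add (iff'.mul_const c₀) ((ifg'.add igf').mul_const c₁)
    have s3 := integral_add ifg' igf'
    simp only [Pi.add_apply, integral_mul_const] at s1 s2 s3
    rw [s2, s3] at s1
    refine Eq.trans ?_ s1.symm
    ring
  rw [e]
  refine tendsto_integral_filter_of_dominated_convergence (fun p => M * prodDom γ γ' p) ?_ ?_
    ((integrable_prodDom γ γ').const_mul M) (ae_of_all _ fun p => ?_)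
  · filter_upwards [tendsto_norm_cobounded_atTop.eventually_ge_atTop (4 * R + 4)] with X hX
      using hm X hX
  · filter_upwards [tendsto_norm_cobounded_atTop.eventually_ge_atTop (4 * R + 4)] with X hX
    refine ae_of_all _ fun p => ?_
    have := LB_shiftIntegrand h h' hR (S := {0}) (M := M) (K₀ := fun _ => K₀ ‖X‖)
      (K₁ := fun _ => K₁ ‖X‖) (K₂ := fun _ => K₂ ‖X‖) hX (fun r hr =>
        ⟨(LB.const _).mono (hb _ _ hr).1, (LB.const _).mono (hb _ _ hr).2.1,
          (LB.const _).mono (hb _ _ hr).2.2⟩) p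
    exact this.1 0 rfl
  · obtain ⟨l0, l1, l2⟩ := hl (fun X => ‖p.1 - p.2 - X‖) (tendsto_norm_sub_div _)
    exact ((l0.const_mul _).add (l1.const_mul _)).add (l2.const_mul _)

end

/-! ### The Minkowski vacuum at large separation -/

theorem mix_const_inv {r c : ℝ} (hr : 0 < r) : mix (fun _ => c) r = c * Real.sqrt Real.pi * r⁻¹ := by
  have h := mix_rpow (b := 0) hr (by norm_num)
  rw [zero_add, gamma_half] at h
  simp only [Real.rpow_zero] at h
  have h2 := mix_const_mul (fun _ => 1) c r
  simp only [mul_one] at h2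
  rw [h2, h, mul_assoc, show (-(2 * 0 + 1) : ℝ) = -1 by norm_num, Real.rpow_neg_one]

theorem lap_const (c r : ℝ) : lap (fun _ => c) 1 r = c := by
  have h := integral_exp_mul_rpow (p := 0) (by norm_num)
  rw [zero_add, Real.Gamma_one] at h
  simp only [Real.rpow_zero, mul_one] at h
  simp only [lap, one_pow, neg_mul, one_mul]
  rw [integral_const_mul, h, mul_one]

theorem lapTwo_const (c r : ℝ) : lapTwo (fun _ => c) 1 r = -(c / 2) := by
  have h1 := integral_exp_mul_rpow (p := 1) (by norm_num)
  have h2 := integral_exp_mul_rpow (p := 2) (by norm_num)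
  have i1 := (integrableOn_exp_mul_rpow (p := 1) (by norm_num)).const_mul (3 / 2)
  have i2 := integrableOn_exp_mul_rpow (p := 2) (by norm_num)
  rw [show (1 : ℝ) + 1 = 2 by norm_num, Real.Gamma_two] at h1
  rw [show (2 : ℝ) + 1 = 3 by norm_num, show (3 : ℝ) = ((2 : ℕ) : ℝ) + 1 by norm_num,
    Real.Gamma_nat_eq_factorial] at h2
  have h3 := integral_sub i1 i2
  rw [integral_const_mul, h1, h2] at h3
  simp only [lapTwo, one_pow, neg_mul, one_mul]
  rw [integral_const_mul]
  have e : ∫ τ in Ioi (0 : ℝ), (3 / 2 * τ - τ ^ 2) * Real.exp (-τ) = -(1 / 2) := by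
    refine Eq.trans (setIntegral_congr_fun measurableSet_Ioi (fun τ hτ => ?_)) (h3.trans ?_)
    · simp only [Real.rpow_one, Real.rpow_two]
      ring
    · norm_num
  rw [e]
  ring

/-- Normalized by `minkC` · √π = 1/2: the massless Minkowski spectral functions are mixtures of
constant densities, with the scale H set to 1. -/
def minkC : ℝ := 1 / (2 * Real.sqrt Real.pi)

theorem covMink_position {γ γ' : PhasePoint} {r₀ : ℝ} (hr : 0 < r₀) (hsep : Separated r₀ γ γ') :
    Integrable (posIntegrand (fun r => kerC 1 r * minkC) (fun _ => 0)
      (fun r => kerC 1 r * (4 / r ^ 2 * -(minkC / 2))) γ γ') ∧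
    covMink γ γ' = 2 * ((2 * Real.pi) ^ 3)⁻¹ * ∫ p : Space × Space,
      posIntegrand (fun r => kerC 1 r * minkC) (fun _ => 0)
        (fun r => kerC 1 r * (4 / r ^ 2 * -(minkC / 2))) γ γ' p := by
  have hb : ∀ c : ℝ, |c| ≤ minkC → MixBound minkC 0 (fun _ => c) := fun c hc =>
    ⟨continuousOn_const, fun w hw => by rw [Real.rpow_zero]; linarith [abs_nonneg c]⟩
  have hc : 0 < minkC := by
    have := Real.pi_pos
    unfold minkC; positivity
  have b1 := hb minkC (abs_of_pos hc).le
  have b0 := hb 0 (by rw [abs_zero]; exact hc.le)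
  have h := specCov_mix_eq b1 b0 b0 b1 le_rfl one_pos one_pos hr hsep
  have e0 : ∀ r, lap (fun _ => 0) 1 r = 0 := fun r => lap_const 0 r
  simp only [lap_const, lapTwo_const, mul_zero, zero_add] at h
  refine ⟨h.1, ?_⟩
  rw [← h.2, covMink_eq_specCov]
  have hs : minkC * Real.sqrt Real.pi = 1 / 2 := by
    have := (Real.sqrt_pos.2 Real.pi_pos).ne'
    unfold minkC
    field_simp
  rw [specCov_congr (fun r hr => ?_) (fun r hr => ?_) (fun r hr => ?_)]
  · simp only [div_one]
    rw [mix_const_inv hr, hs, Real.rpow_neg_one]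
  · simp only [div_one]
    rw [mix_const_inv hr]; ring
  · simp only [div_one]
    rw [mix_const_inv hr, mix_const_inv hr, hs, Real.rpow_one]
    have := hr.ne'
    field_simp
    ring

/-- The ff kernel is proportional to r^(-2) and the gg kernel to r^(-4), with no mixed kernel.
Multiplied by |X|², only the product of the averages of f survives. -/
theorem tendsto_covMink {γ γ' : PhasePoint} {R : ℝ} (h : InBall R γ) (h' : InBall R γ')
    (hR : 0 < R) :
    Tendsto (fun X => ‖X‖ ^ 2 * covMink γ (γ'.translate X)) (Bornology.cobounded Space)
      (𝓝 (2 * ((2 * Real.pi) ^ 3)⁻¹ * (4 * Real.pi ^ (3 / 2 : ℝ) * minkC)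
        * ((∫ x, γ.f x) * ∫ x, γ'.f x))) := by
  have hp := Real.pi_pos
  have hc : 0 < minkC := by unfold minkC; positivity
  set N := Real.pi ^ (3 / 2 : ℝ) * minkC with hN
  have hN0 : 0 < N := by positivity
  have key := tendsto_integral_shiftIntegrand h h' hR
    (K₀ := fun d r => d ^ 2 * (kerC 1 r * minkC)) (K₁ := fun _ _ => 0)
    (K₂ := fun d r => d ^ 2 * (kerC 1 r * (4 / r ^ 2 * -(minkC / 2)))) (M := 16 * N)
    (c₀ := 4 * N) (c₁ := 0) (c₂ := 0) ?_ ?_ ?_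
  · have k2 := key.const_mul (2 * ((2 * Real.pi) ^ 3)⁻¹)
    have e : 2 * ((2 * Real.pi) ^ 3)⁻¹ * (4 * Real.pi ^ (3 / 2 : ℝ) * minkC)
        * ((∫ x, γ.f x) * ∫ x, γ'.f x) = 2 * ((2 * Real.pi) ^ 3)⁻¹ *
        (4 * N * ((∫ x, γ.f x) * ∫ x, γ'.f x) + 0 * ((∫ x, γ.f x) * (∫ x, γ'.g x)
        + (∫ x, γ.g x) * ∫ x, γ'.f x) + 0 * ((∫ x, γ.g x) * ∫ x, γ'.g x)) := by rw [hN]; ring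
    rw [e]
    refine k2.congr' ?_
    filter_upwards [tendsto_norm_cobounded_atTop.eventually_ge_atTop (4 * R + 4)] with X hX
    have hs := covMink_position (r₀ := ‖X‖ - 2 * R) (by linarith) (h.separated h' X)
    rw [hs.2, integral_posIntegrand_translate, mul_left_comm, ← integral_const_mul (‖X‖ ^ 2)]
    congr 2
    funext p
    simp only [shiftIntegrand]
    ring
  · intro X hX
    have hs := (covMink_position (r₀ := ‖X‖ - 2 * R) (by linarith) (h.separated h' X)).1
    refine ((integrable_shiftIntegrand hs).const_mul (‖X‖ ^ 2)).aestronglyMeasurable.congr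
      (ae_of_all _ fun p => ?_)
    simp only [shiftIntegrand]
    ring
  · intro d r ⟨h1, h2, h3⟩
    have hr : 0 < r := by linarith
    have hd : 0 < d := by linarith
    have e1 : d ^ 2 * (kerC 1 r * minkC) = 4 * (d ^ 2 / r ^ 2) * N := by
      rw [hN, kerC]; ring
    have e2 : d ^ 2 * (kerC 1 r * (4 / r ^ 2 * -(minkC / 2)))
        = -(8 * (d ^ 2 / r ^ 2) / r ^ 2 * N) := by
      rw [hN, kerC]; ring
    have h4 : d ^ 2 / r ^ 2 ≤ 4 := by
      rw [div_le_iff₀ (by positivity)]; nlinarith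
    have h5 : (d ^ 2 / r ^ 2) / r ^ 2 ≤ 1 := by
      rw [div_le_one (by positivity)]; nlinarith
    refine ⟨?_, by rw [abs_zero]; positivity, ?_⟩
    · rw [e1, abs_of_pos (by positivity)]
      gcongr
      linarith
    · rw [e2, abs_neg, abs_of_pos (by positivity), mul_div_assoc]
      gcongr
      linarith
  · intro r hr
    have hev : ∀ᶠ X : Space in Bornology.cobounded Space, 0 < ‖X‖ :=
      tendsto_norm_cobounded_atTop.eventually_gt_atTop 0
    have h1 : Tendsto (fun X => ‖X‖ ^ 2 / r X ^ 2) (Bornology.cobounded Space) (𝓝 1) := by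
      have := (hr.inv₀ one_ne_zero).pow 2
      rw [inv_one, one_pow] at this
      refine this.congr fun X => ?_
      rw [inv_div, div_pow]
    have h0 : Tendsto (fun X => 4 * (‖X‖ ^ 2 / r X ^ 2) * N) (Bornology.cobounded Space)
        (𝓝 (4 * N)) := by
      simpa using (h1.const_mul 4).mul_const N
    refine ⟨h0.congr fun X => by rw [hN, kerC]; ring, tendsto_const_nhds, ?_⟩
    have h2 : Tendsto (fun X : Space => (‖X‖ ^ 2)⁻¹) (Bornology.cobounded Space) (𝓝 0) :=
      ((tendsto_pow_atTop two_ne_zero).comp tendsto_norm_cobounded_atTop).inv_tendsto_atTop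
    have h3 : Tendsto (fun X => -8 * N * ((‖X‖ ^ 2 / r X ^ 2) * (‖X‖ ^ 2 / r X ^ 2)
        * (‖X‖ ^ 2)⁻¹)) (Bornology.cobounded Space) (𝓝 0) := by
      simpa using ((h1.mul h1).mul h2).const_mul (-8 * N)
    refine h3.congr' ?_
    filter_upwards [hev] with X hX
    rw [hN, kerC]
    have := hX.ne'
    field_simp
    ring

/-! ### The Bunch-Davies covariance in position space -/

def bdN (a : ℝ) : ℝ := Real.pi / 4 * nichC a

theorem triKer_one (A B D : ℝ) {a w : ℝ} (ha : -1 < a) (ha1 : a < 1) (hw : 0 < w) :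
    triKer A B D a 1 w = A * rconfl a a w + B * (w * rconfl (a + 1) (a - 1) w)
      + D * rconfl (a + 1) (a - 1) w := by
  rw [triKer_eq A B D ha ha1 one_pos hw, Real.one_rpow, one_mul, div_one]

theorem triKer_one_div (A B D : ℝ) {a ε w : ℝ} (ha : -1 < a) (ha1 : a < 1) (hε : 0 < ε)
    (hw : 0 < w) : triKer A B D a 1 (w / ε) = (ε ^ a)⁻¹ * triKer A B D a ε w := by
  rw [triKer_one A B D ha ha1 (by positivity), triKer_eq A B D ha ha1 hε hw,
    inv_mul_cancel_left₀ (Real.rpow_pos_of_pos hε a).ne']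

theorem mix_triKer (c A B D : ℝ) {a x : ℝ} (ha : -1 < a) (ha1 : a < 1) (hx : 0 < x) :
    mix (fun w => c * triKer A B D a 1 w) x = c * (A * mix (rconfl a a) x
      + B * mix (fun w => w * rconfl (a + 1) (a - 1) w) x + D * mix (rconfl (a + 1) (a - 1)) x) := by
  have p0 := polyBdd_rconfl_self ha ha1
  have p1 := polyBdd_rconfl_one ha ha1
  rw [mix_const_mul, ← mix_const_mul (rconfl a a) A,
    ← mix_const_mul (fun w => w * rconfl (a + 1) (a - 1) w) B,
    ← mix_const_mul (rconfl (a + 1) (a - 1)) D, ← mix_add (p0.const_mul A) (p1.id_mul.const_mul B) hx,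
    ← mix_add ((p0.const_mul A).add (p1.id_mul.const_mul B)) (p1.const_mul D) hx]
  congr 1
  refine setIntegral_congr_fun measurableSet_Ioi (fun w hw => ?_)
  simp only
  rw [triKer_one A B D ha ha1 hw]

theorem bdP₀_eq_mix {a H r : ℝ} (ha : -1 < a) (ha1 : a < 1) (hH : 0 < H) (hr : 0 < r) :
    bdP₀ a H r = mix (fun w => bdN a / H * triKer 1 0 0 a 1 w) (r / H) := by
  rw [mix_triKer _ _ _ _ ha ha1 (by positivity), bdP₀, nichP, bdN]
  ring

theorem bdP₁_eq_mix {a H r : ℝ} (ha : -1 < a) (ha1 : a < 1) (hH : 0 < H) (hr : 0 < r) :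
    bdP₁ a H r = mix (fun w => bdN a * triKer 1 (-a) 0 a 1 w) (r / H) := by
  rw [mix_triKer _ _ _ _ ha ha1 (by positivity), bdP₁, nichP, nichQ, bdN]
  ring

/-- Collecting 9/4 P + 3/2 Q + R: the coefficient of the basic density is 9/4 - 3/2 + (a + 1/2)² = 1
+ a + a², while -3a comes from Q and -2a from R. The x² term of R stays separate. -/
theorem bdP₂_eq_mix {a H r : ℝ} (ha : -1 < a) (ha1 : a < 1) (hH : 0 < H) (hr : 0 < r) :
    bdP₂ a H r = mix (fun w => bdN a * H * triKer (1 + a + a ^ 2) (-3 * a) (-2 * a) a 1 w) (r / H)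
      + (r / H) ^ 2 * mix (fun w => bdN a * H * triKer 1 0 0 a 1 w) (r / H) := by
  rw [mix_triKer _ _ _ _ ha ha1 (by positivity), mix_triKer _ _ _ _ ha ha1 (by positivity),
    bdP₂, nichP, nichQ, nichR, bdN]
  ring

theorem lap_triKer (c A B D H : ℝ) {a r : ℝ} (ha : -1 < a) (ha1 : a < 1) (hr : 0 < r) :
    lap (fun w => c * triKer A B D a 1 w) H r
      = c * (((4 / r ^ 2) ^ a)⁻¹ * kap A B D a (4 / r ^ 2) H) := by
  rw [kap, ← integral_const_mul, ← integral_const_mul]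
  refine setIntegral_congr_fun measurableSet_Ioi (fun τ hτ => ?_)
  have hτ : (0 : ℝ) < τ := hτ
  have e : r ^ 2 / (4 * τ) = τ⁻¹ / (4 / r ^ 2) := by field_simp
  simp only
  rw [e, triKer_one_div A B D ha ha1 (by positivity) (inv_pos.2 hτ)]
  ring

theorem lapTwo_triKer (c H : ℝ) {a r : ℝ} (ha : -1 < a) (ha1 : a < 1) (hr : 0 < r) :
    lapTwo (fun w => c * triKer 1 0 0 a 1 w) H r
      = c * (((4 / r ^ 2) ^ a)⁻¹ * kapTwo a (4 / r ^ 2) H) := by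
  rw [kapTwo, ← integral_const_mul, ← integral_const_mul]
  refine setIntegral_congr_fun measurableSet_Ioi (fun τ hτ => ?_)
  have hτ : (0 : ℝ) < τ := hτ
  have e : r ^ 2 / (4 * τ) = τ⁻¹ / (4 / r ^ 2) := by field_simp
  simp only
  rw [e, triKer_one_div 1 0 0 ha ha1 (by positivity) (inv_pos.2 hτ)]
  ring

/-- The decay rate (4/r²)^(1-a) is paired with the compensating factor (d²)^(1-a), so for r
comparable with d the prefactor is bounded uniformly in both. -/
def bdPref (a H d r : ℝ) : ℝ :=
  Real.pi ^ (3 / 2 : ℝ) * H ^ 2 * bdN a * (d ^ 2 * (4 / r ^ 2)) ^ (1 - a)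

/-- The position space kernels, rescaled at the separation `d`. -/
def bdKer₀ (a H d r : ℝ) : ℝ := bdPref a H d r * kap 1 0 0 a (4 / r ^ 2) H

def bdKer₁ (a H d r : ℝ) : ℝ := bdPref a H d r * (H * kap 1 (-a) 0 a (4 / r ^ 2) H)

def bdKer₂ (a H d r : ℝ) : ℝ := bdPref a H d r *
  (H ^ 2 * (kap (1 + a + a ^ 2) (-3 * a) (-2 * a) a (4 / r ^ 2) H
    + 4 / r ^ 2 * kapTwo a (4 / r ^ 2) H))

theorem mixBound_triKer (c A B D : ℝ) {a q : ℝ} (ha : 0 < a) (ha1 : a < 1) (hq : a < q)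
    (hq1 : q ≤ 1) : ∃ M, MixBound M q (fun w => c * triKer A B D a 1 w) := by
  obtain ⟨M, hM, h⟩ := abs_triKer_le A B D ha hq hq1
  refine ⟨|c| * M, continuousOn_const.mul (continuousOn_triKer A B D (by linarith) ha1 one_pos),
    fun w hw => ?_⟩
  rw [abs_mul, mul_assoc]
  gcongr
  exact h 1 w zero_le_one le_rfl hw.le (by linarith)

theorem MixBound.mono {K K' b : ℝ} {f : ℝ → ℝ} (h : MixBound K b f) (hK : K ≤ K') :
    MixBound K' b f :=
  ⟨h.cont, fun w hw => (h.bdd w hw).trans (by gcongr)⟩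

theorem covBD_position {a H m d r₀ : ℝ} (ha : 0 < a) (ha1 : a < 1) (hH : 0 < H)
    (hm : bdOrder H m = a + 1 / 2) (hd : 0 < d) (hr : 0 < r₀) {γ γ' : PhasePoint}
    (hsep : Separated r₀ γ γ') :
    Integrable (posIntegrand (bdKer₀ a H d) (bdKer₁ a H d) (bdKer₂ a H d) γ γ') ∧
    (d ^ 2) ^ (1 - a) * covBD H m γ γ' = 2 * ((2 * Real.pi) ^ 3)⁻¹ *
      ∫ p, posIntegrand (bdKer₀ a H d) (bdKer₁ a H d) (bdKer₂ a H d) γ γ' p := by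
  have ham : -1 < a := by linarith
  obtain ⟨q, hq, hq1⟩ := exists_between ha1
  obtain ⟨M₀, h₀⟩ := mixBound_triKer (bdN a / H) 1 0 0 ha ha1 hq hq1.le
  obtain ⟨M₁, h₁⟩ := mixBound_triKer (bdN a) 1 (-a) 0 ha ha1 hq hq1.le
  obtain ⟨M₂, h₂⟩ := mixBound_triKer (bdN a * H) (1 + a + a ^ 2) (-3 * a) (-2 * a) ha ha1 hq hq1.le
  obtain ⟨M₃, h₃⟩ := mixBound_triKer (bdN a * H) 1 0 0 ha ha1 hq hq1.le
  have p0 := h₀.nonneg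
  have p1 := h₁.nonneg
  have p2 := h₂.nonneg
  have p3 := h₃.nonneg
  obtain ⟨hi, hc⟩ := specCov_mix_eq (K := M₀ + M₁ + M₂ + M₃) (h₀.mono (by linarith))
    (h₁.mono (by linarith)) (h₂.mono (by linarith)) (h₃.mono (by linarith)) (ha.trans hq).le hq1 hH
    hr hsep
  have hk : ∀ c A B D r : ℝ, 0 ≤ r → (d ^ 2) ^ (1 - a) * (kerC H r * lap
      (fun w => c * triKer A B D a 1 w) H r) = Real.pi ^ (3 / 2 : ℝ) * H ^ 3 * c *
        (d ^ 2 * (4 / r ^ 2)) ^ (1 - a) * kap A B D a (4 / r ^ 2) H := by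
    intro c A B D r hr0
    -- On the diagonal r = 0 both sides are 0 under division by zero, the right one because 0^(1-a)
    -- = 0.
    rcases hr0.eq_or_lt with rfl | hr0
    · simp [kerC, Real.zero_rpow (sub_pos.2 ha1).ne']
    · have hε : 0 < 4 / r ^ 2 := by positivity
      rw [lap_triKer c A B D H ham ha1 hr0, Real.mul_rpow (by positivity) hε.le,
        Real.rpow_sub hε, Real.rpow_one, kerC]
      ring
  have hk2 : ∀ c r : ℝ, 0 ≤ r → (d ^ 2) ^ (1 - a) * (kerC H r * (4 / r ^ 2 * lapTwo
      (fun w => c * triKer 1 0 0 a 1 w) H r)) = Real.pi ^ (3 / 2 : ℝ) * H ^ 3 * c *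
        (d ^ 2 * (4 / r ^ 2)) ^ (1 - a) * (4 / r ^ 2 * kapTwo a (4 / r ^ 2) H) := by
    intro c r hr0
    rcases hr0.eq_or_lt with rfl | hr0
    · simp
    · have hε : 0 < 4 / r ^ 2 := by positivity
      rw [lapTwo_triKer c H ham ha1 hr0, Real.mul_rpow (by positivity) hε.le,
        Real.rpow_sub hε, Real.rpow_one, kerC]
      ring
  have hpt : ∀ p, (d ^ 2) ^ (1 - a) * posIntegrand
      (fun r => kerC H r * lap (fun w => bdN a / H * triKer 1 0 0 a 1 w) H r)
      (fun r => kerC H r * lap (fun w => bdN a * triKer 1 (-a) 0 a 1 w) H r)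
      (fun r => kerC H r * (lap (fun w => bdN a * H
        * triKer (1 + a + a ^ 2) (-3 * a) (-2 * a) a 1 w) H r
        + 4 / r ^ 2 * lapTwo (fun w => bdN a * H * triKer 1 0 0 a 1 w) H r)) γ γ' p
      = posIntegrand (bdKer₀ a H d) (bdKer₁ a H d) (bdKer₂ a H d) γ γ' p := by
    intro p
    have hn := norm_nonneg (p.1 - p.2)
    have k0 := hk (bdN a / H) 1 0 0 _ hn
    have k1 := hk (bdN a) 1 (-a) 0 _ hn
    have k2 := hk (bdN a * H) (1 + a + a ^ 2) (-3 * a) (-2 * a) _ hn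
    have k3 := hk2 (bdN a * H) _ hn
    have c0 : Real.pi ^ (3 / 2 : ℝ) * H ^ 3 * (bdN a / H) = Real.pi ^ (3 / 2 : ℝ) * H ^ 2 * bdN a := by
      field_simp
    rw [c0] at k0
    simp only [posIntegrand, bdKer₀, bdKer₁, bdKer₂, bdPref]
    linear_combination (γ.f p.1 * γ'.f p.2) * k0
      + (γ.f p.1 * γ'.g p.2 + γ.g p.1 * γ'.f p.2) * k1 + (γ.g p.1 * γ'.g p.2) * (k2 + k3)
  have hi' := hi.const_mul ((d ^ 2) ^ (1 - a))
  simp only [hpt] at hi'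
  refine ⟨hi', ?_⟩
  rw [covBD_eq_specCov ham ha1 hH hm, specCov_congr (fun r hr => bdP₀_eq_mix ham ha1 hH hr)
    (fun r hr => bdP₁_eq_mix ham ha1 hH hr) (fun r hr => bdP₂_eq_mix ham ha1 hH hr), hc,
    mul_left_comm, ← integral_const_mul]
  simp only [hpt]

theorem Comparable.ratio_mem {d r : ℝ} (h : Comparable d r) (hd : 0 < d) :
    0 < d ^ 2 * (4 / r ^ 2) ∧ d ^ 2 * (4 / r ^ 2) ≤ 16 ∧ 4 / r ^ 2 ∈ Ioc (0 : ℝ) 1 := by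
  obtain ⟨h1, h2, h3⟩ := h
  have hr : 0 < r := by linarith
  refine ⟨by positivity, ?_, by positivity, ?_⟩
  · rw [← mul_div_assoc, div_le_iff₀ (by positivity)]; nlinarith
  · rw [div_le_one (by positivity)]; nlinarith

def bdLim (a H : ℝ) : ℝ := 2 * ((2 * Real.pi) ^ 3)⁻¹ * (Real.pi ^ (3 / 2 : ℝ) * H ^ 2 * bdN a
  * 4 ^ (1 - a) * (Real.Gamma (2 * a + 1) * (Real.Gamma (1 - a) * H ^ (2 * a - 2))))

theorem bdN_pos {a : ℝ} (ha : -1 < a) : 0 < bdN a := by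
  have := Real.pi_pos
  have g1 : 0 < Real.Gamma (a + 1) := Real.Gamma_pos_of_pos (by linarith)
  unfold bdN nichC; positivity

theorem bdLim_pos {a H : ℝ} (ha : 0 < a) (ha1 : a < 1) (hH : 0 < H) : 0 < bdLim a H := by
  have := Real.pi_pos
  have g1 := bdN_pos (a := a) (by linarith)
  have g2 : 0 < Real.Gamma (2 * a + 1) := Real.Gamma_pos_of_pos (by linarith)
  have g3 : 0 < Real.Gamma (1 - a) := Real.Gamma_pos_of_pos (by linarith)
  unfold bdLim; positivity

theorem tendsto_covBD {a H m R : ℝ} (ha : 0 < a) (ha1 : a < 1) (hH : 0 < H)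
    (hm : bdOrder H m = a + 1 / 2) {γ γ' : PhasePoint} (h : InBall R γ) (h' : InBall R γ')
    (hR : 0 < R) :
    Tendsto (fun X => (‖X‖ ^ 2) ^ (1 - a) * covBD H m γ (γ'.translate X))
      (Bornology.cobounded Space) (𝓝 (bdLim a H * (((∫ x, γ.f x) + H * (1 - a) * ∫ x, γ.g x)
        * ((∫ x, γ'.f x) + H * (1 - a) * ∫ x, γ'.g x)))) := by
  have hpi := Real.pi_pos
  have ham : -1 < a := by linarith
  have hN := bdN_pos ham
  set k := Real.Gamma (2 * a + 1) * (Real.Gamma (1 - a) * H ^ (2 * a - 2)) with hk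
  set N := Real.pi ^ (3 / 2 : ℝ) * H ^ 2 * bdN a with hNN
  have hN0 : 0 < N := by positivity
  obtain ⟨M₀, b0⟩ := abs_kap_le 1 0 0 ha ha1 hH
  obtain ⟨M₁, b1⟩ := abs_kap_le 1 (-a) 0 ha ha1 hH
  obtain ⟨M₂, b2⟩ := abs_kap_le (1 + a + a ^ 2) (-3 * a) (-2 * a) ha ha1 hH
  have n0 := (abs_nonneg _).trans (b0 1 one_pos le_rfl).1
  have n1 := (abs_nonneg _).trans (b1 1 one_pos le_rfl).1
  have n2 := (abs_nonneg _).trans (b2 1 one_pos le_rfl).1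
  set W := M₀ + H * M₁ + H ^ 2 * (M₂ + M₂) with hW
  have key := tendsto_integral_shiftIntegrand h h' hR (K₀ := bdKer₀ a H) (K₁ := bdKer₁ a H)
    (K₂ := bdKer₂ a H) (M := N * 16 ^ (1 - a) * W) (c₀ := N * 4 ^ (1 - a) * k)
    (c₁ := N * 4 ^ (1 - a) * k * (H * (1 - a))) (c₂ := N * 4 ^ (1 - a) * k * (H * (1 - a)) ^ 2)
    ?_ ?_ ?_
  · have k2 := key.const_mul (2 * ((2 * Real.pi) ^ 3)⁻¹)
    refine (k2.congr' ?_).trans (le_of_eq ?_)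
    · filter_upwards [tendsto_norm_cobounded_atTop.eventually_ge_atTop (4 * R + 4)] with X hX
      have hs := covBD_position ha ha1 hH hm (d := ‖X‖) (r₀ := ‖X‖ - 2 * R) (by linarith)
        (by linarith) (h.separated h' X)
      rw [hs.2, integral_posIntegrand_translate]
    · congr 1
      rw [bdLim]
      ring
  · intro X hX
    exact (integrable_shiftIntegrand (covBD_position ha ha1 hH hm (d := ‖X‖) (r₀ := ‖X‖ - 2 * R)
      (by linarith) (by linarith) (h.separated h' X)).1).aestronglyMeasurable
  · intro d r hdr
    have hd : 0 < d := by linarith [hdr.1, hdr.2.2]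
    obtain ⟨t0, t1, e⟩ := hdr.ratio_mem hd
    have hp : |bdPref a H d r| ≤ N * 16 ^ (1 - a) := by
      rw [bdPref, abs_of_pos (by positivity)]
      gcongr
    have w0 : 0 ≤ N * (16 : ℝ) ^ (1 - a) := by positivity
    refine ⟨?_, ?_, ?_⟩
    · rw [bdKer₀, abs_mul]
      refine mul_le_mul hp ((b0 _ e.1 e.2).1.trans ?_) (abs_nonneg _) w0
      have : 0 ≤ H * M₁ + H ^ 2 * (M₂ + M₂) := by positivity
      linarith
    · rw [bdKer₁, abs_mul, abs_mul, abs_of_pos hH]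
      refine mul_le_mul hp ?_ (by positivity) w0
      have : 0 ≤ M₀ + H ^ 2 * (M₂ + M₂) := by positivity
      have : H * |kap 1 (-a) 0 a (4 / r ^ 2) H| ≤ H * M₁ := by
        gcongr; exact (b1 _ e.1 e.2).1
      linarith
    · rw [bdKer₂, abs_mul, abs_mul, abs_of_pos (by positivity : 0 < H ^ 2)]
      refine mul_le_mul hp ?_ (by positivity) w0
      have : 0 ≤ M₀ + H * M₁ := by positivity
      have h3 : |kap (1 + a + a ^ 2) (-3 * a) (-2 * a) a (4 / r ^ 2) H
          + 4 / r ^ 2 * kapTwo a (4 / r ^ 2) H| ≤ M₂ + M₂ := by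
        refine (abs_add_le _ _).trans (add_le_add (b2 _ e.1 e.2).1 ?_)
        rw [abs_mul, abs_of_pos e.1]
        exact (mul_le_of_le_one_left (abs_nonneg _) e.2).trans (b2 _ e.1 e.2).2
      have h4 : H ^ 2 * |kap (1 + a + a ^ 2) (-3 * a) (-2 * a) a (4 / r ^ 2) H
          + 4 / r ^ 2 * kapTwo a (4 / r ^ 2) H| ≤ H ^ 2 * (M₂ + M₂) := by gcongr
      linarith
  · intro r hr
    have hev : ∀ᶠ X : Space in Bornology.cobounded Space, 0 < ‖X‖ :=
      tendsto_norm_cobounded_atTop.eventually_gt_atTop 0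
    have hrat : Tendsto (fun X => ‖X‖ ^ 2 * (4 / r X ^ 2)) (Bornology.cobounded Space) (𝓝 4) := by
      have := ((hr.inv₀ one_ne_zero).pow 2).const_mul 4
      rw [inv_one, one_pow, mul_one] at this
      refine this.congr fun X => ?_
      rw [inv_div, div_pow]
      ring
    have hpref : Tendsto (fun X => bdPref a H ‖X‖ (r X)) (Bornology.cobounded Space)
        (𝓝 (N * 4 ^ (1 - a))) :=
      (hrat.rpow_const (Or.inl (by norm_num))).const_mul N
    have heps : Tendsto (fun X => 4 / r X ^ 2) (Bornology.cobounded Space) (𝓝[>] 0) := by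
      refine tendsto_nhdsWithin_iff.2 ⟨?_, ?_⟩
      · have h2 : Tendsto (fun X : Space => (‖X‖ ^ 2)⁻¹) (Bornology.cobounded Space) (𝓝 0) :=
          ((tendsto_pow_atTop two_ne_zero).comp tendsto_norm_cobounded_atTop).inv_tendsto_atTop
        have h3 := hrat.mul h2
        rw [mul_zero] at h3
        refine h3.congr' ?_
        filter_upwards [hev] with X hX
        field_simp
      · filter_upwards [hrat.eventually (lt_mem_nhds (by norm_num : (0 : ℝ) < 4)), hev] with X hX h0
        exact (pos_iff_pos_of_mul_pos hX).1 (by positivity)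
    have t0 := (tendsto_kap 1 0 0 ha ha1 hH).comp heps
    have t1 := (tendsto_kap 1 (-a) 0 ha ha1 hH).comp heps
    have t2 := (tendsto_kap (1 + a + a ^ 2) (-3 * a) (-2 * a) ha ha1 hH).comp heps
    have t3 : Tendsto (fun X => 4 / r X ^ 2 * kapTwo a (4 / r X ^ 2) H)
        (Bornology.cobounded Space) (𝓝 0) := by
      refine squeeze_zero_norm' (a := fun X => 4 / r X ^ 2 * M₀) ?_ (by
        simpa using (heps.mono_right nhdsWithin_le_nhds).mul_const M₀)
      filter_upwards [heps (Ioo_mem_nhdsGT one_pos)] with X hX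
      rw [norm_mul, Real.norm_of_nonneg hX.1.le]
      gcongr
      exact (b0 _ hX.1 hX.2.le).2
    -- A perfect square: the limiting gg coefficient is the square of the mixed one relative to ff,
    -- so the limit factorizes as (∫f + Hμ²∫g)(∫f' + Hμ²∫g').
    have e2 : (1 + a + a ^ 2 + -3 * a) = (1 - a) ^ 2 := by ring
    rw [e2] at t2
    refine ⟨(hpref.mul t0).trans (le_of_eq ?_), (hpref.mul (t1.const_mul H)).trans (le_of_eq ?_),
      (hpref.mul ((t2.add t3).const_mul (H ^ 2))).trans (le_of_eq ?_)⟩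
    · congr 1; ring
    · congr 1; ring
    · congr 1; ring

/-! ### Uniform Lipschitz dependence on the Hubble rate -/

/-- The order `a = ν - 1/2` depends on the Hubble rate in a Lipschitz way, inside `(0, 1)`. -/
structure OrderFamily (m H₁ H₂ : ℝ) (a : ℝ → ℝ) (b p q : ℝ) : Prop where
  pos : 0 < H₁
  lb : LB (Icc H₁ H₂) a b
  bpos : 0 ≤ b
  ppos : 0 < p
  ple : p ≤ q
  qlt : q < 1
  mem : ∀ H ∈ Icc H₁ H₂, a H ∈ Icc p q
  order : ∀ H ∈ Icc H₁ H₂, bdOrder H m = a H + 1 / 2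

section

variable {m H₁ H₂ b p q : ℝ} {a : ℝ → ℝ}

theorem OrderFamily.exists_coeff (O : OrderFamily m H₁ H₂ a b p q) : ∃ B, 0 ≤ B ∧ b ≤ B ∧
    LB (Icc H₁ H₂) (fun _ => 1) B ∧ LB (Icc H₁ H₂) (fun _ => 0) B ∧
    LB (Icc H₁ H₂) (fun H => -a H) B ∧ LB (Icc H₁ H₂) (fun H => 1 + a H + a H ^ 2) B ∧
    LB (Icc H₁ H₂) (fun H => -3 * a H) B ∧ LB (Icc H₁ H₂) (fun H => -2 * a H) B := by
  have hb := O.bpos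
  have l1 := LB.const (S := Icc H₁ H₂) 1
  have l2 := ((l1.add O.lb).add (O.lb.mul O.lb)).congr (g := fun H => 1 + a H + a H ^ 2)
    (fun x _ => by ring)
  have l3 := O.lb.const_mul (-3)
  have l4 := O.lb.const_mul (-2)
  rw [abs_neg, abs_of_pos (by norm_num : (0 : ℝ) < 3)] at l3
  rw [abs_neg, abs_of_pos (by norm_num : (0 : ℝ) < 2)] at l4
  rw [abs_one] at l1 l2
  have hbb := mul_nonneg hb hb
  exact ⟨1 + 3 * b + 2 * (b * b), by positivity, by linarith, l1.mono (by linarith),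
    (LB.const 0).mono (by rw [abs_zero]; positivity), O.lb.neg.mono (by linarith),
    l2.mono (by linarith), l3.mono (by linarith), l4.mono (by linarith)⟩

theorem OrderFamily.LB_bdN (O : OrderFamily m H₁ H₂ a b p q) :
    ∃ B, LB (Icc H₁ H₂) (fun H => bdN (a H)) B := by
  obtain ⟨B, hB, hbB, l1, l0, -⟩ := O.exists_coeff
  obtain ⟨M, hM, h⟩ := exists_LB_triKer (O.lb.mono hbB) l1 l0 l0 hB O.ppos O.qlt le_rfl one_pos O.mem
  -- At ε = 1 and w = 0 the kernel reduces to Γ(a + 1), so the Gamma function inherits its Lipschitz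
  -- bound in H from the general estimate.
  have h1 := h 1 0 zero_le_one le_rfl le_rfl (by norm_num)
  have h2 : LB (Icc H₁ H₂) (fun H => Real.Gamma (a H + 1)) (M * (1 + 0 ^ (1 : ℝ))) :=
    h1.congr fun H hH => by
      rw [← integral_exp_mul_rpow (by linarith [(O.mem H hH).1, O.ppos])]
      simp [triKer, triInt]
  obtain ⟨c, hc, hle⟩ := h2.exists_pos_le isCompact_Icc
    (fun H hH => Real.Gamma_pos_of_pos (by linarith [(O.mem H hH).1, O.ppos]))
  refine ⟨_, ((h2.inv hc hle).const_mul (Real.pi / 4 * (2 / (Real.pi * Real.sqrt Real.pi)))).congr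
    fun H _ => ?_⟩
  simp only [bdN, nichC]
  rw [mul_assoc, ← div_eq_mul_inv, div_div]

/-- One constant M serves all distances: the pairs (d, r) are the index set of the uniform families,
and ε = 4/r² stays in (0, 1] on them. -/
theorem OrderFamily.LB_bdKer (O : OrderFamily m H₁ H₂ a b p q) :
    ∃ M, ∀ d r, 0 < d → Comparable d r →
      LB (Icc H₁ H₂) (fun H => bdKer₀ (a H) H d r) M ∧
      LB (Icc H₁ H₂) (fun H => bdKer₁ (a H) H d r) M ∧
      LB (Icc H₁ H₂) (fun H => bdKer₂ (a H) H d r) M := by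
  obtain ⟨B, hB, hbB, l1, l0, la, l2, l3, l4⟩ := O.exists_coeff
  have lab := O.lb.mono hbB
  set T : Set (ℝ × ℝ) := {z | 0 < z.1 ∧ Comparable z.1 z.2} with hT
  have hmap : ∀ z ∈ T, 4 / z.2 ^ 2 ∈ Ioc (0 : ℝ) 1 := fun z hz => (hz.2.ratio_mem hz.1).2.2
  obtain ⟨k0, kt⟩ := ULB_kap O.pos lab l1 l0 l0 hB O.ppos O.ple O.qlt O.mem
  have k1 := (ULB_kap O.pos lab l1 la l0 hB O.ppos O.ple O.qlt O.mem).1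
  have k2 := (ULB_kap O.pos lab l2 l3 l4 hB O.ppos O.ple O.qlt O.mem).1
  replace k0 := k0.comp (T' := T) (φ := fun z => 4 / z.2 ^ 2) hmap
  replace k1 := k1.comp (T' := T) (φ := fun z => 4 / z.2 ^ 2) hmap
  replace k2 := k2.comp (T' := T) (φ := fun z => 4 / z.2 ^ 2) hmap
  replace kt := kt.comp (T' := T) (φ := fun z => 4 / z.2 ^ 2) hmap
  obtain ⟨BN, hBN⟩ := O.LB_bdN
  have uH : ULB (Icc H₁ H₂) T (fun _ H => H) := ULB.of_LB (LB.id O.pos)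
  have uH2 := uH.mul uH
  have u1a : LB (Icc H₁ H₂) (fun H => 1 - a H) (|1| + b) := (LB.const 1).sub O.lb
  have upow : ULB (Icc H₁ H₂) T (fun z H => (z.1 ^ 2 * (4 / z.2 ^ 2)) ^ (1 - a H)) := by
    have hq : 0 < 1 - q := by linarith [O.qlt]
    have hp : 1 - p < 1 := by linarith [O.ppos]
    -- The exponent 1 - a stays in [1 - q, 1 - p] inside (0, 1), so `LB.rpow` applies with q' = 1;
    -- the 17 is 1 plus the bound 16 on d² · 4/r².
    refine ⟨_, fun z hz => (u1a.rpow hq hp (fun H hH => ⟨by linarith [(O.mem H hH).2],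
      by linarith [(O.mem H hH).1]⟩) (hz.2.ratio_mem hz.1).1).mono (mul_le_mul_of_nonneg_left
      (c := 17) ?_ ?_)⟩
    · rw [Real.rpow_one]; linarith [(hz.2.ratio_mem hz.1).2.1]
    · have := O.bpos
      have : 0 < 1 - (1 - p) := by linarith [O.ppos]
      rw [abs_one]
      positivity
  have upref : ULB (Icc H₁ H₂) T (fun z H => bdPref (a H) H z.1 z.2) :=
    (((ULB.const (Real.pi ^ (3 / 2 : ℝ))).mul uH2).mul (ULB.of_LB hBN)).mul upow |>.congr
      fun z _ H _ => by simp only [bdPref]; ring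
  have ueps : ULB (Icc H₁ H₂) T (fun z _ => 4 / z.2 ^ 2) := ⟨1, fun z hz => (LB.const _).mono (by
    rw [abs_of_pos (hmap z hz).1]; exact (hmap z hz).2)⟩
  obtain ⟨M₀, h₀⟩ := upref.mul k0
  obtain ⟨M₁, h₁⟩ := upref.mul (uH.mul k1)
  obtain ⟨M₂, h₂⟩ := (upref.mul (uH2.mul (k2.add (ueps.mul kt)))).congr
    (G := fun z H => bdKer₂ (a H) H z.1 z.2) fun z _ H _ => by simp only [bdKer₂]; ring
  exact ⟨max M₀ (max M₁ M₂), fun d r hd hdr => ⟨(h₀ (d, r) ⟨hd, hdr⟩).mono (le_max_left _ _),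
    (h₁ (d, r) ⟨hd, hdr⟩).mono ((le_max_left _ _).trans (le_max_right _ _)),
    (h₂ (d, r) ⟨hd, hdr⟩).mono ((le_max_right _ _).trans (le_max_right _ _))⟩⟩

theorem OrderFamily.ULB_cross (O : OrderFamily m H₁ H₂ a b p q) {R : ℝ} {γ γ' : PhasePoint}
    (h : InBall R γ) (h' : InBall R γ') (hR : 0 < R) :
    ULB (Icc H₁ H₂) {X : Space | 4 * R + 4 ≤ ‖X‖}
      (fun X H => (‖X‖ ^ 2) ^ (1 - a H) * covBD H m γ (γ'.translate X)) := by
  obtain ⟨M, hM⟩ := O.LB_bdKer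
  refine ⟨|2 * ((2 * Real.pi) ^ 3)⁻¹| * ∫ p, M * prodDom γ γ' p, fun X (hX : 4 * R + 4 ≤ ‖X‖) => ?_⟩
  have hX0 : 0 < ‖X‖ := by linarith
  have hpos := fun H (hH : H ∈ Icc H₁ H₂) =>
    covBD_position (O.ppos.trans_le (O.mem H hH).1) ((O.mem H hH).2.trans_lt O.qlt)
      (O.pos.trans_le hH.1) (O.order H hH) hX0 (r₀ := ‖X‖ - 2 * R) (by linarith) (h.separated h' X)
  have key := LB.integral (S := Icc H₁ H₂) (μ := (volume : Measure (Space × Space)))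
    (F := fun H => shiftIntegrand (bdKer₀ (a H) H ‖X‖) (bdKer₁ (a H) H ‖X‖)
      (bdKer₂ (a H) H ‖X‖) γ γ' X) (b := fun p => M * prodDom γ γ' p)
    (fun H hH => (integrable_shiftIntegrand (hpos H hH).1).aestronglyMeasurable)
    ((integrable_prodDom γ γ').const_mul M)
    (ae_of_all _ fun p => LB_shiftIntegrand h h' hR hX (fun r hr => hM ‖X‖ r hX0 hr) p)
  refine (key.const_mul (2 * ((2 * Real.pi) ^ 3)⁻¹)).congr fun H hH => ?_
  change _ = (‖X‖ ^ 2) ^ (1 - a H) * covBD H m γ (γ'.translate X)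
  rw [(hpos H hH).2, integral_posIntegrand_translate]

end

/-! ### Lipschitz dependence of the Bunch-Davies covariance on the Hubble rate -/

theorem continuousOn_bdP {a H : ℝ} (ha : -1 < a) (ha1 : a < 1) (hH : 0 < H) :
    ContinuousOn (bdP₀ a H) (Ioi 0) ∧ ContinuousOn (bdP₁ a H) (Ioi 0) ∧
      ContinuousOn (bdP₂ a H) (Ioi 0) := by
  obtain ⟨K, hK⟩ := bd_radialModes ha ha1 hH
  exact ⟨(hK.cont_u.norm.pow 2).congr fun r hr => (norm_bdU_sq ha ha1 hH hr).symm,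
    (Complex.continuous_re.comp_continuousOn (hK.cont_u.star.mul hK.cont_v)).congr
      fun r hr => (star_bdU_mul_bdV ha ha1 hH hr).1.symm,
    (hK.cont_v.norm.pow 2).congr fun r hr => (norm_bdV_sq ha ha1 hH hr).symm⟩

section

variable {m H₁ H₂ b p q : ℝ} {a : ℝ → ℝ}

theorem LB_inv_sq (hH : 0 < H₁) : ∃ L, LB (Icc H₁ H₂) (fun H => (H ^ 2)⁻¹) L := by
  have hl := ((LB.id (H₂ := H₂) hH).inv hH (fun x hx => hx.1))
  exact ⟨_, (hl.mul hl).congr fun H _ => by rw [pow_two, mul_inv]⟩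

/-- The Lipschitz constant contains a factor y, which half of the exponential absorbs; this explains
the halved rate in the bound. -/
theorem LB_exp_neg_div_sq (hH : 0 < H₁) (h12 : H₁ ≤ H₂) :
    ∃ C, 0 ≤ C ∧ ∀ y, 0 ≤ y → LB (Icc H₁ H₂) (fun H => Real.exp (-(y * (H ^ 2)⁻¹)))
      (C * Real.exp (-(y / (2 * H₂ ^ 2)))) := by
  have h2 : 0 < H₂ := hH.trans_le h12
  obtain ⟨L, hL⟩ := LB_inv_sq (H₂ := H₂) hH
  have hL0 : 0 ≤ L := hL.nonneg (left_mem_Icc.2 h12)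
  refine ⟨1 + L * (2 * H₂ ^ 2), by positivity, fun y hy => ?_⟩
  have h := LB.exp_neg (S := Icc H₁ H₂) (f := fun H => y * (H ^ 2)⁻¹) (L := y * L)
    (c := y * (H₂ ^ 2)⁻¹) (fun s hs t ht => ?_) (by positivity) (fun x hx => ?_)
  · refine h.mono ?_
    set z := y / (2 * H₂ ^ 2) with hz
    have hz0 : 0 ≤ z := by positivity
    have e1 : y = z * (2 * H₂ ^ 2) := by rw [hz]; field_simp
    have e2 : y * (H₂ ^ 2)⁻¹ = z + z := by rw [hz]; field_simp; ring
    rw [e2, neg_add, Real.exp_add, ← mul_assoc, mul_comm (1 + L * _)]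
    rw [mul_comm _ (Real.exp (-z))]
    refine mul_le_mul_of_nonneg_left ?_ (Real.exp_pos _).le
    have h3 := Real.add_one_le_exp z
    have h4 : Real.exp (-z) * Real.exp z = 1 := by rw [← Real.exp_add]; simp
    have h5 : Real.exp (-z) * (1 + z) ≤ 1 := by
      rw [← h4]; exact mul_le_mul_of_nonneg_left (by linarith) (Real.exp_pos _).le
    have h6 : Real.exp (-z) ≤ 1 := Real.exp_le_one_iff.2 (by linarith)
    have h7 : Real.exp (-z) * z ≤ 1 := by nlinarith [Real.exp_pos (-z)]
    rw [e1]
    have h8 : 0 ≤ L * (2 * H₂ ^ 2) := by positivity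
    nlinarith [mul_le_mul_of_nonneg_left h7 h8]
  · rw [← mul_sub, abs_mul, abs_of_nonneg hy, mul_assoc]
    exact mul_le_mul_of_nonneg_left (hL.2 s hs t ht) hy
  · have := hx.2
    have := hH.trans_le hx.1
    gcongr

theorem OrderFamily.LB_mix (O : OrderFamily m H₁ H₂ a b p q) (h12 : H₁ ≤ H₂) {c A B D : ℝ → ℝ}
    {b' : ℝ} (hc : LB (Icc H₁ H₂) c b') (hA : LB (Icc H₁ H₂) A b') (hB : LB (Icc H₁ H₂) B b')
    (hD : LB (Icc H₁ H₂) D b') (hb : b ≤ b') :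
    ∃ K, ∀ r, 0 < r → LB (Icc H₁ H₂)
      (fun H => mix (fun w => c H * triKer (A H) (B H) (D H) (a H) 1 w) (r / H))
      (K * (r ^ (-1 : ℝ) + r ^ (-(q + 2)))) := by
  -- The midpoint of q and 1 leaves room for the logarithms, and the resulting infrared power 2q' +
  -- 1 = q + 2 is still below 3.
  obtain ⟨q', hqq, hq', hq1⟩ : ∃ q', q' = (q + 1) / 2 ∧ q < q' ∧ q' < 1 :=
    ⟨_, rfl, by linarith [O.qlt], by linarith [O.qlt]⟩
  have hp := O.ppos
  have hq0 : 0 < q' := (O.ppos.trans_le O.ple).trans hq'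
  have h2 : 0 < H₂ := O.pos.trans_le h12
  obtain ⟨C, hC, he⟩ := LB_exp_neg_div_sq O.pos h12
  obtain ⟨M, hM, ht⟩ := exists_LB_triKer (O.lb.mono hb) hA hB hD (O.bpos.trans hb) O.ppos hq' hq1.le
    hq0 O.mem
  have haa : ∀ x ∈ Icc H₁ H₂, -1 < a x ∧ a x < 1 := fun x hx =>
    ⟨by linarith [(O.mem x hx).1], by linarith [(O.mem x hx).2]⟩
  set N := 4 * C * b' * M with hN
  have hN0 : 0 ≤ N := by have := O.bpos.trans hb; positivity
  -- Chosen so that the halved rate r²w/(2H₂²) of the exponential reads (r/z)²w, the form of the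
  -- Gaussian integrals in `mix`.
  set z := Real.sqrt 2 * H₂ with hz
  have hz0 : 0 < z := by positivity
  have hz2 : z ^ 2 = 2 * H₂ ^ 2 := by rw [hz, mul_pow, Real.sq_sqrt (by norm_num)]
  set G := Real.Gamma (1 / 2) * z + Real.Gamma (q' + 1 / 2) * z ^ (q + 2) with hG
  refine ⟨N * G, fun r hr => ?_⟩
  have hx : 0 < r / z := by positivity
  have i1 := integrableOn_exp_sq_mul_rpow hx (s := -(1 / 2)) (by norm_num)
  have i2 := integrableOn_exp_sq_mul_rpow hx (s := q' - 1 / 2) (by linarith)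
  have key := LB.integral (S := Icc H₁ H₂) (μ := volume.restrict (Ioi 0))
    (F := fun H w => Real.exp (-(r / H) ^ 2 * w) * (c H * triKer (A H) (B H) (D H) (a H) 1 w)
      * w ^ (-(1 / 2) : ℝ))
    (b := fun w => N * (Real.exp (-(r / z) ^ 2 * w) * w ^ (-(1 / 2) : ℝ)
      + Real.exp (-(r / z) ^ 2 * w) * w ^ (q' - 1 / 2)))
    (fun x hx => (((Continuous.continuousOn (by fun_prop)).mul (continuousOn_const.mul
        (continuousOn_triKer _ _ _ (haa x hx).1 (haa x hx).2 one_pos))).mul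
        (continuousOn_id.rpow_const fun w hw => Or.inl (ne_of_gt hw))).aestronglyMeasurable
        measurableSet_Ioi)
    ((i1.add i2).const_mul N) ?_
  · refine key.mono ?_
    have e1 := integral_add i1 i2
    rw [integral_const_mul, e1, integral_exp_sq_mul_rpow hx (by norm_num),
      integral_exp_sq_mul_rpow hx (by linarith), mul_assoc N]
    have d1 : (r / z) ^ (-(2 * (-(1 / 2)) + 2) : ℝ) = z * r ^ (-1 : ℝ) := by
      norm_num
      rw [Real.rpow_neg_one, Real.rpow_neg_one, inv_div]
      rfl
    have d2 : (r / z) ^ (-(2 * (q' - 1 / 2) + 2) : ℝ) = z ^ (q + 2) * r ^ (-(q + 2)) := by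
      rw [show -(2 * (q' - 1 / 2) + 2) = -(q + 2) by rw [hqq]; ring, Real.div_rpow hr.le hz0.le,
        Real.rpow_neg hz0.le, div_inv_eq_mul, mul_comm]
    rw [d1, d2, show (-(1 / 2) + 1 : ℝ) = 1 / 2 by norm_num,
      show q' - 1 / 2 + 1 = q' + 1 / 2 by ring, hG]
    have p1 : 0 < Real.Gamma (1 / 2) := Real.Gamma_pos_of_pos (by norm_num)
    have p2 : 0 < Real.Gamma (q' + 1 / 2) := Real.Gamma_pos_of_pos (by linarith)
    refine mul_le_mul_of_nonneg_left ?_ hN0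
    have q1 : 0 ≤ r ^ (-1 : ℝ) := by positivity
    have q2 : 0 ≤ r ^ (-(q + 2)) := by positivity
    have q3 : 0 ≤ z ^ (q + 2) := by positivity
    nlinarith [mul_nonneg (mul_nonneg p1.le hz0.le) q2, mul_nonneg (mul_nonneg p2.le q3) q1]
  · filter_upwards [ae_restrict_mem measurableSet_Ioi] with w hw
    have hw : (0 : ℝ) < w := hw
    have l := (((he (r ^ 2 * w) (by positivity)).mul (hc.mul (ht 1 w zero_le_one le_rfl hw.le
      (by linarith)))).const_mul (w ^ (-(1 / 2) : ℝ)))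
    refine (l.congr fun H hH => ?_).mono (le_of_eq ?_)
    · rw [show -(r ^ 2 * w * (H ^ 2)⁻¹) = -(r / H) ^ 2 * w by field_simp]
      ring
    · rw [abs_of_pos (by positivity), sub_eq_add_neg, Real.rpow_add hw,
        show r ^ 2 * w / (2 * H₂ ^ 2) = (r / z) ^ 2 * w by rw [div_pow, hz2]; ring, hN, neg_mul]
      ring

theorem OrderFamily.LB_covBD (O : OrderFamily m H₁ H₂ a b p q) (h12 : H₁ ≤ H₂)
    (γ γ' : PhasePoint) : ∃ B, LB (Icc H₁ H₂) (fun H => covBD H m γ γ') B := by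
  obtain ⟨B, hB, hbB, l1, l0, la, l2, l3, l4⟩ := O.exists_coeff
  obtain ⟨L, hL⟩ := LB_inv_sq (H₂ := H₂) O.pos
  obtain ⟨N, hN⟩ := O.LB_bdN
  have lH := LB.id (H₂ := H₂) O.pos
  have n0 := lH.nonneg (left_mem_Icc.2 h12)
  have n1 := hL.nonneg (left_mem_Icc.2 h12)
  have n2 := hN.nonneg (left_mem_Icc.2 h12)
  have li := lH.inv O.pos (fun x hx => hx.1)
  have n3 := li.nonneg (left_mem_Icc.2 h12)
  have c0 := (hN.mul li).congr (g := fun H => bdN (a H) / H) fun H _ => (div_eq_mul_inv _ _).symm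
  have c2 := hN.mul lH
  have n4 := c0.nonneg (left_mem_Icc.2 h12)
  have n5 := c2.nonneg (left_mem_Icc.2 h12)
  set E := B + N + 2 * (N * (H₁⁻¹ + (H₂ + 1) / H₁ ^ 2)) + 2 * (N * (H₂ + 1)) with hE
  have f1 := l1.mono (b' := E) (by linarith)
  have f0 := l0.mono (b' := E) (by linarith)
  have fa := la.mono (b' := E) (by linarith)
  obtain ⟨K₀, k0⟩ := O.LB_mix h12 (c0.mono (b' := E) (by linarith)) f1 f0 f0 (by linarith)
  obtain ⟨K₁, k1⟩ := O.LB_mix h12 (hN.mono (b' := E) (by linarith)) f1 fa f0 (by linarith)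
  obtain ⟨K₂, k2⟩ := O.LB_mix h12 (c2.mono (b' := E) (by linarith)) (l2.mono (by linarith))
    (l3.mono (by linarith)) (l4.mono (by linarith)) (by linarith)
  obtain ⟨K₃, k3⟩ := O.LB_mix h12 (c2.mono (b' := E) (by linarith)) f1 f0 f0 (by linarith)
  have hK : ∀ {K : ℝ} {F : ℝ → ℝ → ℝ}, (∀ r, 0 < r → LB (Icc H₁ H₂) (F r)
      (K * (r ^ (-1 : ℝ) + r ^ (-(q + 2))))) → 0 ≤ K := by
    intro K F h
    have := (h 1 one_pos).nonneg (left_mem_Icc.2 h12)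
    simp only [Real.one_rpow] at this
    linarith
  have hK0 := hK k0
  have hK1 := hK k1
  have hK2 := hK k2
  have hK3 := hK k3
  have hp := O.ppos
  have hq0 : 0 < q := O.ppos.trans_le O.ple
  have haa : ∀ x ∈ Icc H₁ H₂, -1 < a x ∧ a x < 1 ∧ 0 < x := fun x hx =>
    ⟨by linarith [(O.mem x hx).1], by linarith [(O.mem x hx).2, O.qlt], O.pos.trans_le hx.1⟩
  set K := K₀ + 2 * K₁ + 2 * K₂ + 4 * (L * K₃) with hKd
  have n6 : 0 ≤ L * K₃ := by positivity
  have b0 : ∀ r, 0 < r → LB (Icc H₁ H₂) (fun H => bdP₀ (a H) H r)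
      (K * (r ^ (-1 : ℝ) + r ^ (-(q + 2)))) := fun r hr =>
    ((k0 r hr).congr fun H hH => (bdP₀_eq_mix (haa H hH).1 (haa H hH).2.1 (haa H hH).2.2 hr).symm).mono
      (by gcongr; linarith)
  have b1 : ∀ r, 0 < r → LB (Icc H₁ H₂) (fun H => bdP₁ (a H) H r)
      (K * (1 + r ^ (-(q + 2)))) := fun r hr =>
    ((k1 r hr).congr fun H hH => (bdP₁_eq_mix (haa H hH).1 (haa H hH).2.1 (haa H hH).2.2 hr).symm).mono
      (by
        have h1 := rpow_le_add_rpow hr (p := -(q + 2)) (q := -1) (s := 0) (by linarith)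
          (by norm_num)
        rw [Real.rpow_zero] at h1
        have h2 : 0 < r ^ (-(q + 2)) := by positivity
        calc _ ≤ K₁ * (2 * (1 + r ^ (-(q + 2)))) := by gcongr; linarith
          _ = 2 * K₁ * (1 + r ^ (-(q + 2))) := by ring
          _ ≤ _ := by gcongr; linarith)
  have b2 : ∀ r, 0 < r → LB (Icc H₁ H₂) (fun H => bdP₂ (a H) H r)
      (K * (r ^ (1 : ℝ) + r ^ (-(q + 2)))) := fun r hr =>
    (((k2 r hr).add ((hL.mul (k3 r hr)).const_mul (r ^ 2))).congr fun H hH => by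
      rw [bdP₂_eq_mix (haa H hH).1 (haa H hH).2.1 (haa H hH).2.2 hr, div_pow]; ring).mono
      (by
        have h1 := rpow_le_add_rpow hr (p := -(q + 2)) (q := -1) (s := 1) (by linarith)
          (by norm_num)
        have h2 := rpow_le_add_rpow hr (p := -(q + 2)) (q := 2 - (q + 2)) (s := 1) (by linarith)
          (by linarith)
        have h3 : r ^ 2 * r ^ (-1 : ℝ) = r ^ (1 : ℝ) := by
          rw [Real.rpow_neg_one, Real.rpow_one]; field_simp
        have h4 : r ^ 2 * r ^ (-(q + 2)) = r ^ (2 - (q + 2)) := by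
          rw [sub_eq_add_neg, Real.rpow_add hr, Real.rpow_two]
        rw [abs_of_pos (by positivity : 0 < r ^ 2)]
        have e1 : r ^ 2 * (2 * (L * (K₃ * (r ^ (-1 : ℝ) + r ^ (-(q + 2))))))
            = 2 * (L * K₃) * (r ^ (1 : ℝ) + r ^ (2 - (q + 2))) := by rw [← h3, ← h4]; ring
        rw [e1, hKd]
        have p1 : 0 < r ^ (-(q + 2)) := by positivity
        have p2 : 0 < r ^ (1 : ℝ) := by positivity
        generalize r ^ (-(q + 2)) = A at *
        generalize r ^ (1 : ℝ) = B at *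
        calc _ ≤ K₂ * (B + A + A) + 2 * (L * K₃) * (B + (B + A)) := by gcongr
          _ ≤ _ := by
            have := mul_nonneg hK0 p2.le
            have := mul_nonneg hK0 p1.le
            have := mul_nonneg hK1 p2.le
            have := mul_nonneg hK1 p1.le
            have := mul_nonneg hK2 p2.le
            have := mul_nonneg n6 p1.le
            linarith)
  have hcov := fun H (hH : H ∈ Icc H₁ H₂) =>
    covBD_eq_specCov (haa H hH).1 (haa H hH).2.1 (haa H hH).2.2 (O.order H hH)
  have key := LB.integral (S := Icc H₁ H₂) (μ := (volume : Measure Space))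
    (F := fun H => specIntegrand (bdP₀ (a H) H) (bdP₁ (a H) H) (bdP₂ (a H) H) γ γ')
    (b := fun k => 2 * K * (specDom (q + 2) γ k + specDom (q + 2) γ' k)) ?_
    (((integrable_specDom (by linarith) (by linarith [O.qlt]) γ).add
      (integrable_specDom (by linarith) (by linarith [O.qlt]) γ')).const_mul _) ?_
  · exact ⟨_, (key.const_mul (2 * ((2 * Real.pi) ^ 3)⁻¹)).congr fun H hH => by rw [hcov H hH]; rfl⟩
  · intro H hH
    obtain ⟨c0, c1, c2⟩ := continuousOn_bdP (haa H hH).1 (haa H hH).2.1 (haa H hH).2.2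
    exact aestronglyMeasurable_specIntegrand c0 c1 c2 γ γ'
  · filter_upwards [ae_ne_zero] with k hk
    refine ⟨fun x hx => abs_specIntegrand_le ⟨fun r hr => (b0 r hr).1 x hx,
      fun r hr => (b1 r hr).1 x hx, fun r hr => (b2 r hr).1 x hx⟩ γ γ' hk, fun x hx y hy => ?_⟩
    -- The integrand is linear in the spectral functions, so the Lipschitz estimate is the size
    -- estimate applied to their differences, with K replaced by K |x - y|.
    have h := abs_specIntegrand_le (c := q + 2) (K := K * |x - y|)
      (P₀ := fun r => bdP₀ (a x) x r - bdP₀ (a y) y r)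
      (P₁ := fun r => bdP₁ (a x) x r - bdP₁ (a y) y r)
      (P₂ := fun r => bdP₂ (a x) x r - bdP₂ (a y) y r)
      ⟨fun r hr => ((b0 r hr).2 x hx y hy).trans (le_of_eq (by ring)),
      fun r hr => ((b1 r hr).2 x hx y hy).trans (le_of_eq (by ring)),
      fun r hr => ((b2 r hr).2 x hx y hy).trans (le_of_eq (by ring))⟩ γ γ' hk
    refine (le_of_eq ?_).trans (h.trans (le_of_eq ?_))
    · congr 1
      simp only [specIntegrand]
      ring
    · ring

end

/-! ### The mutual information as an integral -/

theorem intervalIntegrable_log_sub_sq {y : ℝ} (hy : 1 < y) :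
    IntervalIntegrable (fun u => Real.log (y - u ^ 2)) volume 0 1 := by
  refine ContinuousOn.intervalIntegrable (ContinuousOn.log (by fun_prop) fun u hu => ?_)
  rw [uIcc_of_le zero_le_one] at hu
  have : u ^ 2 ≤ 1 := pow_le_one₀ hu.1 hu.2
  exact (by linarith : 0 < y - u ^ 2).ne'

/-- With ν = √y, log (y - u²) = log (ν - u) + log (ν + u) integrates to the two terms of the
entropy. The entropy thereby becomes a superposition of logarithms of affine functions of ν², so
sums over symplectic eigenvalues turn into logarithms of products. -/
theorem entropy_sqrt {y : ℝ} (hy : 1 < y) : entropy (Real.sqrt y)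
    = ((∫ u in (0 : ℝ)..1, Real.log (y - u ^ 2)) / 2 + 1 - Real.log 2) / Real.log 2 := by
  set ν := Real.sqrt y with hν
  have h1 : 1 < ν := Real.lt_sqrt_of_sq_lt (by linarith)
  have h2 : ν ^ 2 = y := Real.sq_sqrt (by linarith)
  have e : ∫ u in (0 : ℝ)..1, Real.log (y - u ^ 2)
      = ∫ u in (0 : ℝ)..1, (Real.log (ν - u) + Real.log (ν + u)) := by
    refine intervalIntegral.integral_congr fun u hu => ?_
    rw [uIcc_of_le zero_le_one] at hu
    rw [← Real.log_mul (by linarith [hu.2]) (by linarith [hu.1]), ← h2]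
    ring_nf
  have i1 : IntervalIntegrable (fun u => Real.log (ν - u)) volume 0 1 :=
    ContinuousOn.intervalIntegrable (ContinuousOn.log (by fun_prop) fun u hu => by
      rw [uIcc_of_le zero_le_one] at hu; linarith [hu.2])
  have i2 : IntervalIntegrable (fun u => Real.log (ν + u)) volume 0 1 :=
    ContinuousOn.intervalIntegrable (ContinuousOn.log (by fun_prop) fun u hu => by
      rw [uIcc_of_le zero_le_one] at hu; linarith [hu.1])
  rw [e, intervalIntegral.integral_add i1 i2,
    intervalIntegral.integral_comp_sub_left (fun u => Real.log u),
    intervalIntegral.integral_comp_add_left (fun u => Real.log u), integral_log, integral_log,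
    entropy, Real.logb, Real.logb, Real.log_div (by linarith) two_ne_zero,
    Real.log_div (by linarith) two_ne_zero]
  have := (Real.log_pos one_lt_two).ne'
  field_simp
  ring_nf

/-- The function `-log (1 - x) / x`. -/
def logRatio (x : ℝ) : ℝ := ∫ t in Ioc (0 : ℝ) 1, (1 - t * x)⁻¹

theorem logRatio_zero : logRatio 0 = 1 := by simp [logRatio]

/-- The factor x is split off the logarithm so that the correlation strength can be divided out of
the mutual information with a quotient regular at 0. -/
theorem mul_logRatio {x : ℝ} (hx : x < 1) : x * logRatio x = -Real.log (1 - x) := by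
  have hpos : ∀ t ∈ uIcc (0 : ℝ) 1, 0 < 1 - t * x := fun t ht => by
    rw [uIcc_of_le zero_le_one] at ht
    rcases le_total x 0 with h | h
    · nlinarith [ht.1]
    · nlinarith [ht.2]
  have h := intervalIntegral.integral_eq_sub_of_hasDerivAt (a := 0) (b := 1)
    (f := fun t => -Real.log (1 - t * x)) (f' := fun t => x * (1 - t * x)⁻¹) (fun t ht => by
      have h1 : HasDerivAt (fun t : ℝ => 1 - t * x) (-x) t := by
        simpa using ((hasDerivAt_id t).mul_const x).const_sub 1
      have h2 := (h1.log (hpos t ht).ne').neg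
      exact h2.congr_deriv (by rw [neg_div, neg_neg, div_eq_mul_inv]))
    (ContinuousOn.intervalIntegrable (continuousOn_const.mul (ContinuousOn.inv₀ (by fun_prop)
      fun t ht => (hpos t ht).ne')))
  rw [intervalIntegral.integral_const_mul, intervalIntegral.integral_of_le zero_le_one] at h
  simpa [logRatio] using h

theorem LB_logRatio : LB (Icc (-(1 / 2)) (1 / 2)) logRatio 8 := by
  have hpos : ∀ x ∈ Icc (-(1 / 2) : ℝ) (1 / 2), ∀ t ∈ Ioc (0 : ℝ) 1, 1 / 2 ≤ 1 - t * x :=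
    fun x hx t ht => by nlinarith [hx.1, hx.2, ht.1, ht.2]
  have h := LB.integral (S := Icc (-(1 / 2) : ℝ) (1 / 2)) (μ := volume.restrict (Ioc (0 : ℝ) 1))
    (F := fun x t => (1 - t * x)⁻¹) (b := fun _ => 8)
    (fun x hx => (ContinuousOn.inv₀ (by fun_prop) fun t ht => by
      linarith [hpos x hx t ht]).aestronglyMeasurable measurableSet_Ioc)
    (integrable_const _) (by
      filter_upwards [ae_restrict_mem measurableSet_Ioc] with t ht
      have l : LB (Icc (-(1 / 2) : ℝ) (1 / 2)) (fun x => 1 - t * x) (3 / 2) := by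
        refine ⟨fun x hx => ?_, fun x hx y hy => ?_⟩
        · rw [abs_of_pos (by linarith [hpos x hx t ht])]
          nlinarith [hx.1, hx.2, ht.1, ht.2]
        · rw [show 1 - t * x - (1 - t * y) = -(t * (x - y)) by ring, abs_neg, abs_mul,
            abs_of_pos ht.1]
          exact mul_le_mul_of_nonneg_right (by linarith [ht.2]) (abs_nonneg _)
      exact (l.inv (c := 1 / 2) (by norm_num) fun x hx => hpos x hx t ht).mono (by norm_num))
  exact h.mono (by simp)

/-- The squared symplectic eigenvalues y, z have sum α + β + 2d and product αβ + d² - q. Therefore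
(y - u²)(z - u²) = (α - u²)(β - u²) - (q + 2du² - d²), and the four entropies combine into one
logarithm under the integral. -/
theorem mutual_entropy_eq {α β d q ρ : ℝ} (hρ : 0 < ρ) (hα : 1 + ρ ≤ α) (hβ : 1 + ρ ≤ β)
    (hd : |d| < ρ) (hdisc : 0 ≤ (α + β + 2 * d) ^ 2 - 4 * (α * β + d ^ 2 - q))
    (hn : ∀ u ∈ Icc (0 : ℝ) 1,
      (q + 2 * d * u ^ 2 - d ^ 2) * ((α - u ^ 2) * (β - u ^ 2))⁻¹ < 1) :
    entropy (Real.sqrt α) + entropy (Real.sqrt β)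
      - entropy (Real.sqrt ((α + β + 2 * d
        + Real.sqrt ((α + β + 2 * d) ^ 2 - 4 * (α * β + d ^ 2 - q))) / 2))
      - entropy (Real.sqrt ((α + β + 2 * d
        - Real.sqrt ((α + β + 2 * d) ^ 2 - 4 * (α * β + d ^ 2 - q))) / 2))
      = (2 * Real.log 2)⁻¹ * ∫ u in Ioc (0 : ℝ) 1,
        (q + 2 * d * u ^ 2 - d ^ 2) * ((α - u ^ 2) * (β - u ^ 2))⁻¹
          * logRatio ((q + 2 * d * u ^ 2 - d ^ 2) * ((α - u ^ 2) * (β - u ^ 2))⁻¹) := by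
  set D := Real.sqrt ((α + β + 2 * d) ^ 2 - 4 * (α * β + d ^ 2 - q)) with hD
  have hD2 : D ^ 2 = (α + β + 2 * d) ^ 2 - 4 * (α * β + d ^ 2 - q) := Real.sq_sqrt hdisc
  set y := (α + β + 2 * d + D) / 2 with hy
  set z := (α + β + 2 * d - D) / 2 with hz
  have hyz : ∀ u : ℝ, (y - u ^ 2) * (z - u ^ 2)
      = (α - u ^ 2) * (β - u ^ 2) - (q + 2 * d * u ^ 2 - d ^ 2) := fun u => by
    rw [hy, hz]; linear_combination (-1 / 4) * hD2
  have hab : ∀ u ∈ Icc (0 : ℝ) 1, 0 < α - u ^ 2 ∧ 0 < β - u ^ 2 := fun u hu => by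
    have : u ^ 2 ≤ 1 := pow_le_one₀ hu.1 hu.2
    constructor <;> linarith
  have hprod : ∀ u ∈ Icc (0 : ℝ) 1, 0 < (y - u ^ 2) * (z - u ^ 2) := fun u hu => by
    have h := hn u hu
    have hp := mul_pos (hab u hu).1 (hab u hu).2
    rw [← div_eq_mul_inv, div_lt_one hp] at h
    rw [hyz]; linarith
  have hsum : 2 < y + z := by
    have : y + z = α + β + 2 * d := by rw [hy, hz]; ring
    linarith [neg_abs_le d]
  have hD0 : 0 ≤ D := Real.sqrt_nonneg _
  -- Positivity of the product at u = 1 gives (y - 1)(z - 1) > 0, and y + z > 2 excludes that both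
  -- factors are negative.
  have hz1 : 1 < z := by
    have h1 := hprod 1 ⟨zero_le_one, le_rfl⟩
    have h2 : z ≤ y := by rw [hy, hz]; linarith
    by_contra hcon
    push Not at hcon
    have h3 : 0 < y - 1 := by linarith
    rw [one_pow] at h1
    have := (pos_iff_pos_of_mul_pos h1).1 h3
    linarith
  have hy1 : 1 < y := by
    have h2 : z ≤ y := by rw [hy, hz]; linarith
    linarith
  rw [entropy_sqrt (by linarith : 1 < α), entropy_sqrt (by linarith : 1 < β), entropy_sqrt hy1,
    entropy_sqrt hz1]
  have ia := intervalIntegrable_log_sub_sq (by linarith : 1 < α)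
  have ib := intervalIntegrable_log_sub_sq (by linarith : 1 < β)
  have iy := intervalIntegrable_log_sub_sq hy1
  have iz := intervalIntegrable_log_sub_sq hz1
  have key : ∫ u in Ioc (0 : ℝ) 1, (q + 2 * d * u ^ 2 - d ^ 2) * ((α - u ^ 2) * (β - u ^ 2))⁻¹
          * logRatio ((q + 2 * d * u ^ 2 - d ^ 2) * ((α - u ^ 2) * (β - u ^ 2))⁻¹)
      = (∫ u in (0 : ℝ)..1, Real.log (α - u ^ 2)) + (∫ u in (0 : ℝ)..1, Real.log (β - u ^ 2))
        - (∫ u in (0 : ℝ)..1, Real.log (y - u ^ 2)) - ∫ u in (0 : ℝ)..1, Real.log (z - u ^ 2) := by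
    rw [← intervalIntegral.integral_add ia ib, ← intervalIntegral.integral_sub (ia.add ib) iy,
      ← intervalIntegral.integral_sub ((ia.add ib).sub iy) iz,
      intervalIntegral.integral_of_le zero_le_one]
    refine setIntegral_congr_fun measurableSet_Ioc fun u hu => ?_
    have hu : u ∈ Icc (0 : ℝ) 1 := ⟨hu.1.le, hu.2⟩
    obtain ⟨h1, h2⟩ := hab u hu
    have h3 : u ^ 2 ≤ 1 := pow_le_one₀ hu.1 hu.2
    have h4 : 0 < y - u ^ 2 := by linarith
    have h5 : 0 < z - u ^ 2 := by linarith
    have e : 1 - (q + 2 * d * u ^ 2 - d ^ 2) * ((α - u ^ 2) * (β - u ^ 2))⁻¹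
        = (y - u ^ 2) * (z - u ^ 2) / ((α - u ^ 2) * (β - u ^ 2)) := by
      rw [hyz]; field_simp
    rw [mul_logRatio (hn u hu), e, Real.log_div (by positivity) (by positivity),
      Real.log_mul h4.ne' h5.ne', Real.log_mul h1.ne' h2.ne']
    ring
  rw [key]
  have := (Real.log_pos one_lt_two).ne'
  field_simp
  ring

open Matrix

/-! ### Covariance matrices of two modes -/

/-- The trace `tr (adj B · Cᵀ · adj A · C)`. -/
def crossTrace (A B C : Matrix (Fin 2) (Fin 2) ℝ) : ℝ :=
  (B.adjugate * Cᵀ * A.adjugate * C).trace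

theorem crossTrace_eq (A B C : Matrix (Fin 2) (Fin 2) ℝ) : crossTrace A B C =
    (B 1 1 * C 0 0 - B 0 1 * C 0 1) * (A 1 1 * C 0 0 - A 0 1 * C 1 0)
    + (B 1 1 * C 1 0 - B 0 1 * C 1 1) * (A 0 0 * C 1 0 - A 1 0 * C 0 0)
    + (B 0 0 * C 0 1 - B 1 0 * C 0 0) * (A 1 1 * C 0 1 - A 0 1 * C 1 1)
    + (B 0 0 * C 1 1 - B 1 0 * C 1 0) * (A 0 0 * C 1 1 - A 1 0 * C 0 1) := by
  simp only [crossTrace, Matrix.adjugate_fin_two, Matrix.trace_fin_two, Matrix.mul_apply,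
    Fin.sum_univ_two, Matrix.transpose_apply, Matrix.of_apply, Matrix.cons_val', Matrix.cons_val_zero,
    Matrix.cons_val_one, Matrix.cons_val_fin_one]
  ring

/-- The Schur complement, with the inverse of A replaced by its adjugate so that the result is
polynomial in the entries. -/
theorem det_fromBlocks_two {A B C : Matrix (Fin 2) (Fin 2) ℝ} (hA : A.det ≠ 0) :
    (Matrix.fromBlocks A C Cᵀ B).det = A.det * B.det + C.det ^ 2 - crossTrace A B C := by
  have : Invertible A := Matrix.invertibleOfIsUnitDet A (isUnit_iff_ne_zero.2 hA)
  rw [Matrix.det_fromBlocks₁₁, Matrix.invOf_eq_nonsing_inv, Matrix.inv_def, Ring.inverse_eq_inv',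
    crossTrace_eq]
  rw [Matrix.det_fin_two] at hA
  simp only [Matrix.det_fin_two, Matrix.adjugate_fin_two, Matrix.mul_apply, Matrix.sub_apply,
    Fin.sum_univ_two, Matrix.transpose_apply, Matrix.of_apply, Matrix.cons_val', Matrix.cons_val_zero,
    Matrix.cons_val_one, Matrix.cons_val_fin_one, Matrix.smul_apply, smul_eq_mul]
  field_simp
  ring

/-- Completing squares in A and B, as in a Cholesky factorization, makes `crossTrace` times A₀₀B₀₀
equal to x² + y² + z² + w². The determinant, up to positive factors, becomes xw - yz, and 2|xw - yz|
≤ x² + y² + z² + w². -/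
theorem two_mul_abs_det_le_crossTrace {A B C : Matrix (Fin 2) (Fin 2) ℝ} (hA : A 1 0 = A 0 1)
    (hB : B 1 0 = B 0 1) (hA0 : 0 < A 0 0) (hB0 : 0 < B 0 0) (hAd : 0 ≤ A.det) (hBd : 0 ≤ B.det) :
    2 * (Real.sqrt A.det * Real.sqrt B.det) * |C.det| ≤ crossTrace A B C := by
  have hr := Real.sq_sqrt hAd
  have ht := Real.sq_sqrt hBd
  set r := Real.sqrt A.det
  set t := Real.sqrt B.det
  have hr0 : 0 ≤ r := Real.sqrt_nonneg _
  have ht0 : 0 ≤ t := Real.sqrt_nonneg _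
  rw [Matrix.det_fin_two, hA] at hr
  rw [Matrix.det_fin_two, hB] at ht
  rw [crossTrace_eq, Matrix.det_fin_two C, hA, hB]
  set x := r * t * C 0 0
  set y := r * (B 0 0 * C 0 1 - B 0 1 * C 0 0) with hy
  set z := t * (A 0 0 * C 1 0 - A 0 1 * C 0 0) with hz
  set w := A 0 0 * B 0 0 * C 1 1 - A 0 0 * B 0 1 * C 1 0 - A 0 1 * B 0 0 * C 0 1
    + A 0 1 * B 0 1 * C 0 0
  have h1 : x * w - y * z = A 0 0 * B 0 0 * (r * t * (C 0 0 * C 1 1 - C 0 1 * C 1 0)) := by ring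
  have h2 : 2 * |x * w - y * z| ≤ x ^ 2 + y ^ 2 + z ^ 2 + w ^ 2 := by
    rcases abs_cases (x * w - y * z) with ⟨h, -⟩ | ⟨h, -⟩ <;> rw [h] <;>
      nlinarith [sq_nonneg (x - w), sq_nonneg (x + w), sq_nonneg (y - z), sq_nonneg (y + z)]
  have hab : 0 < A 0 0 * B 0 0 := mul_pos hA0 hB0
  rw [h1, abs_mul, abs_of_pos hab, abs_mul, abs_of_nonneg (mul_nonneg hr0 ht0)] at h2
  refine le_of_mul_le_mul_left (le_of_eq_of_le ?_ (h2.trans (le_of_eq ?_))) hab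
  · ring
  · have e1 : x ^ 2 = r ^ 2 * t ^ 2 * C 0 0 ^ 2 := by ring
    have e2 : y ^ 2 = r ^ 2 * (B 0 0 * C 0 1 - B 0 1 * C 0 0) ^ 2 := by ring
    have e3 : z ^ 2 = t ^ 2 * (A 0 0 * C 1 0 - A 0 1 * C 0 0) ^ 2 := by ring
    rw [e1, e2, e3, hr, ht]
    ring

/-- It makes the two symplectic eigenvalues real. With r = √α and t = √β the only competing term is
4|d|(r - t)², which is at most (r - t)²(r + t)² = (α - β)² since r, t ≥ 1 and |d| ≤ 1. -/
theorem discriminant_nonneg {α β d q : ℝ} (hα : 1 ≤ α) (hβ : 1 ≤ β) (hd : |d| ≤ 1)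
    (hq : 2 * (Real.sqrt α * Real.sqrt β) * |d| ≤ q) :
    0 ≤ (α + β + 2 * d) ^ 2 - 4 * (α * β + d ^ 2 - q) := by
  have hr := Real.sq_sqrt (zero_le_one.trans hα)
  have ht := Real.sq_sqrt (zero_le_one.trans hβ)
  have hr1 := Real.one_le_sqrt.2 hα
  have ht1 := Real.one_le_sqrt.2 hβ
  set r := Real.sqrt α
  set t := Real.sqrt β
  have h1 : (α + β + 2 * d) ^ 2 - 4 * (α * β + d ^ 2 - q)
      = (α - β) ^ 2 + 4 * (α + β) * d + 4 * q := by ring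
  have h2 : (r - t) ^ 2 * (4 * |d|) ≤ (α - β) ^ 2 := by
    have : (α - β) ^ 2 = (r - t) ^ 2 * (r + t) ^ 2 := by rw [← hr, ← ht]; ring
    rw [this]
    refine mul_le_mul_of_nonneg_left ?_ (sq_nonneg _)
    nlinarith
  have h3 : (r - t) ^ 2 = α + β - 2 * (r * t) := by rw [← hr, ← ht]; ring
  have h4 := mul_le_mul_of_nonneg_left (neg_abs_le d) (by linarith : 0 ≤ α + β)
  rw [h3] at h2
  linarith

/-- The formal properties of the covariance metric of a translation invariant state. -/
structure IsCovariance (σ : PhasePoint → PhasePoint → ℝ) : Prop where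
  comm : ∀ γ γ', σ γ γ' = σ γ' γ
  nonneg : ∀ γ, 0 ≤ σ γ γ
  translate : ∀ X γ γ', σ (γ.translate X) (γ'.translate X) = σ γ γ'

theorem isCovariance_vacCov (u v : ℝ → ℂ) : IsCovariance (vacCov u v) := by
  refine ⟨vacCov_comm u v, fun γ => ?_, fun X γ γ' => ?_⟩
  · unfold vacCov
    have := Real.pi_pos
    refine mul_nonneg (by positivity) (integral_nonneg fun k => ?_)
    change 0 ≤ (amp u v γ k * (starRingEnd ℂ) (amp u v γ k)).re
    rw [Complex.mul_conj, Complex.ofReal_re]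
    exact Complex.normSq_nonneg _
  · have h : ∀ γ k, amp u v (γ.translate X) k
        = Complex.exp (Complex.I * ((inner ℝ k X : ℝ) : ℂ)) * amp u v γ k := fun γ k => by
      simp only [amp, PhasePoint.translate, fourierT_shift]; ring
    unfold vacCov
    congr 2
    funext k
    rw [h, h, map_mul, mul_mul_mul_comm, Complex.mul_conj, Complex.normSq_eq_norm_sq,
      mul_comm Complex.I, Complex.norm_exp_ofReal_mul_I]
    simp

theorem isCovariance_covBD {a H m : ℝ} (ha : -1 < a) (ha1 : a < 1) (hH : 0 < H)
    (hm : bdOrder H m = a + 1 / 2) : IsCovariance (covBD H m) := by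
  rw [covBD_eq_vacCov ha ha1 hH hm]; exact isCovariance_vacCov _ _

theorem isCovariance_covMink : IsCovariance covMink := by
  rw [covMink_eq_specCov, ← mink_vacCov_eq_specCov]; exact isCovariance_vacCov _ _

section

variable {σ : PhasePoint → PhasePoint → ℝ} (hσ : IsCovariance σ)
include hσ

theorem IsCovariance.covBlock_translate (X : Space) (A : Mode) :
    covBlock σ (A.translate X) (A.translate X) = covBlock σ A A := by
  ext i j; exact hσ.translate X _ _

theorem IsCovariance.covBlock_symm (A : Mode) : covBlock σ A A 1 0 = covBlock σ A A 0 1 :=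
  hσ.comm _ _

theorem IsCovariance.covBlock_pos {A : Mode} (h : 0 < (covBlock σ A A).det) :
    0 < covBlock σ A A 0 0 := by
  rw [Matrix.det_fin_two, hσ.covBlock_symm] at h
  refine lt_of_le_of_ne (hσ.nonneg _) fun h0 => ?_
  rw [← h0] at h
  nlinarith [sq_nonneg (covBlock σ A A 0 1)]

end

/-! ### The mutual information of weakly correlated modes -/

/-- If the correlation block is √s times a reference block, the quantities q and d scale like s and
d² like s². This is the argument of the logarithm divided by s, which stays regular at s = 0. -/
def rateArg (α β q d s u : ℝ) : ℝ :=
  (q + 2 * d * u ^ 2 - s * d ^ 2) * ((α - u ^ 2) * (β - u ^ 2))⁻¹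

/-- The mutual information per squared correlation strength `s`. -/
def infoRate (α β q d s : ℝ) : ℝ :=
  (2 * Real.log 2)⁻¹ * ∫ u in Ioc (0 : ℝ) 1, rateArg α β q d s u * logRatio (s * rateArg α β q d s u)

theorem inv_mul_le_of_one_add_le {α β ρ u : ℝ} (hρ : 0 < ρ) (hα : 1 + ρ ≤ α) (hβ : 1 + ρ ≤ β)
    (hu : u ∈ Icc (0 : ℝ) 1) : 0 < (α - u ^ 2) * (β - u ^ 2) ∧
      ((α - u ^ 2) * (β - u ^ 2))⁻¹ ≤ (ρ ^ 2)⁻¹ := by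
  have : u ^ 2 ≤ 1 := pow_le_one₀ hu.1 hu.2
  have h1 : ρ ≤ α - u ^ 2 := by linarith
  have h2 : ρ ≤ β - u ^ 2 := by linarith
  have h3 : ρ ^ 2 ≤ (α - u ^ 2) * (β - u ^ 2) := by rw [pow_two]; gcongr; linarith
  exact ⟨by nlinarith, by gcongr⟩

theorem abs_rateArg_le {α β q d s ρ M u : ℝ} (hρ : 0 < ρ) (hα : 1 + ρ ≤ α)
    (hβ : 1 + ρ ≤ β) (hq : |q| ≤ M) (hd : |d| ≤ M) (hs : 0 ≤ s) (hu : u ∈ Icc (0 : ℝ) 1) :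
    |rateArg α β q d s u| ≤ (3 * M + s * M ^ 2) * (ρ ^ 2)⁻¹ := by
  obtain ⟨h1, h2⟩ := inv_mul_le_of_one_add_le hρ hα hβ hu
  have hu2 : u ^ 2 ≤ 1 := pow_le_one₀ hu.1 hu.2
  have hM : 0 ≤ M := (abs_nonneg _).trans hq
  have hd2 : d ^ 2 ≤ M ^ 2 := sq_le_sq' (by linarith [neg_abs_le d]) (by linarith [le_abs_self d])
  have hn : |q + 2 * d * u ^ 2 - s * d ^ 2| ≤ 3 * M + s * M ^ 2 := by
    refine (abs_sub _ _).trans (add_le_add ((abs_add_le _ _).trans ?_) ?_)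
    · rw [abs_mul, abs_mul, abs_of_pos (two_pos : (0 : ℝ) < 2), abs_of_nonneg (sq_nonneg u)]
      nlinarith [mul_le_mul hd hu2 (sq_nonneg u) hM]
    · rw [abs_of_nonneg (by positivity)]; gcongr
  rw [rateArg, abs_mul, abs_of_pos (inv_pos.2 h1)]
  gcongr

theorem mul_rateArg_mem {α β q d s ρ M u : ℝ} (hρ : 0 < ρ) (hρ1 : ρ ≤ 1) (hα : 1 + ρ ≤ α)
    (hβ : 1 + ρ ≤ β) (hq : |q| ≤ M) (hd : |d| ≤ M) (hs : 0 ≤ s) (hsM : s * M ≤ ρ ^ 2 / 8)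
    (hu : u ∈ Icc (0 : ℝ) 1) : s * rateArg α β q d s u ∈ Icc (-(1 / 2)) (1 / 2) := by
  have hM : 0 ≤ M := (abs_nonneg _).trans hq
  have hρ2 : ρ ^ 2 ≤ 1 := pow_le_one₀ hρ.le hρ1
  rw [Set.mem_Icc, ← abs_le, abs_mul, abs_of_nonneg hs]
  calc _ ≤ s * ((3 * M + s * M ^ 2) * (ρ ^ 2)⁻¹) := by
        gcongr; exact abs_rateArg_le hρ hα hβ hq hd hs hu
    _ = (3 * (s * M) + (s * M) * (s * M)) * (ρ ^ 2)⁻¹ := by ring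
    _ ≤ (3 * (ρ ^ 2 / 8) + 1 * (ρ ^ 2 / 8)) * (ρ ^ 2)⁻¹ := by
      have : 0 ≤ s * M := by positivity
      gcongr
      linarith
    _ = 1 / 2 := by field_simp; norm_num

theorem continuousOn_rateArg {α β ρ : ℝ} (hρ : 0 < ρ) (hα : 1 + ρ ≤ α) (hβ : 1 + ρ ≤ β)
    (q d s : ℝ) : ContinuousOn (rateArg α β q d s) (Ioc 0 1) := by
  refine ContinuousOn.mul (by fun_prop) (ContinuousOn.inv₀ (by fun_prop) fun u hu => ?_)
  exact (inv_mul_le_of_one_add_le hρ hα hβ ⟨hu.1.le, hu.2⟩).1.ne'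

/-- The factor r² leaves the integral exactly, not only asymptotically. The smallness condition
keeps the argument of `logRatio` within 1/2 of 0, and the uncertainty gap ρ bounds the denominators
from below. -/
theorem mutualInfo_eq {σ : PhasePoint → PhasePoint → ℝ} (hσ : IsCovariance σ) {A B : Mode}
    {C : Matrix (Fin 2) (Fin 2) ℝ} {r ρ M : ℝ} (hC : covBlock σ A B = r • C) (hρ : 0 < ρ)
    (hρ1 : ρ ≤ 1) (hα : 1 + ρ ≤ (covBlock σ A A).det) (hβ : 1 + ρ ≤ (covBlock σ B B).det)
    (hq : |crossTrace (covBlock σ A A) (covBlock σ B B) C| ≤ M) (hd : |C.det| ≤ M)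
    (hM : r ^ 2 * M ≤ ρ ^ 2 / 8) :
    mutualInfo σ A B = r ^ 2 * infoRate (covBlock σ A A).det (covBlock σ B B).det
      (crossTrace (covBlock σ A A) (covBlock σ B B) C) C.det (r ^ 2) := by
  have hd' : (covBlock σ A B).det = r ^ 2 * C.det := by
    rw [hC, Matrix.det_smul, Fintype.card_fin]
  have hq' : crossTrace (covBlock σ A A) (covBlock σ B B) (covBlock σ A B)
      = r ^ 2 * crossTrace (covBlock σ A A) (covBlock σ B B) C := by
    rw [hC, crossTrace_eq, crossTrace_eq]
    simp only [Matrix.smul_apply, smul_eq_mul]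
    ring
  have hle := two_mul_abs_det_le_crossTrace (C := covBlock σ A B) (hσ.covBlock_symm A)
    (hσ.covBlock_symm B) (hσ.covBlock_pos (by linarith)) (hσ.covBlock_pos (by linarith))
    (by linarith) (by linarith)
  have hdet := det_fromBlocks_two (A := covBlock σ A A) (B := covBlock σ B B) (C := covBlock σ A B)
    (by linarith)
  rw [hq', hd'] at hle
  have hds : |r ^ 2 * C.det| < ρ := by
    rw [abs_mul, abs_of_nonneg (sq_nonneg r)]
    have := mul_le_mul_of_nonneg_left hd (sq_nonneg r)
    nlinarith
  have hrate : ∀ u, (r ^ 2 * crossTrace (covBlock σ A A) (covBlock σ B B) C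
      + 2 * (r ^ 2 * C.det) * u ^ 2 - (r ^ 2 * C.det) ^ 2)
      * (((covBlock σ A A).det - u ^ 2) * ((covBlock σ B B).det - u ^ 2))⁻¹
      = r ^ 2 * rateArg (covBlock σ A A).det (covBlock σ B B).det
        (crossTrace (covBlock σ A A) (covBlock σ B B) C) C.det (r ^ 2) u := fun u => by
    rw [rateArg]; ring
  have key := mutual_entropy_eq hρ hα hβ hds (discriminant_nonneg (by linarith) (by linarith)
    (by linarith) hle) (fun u hu => by
      rw [hrate]
      linarith [(mul_rateArg_mem hρ hρ1 hα hβ hq hd (sq_nonneg r) hM hu).2])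
  simp only [hrate] at key
  unfold mutualInfo nuMode nuPlus nuMinus seralian covPair
  rw [hdet, hq', hd', key, infoRate, mul_left_comm]
  simp only [mul_assoc]
  rw [integral_const_mul]

/-! ### Regularity and asymptotics of the mutual information -/

theorem LB.comp {S S' : Set ℝ} {f g : ℝ → ℝ} {b M : ℝ} (hg : LB S' g M) (hf : LB S f b)
    (h : ∀ x ∈ S, f x ∈ S') : LB S (fun x => g (f x)) (M * (1 + b)) := by
  refine ⟨fun x hx => (hg.1 _ (h x hx)).trans ?_, fun x hx y hy =>
    (hg.2 _ (h x hx) _ (h y hy)).trans ?_⟩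
  · nlinarith [mul_nonneg (hg.nonneg (h x hx)) (hf.nonneg hx)]
  · have h0 := hg.nonneg (h x hx)
    have h1 := mul_le_mul_of_nonneg_left (hf.2 x hx y hy) h0
    have h2 := mul_nonneg h0 (abs_nonneg (x - y))
    linarith

theorem ULB_infoRate {ι : Type*} {S : Set ℝ} {T : Set ι} {α β : ℝ → ℝ} {q d s : ι → ℝ → ℝ}
    {bα bβ ρ M : ℝ} (hα : LB S α bα) (hβ : LB S β bβ) (hq : ULB S T q) (hd : ULB S T d)
    (hs : ULB S T s) (hρ : 0 < ρ) (hρ1 : ρ ≤ 1) (hαρ : ∀ H ∈ S, 1 + ρ ≤ α H)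
    (hβρ : ∀ H ∈ S, 1 + ρ ≤ β H) (hqM : ∀ i ∈ T, ∀ H ∈ S, |q i H| ≤ M)
    (hdM : ∀ i ∈ T, ∀ H ∈ S, |d i H| ≤ M) (hs0 : ∀ i ∈ T, ∀ H ∈ S, 0 ≤ s i H)
    (hsM : ∀ i ∈ T, ∀ H ∈ S, s i H * M ≤ ρ ^ 2 / 8) :
    ULB S T (fun i H => infoRate (α H) (β H) (q i H) (d i H) (s i H)) := by
  set T' : Set (ι × ℝ) := T ×ˢ Ioc 0 1 with hT'
  have hfst : ∀ z ∈ T', z.1 ∈ T := fun z hz => hz.1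
  replace hq := hq.comp hfst
  replace hd := hd.comp hfst
  replace hs := hs.comp hfst
  have hIcc : ∀ z ∈ T', z.2 ∈ Icc (0 : ℝ) 1 := fun z hz => ⟨hz.2.1.le, hz.2.2⟩
  have hu : ULB S T' (fun z _ => z.2 ^ 2) := ⟨1, fun z hz => (LB.const _).mono (by
    rw [abs_of_nonneg (sq_nonneg _)]; exact pow_le_one₀ (hIcc z hz).1 (hIcc z hz).2)⟩
  have hprod := ((ULB.of_LB (T := T') hα).sub hu).mul ((ULB.of_LB hβ).sub hu)
  have hinv := hprod.inv (c := ρ ^ 2) (by positivity) fun z hz H hH => by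
    have h1 : z.2 ^ 2 ≤ 1 := pow_le_one₀ (hIcc z hz).1 (hIcc z hz).2
    have := hαρ H hH
    have := hβρ H hH
    rw [pow_two ρ]
    exact mul_le_mul (by linarith) (by linarith) hρ.le (by linarith)
  have hrate : ULB S T' (fun z H => rateArg (α H) (β H) (q z.1 H) (d z.1 H) (s z.1 H) z.2) :=
    (((hq.add (((ULB.const 2).mul hd).mul hu)).sub (hs.mul (hd.mul hd))).mul hinv).congr
      fun z _ H _ => by simp only [rateArg]; ring
  obtain ⟨b, hb⟩ := hs.mul hrate
  have hlog : ULB S T' (fun z H => logRatio (s z.1 H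
      * rateArg (α H) (β H) (q z.1 H) (d z.1 H) (s z.1 H) z.2)) :=
    ⟨_, fun z hz => LB_logRatio.comp (hb z hz) fun H hH =>
      mul_rateArg_mem hρ hρ1 (hαρ H hH) (hβρ H hH) (hqM z.1 hz.1 H hH) (hdM z.1 hz.1 H hH)
        (hs0 z.1 hz.1 H hH) (hsM z.1 hz.1 H hH) (hIcc z hz)⟩
  obtain ⟨N, hN⟩ := hrate.mul hlog
  refine ⟨_, fun i hi => (LB.integral (S := S) (μ := volume.restrict (Ioc (0 : ℝ) 1))
    (F := fun H u => rateArg (α H) (β H) (q i H) (d i H) (s i H) u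
      * logRatio (s i H * rateArg (α H) (β H) (q i H) (d i H) (s i H) u)) (b := fun _ => N)
    (fun H hH => ?_) (integrable_const _) ?_).const_mul (2 * Real.log 2)⁻¹⟩
  · have hc := continuousOn_rateArg hρ (hαρ H hH) (hβρ H hH) (q i H) (d i H) (s i H)
    exact (hc.mul (LB_logRatio.continuousOn.comp (continuousOn_const.mul hc) fun u hu =>
      mul_rateArg_mem hρ hρ1 (hαρ H hH) (hβρ H hH) (hqM i hi H hH) (hdM i hi H hH)
        (hs0 i hi H hH) (hsM i hi H hH) ⟨hu.1.le, hu.2⟩)).aestronglyMeasurable measurableSet_Ioc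
  · filter_upwards [ae_restrict_mem measurableSet_Ioc] with u hu using hN (i, u) ⟨hi, hu⟩

/-- When the strength s tends to 0 the logarithm linearizes and `logRatio` tends to 1, leaving the
leading quadratic response of the mutual information to the correlations. -/
theorem tendsto_infoRate {ι : Type*} {l : Filter ι} [l.IsCountablyGenerated] {α β q₀ ρ : ℝ}
    {q d s : ι → ℝ} (hρ : 0 < ρ) (hρ1 : ρ ≤ 1) (hα : 1 + ρ ≤ α) (hβ : 1 + ρ ≤ β)
    (hq : Tendsto q l (𝓝 q₀)) (hd : Tendsto d l (𝓝 0)) (hs : Tendsto s l (𝓝 0))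
    (hs0 : ∀ i, 0 ≤ s i) :
    Tendsto (fun i => infoRate α β (q i) (d i) (s i)) l (𝓝 ((2 * Real.log 2)⁻¹ *
      ∫ u in Ioc (0 : ℝ) 1, q₀ * ((α - u ^ 2) * (β - u ^ 2))⁻¹)) := by
  set M := |q₀| + 1 with hM
  have hM1 : 1 ≤ M := by linarith [abs_nonneg q₀]
  have hev : ∀ᶠ i in l, |q i| ≤ M ∧ |d i| ≤ M ∧ s i * M ≤ ρ ^ 2 / 8 ∧ s i ≤ 1 := by
    have e1 := hq.abs.eventually (gt_mem_nhds (by linarith : |q₀| < M))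
    have e2 := hd.abs.eventually (gt_mem_nhds (by rw [abs_zero]; linarith : |(0 : ℝ)| < M))
    have e3 := (hs.mul_const M).eventually (gt_mem_nhds
      (by rw [zero_mul]; positivity : 0 * M < ρ ^ 2 / 8))
    have e4 := hs.eventually (gt_mem_nhds (one_pos : (0 : ℝ) < 1))
    filter_upwards [e1, e2, e3, e4] with i h1 h2 h3 h4 using ⟨h1.le, h2.le, h3.le, h4.le⟩
  have hlog0 : Tendsto logRatio (𝓝 0) (𝓝 1) := by
    have := (LB_logRatio.continuousOn.continuousAt (x := 0)
      (Icc_mem_nhds (by norm_num) (by norm_num))).tendsto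
    rwa [logRatio_zero] at this
  refine (tendsto_integral_filter_of_dominated_convergence
    (fun _ => (3 * M + M ^ 2) * (ρ ^ 2)⁻¹ * 8) ?_ ?_ (integrable_const _) ?_).const_mul _
  · filter_upwards [hev] with i hi
    have hc := continuousOn_rateArg hρ hα hβ (q i) (d i) (s i)
    exact (hc.mul (LB_logRatio.continuousOn.comp (continuousOn_const.mul hc) fun u hu =>
      mul_rateArg_mem hρ hρ1 hα hβ hi.1 hi.2.1 (hs0 i) hi.2.2.1
        ⟨hu.1.le, hu.2⟩)).aestronglyMeasurable measurableSet_Ioc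
  · filter_upwards [hev] with i hi
    filter_upwards [ae_restrict_mem measurableSet_Ioc] with u hu
    rw [norm_mul, Real.norm_eq_abs, Real.norm_eq_abs]
    have hu' : u ∈ Icc (0 : ℝ) 1 := ⟨hu.1.le, hu.2⟩
    refine mul_le_mul ((abs_rateArg_le hρ hα hβ hi.1 hi.2.1 (hs0 i) hu').trans ?_)
      (LB_logRatio.1 _ (mul_rateArg_mem hρ hρ1 hα hβ hi.1 hi.2.1 (hs0 i) hi.2.2.1 hu'))
      (abs_nonneg _) (by positivity)
    gcongr
    exact mul_le_of_le_one_left (by positivity) hi.2.2.2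
  · refine ae_of_all _ fun u => ?_
    have hr : Tendsto (fun i => rateArg α β (q i) (d i) (s i) u) l
        (𝓝 (q₀ * ((α - u ^ 2) * (β - u ^ 2))⁻¹)) := by
      have h := ((hq.add ((hd.const_mul 2).mul_const (u ^ 2))).sub (hs.mul (hd.pow 2))).mul_const
        (((α - u ^ 2) * (β - u ^ 2))⁻¹)
      simpa [rateArg] using h
    have h2 := hr.mul (hlog0.comp (by simpa using hs.mul hr))
    rwa [mul_one] at h2

/-! ### Leading asymptotics for rank-one correlation limits -/

theorem crossTrace_rankOne (A B : Matrix (Fin 2) (Fin 2) ℝ) (hA : A 1 0 = A 0 1)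
    (hB : B 1 0 = B 0 1) (k : ℝ) (v w : Fin 2 → ℝ) :
    crossTrace A B (Matrix.of fun i j => k * (v i * w j)) = k ^ 2 *
      ((A 1 1 * v 0 ^ 2 - 2 * A 0 1 * (v 0 * v 1) + A 0 0 * v 1 ^ 2)
        * (B 1 1 * w 0 ^ 2 - 2 * B 0 1 * (w 0 * w 1) + B 0 0 * w 1 ^ 2)) := by
  rw [crossTrace_eq, hA, hB]
  simp only [Matrix.of_apply]
  ring

/-- This is the quadratic form of the adjugate of A, up to the order of the components; completing
the square gives positivity. It ensures that a nonzero v produces a nonzero leading amplitude. -/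
theorem quadForm_pos {A : Matrix (Fin 2) (Fin 2) ℝ} (hA : A 1 0 = A 0 1) (hA0 : 0 < A 0 0)
    (hdet : 0 < A.det) {v : Fin 2 → ℝ} (hv : ∃ i, v i ≠ 0) :
    0 < A 1 1 * v 0 ^ 2 - 2 * A 0 1 * (v 0 * v 1) + A 0 0 * v 1 ^ 2 := by
  rw [Matrix.det_fin_two, hA] at hdet
  have e : A 0 0 * (A 1 1 * v 0 ^ 2 - 2 * A 0 1 * (v 0 * v 1) + A 0 0 * v 1 ^ 2)
      = (A 0 0 * A 1 1 - A 0 1 * A 0 1) * v 0 ^ 2 + (A 0 0 * v 1 - A 0 1 * v 0) ^ 2 := by ring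
  refine pos_of_mul_pos_right ?_ hA0.le
  rw [e]
  rcases eq_or_ne (v 0) 0 with h0 | h0
  · have h1 : v 1 ≠ 0 := by
      obtain ⟨i, hi⟩ := hv
      fin_cases i
      · exact absurd h0 hi
      · exact hi
    rw [h0]
    have : 0 < (A 0 0 * v 1) ^ 2 := by positivity
    simpa using this
  · have := mul_pos hdet (by positivity : 0 < v 0 ^ 2)
    nlinarith [sq_nonneg (A 0 0 * v 1 - A 0 1 * v 0)]

/-- The rescaled block tends to a rank-one matrix, so its determinant tends to 0 and only
`crossTrace` contributes to the limit. By `crossTrace_rankOne` that contribution is k² times two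
positive quadratic forms. -/
theorem tendsto_mutualInfo {σ : PhasePoint → PhasePoint → ℝ} (hσ : IsCovariance σ) {A B : Mode}
    (hA : 1 < (covBlock σ A A).det) (hB : 1 < (covBlock σ B B).det) {t : Space → ℝ}
    (ht : Tendsto t (Bornology.cobounded Space) atTop) {k : ℝ} (hk : k ≠ 0) {v w : Fin 2 → ℝ}
    (hv : ∃ i, v i ≠ 0) (hw : ∃ i, w i ≠ 0)
    (hC : ∀ i j, Tendsto (fun X => t X * σ (A.γ i) ((B.γ j).translate X))
      (Bornology.cobounded Space) (𝓝 (k * (v i * w j)))) :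
    ∃ β, 0 < β ∧ Tendsto (fun X => mutualInfo σ A (B.translate X) * t X ^ 2)
      (Bornology.cobounded Space) (𝓝 β) := by
  set a := (covBlock σ A A).det with ha
  set b := (covBlock σ B B).det with hb
  set ρ := min 1 (min (a - 1) (b - 1)) with hρ
  have hρ0 : 0 < ρ := lt_min one_pos (lt_min (by linarith) (by linarith))
  have hρ1 : ρ ≤ 1 := min_le_left _ _
  have hρa : 1 + ρ ≤ a := by linarith [(min_le_right _ _ : ρ ≤ _).trans (min_le_left _ _)]
  have hρb : 1 + ρ ≤ b := by linarith [(min_le_right _ _ : ρ ≤ _).trans (min_le_right _ _)]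
  set C : Space → Matrix (Fin 2) (Fin 2) ℝ := fun X => t X • covBlock σ A (B.translate X) with hCd
  set C₀ : Matrix (Fin 2) (Fin 2) ℝ := Matrix.of fun i j => k * (v i * w j) with hC0
  have hCt : Tendsto C (Bornology.cobounded Space) (𝓝 C₀) :=
    tendsto_pi_nhds.2 fun i => tendsto_pi_nhds.2 fun j => hC i j
  have hcr : Continuous fun C => crossTrace (covBlock σ A A) (covBlock σ B B) C := by
    unfold crossTrace
    fun_prop
  have hq := (hcr.tendsto C₀).comp hCt
  have hd : Tendsto (fun X => (C X).det) (Bornology.cobounded Space) (𝓝 0) := by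
    have h := ((continuous_id.matrix_det).tendsto C₀).comp hCt
    have e : C₀.det = 0 := by
      rw [Matrix.det_fin_two, hC0]; simp only [Matrix.of_apply]; ring
    simp only [id] at h
    rwa [e] at h
  have hs : Tendsto (fun X => (t X)⁻¹ ^ 2) (Bornology.cobounded Space) (𝓝 0) := by
    simpa using ht.inv_tendsto_atTop.pow 2
  have hlim := tendsto_infoRate hρ0 hρ1 hρa hρb hq hd hs (fun X => sq_nonneg _)
  refine ⟨_, ?_, hlim.congr' ?_⟩
  · have hq0 : 0 < crossTrace (covBlock σ A A) (covBlock σ B B) C₀ := by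
      rw [hC0, crossTrace_rankOne _ _ (hσ.covBlock_symm A) (hσ.covBlock_symm B)]
      have h1 := quadForm_pos (hσ.covBlock_symm A) (hσ.covBlock_pos (by linarith)) (by linarith) hv
      have h2 := quadForm_pos (hσ.covBlock_symm B) (hσ.covBlock_pos (by linarith)) (by linarith) hw
      positivity
    have hl := Real.log_pos one_lt_two
    refine mul_pos (by positivity) ?_
    rw [← intervalIntegral.integral_of_le zero_le_one]
    refine intervalIntegral.intervalIntegral_pos_of_pos_on ?_ (fun u hu => ?_) one_pos
    · refine ContinuousOn.intervalIntegrable (continuousOn_const.mul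
        (ContinuousOn.inv₀ (by fun_prop) fun u hu => ?_))
      rw [uIcc_of_le zero_le_one] at hu
      exact (inv_mul_le_of_one_add_le hρ0 hρa hρb hu).1.ne'
    · have := (inv_mul_le_of_one_add_le hρ0 hρa hρb ⟨hu.1.le, hu.2.le⟩).1
      positivity
  · set M := |crossTrace (covBlock σ A A) (covBlock σ B B) C₀| + 1 with hM
    have hM1 : 1 ≤ M := by linarith [abs_nonneg (crossTrace (covBlock σ A A) (covBlock σ B B) C₀)]
    have e1 := hq.abs.eventually (gt_mem_nhds (by linarith :
      |crossTrace (covBlock σ A A) (covBlock σ B B) C₀| < M))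
    have e2 := hd.abs.eventually (gt_mem_nhds (by rw [abs_zero]; linarith : |(0 : ℝ)| < M))
    have e3 := (hs.mul_const M).eventually (gt_mem_nhds
      (by rw [zero_mul]; positivity : 0 * M < ρ ^ 2 / 8))
    filter_upwards [e1, e2, e3, ht.eventually_gt_atTop 0] with X h1 h2 h3 h4
    have hbl := hσ.covBlock_translate X B
    have hr : covBlock σ A (B.translate X) = (t X)⁻¹ • C X := by
      rw [hCd]; simp only [smul_smul]; rw [inv_mul_cancel₀ h4.ne', one_smul]
    have key := mutualInfo_eq (B := B.translate X) hσ hr hρ0 hρ1 hρa (by rw [hbl]; exact hρb)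
      (by rw [hbl]; exact h1.le) h2.le h3.le
    rw [hbl] at key
    rw [key]
    simp only [Function.comp]
    field_simp
    rfl

/-! ### Uniformity in the Hubble rate -/

/-- A pointwise limit inherits the common bound and Lipschitz constant. It is thus continuous and
bounded below on the compact set, and a finite cover transfers half of this lower bound to the
family uniformly in H. -/
theorem ULB.eventually_ge {ι : Type*} {l : Filter ι} [l.NeBot] {S : Set ℝ} {T : Set ι}
    {F : ι → ℝ → ℝ} {α : ℝ → ℝ} (hF : ULB S T F) (hT : T ∈ l) (hS : IsCompact S)
    (hlim : ∀ H ∈ S, Tendsto (fun i => F i H) l (𝓝 (α H))) (hα : ∀ H ∈ S, 0 < α H) :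
    ∃ b, LB S α b ∧ (∀ i ∈ T, LB S (F i) b) ∧ ∃ c, 0 < c ∧ (∀ H ∈ S, c ≤ α H) ∧
      ∀ᶠ i in l, ∀ H ∈ S, c ≤ F i H := by
  obtain ⟨b, hb⟩ := hF
  have hαb : LB S α b := by
    refine ⟨fun x hx => le_of_tendsto (hlim x hx).abs ?_, fun x hx y hy =>
      le_of_tendsto ((hlim x hx).sub (hlim y hy)).abs ?_⟩
    · filter_upwards [hT] with i hi using (hb i hi).1 x hx
    · filter_upwards [hT] with i hi using (hb i hi).2 x hx y hy
  obtain ⟨c, hc, hle⟩ := hαb.exists_pos_le hS hα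
  refine ⟨b, hαb, hb, c / 2, by linarith, fun H hH => by linarith [hle H hH], ?_⟩
  refine hS.induction_on (p := fun s => ∀ᶠ i in l, ∀ H ∈ s, H ∈ S → c / 2 ≤ F i H)
    (by simp) (fun s t hst ht => ht.mono fun i hi H hH => hi H (hst hH))
    (fun s t hs ht => by
      filter_upwards [hs, ht] with i h1 h2 H hH
      exact hH.elim (h1 H) (h2 H)) (fun x hx => ?_) |>.mono fun i hi H hH => hi H hH hH
  have hb0 := hαb.nonneg hx
  -- On a ball of this radius the family varies by at most c/8, so the value 3c/4 reached eventually
  -- at the centre stays above c/2.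
  set r := c / (8 * (b + 1)) with hr
  have hr0 : 0 < r := by positivity
  refine ⟨Metric.ball x r, mem_nhdsWithin_of_mem_nhds (Metric.ball_mem_nhds x hr0), ?_⟩
  have e := (hlim x hx).eventually (lt_mem_nhds (by linarith [hle x hx] : 3 / 4 * c < α x))
  filter_upwards [hT, e] with i hi h1 H hH hHS
  have h2 := (hb i hi).2 x hx H hHS
  rw [Metric.mem_ball, Real.dist_eq, abs_sub_comm] at hH
  have h3 : b * |x - H| ≤ (b + 1) * r := by
    refine mul_le_mul (by linarith) hH.le (abs_nonneg _) (by linarith)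
  have h4 : (b + 1) * r = c / 8 := by rw [hr]; field_simp
  have := le_abs_self (F i x - F i H)
  linarith

/-- The logarithm of J changes at a rate of at most b/c, while -μ(H) log x grows at a rate of at
least κ log x; beyond the threshold the power wins. -/
theorem strictMonoOn_mul_rpow {S : Set ℝ} {J μ : ℝ → ℝ} {b c κ x : ℝ} (hJ : LB S J b)
    (hc : 0 < c) (hJc : ∀ H ∈ S, c ≤ J H)
    (hμ : ∀ H ∈ S, ∀ H' ∈ S, H < H' → κ * (H' - H) ≤ μ H - μ H')
    (hx : 0 < x) (hκ0 : 0 < κ) (hκ : b / c < κ * Real.log x) :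
    StrictMonoOn (fun H => J H * x ^ (-μ H)) S := by
  intro H hH H' hH' hlt
  have hb := hJ.nonneg hH
  have h1 := hJc H' hH'
  have h0 : 0 < J H' := hc.trans_le h1
  have hd : 0 < H' - H := by linarith
  have h2 : J H ≤ J H' * Real.exp (b / c * (H' - H)) := by
    have h3 := (le_abs_self _).trans (hJ.2 H hH H' hH')
    rw [abs_sub_comm, abs_of_pos hd] at h3
    have h4 := Real.add_one_le_exp (b / c * (H' - H))
    have h5 : b * (H' - H) ≤ J H' * (b / c * (H' - H)) := by
      calc _ = c * (b / c * (H' - H)) := by field_simp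
        _ ≤ _ := by gcongr
    nlinarith [mul_le_mul_of_nonneg_left h4 h0.le]
  have hL : 0 < Real.log x := (pos_iff_pos_of_mul_pos ((by positivity : 0 ≤ b / c).trans_lt hκ)).1 hκ0
  simp only
  rw [Real.rpow_def_of_pos hx, Real.rpow_def_of_pos hx]
  calc _ ≤ J H' * Real.exp (b / c * (H' - H)) * Real.exp (Real.log x * -μ H) := by gcongr
    _ = J H' * Real.exp (b / c * (H' - H) + Real.log x * -μ H) := by rw [Real.exp_add]; ring
    _ < _ := by
      refine mul_lt_mul_of_pos_left (Real.exp_lt_exp.2 ?_) h0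
      have h5 := mul_le_mul_of_nonneg_left (hμ H hH H' hH' hlt) hL.le
      have h6 := mul_lt_mul_of_pos_right hκ hd
      linarith

/-! ### Light fields in the Bunch-Davies vacuum -/

/-- All follows from μ²(3/2 + ν) = m²/H². The condition m < H gives ν > 1, so 2ν lies strictly
between 2 and 3, as `bd_nondegenerate` requires. -/
theorem order_bounds {H m : ℝ} (hm : 0 < m) (hmH : m < H) :
    1 < bdOrder H m ∧ bdOrder H m < 3 / 2 ∧ 0 < muSq H m ∧ muSq H m ≤ 2 / 3 * (m / H) ^ 2 := by
  have hH : 0 < H := hm.trans hmH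
  have h1 : m ^ 2 / H ^ 2 = (m / H) ^ 2 := (div_pow _ _ _).symm
  have h2 : 0 < m / H := by positivity
  have h3 : m / H < 1 := (div_lt_one hH).2 hmH
  have h4 : (m / H) ^ 2 < 1 := by nlinarith
  have h5 : bdOrder H m ^ 2 = 9 / 4 - (m / H) ^ 2 := by
    rw [bdOrder, h1]; exact Real.sq_sqrt (by linarith)
  have h6 : 0 ≤ bdOrder H m := Real.sqrt_nonneg _
  have h7 : 1 < bdOrder H m := by nlinarith
  have h8 : bdOrder H m < 3 / 2 := by nlinarith [pow_pos h2 2]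
  unfold muSq
  exact ⟨h7, h8, by linarith, by nlinarith⟩

theorem exists_orderFamily {m H₁ H₂ : ℝ} (hm : 0 < m) (hmH : m < H₁) (h12 : H₁ ≤ H₂) :
    ∃ b, OrderFamily m H₁ H₂ (fun H => bdOrder H m - 1 / 2) b (1 / 2) (bdOrder H₂ m - 1 / 2) := by
  have h1 : 0 < H₁ := hm.trans hmH
  obtain ⟨L, hL⟩ := LB_inv_sq (H₂ := H₂) h1
  have hsq := (LB.const (S := Icc H₁ H₂) (9 / 4)).sub (hL.const_mul (m ^ 2))
  have hord : ∀ H ∈ Icc H₁ H₂, _ := fun H (hH : H ∈ Icc H₁ H₂) =>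
    order_bounds hm (hmH.trans_le hH.1)
  have hs := (hsq.sqrt one_pos fun H hH => by
    have h := (hord H hH).1
    by_contra hcon
    push Not at hcon
    have : bdOrder H m ≤ 1 := Real.sqrt_le_one.2 (by rw [div_eq_mul_inv (m ^ 2)]; linarith)
    linarith).congr (g := fun H => bdOrder H m) fun H _ => by rw [bdOrder, div_eq_mul_inv (m ^ 2)]
  have ha := hs.sub (LB.const (1 / 2))
  have h2 := right_mem_Icc.2 h12
  refine ⟨_, h1, ha, ha.nonneg h2, by norm_num, ?_, ?_, fun H hH => ⟨?_, ?_⟩, fun H hH => ?_⟩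
  · linarith [(hord H₂ h2).1]
  · linarith [(hord H₂ h2).2.1]
  · linarith [(hord H hH).1]
  · have h0 : 0 < H := h1.trans_le hH.1
    have := hH.2
    unfold bdOrder
    gcongr
  · ring

/-- The difference ν(H')² - ν(H)² = m²(1/H² - 1/H'²) is explicit and at least a constant times H' -
H on the interval; dividing by ν(H') + ν(H) < 3 gives the rate. -/
theorem muSq_slope {m H₁ H₂ : ℝ} (hm : 0 < m) (hmH : m < H₁) (h12 : H₁ ≤ H₂) :
    ∃ κ, 0 < κ ∧ ∀ H ∈ Icc H₁ H₂, ∀ H' ∈ Icc H₁ H₂, H < H' →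
      κ * (H' - H) ≤ 4 * muSq H m - 4 * muSq H' m := by
  have h1 : 0 < H₁ := hm.trans hmH
  have h2 : 0 < H₂ := h1.trans_le h12
  refine ⟨4 * (m ^ 2 * (2 * H₁) / (H₂ ^ 2 * H₂ ^ 2) / 3), by positivity, fun H hH H' hH' hlt => ?_⟩
  have hp : 0 < H := h1.trans_le hH.1
  have hp' : 0 < H' := hp.trans hlt
  have hsq : ∀ K ∈ Icc H₁ H₂, bdOrder K m ^ 2 = 9 / 4 - m ^ 2 / K ^ 2 := fun K hK => by
    refine Real.sq_sqrt ?_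
    have h3 := (order_bounds hm (hmH.trans_le hK.1)).1
    by_contra hcon
    push Not at hcon
    rw [bdOrder, Real.sqrt_eq_zero_of_nonpos hcon.le] at h3
    linarith
  have b1 := order_bounds hm (hmH.trans_le hH.1)
  have b2 := order_bounds hm (hmH.trans_le hH'.1)
  have hd : 0 < H' - H := by linarith
  have e : bdOrder H' m ^ 2 - bdOrder H m ^ 2
      = m ^ 2 * (H + H') / (H ^ 2 * H' ^ 2) * (H' - H) := by
    rw [hsq H hH, hsq H' hH']; field_simp; ring
  have e2 : m ^ 2 * (2 * H₁) / (H₂ ^ 2 * H₂ ^ 2) ≤ m ^ 2 * (H + H') / (H ^ 2 * H' ^ 2) := by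
    have := hH.2
    have := hH'.2
    gcongr
    linarith [hH.1, hH'.1]
  have e3 := mul_le_mul_of_nonneg_right e2 hd.le
  rw [← e] at e3
  have e4 : 0 ≤ m ^ 2 * (2 * H₁) / (H₂ ^ 2 * H₂ ^ 2) * (H' - H) := by positivity
  have e5 : 0 < bdOrder H' m - bdOrder H m := by
    have : 0 < m ^ 2 * (2 * H₁) / (H₂ ^ 2 * H₂ ^ 2) * (H' - H) := by positivity
    nlinarith
  unfold muSq
  nlinarith

/-- The power of |X| compensates the decay exactly, since the squared factor is |X|^(4μ²). The
remaining amplitude is `infoRate` evaluated on data that are uniformly Lipschitz in H. Compactness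
of the H-interval gives one uncertainty gap ρ for all H. -/
theorem OrderFamily.ULB_mutualInfoBD {m H₁ H₂ b p q : ℝ} {a : ℝ → ℝ}
    (O : OrderFamily m H₁ H₂ a b p q) (h12 : H₁ ≤ H₂) (hp2 : ∀ H ∈ Icc H₁ H₂, 1 / 2 < a H)
    {R : ℝ} (hR : 0 < R) {A B : Mode} (hA : A.SupportedInBall R) (hB : B.SupportedInBall R) :
    ∃ r₀, 0 < r₀ ∧ ULB (Icc H₁ H₂) {X : Space | r₀ ≤ ‖X‖}
      (fun X H => mutualInfoBD H m A (B.translate X) * ((‖X‖ ^ 2) ^ (1 - a H)) ^ 2) := by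
  have hcov := fun H (hH : H ∈ Icc H₁ H₂) => isCovariance_covBD (a := a H) (m := m)
    (by linarith [hp2 H hH]) ((O.mem H hH).2.trans_lt O.qlt) (O.pos.trans_le hH.1) (O.order H hH)
  have hdet1 : ∀ (A : Mode) H, H ∈ Icc H₁ H₂ → 1 < (covBlock (covBD H m) A A).det := fun A H hH =>
    one_lt_det_covBD (hp2 H hH) ((O.mem H hH).2.trans_lt O.qlt) (O.pos.trans_le hH.1)
      (O.order H hH) A
  have hent : ∀ (A : Mode) (i j : Fin 2),
      ULB (Icc H₁ H₂) (univ : Set Space) (fun _ H => covBlock (covBD H m) A A i j) := fun A i j =>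
    (O.LB_covBD h12 (A.γ i) (A.γ j)).elim fun _ h => ULB.of_LB h
  have hdet : ∀ A : Mode, ∃ B, LB (Icc H₁ H₂) (fun H => (covBlock (covBD H m) A A).det) B :=
    fun A => by
      obtain ⟨B, h⟩ := (((hent A 0 0).mul (hent A 1 1)).sub ((hent A 0 1).mul (hent A 1 0))).congr
        (G := fun _ H => (covBlock (covBD H m) A A).det) fun _ _ H _ => by rw [Matrix.det_fin_two]
      exact ⟨B, h 0 (mem_univ _)⟩
  have hgap : ∀ A : Mode, ∃ c, 0 < c ∧ ∀ H ∈ Icc H₁ H₂, 1 + c ≤ (covBlock (covBD H m) A A).det :=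
    fun A => by
      obtain ⟨B, h⟩ := hdet A
      obtain ⟨c, hc, hle⟩ := (h.sub (LB.const 1)).exists_pos_le isCompact_Icc
        fun H hH => by linarith [hdet1 A H hH]
      exact ⟨c, hc, fun H hH => by linarith [hle H hH]⟩
  obtain ⟨cA, hcA, hleA⟩ := hgap A
  obtain ⟨cB, hcB, hleB⟩ := hgap B
  set ρ := min 1 (min cA cB) with hρ
  have hρ0 : 0 < ρ := lt_min one_pos (lt_min hcA hcB)
  have hρ1 : ρ ≤ 1 := min_le_left _ _
  have hρA : ρ ≤ cA := (min_le_right _ _).trans (min_le_left _ _)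
  have hρB : ρ ≤ cB := (min_le_right _ _).trans (min_le_right _ _)
  obtain ⟨bA, hbA⟩ := hdet A
  obtain ⟨bB, hbB⟩ := hdet B
  set T : Set Space := {X | 4 * R + 4 ≤ ‖X‖} with hT
  set C : Space → ℝ → Matrix (Fin 2) (Fin 2) ℝ :=
    fun X H => (‖X‖ ^ 2) ^ (1 - a H) • covBlock (covBD H m) A (B.translate X) with hC
  have hCe : ∀ i j, ULB (Icc H₁ H₂) T (fun X H => C X H i j) := fun i j =>
    O.ULB_cross (hA.inBall i) (hB.inBall j) hR
  have hd : ULB (Icc H₁ H₂) T (fun X H => (C X H).det) :=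
    (((hCe 0 0).mul (hCe 1 1)).sub ((hCe 0 1).mul (hCe 1 0))).congr fun X _ H _ => by
      rw [Matrix.det_fin_two]
  have hq : ULB (Icc H₁ H₂) T (fun X H => crossTrace (covBlock (covBD H m) A A)
      (covBlock (covBD H m) B B) (C X H)) := by
    have e := fun (M : Mode) i j => (hent M i j).mono (subset_univ T)
    have f := fun i j k l i' j' k' l' => ((((e B i j).mul (hCe k l)).sub
      ((e B i' j').mul (hCe k' l'))))
    have g := fun i j k l i' j' k' l' => ((((e A i j).mul (hCe k l)).sub
      ((e A i' j').mul (hCe k' l'))))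
    refine ((((f 1 1 0 0 0 1 0 1).mul (g 1 1 0 0 0 1 1 0)).add
      ((f 1 1 1 0 0 1 1 1).mul (g 0 0 1 0 1 0 0 0))).add
      ((f 0 0 0 1 1 0 0 0).mul (g 1 1 0 1 0 1 1 1))).add
      ((f 0 0 1 1 1 0 1 0).mul (g 0 0 1 1 1 0 0 1)) |>.congr fun X _ H _ => ?_
    rw [crossTrace_eq]
  obtain ⟨M₁, hM₁⟩ := hq
  obtain ⟨M₂, hM₂⟩ := hd
  set M := |M₁| + |M₂| with hM
  have hM0 : 0 ≤ M := by positivity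
  have h1q : 0 < 1 - q := by linarith [O.qlt]
  -- The weakest decay on the interval belongs to the largest order, a = q. Beyond r₁ it already
  -- makes the correlation strength small enough for the logarithm, for every H at once.
  have hsm : ∀ᶠ x : ℝ in atTop, x ^ (-(4 * (1 - q))) * M < ρ ^ 2 / 8 := by
    have h := (tendsto_rpow_neg_atTop (y := 4 * (1 - q)) (by linarith)).mul_const M
    exact h.eventually (gt_mem_nhds (by rw [zero_mul]; positivity))
  obtain ⟨r₁, hr₁⟩ := eventually_atTop.1 hsm
  refine ⟨max r₁ (4 * R + 4), lt_max_of_lt_right (by linarith), ?_⟩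
  have hsub : {X : Space | max r₁ (4 * R + 4) ≤ ‖X‖} ⊆ T :=
    fun X hX => show 4 * R + 4 ≤ ‖X‖ from (le_max_right r₁ _).trans hX
  have hs_eq : ∀ X ∈ T, ∀ H, (((‖X‖ ^ 2) ^ (1 - a H))⁻¹) ^ 2 = ((‖X‖ ^ 2)⁻¹) ^ (2 * (1 - a H)) :=
    fun X hX H => by
      rw [← Real.inv_rpow (by positivity), ← Real.rpow_natCast, ← Real.rpow_mul (by positivity),
        mul_comm]
      norm_num
  have hs : ULB (Icc H₁ H₂) T (fun X H => (((‖X‖ ^ 2) ^ (1 - a H))⁻¹) ^ 2) := by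
    have hp := O.ppos
    have l := ((LB.const (S := Icc H₁ H₂) 1).sub O.lb).const_mul 2
    refine ⟨_, fun X (hX : 4 * R + 4 ≤ ‖X‖) => ((l.rpow (p := 2 * (1 - q)) (q := 2 * (1 - p)) (q' := 2)
      (by linarith) (by linarith) (fun H hH => ⟨by linarith [(O.mem H hH).2],
      by linarith [(O.mem H hH).1]⟩) (t := (‖X‖ ^ 2)⁻¹) (by
        have : 0 < ‖X‖ := by linarith
        positivity)).congr fun H _ => (hs_eq X hX H).symm).mono
      (mul_le_mul_of_nonneg_left (c := 2) ?_ ?_)⟩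
    · have h1 : (‖X‖ ^ 2)⁻¹ ≤ 1 := inv_le_one_of_one_le₀ (by nlinarith)
      have := Real.rpow_le_one (by positivity) h1 (zero_le_two (α := ℝ))
      linarith
    · have := O.bpos
      have : 0 < 2 - 2 * (1 - p) := by linarith
      have : 0 < 2 * (1 - q) := by linarith
      positivity
  have hsmall : ∀ X ∈ {X : Space | max r₁ (4 * R + 4) ≤ ‖X‖}, ∀ H ∈ Icc H₁ H₂,
      (((‖X‖ ^ 2) ^ (1 - a H))⁻¹) ^ 2 * M ≤ ρ ^ 2 / 8 := fun X hX H hH => by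
    have hXT : 4 * R + 4 ≤ ‖X‖ := hsub hX
    have h0 : 1 ≤ ‖X‖ := by linarith
    refine le_trans ?_ (hr₁ ‖X‖ ((le_max_left _ _).trans hX)).le
    gcongr
    rw [hs_eq X hXT, ← Real.rpow_natCast, ← Real.rpow_neg (by positivity), ← Real.rpow_mul
      (by positivity)]
    refine Real.rpow_le_rpow_of_exponent_le h0 ?_
    push_cast
    linarith [(O.mem H hH).2]
  have hqM : ∀ X ∈ {X : Space | max r₁ (4 * R + 4) ≤ ‖X‖}, ∀ H ∈ Icc H₁ H₂,
      |crossTrace (covBlock (covBD H m) A A) (covBlock (covBD H m) B B) (C X H)| ≤ M :=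
    fun X hX H hH => ((hM₁ X (hsub hX)).1 H hH).trans (by
      linarith [le_abs_self M₁, abs_nonneg M₂])
  have hdM : ∀ X ∈ {X : Space | max r₁ (4 * R + 4) ≤ ‖X‖}, ∀ H ∈ Icc H₁ H₂,
      |(C X H).det| ≤ M := fun X hX H hH => ((hM₂ X (hsub hX)).1 H hH).trans (by
      linarith [le_abs_self M₂, abs_nonneg M₁])
  refine (ULB_infoRate hbA hbB (ULB.mono ⟨M₁, hM₁⟩ hsub) (ULB.mono ⟨M₂, hM₂⟩ hsub) (hs.mono hsub)
    hρ0 hρ1 (fun H hH => by linarith [hleA H hH]) (fun H hH => by linarith [hleB H hH]) hqM hdM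
    (fun X _ H _ => sq_nonneg _) hsmall).congr fun X hX H hH => ?_
  have hX0 : 0 < ‖X‖ := by
    have : 4 * R + 4 ≤ ‖X‖ := hsub hX
    linarith
  have hr0 : 0 < (‖X‖ ^ 2) ^ (1 - a H) := by positivity
  have hbl := (hcov H hH).covBlock_translate X B
  have hr : covBlock (covBD H m) A (B.translate X) = ((‖X‖ ^ 2) ^ (1 - a H))⁻¹ • C X H := by
    simp only [hC, smul_smul]; rw [inv_mul_cancel₀ hr0.ne', one_smul]
  have key := mutualInfo_eq (B := B.translate X) (hcov H hH) hr hρ0 hρ1 (by linarith [hleA H hH])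
    (by rw [hbl]; linarith [hleB H hH]) (by rw [hbl]; exact hqM X hX H hH) (hdM X hX H hH)
    (hsmall X hX H hH)
  rw [hbl] at key
  rw [mutualInfoBD, key]
  field_simp

/-! ### The flat limit -/

/-- At fixed r the Hankel argument r/H tends to infinity, so the asymptotics that identified the
mixtures with the Hankel products also give the flat limit. -/
theorem tendsto_bdP {a r : ℝ} (ha : -1 < a) (ha1 : a < 1) (hr : 0 < r) :
    Tendsto (fun H => bdP₀ a H r) (𝓝[>] 0) (𝓝 (1 / 2 * r ^ (-1 : ℝ))) ∧
    Tendsto (fun H => bdP₁ a H r) (𝓝[>] 0) (𝓝 0) ∧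
    Tendsto (fun H => bdP₂ a H r) (𝓝[>] 0) (𝓝 (1 / 2 * r ^ (1 : ℝ))) := by
  have hpi := Real.pi_pos
  have hH : Tendsto (fun H : ℝ => H) (𝓝[>] 0) (𝓝 0) := tendsto_id.mono_left nhdsWithin_le_nhds
  have hx : Tendsto (fun H : ℝ => r / H) (𝓝[>] 0) atTop := by
    simpa only [div_eq_mul_inv] using tendsto_inv_nhdsGT_zero.const_mul_atTop hr
  have tP := (tendsto_mul_nichP ha ha1).comp hx
  have tQ := (tendsto_nichQ ha ha1).comp hx
  have tR := (tendsto_nichR_div ha ha1).comp hx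
  have tP0 : Tendsto (fun H => nichP a (r / H)) (𝓝[>] 0) (𝓝 0) := by
    have h := (hH.mul_const r⁻¹).mul tP
    rw [zero_mul, zero_mul] at h
    refine h.congr' ?_
    filter_upwards [self_mem_nhdsWithin] with H hH
    have : H ≠ 0 := ne_of_gt hH
    simp only [Function.comp]
    field_simp
  refine ⟨?_, ?_, ?_⟩
  · refine ((tP.const_mul (Real.pi / (4 * r))).congr' ?_).trans (le_of_eq ?_)
    · filter_upwards [self_mem_nhdsWithin] with H hH
      have : H ≠ 0 := ne_of_gt hH
      simp only [Function.comp, bdP₀]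
      field_simp
    · congr 1
      rw [Real.rpow_neg_one]
      field_simp
      norm_num
  · have h := ((tP0.const_mul (3 / 2)).add (tQ.const_mul (1 / 2))).const_mul (Real.pi / 4)
    simpa [bdP₁, Function.comp] using h
  · have h := ((hH.const_mul (Real.pi / 4)).mul ((tP0.const_mul (9 / 4)).add
      (tQ.const_mul (3 / 2)))).add (tR.const_mul (Real.pi * r / 4))
    refine (h.congr' ?_).trans (le_of_eq ?_)
    · filter_upwards [self_mem_nhdsWithin] with H hH
      have : H ≠ 0 := ne_of_gt hH
      simp only [Function.comp, bdP₂]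
      field_simp
    · congr 1
      rw [Real.rpow_one]
      field_simp
      ring

/-- With m = κH the order does not depend on H, and only the scale in r/H moves; the constants of
`bd_specBound` remain bounded as H → 0. -/
theorem tendsto_covBD_covMink {κ : ℝ} (hκ : 0 < κ) (γ γ' : PhasePoint) :
    Tendsto (fun H => covBD H (κ * H) γ γ') (𝓝[>] 0) (𝓝 (covMink γ γ')) := by
  set a := Real.sqrt (9 / 4 - κ ^ 2) - 1 / 2 with ha
  have h1 : -1 < a := by linarith [Real.sqrt_nonneg (9 / 4 - κ ^ 2)]
  have h2 : a < 1 := by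
    have : Real.sqrt (9 / 4 - κ ^ 2) < 3 / 2 := by
      rw [Real.sqrt_lt' (by norm_num)]; nlinarith [pow_pos hκ 2]
    linarith
  obtain ⟨C, hC, hb⟩ := bd_specBound h1 h2
  have he := one_le_irExp a
  have hI : ∀ᶠ H : ℝ in 𝓝[>] 0, H ∈ Ioc (0 : ℝ) 1 := Ioc_mem_nhdsGT one_pos
  rw [covMink_eq_specCov]
  have key : Tendsto (fun H => specCov (bdP₀ a H) (bdP₁ a H) (bdP₂ a H) γ γ') (𝓝[>] 0)
      (𝓝 (specCov (fun r => 1 / 2 * r ^ (-1 : ℝ)) (fun _ => 0) (fun r => 1 / 2 * r ^ (1 : ℝ))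
        γ γ')) := by
    refine (tendsto_integral_filter_of_dominated_convergence
      (fun k => 2 * (C * 5) * (specDom (irExp a) γ k + specDom (irExp a) γ' k)) ?_ ?_
      (((integrable_specDom he (irExp_lt_three h2) γ).add
        (integrable_specDom he (irExp_lt_three h2) γ')).const_mul _) ?_).const_mul _
    · filter_upwards [hI] with H hH
      obtain ⟨c0, c1, c2⟩ := continuousOn_bdP h1 h2 hH.1
      exact aestronglyMeasurable_specIntegrand c0 c1 c2 γ γ'
    · filter_upwards [hI] with H hH
      filter_upwards [ae_ne_zero] with k hk
      refine (abs_specIntegrand_le (hb H hH.1) γ γ' hk).trans ?_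
      have p : ∀ s : ℝ, 0 ≤ s → H ^ s ≤ 1 := fun s hs => Real.rpow_le_one hH.1.le hH.2 hs
      have q1 := p (irExp a - 1) (by linarith)
      have q2 := p (irExp a) (by linarith)
      have q3 := p (irExp a + 1) (by linarith)
      have hs : ∀ γ, 0 ≤ specDom (irExp a) γ k := fun γ => by unfold specDom; positivity
      have := hs γ
      have := hs γ'
      gcongr
      linarith [hH.2]
    · filter_upwards [ae_ne_zero] with k hk
      obtain ⟨t0, t1, t2⟩ := tendsto_bdP h1 h2 (norm_pos_iff.2 hk)
      exact ((t0.mul_const _).add (t1.mul_const _)).add (t2.mul_const _)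
  refine key.congr' ?_
  filter_upwards [hI] with H hH
  have hm : bdOrder H (κ * H) = a + 1 / 2 := by
    have := hH.1.ne'
    rw [bdOrder, ha, show (κ * H) ^ 2 / H ^ 2 = κ ^ 2 by field_simp]
    ring
  rw [covBD_eq_specCov h1 h2 hH.1 hm]

theorem continuous_entropy : Continuous entropy := by
  have h : entropy = fun ν => ((ν + 1) / 2 * Real.log ((ν + 1) / 2)) / Real.log 2
      - ((ν - 1) / 2 * Real.log ((ν - 1) / 2)) / Real.log 2 := by
    funext ν
    simp only [entropy, Real.logb, mul_div_assoc]
  have c := Real.continuous_mul_log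
  rw [h]
  exact ((c.comp (by fun_prop : Continuous fun ν : ℝ => (ν + 1) / 2)).div_const _).sub
    ((c.comp (by fun_prop : Continuous fun ν : ℝ => (ν - 1) / 2)).div_const _)

/-- The mutual information is continuous everywhere: the real square root is continuous with value 0
on negative numbers, and x log x is continuous at 0. No positivity of determinants or discriminants
has to be checked. -/
theorem tendsto_mutualInfo_of_tendsto {ι : Type*} {l : Filter ι}
    {σ : ι → PhasePoint → PhasePoint → ℝ} {σ₀ : PhasePoint → PhasePoint → ℝ}
    (h : ∀ γ γ', Tendsto (fun i => σ i γ γ') l (𝓝 (σ₀ γ γ'))) (A B : Mode) :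
    Tendsto (fun i => mutualInfo (σ i) A B) l (𝓝 (mutualInfo σ₀ A B)) := by
  have hb : ∀ A B : Mode, Tendsto (fun i => covBlock (σ i) A B) l (𝓝 (covBlock σ₀ A B)) :=
    fun A B => tendsto_pi_nhds.2 fun i => tendsto_pi_nhds.2 fun j => h _ _
  have hd : ∀ A B : Mode, Tendsto (fun i => (covBlock (σ i) A B).det) l
      (𝓝 (covBlock σ₀ A B).det) := fun A B => ((continuous_id.matrix_det).tendsto _).comp (hb A B)
  have hp : Tendsto (fun i => (covPair (σ i) A B).det) l (𝓝 (covPair σ₀ A B).det) := by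
    have hm : Tendsto (fun i => covPair (σ i) A B) l (𝓝 (covPair σ₀ A B)) :=
      tendsto_pi_nhds.2 fun i => tendsto_pi_nhds.2 fun j => by
        rcases i with i | i <;> rcases j with j | j <;> exact h _ _
    exact ((continuous_id.matrix_det).tendsto (covPair σ₀ A B)).comp hm
  have hs : Tendsto (fun i => seralian (σ i) A B) l (𝓝 (seralian σ₀ A B)) :=
    ((hd A A).add (hd B B)).add ((hd A B).const_mul 2)
  have he : ∀ {f : ι → ℝ} {x : ℝ}, Tendsto f l (𝓝 x) →
      Tendsto (fun i => entropy (Real.sqrt (f i))) l (𝓝 (entropy (Real.sqrt x))) := fun hf =>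
    (continuous_entropy.tendsto _).comp hf.sqrt
  have hdisc := ((hs.pow 2).sub (hp.const_mul 4)).sqrt
  exact (((he (hd A A)).add (he (hd B B))).sub (he ((hs.add hdisc).div_const 2))).sub
    (he ((hs.sub hdisc).div_const 2))

/-! ### Large separations -/

theorem exists_mutualInfoMink_limit {A B : Mode} {R : ℝ} (hR : 0 < R) (hA : A.SupportedInBall R)
    (hB : B.SupportedInBall R) (hA0 : A.NonSpecial) (hB0 : B.NonSpecial) :
    ∃ β, 0 < β ∧ Tendsto (fun X => mutualInfoMink A (B.translate X) * ‖X‖ ^ 4)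
      (Bornology.cobounded Space) (𝓝 β) := by
  have hpi := Real.pi_pos
  have hc : 0 < minkC := by unfold minkC; positivity
  obtain ⟨β, h0, h⟩ := tendsto_mutualInfo isCovariance_covMink (one_lt_det_covMink A)
    (one_lt_det_covMink B) ((tendsto_pow_atTop two_ne_zero).comp tendsto_norm_cobounded_atTop)
    (k := 2 * ((2 * Real.pi) ^ 3)⁻¹ * (4 * Real.pi ^ (3 / 2 : ℝ) * minkC)) (by positivity) hA0 hB0
    fun i j => tendsto_covMink (hA.inBall i) (hB.inBall j) hR
  refine ⟨β, h0, h.congr fun X => ?_⟩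
  simp only [Function.comp, mutualInfoMink]
  ring

theorem rpow_sq_rpow_sq (x y : ℝ) (hx : 0 ≤ x) : ((x ^ 2) ^ y) ^ 2 = x ^ (4 * y) := by
  rw [← Real.rpow_natCast, ← Real.rpow_natCast, ← Real.rpow_mul hx, ← Real.rpow_mul hx]
  congr 1
  push_cast
  ring

theorem exists_mutualInfoBD_limit {A B : Mode} {R H m : ℝ} (hR : 0 < R) (hA : A.SupportedInBall R)
    (hB : B.SupportedInBall R) (hm : 0 < m) (hmH : m < H)
    (hA0 : ∃ i, (∫ x, (A.γ i).f x) + H * muSq H m * ∫ x, (A.γ i).g x ≠ 0)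
    (hB0 : ∃ i, (∫ x, (B.γ i).f x) + H * muSq H m * ∫ x, (B.γ i).g x ≠ 0) :
    ∃ α, 0 < α ∧ Tendsto (fun X => mutualInfoBD H m A (B.translate X) * ‖X‖ ^ (4 * muSq H m))
      (Bornology.cobounded Space) (𝓝 α) := by
  have hH : 0 < H := hm.trans hmH
  obtain ⟨h1, h2, h3, -⟩ := order_bounds hm hmH
  set a := bdOrder H m - 1 / 2 with ha
  have hord : bdOrder H m = a + 1 / 2 := by rw [ha]; ring
  have hmu : muSq H m = 1 - a := by rw [muSq, ha]; ring
  rw [hmu] at hA0 hB0 h3 ⊢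
  have a1 : 1 / 2 < a := by linarith
  have a2 : a < 1 := by linarith
  have ht : Tendsto (fun X : Space => (‖X‖ ^ 2) ^ (1 - a)) (Bornology.cobounded Space) atTop :=
    (tendsto_rpow_atTop h3).comp ((tendsto_pow_atTop two_ne_zero).comp tendsto_norm_cobounded_atTop)
  obtain ⟨α, h0, h⟩ := tendsto_mutualInfo
    (isCovariance_covBD (by linarith) a2 hH hord) (one_lt_det_covBD a1 a2 hH hord A)
    (one_lt_det_covBD a1 a2 hH hord B) ht (bdLim_pos (by linarith) a2 hH).ne' hA0 hB0
    fun i j => tendsto_covBD (by linarith) a2 hH hord (hA.inBall i) (hB.inBall j) hR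
  refine ⟨α, h0, h.congr fun X => ?_⟩
  rw [rpow_sq_rpow_sq _ _ (norm_nonneg X)]
  rfl

/-- For light fields the leading amplitude of a non-special mode does not vanish. -/
theorem exists_light_bound {A : Mode} (hA : A.NonSpecial) {H₁ : ℝ} (hH : 0 < H₁) :
    ∃ δ, 0 < δ ∧ δ ≤ 1 ∧ ∀ m H, 0 < m → m < δ * H₁ → H₁ ≤ H →
      ∃ i, (∫ x, (A.γ i).f x) + H * muSq H m * ∫ x, (A.γ i).g x ≠ 0 := by
  obtain ⟨i, hi⟩ := hA
  set F := ∫ x, (A.γ i).f x with hF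
  set G := ∫ x, (A.γ i).g x with hG
  have hF0 : 0 < |F| := abs_pos.2 hi
  have hG0 : 0 ≤ H₁ * |G| := by positivity
  -- The choice gives δ H₁ |G| ≤ |F|. As Hμ² ≤ (2/3) m²/H ≤ (2/3) δ H₁, the g-term is at most two
  -- thirds of |F| and cannot cancel F.
  refine ⟨|F| / (|F| + H₁ * |G|), by positivity, (div_le_one (by positivity)).2 (by linarith),
    fun m H hm hmδ hHH => ⟨i, fun h0 => ?_⟩⟩
  set δ := |F| / (|F| + H₁ * |G|) with hδ
  have hδ0 : 0 < δ := by positivity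
  have hδ1 : δ ≤ 1 := (div_le_one (by positivity)).2 (by linarith)
  have hδe : δ * (H₁ * |G|) ≤ |F| := by
    rw [hδ, div_mul_eq_mul_div, div_le_iff₀ (by positivity)]
    nlinarith
  have hHp : 0 < H := hH.trans_le hHH
  have hmH : m < H := by nlinarith
  obtain ⟨-, -, h3, h4⟩ := order_bounds hm hmH
  have h5 : H * muSq H m ≤ 2 / 3 * (δ * H₁) := by
    have e : H * (2 / 3 * (m / H) ^ 2) = 2 / 3 * (m * (m / H)) := by field_simp
    have h6 : m / H ≤ 1 := (div_le_one hHp).2 hmH.le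
    have h7 : m * (m / H) ≤ δ * H₁ := by nlinarith
    have h8 := mul_le_mul_of_nonneg_left h4 hHp.le
    rw [e] at h8
    linarith
  change F + H * muSq H m * G = 0 at h0
  have h9 : |F| = H * muSq H m * |G| := by
    rw [eq_neg_of_add_eq_zero_left h0, abs_neg, abs_mul, abs_of_pos (by positivity : 0 < H * muSq H m)]
  have h10 := mul_le_mul_of_nonneg_right h5 (abs_nonneg G)
  nlinarith

theorem exists_strictMonoOn {A B : Mode} {R m H₁ H₂ : ℝ} {α : ℝ → ℝ} (hR : 0 < R)
    (hA : A.SupportedInBall R) (hB : B.SupportedInBall R) (hm : 0 < m) (hmH : m < H₁)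
    (h12 : H₁ < H₂) (hα : ∀ H, H₁ ≤ H → 0 < α H ∧
      Tendsto (fun X => mutualInfoBD H m A (B.translate X) * ‖X‖ ^ (4 * muSq H m))
        (Bornology.cobounded Space) (𝓝 (α H))) :
    ∃ r, 0 < r ∧ (∀ ℓ, r ≤ ℓ → StrictMonoOn (fun H => α H * ℓ ^ (-(4 * muSq H m))) (Icc H₁ H₂)) ∧
      ∀ X : Space, r ≤ ‖X‖ →
        StrictMonoOn (fun H => mutualInfoBD H m A (B.translate X)) (Icc H₁ H₂) := by
  obtain ⟨b, O⟩ := exists_orderFamily hm hmH h12.le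
  obtain ⟨κ, hκ, hsl⟩ := muSq_slope hm hmH h12.le
  obtain ⟨r₀, hr₀, hU⟩ := O.ULB_mutualInfoBD h12.le (fun H hH => by
    linarith [(order_bounds hm (hmH.trans_le hH.1)).1]) hR hA hB
  have hU' : ULB (Icc H₁ H₂) {X : Space | r₀ ≤ ‖X‖}
      (fun X H => mutualInfoBD H m A (B.translate X) * ‖X‖ ^ (4 * muSq H m)) :=
    hU.congr fun X _ H _ => by
      rw [rpow_sq_rpow_sq _ _ (norm_nonneg X), muSq]
      ring_nf
  have hT : {X : Space | r₀ ≤ ‖X‖} ∈ Bornology.cobounded Space :=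
    tendsto_norm_cobounded_atTop.eventually_ge_atTop r₀
  obtain ⟨b', hαb, hFb, c, hc, hαc, hev⟩ := hU'.eventually_ge hT isCompact_Icc
    (fun H hH => (hα H hH.1).2) (fun H hH => (hα H hH.1).1)
  obtain ⟨r₁, hr₁⟩ : ∃ r₁, ∀ X : Space, r₁ ≤ ‖X‖ → ∀ H ∈ Icc H₁ H₂,
      c ≤ mutualInfoBD H m A (B.translate X) * ‖X‖ ^ (4 * muSq H m) := by
    rw [← comap_norm_atTop, eventually_comap, eventually_atTop] at hev
    obtain ⟨r, hr⟩ := hev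
    exact ⟨r, fun X hX => hr _ hX X rfl⟩
  obtain ⟨r₂, hr₂⟩ := eventually_atTop.1
    ((Real.tendsto_log_atTop.const_mul_atTop hκ).eventually_gt_atTop (b' / c))
  refine ⟨max r₀ (max r₁ r₂), lt_max_of_lt_left hr₀, fun ℓ hℓ => ?_, fun X hX => ?_⟩
  · have h0 : 0 < ℓ := hr₀.trans_le ((le_max_left _ _).trans hℓ)
    exact strictMonoOn_mul_rpow hαb hc hαc hsl h0 hκ
      (hr₂ _ (((le_max_right _ _).trans (le_max_right _ _)).trans hℓ))
  · have h0 : 0 < ‖X‖ := hr₀.trans_le ((le_max_left _ _).trans hX)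
    have h := strictMonoOn_mul_rpow (hFb X ((le_max_left _ _).trans hX)) hc
      (hr₁ X (((le_max_left _ _).trans (le_max_right _ _)).trans hX)) hsl h0 hκ
      (hr₂ _ (((le_max_right _ _).trans (le_max_right _ _)).trans hX))
    refine h.congr fun H _ => ?_
    simp only
    rw [mul_assoc, ← Real.rpow_add h0, add_neg_cancel, Real.rpow_zero, mul_one]

end DeSitter

end

open DeSitter in
theorem proposition3 (A B : DeSitter.Mode) (R : ℝ) (hR : 0 < R)
    (hAR : A.SupportedInBall R) (hBR : B.SupportedInBall R)
    (hA : A.NonSpecial) (hB : B.NonSpecial) :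
    (∀ H₁ : ℝ, 0 < H₁ → ∃ δ : ℝ, 0 < δ ∧ δ ≤ 3 / 2 ∧ ∀ m : ℝ, 0 < m → m < δ * H₁ →
      ∃ α : ℝ → ℝ,
        (∀ H : ℝ, H₁ ≤ H →
          0 < α H ∧
          Tendsto (fun Δx : DeSitter.Space =>
              DeSitter.mutualInfoBD H m A (B.translate Δx) * ‖Δx‖ ^ (4 * DeSitter.muSq H m))
            (Bornology.cobounded DeSitter.Space) (𝓝 (α H)) ∧
          0 < DeSitter.muSq H m ∧ 4 * DeSitter.muSq H m ≤ 8 / 3 * (m / H) ^ 2) ∧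
        (∀ H₂ : ℝ, H₁ < H₂ →
          ∃ Λ : ℝ, 0 < Λ ∧
            (∀ ℓ : ℝ, Λ * R ≤ ℓ →
              StrictMonoOn (fun H => α H * ℓ ^ (-(4 * DeSitter.muSq H m))) (Set.Icc H₁ H₂)) ∧
            (∀ Δx : DeSitter.Space, Λ * R ≤ ‖Δx‖ → Λ ≤ ‖Δx‖ * H₁ →
              StrictMonoOn (fun H => DeSitter.mutualInfoBD H m A (B.translate Δx))
                (Set.Icc H₁ H₂)))) ∧
    (∀ κ : ℝ, 0 < κ → κ < 3 / 2 → ∀ Δx : DeSitter.Space, 2 * R < ‖Δx‖ →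
      Tendsto (fun H => DeSitter.mutualInfoBD H (κ * H) A (B.translate Δx)) (𝓝[>] 0)
        (𝓝 (DeSitter.mutualInfoMink A (B.translate Δx)))) ∧
    (∃ β : ℝ, 0 < β ∧
      Tendsto (fun Δx : DeSitter.Space =>
          DeSitter.mutualInfoMink A (B.translate Δx) * ‖Δx‖ ^ 4)
        (Bornology.cobounded DeSitter.Space) (𝓝 β)) := by
  refine ⟨fun H₁ hH₁ => ?_, fun κ hκ _ X _ => tendsto_mutualInfo_of_tendsto
    (tendsto_covBD_covMink hκ) A (B.translate X),
    exists_mutualInfoMink_limit hR hAR hBR hA hB⟩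
  obtain ⟨δA, hδA, hδA1, hvA⟩ := exists_light_bound hA hH₁
  obtain ⟨δB, hδB, hδB1, hvB⟩ := exists_light_bound hB hH₁
  -- Both modes need a nonvanishing leading vector. Each δ is at most 1, so m < H₁ holds too, which
  -- puts every H ≥ H₁ in the light regime ν > 1.
  refine ⟨min δA δB, lt_min hδA hδB, (min_le_left _ _).trans (by linarith), fun m hm hmδ => ?_⟩
  have hmA : m < δA * H₁ := hmδ.trans_le (by gcongr; exact min_le_left _ _)
  have hmB : m < δB * H₁ := hmδ.trans_le (by gcongr; exact min_le_right _ _)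
  have hmH : m < H₁ := by nlinarith
  have hex : ∀ H, ∃ α, H₁ ≤ H → 0 < α ∧
      Tendsto (fun X => mutualInfoBD H m A (B.translate X) * ‖X‖ ^ (4 * muSq H m))
        (Bornology.cobounded Space) (𝓝 α) := fun H => by
    by_cases hH : H₁ ≤ H
    · obtain ⟨α, h⟩ := exists_mutualInfoBD_limit hR hAR hBR hm (hmH.trans_le hH)
        (hvA m H hm hmA hH) (hvB m H hm hmB hH)
      exact ⟨α, fun _ => h⟩
    · exact ⟨0, fun h => absurd h hH⟩
  choose α hα using hex
  refine ⟨α, fun H hH => ?_, fun H₂ h12 => ?_⟩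
  · obtain ⟨-, -, h3, h4⟩ := order_bounds hm (hmH.trans_le hH)
    exact ⟨(hα H hH).1, (hα H hH).2, h3, by linarith⟩
  · obtain ⟨r, hr, h1, h2⟩ := exists_strictMonoOn hR hAR hBR hm hmH h12 hα
    -- Λ is the threshold separation measured in units of R.
    refine ⟨r / R, by positivity, fun ℓ hℓ => h1 ℓ ?_, fun X hX _ => h2 X ?_⟩
    · rwa [div_mul_cancel₀ _ hR.ne'] at hℓ
    · rwa [div_mul_cancel₀ _ hR.ne'] at hX
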